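/- **Setting.** Both discrete time ($\mathbb U=\mathbb Z$, $\Lambda=[-\pi,\pi]$, $T\in\mathbb N$) and continuous time ($\mathbb U=\mathbb R$, $\Lambda=\mathbb R$, $T>0$ real) are considered. Let $X=\{X(t),t\in\mathbb U\}$ be a centered real Gaussian stationary process (jointly measurable in $(t,\omega)$ in continuous time) with spectral density $f\ge0$, $f\in L^1(\Lambda)$, that is, $\mathbb E[X(t+u)X(t)]=\int_\Lambda e^{i\lambda u}f(\lambda)\,d\lambda$ for all $t,u\in\mathbb U$. Let $g\in L^1(\Lambda)$ be real and even, $\widehat g(t)=\int_\Lambda e^{i\lambda t}g(\lambda)\,d\lambda$, and likewise $\widehat f$. In discrete time $f$ and $g$ are extended $2\pi$-periodically to $\mathbb R$. Let the taper $h:\mathbb R\to[0,\infty)$ vanish outside $[0,1]$, be continuous and of bounded variation on $[0,1]$, and satisfy $H_k=\int_0^1h^k(t)\,dt\ne0$ for all $k\ge1$. Put $h_T(t)=h(t/T)$ and $$Q_T^h=\sum_{t=1}^T\sum_{s=1}^T\widehat g(t-s)h_T(t)h_T(s)X(t)X(s)\quad\text{or}\quad Q_T^h=\int_0^T\!\!\int_0^T\widehat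 g(t-s)h_T(t)h_T(s)X(t)X(s)\,dt\,ds$$ in discrete and continuous time, respectively, and $$\widetilde Q_T^h=T^{-1/2}\left(Q_T^h-\mathbb E[Q_T^h]\right),\qquad \sigma_h^2=16\pi^3H_4\int_\Lambda f^2(\lambda)g^2(\lambda)\,d\lambda .$$ Let $A_T(\psi)$ be the $T\times T$ matrix $\big(\widehat\psi(t-s)h_T(s)\big)_{t,s=1}^T$ in discrete time, and the integral operator $u\mapsto\int_0^T\widehat\psi(\cdot-s)u(s)h_T(s)\,ds$ on $[0,T]$ in continuous time. **Theorem.** In both cases the second cumulant (variance) of $\widetilde Q_T^h$ is $\chi_2(\widetilde Q_T^h)=\frac2T\operatorname{tr}\big[A_T(f)A_T(g)\big]^2$ for every $T>0$. Moreover, each of the following conditions implies that $f^2g^2\in L^1(\Lambda)$ and that $\widetilde Q_T^h$ converges in distribution to $N(0,\sigma_h^2)$ as $T\to\infty$: 1. $f\in L^p(\Lambda)$ and $g\in L^q(\Lambda)$ for some $1\le p,q\le\infty$ with $1/p+1/q\le1/2$; 2. $fg\in L^1(\Lambda)\cap L^2(\Lambda)$ and $\chi_2(\widetilde Q_T^h)\to\sigma_h^2$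 as $T\to\infty$; 3. the function $\varphi(x_1,x_2,x_3)=\int_\Lambda f(u)g(u-x_1)f(u-x_2)g(u-x_3)\,du$ belongs to $L^2(\Lambda^3)$ and is continuous at $(0,0,0)$; 4. $f,g,fg\in L^2(\Lambda)$ and $\int_\Lambda f^2(\lambda)g^2(\lambda-\mu)\,d\lambda\to\int_\Lambda f^2(\lambda)g^2(\lambda)\,d\lambda$ as $\mu\to0$; 5. $f$ and $g$ are bounded on $\Lambda$ outside any neighbourhood of the origin, and for some $a>0$, $\alpha<1$, $\beta<1$ with $\alpha+\beta\le1/2$ and some $L_1,L_2\in SV_0(\mathbb R)$ with $|\lambda|^{-(\alpha+\beta)}L_i(\lambda)\in L^2[-a,a]$, $i=1,2$, $$f(\lambda)\le|\lambda|^{-\alpha}L_1(\lambda),\qquad |g(\lambda)|\le|\lambda|^{-\beta}L_2(\lambda),\qquad 0<|\lambda|\le a .$$ Here $SV_0(\mathbb R)$ is the class of even functions $u$ that are slowly varying at zero (that is, $u(c\lambda)/u(\lambda)\to1$ as $\lambda\downarrow0$ for every $c>0$), tend to $0$ as $\lambda\to0$, and for some $b>0$ are bounded on $[-b,b]$ and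 satisfy $0<u(\lambda)<u(\mu)$ for $0<\lambda<\mu<b$. -/

import Mathlib

open MeasureTheory ProbabilityTheory Filter Topology Set
open scoped ENNReal NNReal

namespace TaperedCLT

noncomputable section

/-! ### Frequency domains, Fourier transforms, tapers -/

/-- The frequency domain `[-π, π]` of a discrete-time process. -/
def freqD : Set ℝ := Icc (-Real.pi) Real.pi

/-- The frequency domain `ℝ` of a continuous-time process. -/
def freqC : Set ℝ := univ

/-- The Fourier transform `∫_Λ e^{i λ t} ψ(λ) dλ`. -/
def fourierC (Λ : Set ℝ) (ψ : ℝ → ℝ) (t : ℝ) : ℂ :=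
  ∫ x in Λ, Complex.exp (Complex.I * (x : ℂ) * (t : ℂ)) * (ψ x : ℂ)

/-- The Fourier transform as a real number; for (almost everywhere) even `ψ`, the only ones it is
used for, the complex number `fourierC Λ ψ t` is real. -/
def fourierR (Λ : Set ℝ) (ψ : ℝ → ℝ) (t : ℝ) : ℝ := (fourierC Λ ψ t).re

/-- `H_k = ∫_0^1 h(t)^k dt`. -/
def taperMoment (h : ℝ → ℝ) (k : ℕ) : ℝ := ∫ t in Icc (0 : ℝ) 1, h t ^ k

/-- Admissible tapers. Continuity is required on `[0, 1]` only, so that `h(t) = 1 - t` on `[0, 1]`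
and the indicator of `[0, 1]` (no tapering) are included. -/
structure IsTaper (h : ℝ → ℝ) : Prop where
  continuousOn : ContinuousOn h (Icc 0 1)
  nonneg : ∀ t, 0 ≤ h t
  boundedVariation : BoundedVariationOn h (Icc 0 1)
  support : ∀ t, t ∉ Icc (0 : ℝ) 1 → h t = 0
  moment_ne_zero : ∀ k : ℕ, 1 ≤ k → taperMoment h k ≠ 0

/-! ### The model and the generating function -/

/-- `X` is a centered Gaussian stationary process indexed by `U` (which is `ℤ` or `ℝ`, embedded
in the reals by `c`) with spectral density `f` on `Λ`:
`E[X(t + u) X(t)] = ∫_Λ e^{i λ u} f(λ) dλ` for all `t, u`. -/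
structure IsGaussianStationary {Ω : Type*} [MeasurableSpace Ω] {U : Type*} [AddCommGroup U]
    (c : U → ℝ) (Λ : Set ℝ) (X : U → Ω → ℝ) (P : Measure Ω) (f : ℝ → ℝ) : Prop where
  gaussian : IsGaussianProcess X P
  centered : ∀ t, ∫ ω, X t ω ∂P = 0
  density_nonneg : ∀ x ∈ Λ, 0 ≤ f x
  density_integrable : IntegrableOn f Λ
  covariance : ∀ t u : U, ((∫ ω, X (t + u) ω * X t ω ∂P : ℝ) : ℂ) = fourierC Λ f (c u)

/-- Generating functions: real, even and integrable on `Λ`. -/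
structure IsGenerating (Λ : Set ℝ) (g : ℝ → ℝ) : Prop where
  even : ∀ x, g (-x) = g x
  integrable : IntegrableOn g Λ

/-! ### Quadratic functionals -/

/-- The tapered Toeplitz quadratic functional, discrete time. -/
def quadD {Ω : Type*} (h g : ℝ → ℝ) (X : ℤ → Ω → ℝ) (T : ℕ) (ω : Ω) : ℝ :=
  ∑ t ∈ Finset.Icc 1 T, ∑ s ∈ Finset.Icc 1 T,
    fourierR freqD g ((t : ℝ) - s) * h (t / T) * h (s / T) * X t ω * X s ω

/-- The tapered Toeplitz quadratic functional, continuous time. -/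
def quadC {Ω : Type*} (h g : ℝ → ℝ) (X : ℝ → Ω → ℝ) (T : ℝ) (ω : Ω) : ℝ :=
  ∫ p in Icc (0 : ℝ) T ×ˢ Icc (0 : ℝ) T,
    fourierR freqC g (p.1 - p.2) * h (p.1 / T) * h (p.2 / T) * X p.1 ω * X p.2 ω

/-- `T^{-1/2} (Q - E[Q])`. -/
def normalized {Ω : Type*} [MeasurableSpace Ω] (P : Measure Ω) (T : ℝ) (Q : Ω → ℝ) (ω : Ω) : ℝ :=
  (√T)⁻¹ * (Q ω - ∫ ω', Q ω' ∂P)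

/-- The normalized quadratic functional, discrete time. -/
def normQuadD {Ω : Type*} [MeasurableSpace Ω] (P : Measure Ω) (h g : ℝ → ℝ) (X : ℤ → Ω → ℝ)
    (T : ℕ) : Ω → ℝ :=
  normalized P T (quadD h g X T)

/-- The normalized quadratic functional, continuous time. -/
def normQuadC {Ω : Type*} [MeasurableSpace Ω] (P : Measure Ω) (h g : ℝ → ℝ) (X : ℝ → Ω → ℝ)
    (T : ℝ) : Ω → ℝ :=
  normalized P T (quadC h g X T)

/-! ### Tapered Toeplitz matrices and operators -/

/-- The tapered Toeplitz matrix `(ψ̂(t - s) h(s/T))`, `t, s = 1, …, T`. -/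
def toeplitzMatrix (h ψ : ℝ → ℝ) (T : ℕ) :
    Matrix (Finset.Icc 1 T) (Finset.Icc 1 T) ℝ :=
  Matrix.of fun t s => fourierR freqD ψ (((t : ℕ) : ℝ) - ((s : ℕ) : ℝ)) * h (((s : ℕ) : ℝ) / T)

/-- The kernel `ψ̂(t - s) h(s/T)` (with respect to `ds` on `[0, T]`) of the tapered Toeplitz
operator `u ↦ ∫_0^T ψ̂(· - s) u(s) h(s/T) ds`. -/
def toeplitzKernel (h ψ : ℝ → ℝ) (T : ℝ) (t s : ℝ) : ℝ :=
  fourierR freqC ψ (t - s) * h (s / T)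

/-- The kernel of the composition of two integral operators on `[0, T]`. -/
def kernelComp (T : ℝ) (K L : ℝ → ℝ → ℝ) (t s : ℝ) : ℝ := ∫ u in Icc (0 : ℝ) T, K t u * L u s

/-- The trace of an integral operator on `[0, T]` (here always a product of Hilbert-Schmidt
operators with continuous kernels). -/
def kernelTrace (T : ℝ) (K : ℝ → ℝ → ℝ) : ℝ := ∫ t in Icc (0 : ℝ) T, K t t

/-- `tr [A_T(f) A_T(g)]²`, discrete time. -/
def traceD (h f g : ℝ → ℝ) (T : ℕ) : ℝ :=
  ((toeplitzMatrix h f T * toeplitzMatrix h g T) ^ 2).trace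

/-- `tr [A_T(f) A_T(g)]²`, continuous time. -/
def traceC (h f g : ℝ → ℝ) (T : ℝ) : ℝ :=
  let K := kernelComp T (toeplitzKernel h f T) (toeplitzKernel h g T)
  kernelTrace T (kernelComp T K K)

/-! ### Asymptotic normality -/

/-- `σ_h² = 16 π³ H_4 ∫_Λ f² g²`. -/
def asympVar (Λ : Set ℝ) (h f g : ℝ → ℝ) : ℝ :=
  16 * Real.pi ^ 3 * taperMoment h 4 * ∫ x in Λ, f x ^ 2 * g x ^ 2

/-- The integral in `σ_h²` converges, and `Y_T` tends in distribution to `N(0, σ_h²)`. -/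
def IsAsympNormal {Ω : Type*} [MeasurableSpace Ω] {ι : Type*} [Preorder ι]
    (P : Measure Ω) [IsProbabilityMeasure P]
    (Λ : Set ℝ) (h f g : ℝ → ℝ) (Y : ι → Ω → ℝ) : Prop :=
  IntegrableOn (fun x => f x ^ 2 * g x ^ 2) Λ ∧
  TendstoInDistribution Y atTop (id : ℝ → ℝ) (fun _ => P)
    (gaussianReal 0 (asympVar Λ h f g).toNNReal)

/-! ### The sufficient conditions -/

/-- `f ∈ L^p`, `g ∈ L^q` with `p, q ≥ 1` and `1/p + 1/q ≤ 1/2`. -/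
def CondLp (Λ : Set ℝ) (f g : ℝ → ℝ) : Prop :=
  ∃ p q : ℝ≥0∞, 1 ≤ p ∧ 1 ≤ q ∧ p⁻¹ + q⁻¹ ≤ 2⁻¹ ∧
    MemLp f p (volume.restrict Λ) ∧ MemLp g q (volume.restrict Λ)

/-- `f g ∈ L¹ ∩ L²` and the variances `V T` converge to `σ_h²`. -/
def CondVariance {ι : Type*} [Preorder ι] (Λ : Set ℝ) (h f g : ℝ → ℝ) (V : ι → ℝ) : Prop :=
  MemLp (fun x => f x * g x) 1 (volume.restrict Λ) ∧
  MemLp (fun x => f x * g x) 2 (volume.restrict Λ) ∧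
  Tendsto V atTop (𝓝 (asympVar Λ h f g))

/-- `φ(x₁, x₂, x₃) = ∫_Λ f(u) g(u - x₁) f(u - x₂) g(u - x₃) du`. -/
def convFun (Λ : Set ℝ) (f g : ℝ → ℝ) (x : ℝ × ℝ × ℝ) : ℝ :=
  ∫ u in Λ, f u * g (u - x.1) * f (u - x.2.1) * g (u - x.2.2)

/-- `φ` belongs to `L²(Λ³)` and is continuous at the origin. -/
def CondConv (Λ : Set ℝ) (f g : ℝ → ℝ) : Prop :=
  MemLp (convFun Λ f g) 2 (volume.restrict (Λ ×ˢ Λ ×ˢ Λ)) ∧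
  ContinuousAt (convFun Λ f g) (0, 0, 0)

/-- `f, g, f g ∈ L²` and `∫ f²(λ) g²(λ - μ) dλ → ∫ f²(λ) g²(λ) dλ` as `μ → 0`. -/
def CondShift (Λ : Set ℝ) (f g : ℝ → ℝ) : Prop :=
  MemLp f 2 (volume.restrict Λ) ∧ MemLp g 2 (volume.restrict Λ) ∧
  MemLp (fun x => f x * g x) 2 (volume.restrict Λ) ∧
  Tendsto (fun m : ℝ => ∫⁻ x in Λ, ENNReal.ofReal (f x ^ 2 * g (x - m) ^ 2)) (𝓝[≠] 0)
    (𝓝 (∫⁻ x in Λ, ENNReal.ofReal (f x ^ 2 * g x ^ 2)))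

/-- The class `SV₀` of slowly varying functions at zero. -/
structure IsSV0 (u : ℝ → ℝ) : Prop where
  slowlyVarying : ∀ c : ℝ, 0 < c → Tendsto (fun x => u (c * x) / u x) (𝓝[>] 0) (𝓝 1)
  tendsto_zero : Tendsto u (𝓝[≠] 0) (𝓝 0)
  even : ∀ x, u (-x) = u x
  local_cond : ∃ a : ℝ, 0 < a ∧ (∃ M : ℝ, ∀ x ∈ Icc (-a) a, |u x| ≤ M) ∧
    ∀ x y : ℝ, 0 < x → x < y → y < a → 0 < u x ∧ u x < u y

/-- `f` is bounded on `Λ` outside any neighbourhood of the origin. -/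
def BoundedOffZero (Λ : Set ℝ) (f : ℝ → ℝ) : Prop :=
  ∀ ε : ℝ, 0 < ε → ∃ M : ℝ, ∀ x ∈ Λ, ε ≤ |x| → |f x| ≤ M

/-- Power-type singularities at the origin, with slowly varying factors. -/
def CondSingular (Λ : Set ℝ) (f g : ℝ → ℝ) : Prop :=
  BoundedOffZero Λ f ∧ BoundedOffZero Λ g ∧
  ∃ (a α β : ℝ) (L₁ L₂ : ℝ → ℝ), 0 < a ∧ α < 1 ∧ β < 1 ∧ α + β ≤ 1 / 2 ∧
    IsSV0 L₁ ∧ IsSV0 L₂ ∧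
    MemLp (fun x => |x| ^ (-(α + β)) * L₁ x) 2 (volume.restrict (Icc (-a) a)) ∧
    MemLp (fun x => |x| ^ (-(α + β)) * L₂ x) 2 (volume.restrict (Icc (-a) a)) ∧
    (∀ x ∈ Icc (-a) a, x ≠ 0 → f x ≤ |x| ^ (-α) * L₁ x) ∧
    (∀ x ∈ Icc (-a) a, x ≠ 0 → |g x| ≤ |x| ^ (-β) * L₂ x)

end

end TaperedCLT

open scoped ComplexConjugate

set_option linter.unusedSectionVars false

namespace TaperedCLT

open ENNReal (ofReal ofReal_le_ofReal mul_ne_top pow_ne_top ofReal_ne_top ofReal_mul coe_ne_top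
  mul_lt_top ofReal_coe_nnreal le_div_iff_mul_le mul_rpow_of_nonneg ofReal_lt_top ofReal_rpow_of_pos ofReal_inv_of_pos rpow_ne_top_of_nonneg div_le_of_le_mul toReal_ofReal)

noncomputable section

/-! ### Quadratic forms of finite Gaussian vectors -/

lemma integral_sq_stdGaussian : ∫ x, x ^ 2 ∂(gaussianReal 0 1) = 1 := by
  have h := variance_fun_id_gaussianReal (μ := 0) (v := 1)
  rw [variance_eq_integral (by fun_prop)] at h
  simpa using h

lemma integral_pow_four_stdGaussian : ∫ x, x ^ 4 ∂(gaussianReal 0 1) = 3 := by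
  have h := iteratedDeriv_mgf_zero (X := id) (μ := gaussianReal 0 1)
    (by simp [integrableExpSet_id_gaussianReal]) 4
  have e (p p' : ℝ → ℝ) (hp : ∀ t, HasDerivAt p (p' t) t) :
      deriv (fun t => p t * Real.exp (t ^ 2 / 2)) =
        fun t => (p' t + p t * t) * Real.exp (t ^ 2 / 2) := by
    funext t
    have h2 : HasDerivAt (fun t : ℝ => Real.exp (t ^ 2 / 2)) (Real.exp (t ^ 2 / 2) * t) t := by
      have := ((hasDerivAt_pow 2 t).div_const 2).exp
      convert this using 1
      simp
    rw [((hp t).fun_mul h2).deriv]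
    ring
  have h0 : mgf id (gaussianReal 0 1) = fun t => (1 : ℝ) * Real.exp (t ^ 2 / 2) := by
    rw [mgf_id_gaussianReal]; simp
  rw [h0] at h
  simp only [iteratedDeriv_succ, iteratedDeriv_zero] at h
  rw [e (fun _ => 1) (fun _ => 0) (fun t => hasDerivAt_const _ _),
    e (fun t => 0 + 1 * t) (fun _ => 1) (fun t => by simpa using hasDerivAt_id' t),
    e (fun t => 1 + (0 + 1 * t) * t) (fun t => 2 * t)
      (fun t => by
        have := (hasDerivAt_pow 2 t).const_add 1
        convert! this using 1
        · funext x; ring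
        · simp),
    e (fun t => 2 * t + (1 + (0 + 1 * t) * t) * t) (fun t => 3 + 3 * t ^ 2)
      (fun t => by
        have := ((hasDerivAt_id' t).const_mul 3).fun_add (hasDerivAt_pow 3 t)
        convert! this using 1
        · funext x; ring
        · simp)] at h
  simp at h
  simpa using h.symm

lemma memLp_sq_stdGaussian : MemLp (fun x : ℝ => x ^ 2) 2 (gaussianReal 0 1) := by
  have h4 : MemLp (id : ℝ → ℝ) 4 (gaussianReal 0 1) := by
    simpa using memLp_id_gaussianReal' (μ := 0) (v := 1) 4 (by simp)
  have := h4.mul (p := 4) (q := 4) (r := 2) h4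
    (hpqr := ⟨by
      rw [show (4 : ℝ≥0∞) = 2 * 2 by norm_num, ENNReal.mul_inv (by simp) (by simp), ← mul_add,
        ENNReal.inv_two_add_inv_two, mul_one]⟩)
  convert this using 1
  funext x; simp [pow_two]

lemma variance_sq_stdGaussian : Var[fun x : ℝ => x ^ 2; gaussianReal 0 1] = 2 := by
  rw [variance_eq_sub memLp_sq_stdGaussian]
  simp only [Pi.pow_apply, ← pow_mul]
  norm_num [integral_pow_four_stdGaussian, integral_sq_stdGaussian]

lemma norm_cexp_I_taylor_two (x : ℝ) :
    ‖Complex.exp (x * Complex.I) - (1 + x * Complex.I - x ^ 2 / 2)‖ ≤ 4 * |x| ^ 3 := by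
  rcases le_or_gt |x| 1 with h | h
  · have := Complex.exp_bound (x := x * Complex.I) (by simpa using h) (n := 3) (by norm_num)
    simp only [Finset.sum_range_succ, Finset.range_zero, Finset.sum_empty, norm_mul,
      Complex.norm_I, mul_one, Complex.norm_real, Real.norm_eq_abs] at this
    have e : (0 + (x * Complex.I) ^ 0 / ((Nat.factorial 0 : ℕ) : ℂ) +
        (x * Complex.I) ^ 1 / ((Nat.factorial 1 : ℕ) : ℂ) +
        (x * Complex.I) ^ 2 / ((Nat.factorial 2 : ℕ) : ℂ)) = 1 + x * Complex.I - x ^ 2 / 2 := by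
      simp [mul_pow, Nat.factorial]; ring
    rw [e] at this
    refine this.trans ?_
    have : 0 ≤ |x| ^ 3 := by positivity
    norm_num [Nat.factorial]
    nlinarith
  · have h1 : ‖Complex.exp (x * Complex.I)‖ = 1 := Complex.norm_exp_ofReal_mul_I x
    have h2 : ‖(1 + x * Complex.I - x ^ 2 / 2 : ℂ)‖ ≤ 1 + |x| + |x| ^ 2 / 2 := by
      refine (norm_sub_le _ _).trans ?_
      gcongr
      · refine (norm_add_le _ _).trans ?_
        simp
      · simp
    refine (norm_sub_le _ _).trans ?_
    rw [h1]
    nlinarith [sq_nonneg (|x| - 1), mul_pos (sub_pos.2 h) (sub_pos.2 h), pow_pos (by linarith : 0 < |x|) 2, pow_pos (sub_pos.2 h) 3]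

lemma exists_charFun_chiSq_bound : ∃ C : ℝ, 0 ≤ C ∧ ∀ s : ℝ,
    ‖∫ x, Complex.exp ((s * (x ^ 2 - 1) : ℝ) * Complex.I) ∂(gaussianReal 0 1) -
      Complex.exp (-(s ^ 2 : ℝ))‖ ≤ C * |s| ^ 3 := by
  set γ := gaussianReal 0 1
  have hm : MemLp (id : ℝ → ℝ) 6 γ := by
    simpa using memLp_id_gaussianReal' (μ := 0) (v := 1) 6 (by simp)
  have i6 : Integrable (fun x : ℝ => |x| ^ 6) γ := by
    have := hm.integrable_norm_pow (p := 6) (by norm_num)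
    simpa using this
  have i3 : Integrable (fun x : ℝ => |x ^ 2 - 1| ^ 3) γ := by
    refine ((i6.const_mul 8).add (integrable_const 8)).mono' (by fun_prop) (ae_of_all _ fun x => ?_)
    simp only [Real.norm_eq_abs, Pi.add_apply, abs_pow, abs_abs]
    have h1 : |x ^ 2 - 1| ≤ |x| ^ 2 + 1 := by have := abs_sub (x ^ 2) 1; simpa using this
    have h2 : 0 ≤ |x| ^ 2 := by positivity
    calc |x ^ 2 - 1| ^ 3 ≤ (|x| ^ 2 + 1) ^ 3 := by gcongr
      _ ≤ 8 * |x| ^ 6 + 8 := by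
        have : |x| ^ 6 = (|x| ^ 2) ^ 3 := by ring
        rw [this]
        nlinarith [mul_nonneg h2 (sq_nonneg (|x| ^ 2 - 1)), sq_nonneg (|x| ^ 2 - 1)]
  have i2 : Integrable (fun x : ℝ => (x ^ 2 - 1) ^ 2) γ :=
    (memLp_sq_stdGaussian.sub (memLp_const 1)).integrable_sq
  have i1 : Integrable (fun x : ℝ => x ^ 2 - 1) γ :=
    (memLp_sq_stdGaussian.sub (memLp_const 1)).integrable (by norm_num)
  have e1 : ∫ x, (x ^ 2 - 1) ∂γ = 0 := by
    rw [integral_sub (memLp_sq_stdGaussian.integrable (by norm_num)) (integrable_const _)]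
    simp [integral_sq_stdGaussian]
  have e2 : ∫ x, (x ^ 2 - 1) ^ 2 ∂γ = 2 := by
    have := variance_sq_stdGaussian
    rw [variance_eq_integral (by fun_prop)] at this
    simpa [integral_sq_stdGaussian] using this
  set K := ∫ x, |x ^ 2 - 1| ^ 3 ∂γ
  have hK : 0 ≤ K := integral_nonneg fun x => by positivity
  refine ⟨4 * K + 2, by positivity, fun s => ?_⟩
  have key : ‖∫ x, Complex.exp ((s * (x ^ 2 - 1) : ℝ) * Complex.I) ∂γ - (1 - s ^ 2 : ℝ)‖
      ≤ 4 * K * |s| ^ 3 := by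
    have e3 : ((1 - s ^ 2 : ℝ) : ℂ) = ∫ x, (1 + (s * (x ^ 2 - 1) : ℝ) * Complex.I -
        ((s * (x ^ 2 - 1) : ℝ) : ℂ) ^ 2 / 2) ∂γ := by
      have j1 : Integrable (fun x : ℝ => ((s * (x ^ 2 - 1) : ℝ) : ℂ) * Complex.I) γ :=
        ((i1.const_mul s).ofReal).mul_const _
      have j2 : Integrable (fun x : ℝ => ((s * (x ^ 2 - 1) : ℝ) : ℂ) ^ 2 / 2) γ := by
        have := ((i2.const_mul (s ^ 2)).ofReal (𝕜 := ℂ)).div_const 2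
        refine this.congr (ae_of_all _ fun x => ?_)
        simp; ring
      have j3 : Integrable (fun x : ℝ => 1 + ((s * (x ^ 2 - 1) : ℝ) : ℂ) * Complex.I) γ :=
        (integrable_const _).add j1
      rw [integral_sub j3 j2, integral_add (integrable_const _) j1,
        integral_mul_const, integral_complex_ofReal, integral_const_mul, e1]
      have : ∀ x : ℝ, ((s * (x ^ 2 - 1) : ℝ) : ℂ) ^ 2 / 2 = ((s ^ 2 / 2 * (x ^ 2 - 1) ^ 2 : ℝ) : ℂ) := by
        intro x; push_cast; ring
      simp_rw [this]
      rw [integral_complex_ofReal, integral_const_mul, e2]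
      simp
    rw [e3, ← integral_sub]
    · refine (norm_integral_le_of_norm_le ((i3.const_mul (4 * |s| ^ 3))) (ae_of_all _ fun x => ?_)).trans
        (le_of_eq ?_)
      · refine (norm_cexp_I_taylor_two _).trans (le_of_eq ?_)
        rw [abs_mul]; ring
      · rw [integral_const_mul]; ring
    · refine (integrable_const (1 : ℝ)).mono' (by fun_prop) (ae_of_all _ fun x => ?_)
      rw [Complex.norm_exp_ofReal_mul_I]
    · refine (((integrable_const _).add (((i1.const_mul s).ofReal).mul_const _))).sub ?_
      have := ((i2.const_mul (s ^ 2)).ofReal (𝕜 := ℂ)).div_const 2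
      refine this.congr (ae_of_all _ fun x => ?_)
      simp; ring
  have hs0 : 0 ≤ |s| := abs_nonneg s
  rcases le_or_gt |s| 1 with h | h
  · have h4 : ‖((1 - s ^ 2 : ℝ) : ℂ) - Complex.exp (-(s ^ 2 : ℝ))‖ ≤ 2 * |s| ^ 3 := by
      rw [← Complex.ofReal_neg, ← Complex.ofReal_exp, ← Complex.ofReal_sub, Complex.norm_real,
        Real.norm_eq_abs, abs_sub_comm]
      have hq : |-(s ^ 2)| ≤ 1 := by rw [abs_neg, abs_of_nonneg (sq_nonneg s), ← sq_abs]; nlinarith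
      have := Real.abs_exp_sub_one_sub_id_le hq
      have e : Real.exp (-(s^2)) - (1 - s^2) = Real.exp (-(s^2)) - 1 - -(s^2) := by ring
      rw [e]
      refine this.trans ?_
      have : (-(s^2))^2 = |s|^3 * |s| := by rw [neg_sq, ← sq_abs s]; ring
      rw [this]
      nlinarith [pow_nonneg hs0 3]
    calc _ ≤ _ := norm_sub_le_norm_sub_add_norm_sub _ ((1 - s ^ 2 : ℝ) : ℂ) _
      _ ≤ 4 * K * |s| ^ 3 + 2 * |s| ^ 3 := add_le_add key h4
      _ = _ := by ring
  · have h1 : ‖∫ x, Complex.exp ((s * (x ^ 2 - 1) : ℝ) * Complex.I) ∂γ‖ ≤ 1 := by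
      refine (norm_integral_le_of_norm_le (integrable_const (1 : ℝ)) (ae_of_all _ fun x => ?_)).trans ?_
      · rw [Complex.norm_exp_ofReal_mul_I]
      · simp
    have h2 : ‖Complex.exp (-(s ^ 2 : ℝ))‖ ≤ 1 := by
      rw [← Complex.ofReal_neg, ← Complex.ofReal_exp, Complex.norm_real, Real.norm_eq_abs,
        abs_of_pos (Real.exp_pos _)]
      exact Real.exp_le_one_iff.2 (by nlinarith [sq_nonneg s])
    have h3 : 1 ≤ |s| ^ 3 := one_le_pow₀ h.le
    calc _ ≤ 1 + 1 := (norm_sub_le _ _).trans (add_le_add h1 h2)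
      _ ≤ _ := by nlinarith [mul_nonneg hK (pow_nonneg hs0 3)]

/-- A constant in the comparison of the characteristic function of `s (ξ² - 1)`, `ξ` standard
Gaussian, with `exp (-s²)`. -/
def chiSqConst : ℝ := exists_charFun_chiSq_bound.choose

lemma chiSqConst_nonneg : 0 ≤ chiSqConst := exists_charFun_chiSq_bound.choose_spec.1

lemma charFun_chiSq_bound (s : ℝ) :
    ‖∫ x, Complex.exp ((s * (x ^ 2 - 1) : ℝ) * Complex.I) ∂(gaussianReal 0 1) -
      Complex.exp (-(s ^ 2 : ℝ))‖ ≤ chiSqConst * |s| ^ 3 :=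
  exists_charFun_chiSq_bound.choose_spec.2 s

lemma norm_finset_prod_sub_prod_le {ι : Type*} (s : Finset ι) (a b : ι → ℂ)
    (ha : ∀ i ∈ s, ‖a i‖ ≤ 1) (hb : ∀ i ∈ s, ‖b i‖ ≤ 1) :
    ‖∏ i ∈ s, a i - ∏ i ∈ s, b i‖ ≤ ∑ i ∈ s, ‖a i - b i‖ := by
  classical
  induction s using Finset.induction_on with
  | empty => simp
  | insert i s hi ih =>
    rw [Finset.prod_insert hi, Finset.prod_insert hi, Finset.sum_insert hi]
    have h1 : ‖∏ j ∈ s, a j‖ ≤ 1 := by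
      rw [norm_prod]
      exact Finset.prod_le_one (fun _ _ => norm_nonneg _)
        fun j hj => ha j (Finset.mem_insert_of_mem hj)
    have h2 := ih (fun j hj => ha j (Finset.mem_insert_of_mem hj))
      (fun j hj => hb j (Finset.mem_insert_of_mem hj))
    have e : a i * ∏ j ∈ s, a j - b i * ∏ j ∈ s, b j =
        (a i - b i) * ∏ j ∈ s, a j + b i * (∏ j ∈ s, a j - ∏ j ∈ s, b j) := by ring
    rw [e]
    refine (norm_add_le _ _).trans ?_
    rw [norm_mul, norm_mul]
    refine add_le_add (mul_le_of_le_one_right (norm_nonneg _) h1) ?_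
    exact (mul_le_of_le_one_left (norm_nonneg _) (hb i (Finset.mem_insert_self _ _))).trans h2

section Pi

variable {ι : Type*} [Fintype ι]

lemma memLp_sq_eval_pi (c : ι → ℝ) (i : ι) :
    MemLp (fun ξ : ι → ℝ => c i * ξ i ^ 2) 2 (Measure.pi fun _ => gaussianReal 0 1) :=
  (memLp_sq_stdGaussian.comp_measurePreserving
    (measurePreserving_eval (fun _ : ι => gaussianReal 0 1) i)).const_mul (c i)

lemma memLp_weighted_chiSq (c : ι → ℝ) :
    MemLp (fun ξ : ι → ℝ => ∑ i, c i * ξ i ^ 2) 2 (Measure.pi fun _ => gaussianReal 0 1) :=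
  memLp_finsetSum _ fun i _ => memLp_sq_eval_pi c i

lemma integral_weighted_chiSq (c : ι → ℝ) :
    ∫ ξ : ι → ℝ, ∑ i, c i * ξ i ^ 2 ∂(Measure.pi fun _ => gaussianReal 0 1) = ∑ i, c i := by
  rw [integral_finsetSum _ fun i _ => (memLp_sq_eval_pi c i).integrable (by norm_num)]
  refine Finset.sum_congr rfl fun i _ => ?_
  rw [integral_const_mul]
  have := (measurePreserving_eval (fun _ : ι => gaussianReal 0 1) i).hasLaw.integral_comp
    (f := fun x : ℝ => x ^ 2) (by fun_prop)
  simp only [Function.comp_def, Function.eval] at this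
  rw [this, integral_sq_stdGaussian, mul_one]

lemma variance_weighted_chiSq (c : ι → ℝ) :
    Var[fun ξ : ι → ℝ => ∑ i, c i * ξ i ^ 2; Measure.pi fun _ => gaussianReal 0 1] =
      2 * ∑ i, c i ^ 2 := by
  have hind : iIndepFun (fun i (ξ : ι → ℝ) => c i * ξ i ^ 2)
      (Measure.pi fun _ : ι => gaussianReal 0 1) :=
    iIndepFun_pi (X := fun i x => c i * x ^ 2) fun i => by fun_prop
  have := IndepFun.variance_sum (s := Finset.univ) (fun i _ => memLp_sq_eval_pi c i)
    fun i _ j _ hij => hind.indepFun hij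
  have e : (∑ i, fun ξ : ι → ℝ => c i * ξ i ^ 2) = fun ξ => ∑ i, c i * ξ i ^ 2 := by funext ξ; simp
  rw [e] at this
  rw [this, Finset.mul_sum]
  refine Finset.sum_congr rfl fun i _ => ?_
  rw [variance_const_mul]
  have h2 := (measurePreserving_eval (fun _ : ι => gaussianReal 0 1) i).variance_fun_comp
    (f := fun x : ℝ => x ^ 2) (by fun_prop)
  simp only [Function.eval] at h2
  rw [h2, variance_sq_stdGaussian]
  ring

lemma charFun_weighted_chiSq_bound (c : ι → ℝ) (θ : ℝ) :
    ‖∫ ξ : ι → ℝ, Complex.exp ((θ * (∑ i, c i * ξ i ^ 2 - ∑ i, c i) : ℝ) * Complex.I)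
        ∂(Measure.pi fun _ => gaussianReal 0 1) -
      Complex.exp (-(θ ^ 2 * ∑ i, c i ^ 2 : ℝ))‖ ≤
      chiSqConst * |θ| ^ 3 * √((∑ i, c i ^ 2) * ∑ i, c i ^ 4) := by
  have e1 : ∀ ξ : ι → ℝ, Complex.exp ((θ * (∑ i, c i * ξ i ^ 2 - ∑ i, c i) : ℝ) * Complex.I) =
      ∏ i, Complex.exp (((θ * c i) * (ξ i ^ 2 - 1) : ℝ) * Complex.I) := by
    intro ξ
    rw [← Complex.exp_sum, ← Finset.sum_mul, ← Complex.ofReal_sum, ← Finset.sum_sub_distrib,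
      Finset.mul_sum]
    congr 3
    refine Finset.sum_congr rfl fun i _ => ?_
    ring
  have e2 : Complex.exp (-(θ ^ 2 * ∑ i, c i ^ 2 : ℝ)) =
      ∏ i, Complex.exp (-((θ * c i) ^ 2 : ℝ)) := by
    rw [← Complex.exp_sum, Finset.sum_neg_distrib, ← Complex.ofReal_sum, Finset.mul_sum]
    simp only [mul_pow]
  simp_rw [e1]
  rw [e2, integral_fintype_prod_eq_prod
    (f := fun i (x : ℝ) => Complex.exp (((θ * c i) * (x ^ 2 - 1) : ℝ) * Complex.I))]
  refine (norm_finset_prod_sub_prod_le _ _ _ (fun i _ => ?_) fun i _ => ?_).trans ?_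
  · refine (norm_integral_le_of_norm_le (integrable_const (1 : ℝ)) (ae_of_all _ fun x => ?_)).trans ?_
    · rw [Complex.norm_exp_ofReal_mul_I]
    · simp
  · rw [← Complex.ofReal_neg, ← Complex.ofReal_exp, Complex.norm_real, Real.norm_eq_abs,
      abs_of_pos (Real.exp_pos _)]
    exact Real.exp_le_one_iff.2 (by nlinarith [sq_nonneg (θ * c i)])
  · calc ∑ i, _ ≤ ∑ i, chiSqConst * |θ| ^ 3 * (|c i| * |c i| ^ 2) := by
          refine Finset.sum_le_sum fun i _ => (charFun_chiSq_bound (θ * c i)).trans (le_of_eq ?_)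
          rw [abs_mul]; ring
      _ = chiSqConst * |θ| ^ 3 * ∑ i, |c i| * |c i| ^ 2 := by rw [Finset.mul_sum]
      _ ≤ _ := by
          refine mul_le_mul_of_nonneg_left ?_ (mul_nonneg chiSqConst_nonneg (by positivity))
          refine Real.le_sqrt_of_sq_le ?_
          refine (Finset.sum_mul_sq_le_sq_mul_sq _ _ _).trans (le_of_eq ?_)
          simp only [← pow_mul, sq_abs, show 2 * 2 = 4 from rfl]

end Pi

section Vector

variable {Ω : Type*} [MeasurableSpace Ω] {P : Measure Ω} {ι : Type*} [Fintype ι] [DecidableEq ι]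

open Matrix
open scoped MatrixOrder

lemma trace_pow_eq_sum_eigenvalues_pow {M : Matrix ι ι ℝ} (hM : M.IsHermitian) (k : ℕ) :
    (M ^ k).trace = ∑ i, hM.eigenvalues i ^ k := by
  conv_lhs => rw [hM.spectral_theorem]
  rw [← map_pow, Unitary.conjStarAlgAut_apply, Matrix.trace_mul_comm, ← mul_assoc]
  simp [Matrix.diagonal_pow, Matrix.trace_diagonal]

lemma posSemidef_of_moments [IsProbabilityMeasure P] {X : ι → Ω → ℝ} (hX : ∀ i, MemLp (X i) 2 P)
    {R : Matrix ι ι ℝ} (hR : ∀ i j, ∫ ω, X i ω * X j ω ∂P = R i j) : R.PosSemidef := by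
  refine Matrix.PosSemidef.of_dotProduct_mulVec_nonneg ?_ fun x => ?_
  · ext i j
    simp only [conjTranspose_apply, star_trivial, ← hR]
    simp_rw [mul_comm]
  · have : star x ⬝ᵥ R *ᵥ x = ∫ ω, (∑ i, x i * X i ω) ^ 2 ∂P := by
      have e : ∀ ω, (∑ i, x i * X i ω) ^ 2 = ∑ i, ∑ j, x i * x j * (X i ω * X j ω) := by
        intro ω
        rw [pow_two, Finset.sum_mul_sum]
        refine Finset.sum_congr rfl fun i _ => Finset.sum_congr rfl fun j _ => by ring
      simp_rw [e]
      have hi : ∀ i j, Integrable (fun ω => X i ω * X j ω) P :=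
        fun i j => (hX i).integrable_mul (hX j)
      rw [integral_finsetSum _ fun i _ => integrable_finsetSum _ fun j _ => (hi i j).const_mul _]
      simp_rw [integral_finsetSum _ fun j _ => (hi _ j).const_mul _, integral_const_mul, hR]
      simp only [dotProduct, mulVec, star_trivial, Finset.mul_sum]
      refine Finset.sum_congr rfl fun i _ => Finset.sum_congr rfl fun j _ => by ring
    rw [this]
    exact integral_nonneg fun ω => sq_nonneg _

lemma map_eq_multivariateGaussian [IsProbabilityMeasure P] {X : ι → Ω → ℝ}
    (hX : HasGaussianLaw (fun ω i => X i ω) P) (h0 : ∀ i, ∫ ω, X i ω ∂P = 0)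
    {R : Matrix ι ι ℝ} (hR : ∀ i j, ∫ ω, X i ω * X j ω ∂P = R i j) :
    P.map (fun ω => WithLp.toLp 2 (X · ω)) = multivariateGaussian 0 R := by
  have hL : HasGaussianLaw (fun ω => WithLp.toLp 2 (X · ω)) P := hX.toLp_pi 2
  have h2 : ∀ i, MemLp (X i) 2 P := fun i => (hX.eval i).memLp_two
  have := hL.isGaussian_map
  refine IsGaussian.ext ?_ ?_
  · rw [integral_id_multivariateGaussian', integral_map hL.aemeasurable (by fun_prop)]
    ext i
    have := (EuclideanSpace.proj (𝕜 := ℝ) i).integral_comp_comm hL.integrable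
    simp only [id]
    refine (this.symm.trans ?_)
    simpa using h0 i
  · ext x y
    rw [covarianceBilin_apply_pi h2, covarianceBilin_multivariateGaussian (posSemidef_of_moments h2 hR)]
    simp only [dotProduct, mulVec, Finset.mul_sum]
    refine Finset.sum_congr rfl fun i _ => Finset.sum_congr rfl fun j _ => ?_
    rw [covariance_eq_sub (h2 i) (h2 j)]
    simp only [h0, Pi.mul_apply, hR]
    ring

lemma map_multivariateGaussian_eq_map_pi {R : Matrix ι ι ℝ} {F : EuclideanSpace ℝ ι → ℝ}
    (hF : Measurable F) (b : OrthonormalBasis ι ℝ (EuclideanSpace ℝ ι)) :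
    (multivariateGaussian 0 R).map F = (Measure.pi fun _ => gaussianReal 0 1).map
      fun ξ : ι → ℝ => F (toEuclideanCLM (𝕜 := ℝ) (CFC.sqrt R) (∑ i, ξ i • b i)) := by
  rw [multivariateGaussian, stdGaussian_eq_map_pi_orthonormalBasis b,
    Measure.map_map hF (by fun_prop), Measure.map_map (hF.comp (by fun_prop)) (by fun_prop)]
  simp only [Function.comp_def, zero_add]

lemma quadForm_sum_eigenbasis {S B : Matrix ι ι ℝ} (hSt : Sᵀ = S)
    (b : OrthonormalBasis ι ℝ (EuclideanSpace ℝ ι)) {c : ι → ℝ}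
    (hb : ∀ j, (S * B * S) *ᵥ (b j).ofLp = c j • (b j).ofLp) (ξ : ι → ℝ) (y : ι → ℝ)
    (hy : y = S *ᵥ (∑ i, ξ i • b i : EuclideanSpace ℝ ι).ofLp) :
    ∑ i, ∑ j, B i j * y i * y j = ∑ i, c i * ξ i ^ 2 := by
  have e1 : ∑ i, ∑ j, B i j * y i * y j = y ⬝ᵥ B *ᵥ y := by
    simp only [dotProduct, mulVec, Finset.mul_sum]
    refine Finset.sum_congr rfl fun i _ => Finset.sum_congr rfl fun j _ => by ring
  set v : EuclideanSpace ℝ ι := ∑ i, ξ i • b i with hv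
  have e3 : (S * B * S) *ᵥ v.ofLp = (∑ i, (ξ i * c i) • b i : EuclideanSpace ℝ ι).ofLp := by
    rw [hv]
    simp only [WithLp.ofLp_sum, WithLp.ofLp_smul, mulVec_sum, mulVec_smul, hb, smul_smul]
  have e5 : y ⬝ᵥ B *ᵥ y = v.ofLp ⬝ᵥ (S * B * S) *ᵥ v.ofLp := by
    rw [hy, mul_assoc, ← mulVec_mulVec, ← mulVec_mulVec,
      dotProduct_mulVec v.ofLp S (B *ᵥ (S *ᵥ v.ofLp)), ← mulVec_transpose S, hSt]
  have e4 := b.orthonormal.inner_sum (fun i => ξ i * c i) ξ Finset.univ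
  rw [EuclideanSpace.inner_eq_star_dotProduct] at e4
  simp only [star_trivial] at e4
  rw [e1, e5, e3, hv]
  refine e4.trans (Finset.sum_congr rfl fun i _ => ?_)
  simp
  ring

/-- The law of a quadratic form in a centered Gaussian vector is that of a weighted sum of
squares of independent standard Gaussian variables. -/
lemma exists_weights_quadForm [IsProbabilityMeasure P] {X : ι → Ω → ℝ}
    (hX : HasGaussianLaw (fun ω i => X i ω) P) (h0 : ∀ i, ∫ ω, X i ω ∂P = 0)
    {R B : Matrix ι ι ℝ} (hR : ∀ i j, ∫ ω, X i ω * X j ω ∂P = R i j) (hB : B.IsSymm) :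
    ∃ c : ι → ℝ, ∑ i, c i ^ 2 = ((B * R) ^ 2).trace ∧ ∑ i, c i ^ 4 = ((B * R) ^ 4).trace ∧
      IdentDistrib (fun ω => ∑ i, ∑ j, B i j * X i ω * X j ω)
        (fun ξ : ι → ℝ => ∑ i, c i * ξ i ^ 2) P (Measure.pi fun _ => gaussianReal 0 1) := by
  have h2 : ∀ i, MemLp (X i) 2 P := fun i => (hX.eval i).memLp_two
  have hRp := posSemidef_of_moments h2 hR
  set S := CFC.sqrt R with hS
  have hSS : S * S = R := CFC.sqrt_mul_sqrt_self _ hRp.nonneg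
  have hSh : S.IsHermitian := (CFC.sqrt_nonneg R).isSelfAdjoint
  have hSt : Sᵀ = S := by simpa [Matrix.IsHermitian, conjTranspose_eq_transpose_of_trivial] using hSh
  have hM : (S * B * S).IsHermitian := by
    rw [Matrix.IsHermitian, conjTranspose_eq_transpose_of_trivial, transpose_mul, transpose_mul,
      hSt, hB.eq, mul_assoc]
  have htr : ∀ k, ((S * B * S) ^ (k + 1)).trace = ((B * R) ^ (k + 1)).trace := by
    intro k
    have : ∀ k, (S * B * S) ^ (k + 1) = S * (B * R) ^ k * B * S := by
      intro k
      induction k with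
      | zero => simp
      | succ k ih =>
        rw [pow_succ, ih, pow_succ (B * R) k, ← hSS]
        simp only [mul_assoc]
    rw [this, mul_assoc, mul_assoc, Matrix.trace_mul_comm, mul_assoc, mul_assoc, hSS, ← pow_succ]
  refine ⟨hM.eigenvalues, ?_, ?_, ?_⟩
  · rw [← trace_pow_eq_sum_eigenvalues_pow, htr 1]
  · rw [← trace_pow_eq_sum_eigenvalues_pow, htr 3]
  · have hL : HasGaussianLaw (fun ω => WithLp.toLp 2 (X · ω)) P := hX.toLp_pi 2
    obtain ⟨c, b, hb, hc⟩ : ∃ (c : ι → ℝ) (b : OrthonormalBasis ι ℝ (EuclideanSpace ℝ ι)),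
        (∀ j, (S * B * S) *ᵥ (b j).ofLp = c j • (b j).ofLp) ∧ c = hM.eigenvalues :=
      ⟨_, hM.eigenvectorBasis, hM.mulVec_eigenvectorBasis, rfl⟩
    rw [← hc]
    have hFm : Measurable (fun x : EuclideanSpace ℝ ι => ∑ i, ∑ j, B i j * x i * x j) := by fun_prop
    have e1 : P.map (fun ω => ∑ i, ∑ j, B i j * X i ω * X j ω) =
        (P.map (fun ω => WithLp.toLp 2 (X · ω))).map
          (fun x : EuclideanSpace ℝ ι => ∑ i, ∑ j, B i j * x i * x j) := by
      rw [AEMeasurable.map_map_of_aemeasurable hFm.aemeasurable hL.aemeasurable]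
      rfl
    have hXm : ∀ i, AEMeasurable (X i) P := fun i => (hX.eval i).aemeasurable
    refine ⟨by fun_prop, (memLp_weighted_chiSq c).aestronglyMeasurable.aemeasurable, ?_⟩
    rw [e1, map_eq_multivariateGaussian hX h0 hR, map_multivariateGaussian_eq_map_pi hFm b]
    congr 1
    funext ξ
    exact quadForm_sum_eigenbasis hSt b hb ξ _ (by simp [hS, mulVec_sum, mulVec_smul])

/-- `Q` has the variance of a Gaussian quadratic form with traces `m₂` and `m₄` of the second and
fourth powers, and nearly its Gaussian characteristic function. -/
def HasQuadLaw {Ω : Type*} [MeasurableSpace Ω] (P : Measure Ω) (Q : Ω → ℝ) (m₂ m₄ : ℝ) : Prop :=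
  MemLp Q 2 P ∧ Var[Q; P] = 2 * m₂ ∧ ∀ θ : ℝ,
    ‖∫ ω, Complex.exp ((θ * (Q ω - ∫ ω', Q ω' ∂P) : ℝ) * Complex.I) ∂P -
      Complex.exp (-(θ ^ 2 * m₂ : ℝ))‖ ≤ chiSqConst * |θ| ^ 3 * √(m₂ * m₄)

/-- Second moment, variance and characteristic function of a centered quadratic form in a
centered Gaussian vector with covariance matrix `R`. -/
lemma quadForm_gaussian_vector [IsProbabilityMeasure P] {X : ι → Ω → ℝ}
    (hX : HasGaussianLaw (fun ω i => X i ω) P) (h0 : ∀ i, ∫ ω, X i ω ∂P = 0)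
    {R B : Matrix ι ι ℝ} (hR : ∀ i j, ∫ ω, X i ω * X j ω ∂P = R i j) (hB : B.IsSymm)
    {Q : Ω → ℝ} (hQ : Q = fun ω => ∑ i, ∑ j, B i j * X i ω * X j ω) :
    HasQuadLaw P Q ((B * R) ^ 2).trace ((B * R) ^ 4).trace := by
  obtain ⟨c, h2, h4, hid⟩ := exists_weights_quadForm hX h0 hR hB
  rw [← hQ] at hid
  refine ⟨hid.symm.memLp_snd (memLp_weighted_chiSq c), ?_, fun θ => ?_⟩
  · rw [hid.variance_eq, variance_weighted_chiSq, h2]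
  · rw [hid.integral_eq, integral_weighted_chiSq]
    have := (hid.comp (u := fun x : ℝ =>
      Complex.exp ((θ * (x - ∑ i, c i) : ℝ) * Complex.I)) (by fun_prop)).integral_eq
    simp only [Function.comp_def] at this
    rw [this, ← h2, ← h4]
    exact charFun_weighted_chiSq_bound c θ

end Vector

/-! ### Quadratic functionals of Gaussian processes -/

/-- The Cauchy-Schwarz inequality for Lebesgue integrals. -/
lemma lintegral_mul_sq_le {Z : Type*} [MeasurableSpace Z] (κ : Measure Z) {f g : Z → ℝ≥0∞}
    (hf : AEMeasurable f κ) (hg : AEMeasurable g κ) :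
    (∫⁻ z, f z * g z ∂κ) ^ 2 ≤ (∫⁻ z, f z ^ 2 ∂κ) * ∫⁻ z, g z ^ 2 ∂κ := by
  have h := ENNReal.lintegral_mul_le_Lp_mul_Lq κ Real.HolderConjugate.two_two hf hg
  simp only [Pi.mul_apply] at h
  have e : ∀ x : ℝ≥0∞, (x ^ (1 / (2 : ℝ))) ^ 2 = x := fun x => by
    rw [← ENNReal.rpow_natCast, ← ENNReal.rpow_mul]; norm_num
  calc _ ≤ _ := pow_le_pow_left' h 2
    _ = _ := by
      rw [mul_pow, e, e]
      norm_cast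

lemma lintegral_sq_le {Z : Type*} [MeasurableSpace Z] (κ : Measure Z) {f : Z → ℝ≥0∞}
    (hf : AEMeasurable f κ) :
    (∫⁻ z, f z ∂κ) ^ 2 ≤ κ univ * ∫⁻ z, f z ^ 2 ∂κ := by
  have := lintegral_mul_sq_le κ (f := 1) (g := f) aemeasurable_const hf
  simpa using this

section L2mean

variable {Ω : Type*} [MeasurableSpace Ω] {P : Measure Ω} [IsProbabilityMeasure P]
  {Z : Type*} [MeasurableSpace Z] {κ : Measure Z} [IsFiniteMeasure κ]

omit [IsProbabilityMeasure P] in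
lemma eLpNorm_two_sq {f : Ω → ℝ} : eLpNorm f 2 P ^ 2 = ∫⁻ ω, ‖f ω‖ₑ ^ 2 ∂P := by
  have := eLpNorm_nnreal_pow_eq_lintegral (f := f) (μ := P) (p := 2) (by norm_num)
  simpa using this

lemma ae_integrable_of_eLpNorm_le {Y : Z → Ω → ℝ} (hY : Measurable (fun p : Z × Ω => Y p.1 p.2))
    {K : ℝ≥0∞} (hK : K ≠ ∞) (h : ∀ z, eLpNorm (Y z) 2 P ≤ K) :
    ∀ᵐ ω ∂P, Integrable (fun z => Y z ω) κ := by
  have h1 : ∫⁻ ω, ∫⁻ z, ‖Y z ω‖ₑ ∂κ ∂P ≤ K * κ univ := by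
    rw [lintegral_lintegral_swap (by fun_prop)]
    refine (lintegral_mono (g := fun _ => K) fun z => ?_).trans (by simp)
    rw [← eLpNorm_one_eq_lintegral_enorm]
    exact (eLpNorm_le_eLpNorm_of_exponent_le (by norm_num)
      (hY.comp measurable_prodMk_left).aestronglyMeasurable).trans (h z)
  have h2 := ae_lt_top' (μ := P) (f := fun ω => ∫⁻ z, ‖Y z ω‖ₑ ∂κ)
    (by
      have : Measurable fun q : Ω × Z => ‖Y q.2 q.1‖ₑ := by fun_prop
      exact this.lintegral_prod_right'.aemeasurable)
    (ne_top_of_le_ne_top (mul_ne_top hK (measure_ne_top _ _)) h1)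
  filter_upwards [h2] with ω hω
  exact ⟨(hY.comp measurable_prodMk_right).aestronglyMeasurable, hω⟩

lemma measurable_integral_left {Y : Z → Ω → ℝ} (hY : Measurable (fun p : Z × Ω => Y p.1 p.2)) :
    Measurable fun ω => ∫ z, Y z ω ∂κ := by
  have : Measurable fun q : Ω × Z => Y q.2 q.1 := by fun_prop
  exact this.stronglyMeasurable.integral_prod_right'.measurable

lemma eLpNorm_integral_sq_le {Y : Z → Ω → ℝ} (hY : Measurable (fun p : Z × Ω => Y p.1 p.2)) :
    eLpNorm (fun ω => ∫ z, Y z ω ∂κ) 2 P ^ 2 ≤ κ univ * ∫⁻ z, eLpNorm (Y z) 2 P ^ 2 ∂κ := by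
  simp_rw [eLpNorm_two_sq]
  calc _ ≤ ∫⁻ ω, κ univ * ∫⁻ z, ‖Y z ω‖ₑ ^ 2 ∂κ ∂P := by
        refine lintegral_mono fun ω => ?_
        refine (pow_le_pow_left' (enorm_integral_le_lintegral_enorm _) 2).trans ?_
        exact lintegral_sq_le κ (by fun_prop)
    _ = _ := by
        have hm : Measurable fun q : Ω × Z => ‖Y q.2 q.1‖ₑ ^ 2 := by fun_prop
        rw [lintegral_const_mul _ hm.lintegral_prod_right',
          lintegral_lintegral_swap (by fun_prop)]

/-- Variances and characteristic functions pass to the limit in `L²`. -/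
lemma tendsto_variance_charFun {Qn : ℕ → Ω → ℝ} {Q : Ω → ℝ} (hn : ∀ n, MemLp (Qn n) 2 P)
    (hQ : MemLp Q 2 P) (h : Tendsto (fun n => eLpNorm (Qn n - Q) 2 P) atTop (𝓝 0)) :
    Tendsto (fun n => Var[Qn n; P]) atTop (𝓝 Var[Q; P]) ∧ ∀ θ : ℝ,
      Tendsto (fun n => ∫ ω, Complex.exp ((θ * (Qn n ω - ∫ ω', Qn n ω' ∂P) : ℝ) * Complex.I) ∂P)
        atTop (𝓝 (∫ ω, Complex.exp ((θ * (Q ω - ∫ ω', Q ω' ∂P) : ℝ) * Complex.I) ∂P)) := by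
  have h1 : Tendsto (fun n => eLpNorm (Qn n - Q) 1 P) atTop (𝓝 0) :=
    tendsto_of_tendsto_of_tendsto_of_le_of_le tendsto_const_nhds h (fun n => bot_le) fun n =>
      eLpNorm_le_eLpNorm_of_exponent_le (by norm_num) ((hn n).sub hQ).1
  have hi : Tendsto (fun n => ∫ ω, Qn n ω ∂P) atTop (𝓝 (∫ ω, Q ω ∂P)) :=
    tendsto_integral_of_L1' _ hQ.1 (Eventually.of_forall fun n => (hn n).integrable (by norm_num)) h1
  constructor
  · have hL := (Lp.tendsto_Lp_iff_tendsto_eLpNorm'' Qn hn Q hQ).2 h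
    have h2 : ∀ {f : Ω → ℝ} (hf : MemLp f 2 P), ‖hf.toLp‖ ^ 2 = ∫ ω, (f ^ 2) ω ∂P := by
      intro f hf
      rw [← real_inner_self_eq_norm_sq, L2.inner_def]
      refine integral_congr_ae ?_
      filter_upwards [hf.coeFn_toLp] with ω hω
      simp [hω, pow_two]
    have h3 := (hL.norm.pow 2)
    simp_rw [h2] at h3
    simp_rw [variance_eq_sub (hn _), variance_eq_sub hQ]
    exact h3.sub (hi.pow 2)
  · intro θ
    rw [tendsto_iff_norm_sub_tendsto_zero]
    have hb : Tendsto (fun n => |θ| * ((eLpNorm (Qn n - Q) 1 P).toReal +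
        |∫ ω, Qn n ω ∂P - ∫ ω, Q ω ∂P|)) atTop (𝓝 0) := by
      have a1 := (ENNReal.tendsto_toReal ENNReal.zero_ne_top).comp h1
      have a2 := (tendsto_sub_nhds_zero_iff.2 hi).abs
      simpa using (a1.add a2).const_mul |θ|
    refine squeeze_zero (fun n => norm_nonneg _) (fun n => ?_) hb
    have hexp : ∀ a b : ℝ, ‖Complex.exp (a * Complex.I) - Complex.exp (b * Complex.I)‖ ≤ |a - b| := by
      intro a b
      have e : Complex.exp (a * Complex.I) - Complex.exp (b * Complex.I) =
          Complex.exp (b * Complex.I) * (Complex.exp (Complex.I * (a - b : ℝ)) - 1) := by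
        rw [mul_sub, ← Complex.exp_add, mul_one]
        congr 2
        push_cast; ring
      rw [e, norm_mul, Complex.norm_exp_ofReal_mul_I, one_mul]
      exact Real.norm_exp_I_mul_ofReal_sub_one_le
    have hint : ∀ {f : Ω → ℝ}, MemLp f 2 P →
        Integrable (fun ω => Complex.exp ((θ * (f ω - ∫ ω', f ω' ∂P) : ℝ) * Complex.I)) P := by
      intro f hf
      have := hf.1.aemeasurable
      refine (integrable_const (1 : ℝ)).mono' (by fun_prop) (ae_of_all _ fun x => ?_)
      rw [Complex.norm_exp_ofReal_mul_I]
    have hd : Integrable (Qn n - Q) P := ((hn n).sub hQ).integrable (by norm_num)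
    rw [← integral_sub (hint (hn n)) (hint hQ)]
    refine (norm_integral_le_of_norm_le
      ((hd.norm.add (integrable_const |∫ ω, Qn n ω ∂P - ∫ ω, Q ω ∂P|)).const_mul |θ|)
      (ae_of_all _ fun ω => ?_)).trans (le_of_eq ?_)
    · refine (hexp _ _).trans ?_
      rw [← mul_sub, abs_mul]
      refine mul_le_mul_of_nonneg_left ?_ (abs_nonneg _)
      simp only [Pi.add_apply, Pi.sub_apply, Real.norm_eq_abs]
      rw [show Qn n ω - ∫ ω', Qn n ω' ∂P - (Q ω - ∫ ω', Q ω' ∂P) =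
        (Qn n ω - Q ω) - (∫ ω', Qn n ω' ∂P - ∫ ω', Q ω' ∂P) by ring]
      exact abs_sub _ _
    · rw [integral_const_mul]
      simp only [Pi.add_apply]
      rw [integral_add hd.norm (integrable_const _)]
      rw [integral_norm_eq_lintegral_enorm hd.1, eLpNorm_one_eq_lintegral_enorm]
      simp

end L2mean

/-- The `L⁴` norm of a standard Gaussian variable. -/
def gaussFour : ℝ≥0∞ := eLpNorm (id : ℝ → ℝ) 4 (gaussianReal 0 1)

lemma gaussFour_ne_top : gaussFour ≠ ∞ :=
  (memLp_id_gaussianReal' (μ := 0) (v := 1) 4 (by simp)).eLpNorm_ne_top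

lemma eLpNorm_four_gaussian {Ω : Type*} [MeasurableSpace Ω] {P : Measure Ω}
    [IsProbabilityMeasure P] {U : Ω → ℝ} (hU : HasGaussianLaw U P) (h0 : ∫ ω, U ω ∂P = 0) :
    eLpNorm U 4 P = ofReal √(∫ ω, U ω ^ 2 ∂P) * gaussFour := by
  have hm := hU.map_eq_gaussianReal
  have hv : Var[U; P] = ∫ ω, U ω ^ 2 ∂P := by rw [variance_eq_sub hU.memLp_two, h0]; simp
  have hpos : 0 ≤ ∫ ω, U ω ^ 2 ∂P := integral_nonneg fun _ => sq_nonneg _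
  have e : gaussianReal (∫ ω, U ω ∂P) Var[U; P].toNNReal =
      (gaussianReal 0 1).map (fun x => √(∫ ω, U ω ^ 2 ∂P) * x) := by
    rw [gaussianReal_map_const_mul, h0, hv]
    congr 1
    · simp
    · ext
      simp [Real.sq_sqrt hpos, hpos]
  have h1 : eLpNorm U 4 P = eLpNorm (id : ℝ → ℝ) 4 (P.map U) := by
    rw [eLpNorm_map_measure (by fun_prop) hU.aemeasurable]; rfl
  rw [h1, hm, e, eLpNorm_map_measure (by fun_prop) (by fun_prop)]
  have : (id : ℝ → ℝ) ∘ (fun x => √(∫ ω, U ω ^ 2 ∂P) * x) = √(∫ ω, U ω ^ 2 ∂P) • (id : ℝ → ℝ) := by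
    funext x; simp
  rw [this, eLpNorm_const_smul, gaussFour, Real.enorm_of_nonneg (Real.sqrt_nonneg _)]

lemma eLpNorm_two_mul_le {Ω : Type*} [MeasurableSpace Ω] {P : Measure Ω} {U V : Ω → ℝ}
    (hU : AEStronglyMeasurable U P) (hV : AEStronglyMeasurable V P) :
    eLpNorm (fun ω => U ω * V ω) 2 P ≤ eLpNorm U 4 P * eLpNorm V 4 P := by
  have : ENNReal.HolderTriple 4 4 2 := ⟨by
    rw [show (4 : ℝ≥0∞) = 2 * 2 by norm_num, ENNReal.mul_inv (by simp) (by simp), ← mul_add,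
      ENNReal.inv_two_add_inv_two, mul_one]⟩
  have := eLpNorm_le_eLpNorm_mul_eLpNorm_of_nnnorm (p := 4) (q := 4) (r := 2) hU hV
    (fun x y : ℝ => x * y) 1 (ae_of_all _ fun x => by simp)
  simpa using this

/-! ### Composition and trace of kernels over a finite measure space -/

section Kernels

variable {S : Type*} [MeasurableSpace S] (τ : Measure S) {𝕜 : Type*} [RCLike 𝕜]

/-- Composition of integral kernels with respect to the measure `τ`. -/
def mcomp {α γ : Type*} (K : α → S → 𝕜) (L : S → γ → 𝕜) (t : α) (s : γ) : 𝕜 := ∫ u, K t u * L u s ∂τ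

/-- Trace of an integral kernel with respect to the measure `τ`. -/
def mtrace (K : S → S → 𝕜) : 𝕜 := ∫ t, K t t ∂τ

/-- `tr [B R]²`. -/
def mtrace2 (B R : S → S → 𝕜) : 𝕜 :=
  mtrace τ (mcomp τ (mcomp τ B R) (mcomp τ B R))

/-- `tr [B R]⁴`. -/
def mtrace4 (B R : S → S → 𝕜) : 𝕜 :=
  mtrace τ (mcomp τ (mcomp τ (mcomp τ B R) (mcomp τ B R)) (mcomp τ (mcomp τ B R) (mcomp τ B R)))

variable {τ}

lemma integral_comp_finite_range {E : Type*} [NormedAddCommGroup E] [NormedSpace ℝ E]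
    [CompleteSpace E] [IsFiniteMeasure τ] [MeasurableSingletonClass S] {r : S → S}
    (hr : Measurable r) {I : Finset S} (hI : ∀ t, r t ∈ I) (F : S → E) :
    ∫ t, F (r t) ∂τ = ∑ a : I, τ.real (r ⁻¹' {(a : S)}) • F a := by
  classical
  have e : ∀ t, F (r t) = ∑ a : I, (r ⁻¹' {(a : S)}).indicator (fun _ => F a) t := by
    intro t
    rw [Finset.sum_eq_single ⟨r t, hI t⟩]
    · simp
    · intro b _ hb
      refine indicator_of_notMem ?_ _
      rintro h
      exact hb (Subtype.ext (by simpa using h.symm))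
    · simp
  simp_rw [e]
  rw [integral_finsetSum]
  · refine Finset.sum_congr rfl fun a _ => ?_
    rw [integral_indicator_const _ (hr (measurableSet_singleton _))]
  · intro a _
    exact (integrable_const _).indicator (hr (measurableSet_singleton _))

open Matrix in
lemma mtrace_finite_range [IsFiniteMeasure τ] [MeasurableSingletonClass S] {r : S → S}
    (hr : Measurable r) {I : Finset S} (hI : ∀ t, r t ∈ I) (B R : S → S → ℝ)
    (Bm Rm : Matrix I I ℝ)
    (hBm : Bm = Matrix.of fun a b : I =>
      τ.real (r ⁻¹' {(a : S)}) * τ.real (r ⁻¹' {(b : S)}) * B a b)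
    (hRm : Rm = Matrix.of fun a b : I => R a b) [DecidableEq I] :
    mtrace2 τ (fun t s => B (r t) (r s)) (fun t s => R (r t) (r s)) = ((Bm * Rm) ^ 2).trace ∧
    mtrace4 τ (fun t s => B (r t) (r s)) (fun t s => R (r t) (r s)) = ((Bm * Rm) ^ 4).trace := by
  set w : I → ℝ := fun a => τ.real (r ⁻¹' {(a : S)}) with hw
  set d : (S → S → ℝ) → (S → S → ℝ) → S → S → ℝ :=
    fun K L t s => ∑ a : I, w a * (K t a * L a s) with hd
  have hc : ∀ K L : S → S → ℝ, mcomp τ (fun t s => K (r t) (r s)) (fun t s => L (r t) (r s)) =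
      fun t s => d K L (r t) (r s) := by
    intro K L
    funext t s
    exact integral_comp_finite_range hr hI fun u => K (r t) u * L u (r s)
  have ht : ∀ K : S → S → ℝ, mtrace τ (fun t s => K (r t) (r s)) = ∑ a : I, w a * K a a :=
    fun K => integral_comp_finite_range hr hI fun u => K u u
  set M : (S → S → ℝ) → Matrix I I ℝ := fun K => Matrix.of fun a b => w a * K a b with hM
  have hMd : ∀ K L, M (d K L) = M K * M L := by
    intro K L
    ext a b
    simp only [hM, hd, Matrix.of_apply, Matrix.mul_apply, Finset.mul_sum]
    exact Finset.sum_congr rfl fun u _ => by ring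
  have hMt : ∀ K : S → S → ℝ, ∑ a : I, w a * K a a = (M K).trace := fun K => rfl
  have hBR : M (d B R) = Bm * Rm := by
    ext a b
    simp only [hM, hd, hBm, hRm, Matrix.of_apply, Matrix.mul_apply, Finset.mul_sum]
    exact Finset.sum_congr rfl fun u _ => by ring
  constructor
  · rw [mtrace2, hc, hc, ht, hMt, hMd, hBR, pow_two]
  · rw [mtrace4, hc, hc, hc, ht, hMt, hMd, hMd, hBR, pow_succ, pow_succ, pow_two]
    simp only [mul_assoc]

/-- Measurable, bounded kernels. -/
structure BddKernel {α β : Type*} [MeasurableSpace α] [MeasurableSpace β] (K : α → β → 𝕜)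
    (b : ℝ) : Prop where
  meas : Measurable (fun p : α × β => K p.1 p.2)
  bound : ∀ t s, ‖K t s‖ ≤ b

lemma BddKernel.comp {α γ : Type*} [MeasurableSpace α] [MeasurableSpace γ] {K : α → S → 𝕜}
    {L : S → γ → 𝕜} {b c : ℝ} [IsFiniteMeasure τ] (hK : BddKernel K b) (hL : BddKernel L c) (hb : 0 ≤ b) : BddKernel (mcomp τ K L) (b * c * τ.real univ) := by
  constructor
  · have : Measurable fun q : (α × γ) × S => K q.1.1 q.2 * L q.2 q.1.2 :=
      (hK.meas.comp (by fun_prop : Measurable fun q : (α × γ) × S => (q.1.1, q.2))).mul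
        (hL.meas.comp (by fun_prop : Measurable fun q : (α × γ) × S => (q.2, q.1.2)))
    exact this.stronglyMeasurable.integral_prod_right'.measurable
  · intro t s
    refine norm_integral_le_of_norm_le_const (ae_of_all _ fun u => ?_)
    rw [norm_mul]
    exact mul_le_mul (hK.bound _ _) (hL.bound _ _) (norm_nonneg _) hb

lemma BddKernel.pullback {K : S → S → 𝕜} {b : ℝ} (hK : BddKernel K b) {r : S → S}
    (hr : Measurable r) : BddKernel (fun t s => K (r t) (r s)) b :=
  ⟨hK.meas.comp (by fun_prop : Measurable fun p : S × S => (r p.1, r p.2)), fun _ _ => hK.bound _ _⟩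

lemma tendsto_mcomp [IsFiniteMeasure τ] {A : Set S} (hA : ∀ᵐ t ∂τ, t ∈ A)
    {Kn Ln : ℕ → S → S → 𝕜} {K L : S → S → 𝕜} {b c : ℝ} (hKn : ∀ n, BddKernel (Kn n) b)
    (hLn : ∀ n, BddKernel (Ln n) c) (hb : 0 ≤ b)
    (hK : ∀ t ∈ A, ∀ s ∈ A, Tendsto (fun n => Kn n t s) atTop (𝓝 (K t s)))
    (hL : ∀ t ∈ A, ∀ s ∈ A, Tendsto (fun n => Ln n t s) atTop (𝓝 (L t s))) :
    ∀ t ∈ A, ∀ s ∈ A, Tendsto (fun n => mcomp τ (Kn n) (Ln n) t s) atTop (𝓝 (mcomp τ K L t s)) := by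
  intro t ht s hs
  refine tendsto_integral_of_dominated_convergence (fun _ => b * c) (fun n => ?_)
    (integrable_const _) (fun n => ae_of_all _ fun u => ?_) ?_
  · exact (((hKn n).meas.comp (by fun_prop : Measurable fun u : S => (t, u))).mul
      ((hLn n).meas.comp (by fun_prop : Measurable fun u : S => (u, s)))).aestronglyMeasurable
  · rw [norm_mul]
    exact mul_le_mul ((hKn n).bound _ _) ((hLn n).bound _ _) (norm_nonneg _) hb
  · filter_upwards [hA] with u hu
    exact (hK t ht u hu).mul (hL u hu s hs)

lemma tendsto_mtrace [IsFiniteMeasure τ] {A : Set S} (hA : ∀ᵐ t ∂τ, t ∈ A)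
    {Kn : ℕ → S → S → 𝕜} {K : S → S → 𝕜} {b : ℝ} (hKn : ∀ n, BddKernel (Kn n) b)
    (hK : ∀ t ∈ A, ∀ s ∈ A, Tendsto (fun n => Kn n t s) atTop (𝓝 (K t s))) :
    Tendsto (fun n => mtrace τ (Kn n)) atTop (𝓝 (mtrace τ K)) := by
  refine tendsto_integral_of_dominated_convergence (fun _ => b) (fun n => ?_)
    (integrable_const _) (fun n => ae_of_all _ fun u => (hKn n).bound _ _) ?_
  · exact ((hKn n).meas.comp (by fun_prop : Measurable fun u : S => (u, u))).aestronglyMeasurable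
  · filter_upwards [hA] with u hu
    exact hK u hu u hu

lemma tendsto_mtrace2_mtrace4 [IsFiniteMeasure τ] {A : Set S} (hA : ∀ᵐ t ∂τ, t ∈ A)
    {Bn Rn : ℕ → S → S → 𝕜} {B R : S → S → 𝕜} {b c : ℝ} (hBn : ∀ n, BddKernel (Bn n) b)
    (hRn : ∀ n, BddKernel (Rn n) c) (hb : 0 ≤ b) (hc : 0 ≤ c)
    (hB : ∀ t ∈ A, ∀ s ∈ A, Tendsto (fun n => Bn n t s) atTop (𝓝 (B t s)))
    (hR : ∀ t ∈ A, ∀ s ∈ A, Tendsto (fun n => Rn n t s) atTop (𝓝 (R t s))) :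
    Tendsto (fun n => mtrace2 τ (Bn n) (Rn n)) atTop (𝓝 (mtrace2 τ B R)) ∧
    Tendsto (fun n => mtrace4 τ (Bn n) (Rn n)) atTop (𝓝 (mtrace4 τ B R)) := by
  have b1 := fun n => (hBn n).comp (τ := τ) (hRn n) hb
  have n1 : 0 ≤ b * c * τ.real univ := by positivity
  have c1 := tendsto_mcomp hA hBn hRn hb hB hR
  have b2 := fun n => (b1 n).comp (τ := τ) (b1 n) n1
  have n2 : 0 ≤ (b * c * τ.real univ) * (b * c * τ.real univ) * τ.real univ := by positivity
  have c2 := tendsto_mcomp hA b1 b1 n1 c1 c1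
  exact ⟨tendsto_mtrace hA b2 c2, tendsto_mtrace hA (fun n => (b2 n).comp (τ := τ) (b2 n) n2)
    (tendsto_mcomp hA b2 b2 n2 c2 c2)⟩

lemma mcomp_assoc {α β γ δ : Type*} [MeasurableSpace α] [MeasurableSpace β] [MeasurableSpace γ]
    [MeasurableSpace δ] {κ : Measure β} {ν : Measure γ} [IsFiniteMeasure κ] [IsFiniteMeasure ν]
    {K : α → β → 𝕜} {L : β → γ → 𝕜} {M : γ → δ → 𝕜} {a b c : ℝ} (hK : BddKernel K a)
    (hL : BddKernel L b) (hM : BddKernel M c) (ha : 0 ≤ a) (hb : 0 ≤ b) :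
    mcomp ν (mcomp κ K L) M = mcomp κ K (mcomp ν L M) := by
  funext t s
  simp only [mcomp, ← integral_const_mul, ← integral_mul_const]
  rw [integral_integral_swap]
  · simp only [mul_assoc]
  · refine (integrable_const (a * b * c)).mono' ?_ (ae_of_all _ fun p => ?_)
    · exact (((hK.meas.comp (by fun_prop : Measurable fun q : γ × β => (t, q.2))).mul
        (hL.meas.comp (by fun_prop : Measurable fun q : γ × β => (q.2, q.1)))).mul
        (hM.meas.comp (by fun_prop : Measurable fun q : γ × β => (q.1, s)))).aestronglyMeasurable
    · simp only [Function.uncurry, norm_mul]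
      have h1 := mul_le_mul (hK.bound t p.2) (hL.bound p.2 p.1) (norm_nonneg _) ha
      exact mul_le_mul h1 (hM.bound _ _) (norm_nonneg _) (mul_nonneg ha hb)

lemma mtrace_mcomp_comm {α β : Type*} [MeasurableSpace α] [MeasurableSpace β]
    {κ : Measure α} {ν : Measure β} [IsFiniteMeasure κ] [IsFiniteMeasure ν]
    {K : α → β → 𝕜} {L : β → α → 𝕜} {a b : ℝ} (hK : BddKernel K a)
    (hL : BddKernel L b) (ha : 0 ≤ a) :
    mtrace κ (mcomp ν K L) = mtrace ν (mcomp κ L K) := by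
  simp only [mtrace, mcomp]
  rw [integral_integral_swap]
  · simp only [mul_comm]
  · refine (integrable_const (a * b)).mono' ?_ (ae_of_all _ fun p => ?_)
    · exact (hK.meas.mul (hL.meas.comp measurable_swap)).aestronglyMeasurable
    · simp only [Function.uncurry, norm_mul]
      exact mul_le_mul (hK.bound _ _) (hL.bound _ _) (norm_nonneg _) ha

/-- Cyclic rearrangement of `tr [B E E']²` and `tr [B E E']⁴`. -/
lemma mtrace_factor {β : Type*} [MeasurableSpace β] {ν : Measure β} [IsFiniteMeasure τ]
    [IsFiniteMeasure ν] {B : S → S → 𝕜} {E : S → β → 𝕜} {E' : β → S → 𝕜} {b e e' : ℝ}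
    (hB : BddKernel B b) (hE : BddKernel E e) (hE' : BddKernel E' e') (hb : 0 ≤ b) (he : 0 ≤ e)
    (he' : 0 ≤ e') {D : β → β → 𝕜} (hD : D = mcomp τ E' (mcomp τ B E)) :
    mtrace2 τ B (mcomp ν E E') = mtrace ν (mcomp ν D D) ∧
    mtrace4 τ B (mcomp ν E E') = mtrace ν (mcomp ν (mcomp ν D D) (mcomp ν D D)) := by
  have hP := hB.comp (τ := τ) hE hb
  set P := mcomp τ B E with hPdef
  have hp : 0 ≤ b * e * τ.real univ := by positivity
  have hDb := hE'.comp (τ := τ) hP he'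
  rw [← hD] at hDb
  have hd : 0 ≤ e' * (b * e * τ.real univ) * τ.real univ := by positivity
  have hDE := hDb.comp (τ := ν) hE' hd
  have hn1 : 0 ≤ e' * (b * e * τ.real univ) * τ.real univ * e' * ν.real univ := by positivity
  have hDD := hDb.comp (τ := ν) hDb hd
  have e1 : mcomp τ B (mcomp ν E E') = mcomp ν P E' := (mcomp_assoc hB hE hE' hb he).symm
  have key : ∀ {M N : β → β → 𝕜} {m n : ℝ}, BddKernel M m → BddKernel N n → 0 ≤ m → 0 ≤ n →
      mcomp τ (mcomp ν P (mcomp ν M E')) (mcomp ν P (mcomp ν N E')) =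
        mcomp ν P (mcomp ν (mcomp ν M (mcomp ν D N)) E') := by
    intro M N m n hM hN hm hn
    have hME := hM.comp (τ := ν) hE' hm
    have hNE := hN.comp (τ := ν) hE' hn
    have hm1 : 0 ≤ m * e' * ν.real univ := by positivity
    have hn1 : 0 ≤ n * e' * ν.real univ := by positivity
    have hDN := hDb.comp (τ := ν) hN hd
    have hdn : 0 ≤ e' * (b * e * τ.real univ) * τ.real univ * n * ν.real univ := by positivity
    rw [mcomp_assoc hP hME (hP.comp (τ := ν) hNE hp) hp hm1,
      mcomp_assoc hM hE' (hP.comp (τ := ν) hNE hp) hm he', ← mcomp_assoc hE' hP hNE he' hp, ← hD,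
      ← mcomp_assoc hDb hN hE' hd hn, ← mcomp_assoc hM hDN hE' hm hdn]
  have key0 : mcomp τ (mcomp ν P E') (mcomp ν P E') = mcomp ν P (mcomp ν D E') := by
    rw [mcomp_assoc hP hE' (hP.comp (τ := ν) hE' hp) hp he', ← mcomp_assoc hE' hP hE' he' hp, ← hD]
  have tr : ∀ {M : β → β → 𝕜} {m : ℝ}, BddKernel M m → 0 ≤ m →
      mtrace τ (mcomp ν P (mcomp ν M E')) = mtrace ν (mcomp ν M D) := by
    intro M m hM hm
    rw [mtrace_mcomp_comm hP (hM.comp (τ := ν) hE' hm) hp, mcomp_assoc hM hE' hP hm he', ← hD]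
  constructor
  · rw [mtrace2, e1, key0, tr hDb hd]
  · have hDDD := hDb.comp (τ := ν) hDD hd
    rw [mtrace4, e1, key0, key hDb hDb hd hd, tr hDDD (by positivity),
      mcomp_assoc hDb hDD hDb hd (by positivity), mcomp_assoc hDb hDb hDb hd hd,
      ← mcomp_assoc hDb hDb hDD hd hd]

end Kernels

/-! ### Quadratic functionals -/

section Sampled

variable {Ω : Type*} [MeasurableSpace Ω] {P : Measure Ω} [IsProbabilityMeasure P]
  {S : Type*} [MeasurableSpace S] [MeasurableSingletonClass S] {τ : Measure S} [IsFiniteMeasure τ]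

/-- Quadratic functionals of a sampled process. -/
lemma quadForm_finite_range {X : S → Ω → ℝ} (hX : IsGaussianProcess X P)
    (h0 : ∀ t, ∫ ω, X t ω ∂P = 0) {R B : S → S → ℝ} (hR : ∀ t s, ∫ ω, X t ω * X s ω ∂P = R t s)
    (hB : ∀ t s, B t s = B s t) {r : S → S} (hr : Measurable r) {I : Finset S}
    (hI : ∀ t, r t ∈ I) {b : ℝ} (hBb : BddKernel B b) {Q : Ω → ℝ}
    (hQ : Q = fun ω => ∫ p, B (r p.1) (r p.2) * X (r p.1) ω * X (r p.2) ω ∂(τ.prod τ)) :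
    HasQuadLaw P Q (mtrace2 τ (fun t s => B (r t) (r s)) fun t s => R (r t) (r s))
      (mtrace4 τ (fun t s => B (r t) (r s)) fun t s => R (r t) (r s)) := by
  classical
  obtain ⟨e2, e4⟩ := mtrace_finite_range (τ := τ) hr hI B R _ (Matrix.of fun a b : I => R a b) rfl rfl
  rw [e2, e4]
  refine quadForm_gaussian_vector (X := fun (a : I) ω => X a ω) (hX.hasGaussianLaw I)
    (fun a => h0 a) (fun a c => hR a c) ?_ ?_
  · ext a c
    simp only [Matrix.transpose_apply, Matrix.of_apply]
    rw [hB]; ring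
  · rw [hQ]
    funext ω
    have hXr : ∀ ω, Measurable fun t => X (r t) ω := by
      intro ω
      have : (fun t => X (r t) ω) = (fun a : I => X a ω) ∘ fun t => (⟨r t, hI t⟩ : I) := rfl
      rw [this]
      exact (measurable_of_countable _).comp (hr.subtype_mk (h := hI))
    have hXb : ∃ C, ∀ t, |X (r t) ω| ≤ C := by
      obtain ⟨C, hC⟩ := (I.finite_toSet.image fun a => |X a ω|).bddAbove
      exact ⟨C, fun t => hC ⟨r t, hI t, rfl⟩⟩
    obtain ⟨C, hC⟩ := hXb
    rw [integral_prod]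
    · have e1 : ∀ t : S, ∫ s, B (r t) (r s) * X (r t) ω * X (r s) ω ∂τ =
          ∑ c : I, τ.real (r ⁻¹' {(c : S)}) • (B (r t) c * X (r t) ω * X c ω) := fun t =>
        integral_comp_finite_range hr hI fun s => B (r t) s * X (r t) ω * X s ω
      simp_rw [e1]
      rw [integral_comp_finite_range hr hI fun t =>
        ∑ c : I, τ.real (r ⁻¹' {(c : S)}) • (B t c * X t ω * X c ω)]
      refine Finset.sum_congr rfl fun a _ => ?_
      rw [Finset.smul_sum]
      refine Finset.sum_congr rfl fun c _ => ?_
      simp only [smul_eq_mul, Matrix.of_apply]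
      ring
    · refine (integrable_const (b * C * C)).mono' ?_ (ae_of_all _ fun p => ?_)
      · have := hXr ω
        exact ((((hBb.pullback hr).meas).mul (this.comp measurable_fst)).mul
          (this.comp measurable_snd)).aestronglyMeasurable
      · have hC0 : 0 ≤ C := (abs_nonneg _).trans (hC p.1)
        have hb0 : 0 ≤ b := (norm_nonneg _).trans (hBb.bound p.1 p.2)
        rw [norm_mul, norm_mul]
        gcongr
        · exact hBb.bound _ _
        · exact hC _
        · exact hC _

variable {X : S → Ω → ℝ} {R B : S → S → ℝ} {b c : ℝ} {r : ℕ → S → S} {I : ℕ → Finset S} {A : Set S}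

lemma eLpNorm_four_process (hX : IsGaussianProcess X P) (h0 : ∀ t, ∫ ω, X t ω ∂P = 0)
    (hR : ∀ t s, ∫ ω, X t ω * X s ω ∂P = R t s) (hRc : ∀ t s, |R t s| ≤ c) (t : S) :
    eLpNorm (X t) 4 P ≤ ofReal √c * gaussFour := by
  rw [eLpNorm_four_gaussian (hX.hasGaussianLaw_eval t) (h0 t)]
  gcongr
  have := hR t t
  simp only [← pow_two] at this
  rw [this]
  exact (le_abs_self _).trans (hRc t t)

lemma eLpNorm_four_process_sub (hX : IsGaussianProcess X P) (h0 : ∀ t, ∫ ω, X t ω ∂P = 0)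
    (hR : ∀ t s, ∫ ω, X t ω * X s ω ∂P = R t s) (t s : S) :
    eLpNorm (X t - X s) 4 P = ofReal √(R t t - 2 * R t s + R s s) * gaussFour := by
  have hL := fun t => (hX.hasGaussianLaw_eval t).memLp_two
  rw [eLpNorm_four_gaussian hX.hasGaussianLaw_sub]
  · congr 3
    have e : ∀ ω, (X t - X s) ω ^ 2 = X t ω * X t ω - 2 * (X t ω * X s ω) + X s ω * X s ω := by
      intro ω; simp; ring
    have i1 : ∀ t s, Integrable (fun ω => X t ω * X s ω) P := fun t s => (hL t).integrable_mul (hL s)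
    simp_rw [e]
    have i2 : Integrable (fun ω => X t ω * X t ω - 2 * (X t ω * X s ω)) P :=
      (i1 t t).sub ((i1 t s).const_mul 2)
    rw [integral_add i2 (i1 s s),
      integral_sub (i1 t t) ((i1 t s).const_mul 2), integral_const_mul, hR, hR, hR]
  · simp only [Pi.sub_apply]
    rw [integral_sub ((hL t).integrable (by norm_num)) ((hL s).integrable (by norm_num)), h0, h0, sub_zero]

omit [IsProbabilityMeasure P] [MeasurableSpace S] [MeasurableSingletonClass S] in
lemma eLpNorm_quad_le (hX : IsGaussianProcess X P) {m : ℝ≥0∞}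
    (hm : ∀ t, eLpNorm (X t) 4 P ≤ m) (β : ℝ) (t s : S) :
    eLpNorm (fun ω => β * X t ω * X s ω) 2 P ≤ ‖β‖ₑ * (m * m) := by
  have e : (fun ω => β * X t ω * X s ω) = β • fun ω => X t ω * X s ω := by funext ω; simp; ring
  rw [e, eLpNorm_const_smul]
  gcongr
  refine (eLpNorm_two_mul_le (hX.aemeasurable t).aestronglyMeasurable
    (hX.aemeasurable s).aestronglyMeasurable).trans ?_
  gcongr
  · exact hm t
  · exact hm s

lemma eLpNorm_quad_sub_le (hX : IsGaussianProcess X P) {m : ℝ≥0∞}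
    (hm : ∀ t, eLpNorm (X t) 4 P ≤ m) (β β' : ℝ) (t s t' s' : S) :
    eLpNorm (fun ω => β' * X t' ω * X s' ω - β * X t ω * X s ω) 2 P ≤
      ‖β' - β‖ₑ * (m * m) + ‖β‖ₑ * (eLpNorm (X t' - X t) 4 P * m + m * eLpNorm (X s' - X s) 4 P) := by
  have hM := fun t => (hX.aemeasurable t).aestronglyMeasurable
  have e : (fun ω => β' * X t' ω * X s' ω - β * X t ω * X s ω) =
      (fun ω => (β' - β) * X t' ω * X s' ω) +
        β • ((fun ω => (X t' - X t) ω * X s' ω) + fun ω => X t ω * (X s' - X s) ω) := by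
    funext ω; simp; ring
  have m1 : AEStronglyMeasurable (fun ω => (X t' - X t) ω * X s' ω) P :=
    ((hM t').sub (hM t)).mul (hM s')
  have m2 : AEStronglyMeasurable (fun ω => X t ω * (X s' - X s) ω) P :=
    (hM t).mul ((hM s').sub (hM s))
  rw [e]
  refine (eLpNorm_add_le (((hM t').const_mul _).mul (hM s')) ((m1.add m2).const_smul β)
    (by norm_num)).trans ?_
  refine add_le_add (eLpNorm_quad_le hX hm _ _ _) ?_
  rw [eLpNorm_const_smul]
  gcongr
  refine (eLpNorm_add_le m1 m2 (by norm_num)).trans (add_le_add ?_ ?_)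
  · refine (eLpNorm_two_mul_le ((hM t').sub (hM t)) (hM s')).trans ?_
    gcongr
    exact hm s'
  · refine (eLpNorm_two_mul_le (hM t) ((hM s').sub (hM s))).trans ?_
    gcongr
    exact hm t

/-- Variance and characteristic function of a quadratic functional of a measurable centered
Gaussian process whose covariance function and kernel can be sampled. -/
theorem quadForm_process (hX : IsGaussianProcess X P) (h0 : ∀ t, ∫ ω, X t ω ∂P = 0)
    (hXm : Measurable fun p : S × Ω => X p.1 p.2)
    (hR : ∀ t s, ∫ ω, X t ω * X s ω ∂P = R t s) (hB : ∀ t s, B t s = B s t)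
    (hBb : BddKernel B b) (hRb : BddKernel R c) (hb : 0 ≤ b) (hc : 0 ≤ c)
    (hr : ∀ n, Measurable (r n)) (hI : ∀ n t, r n t ∈ I n) (hA : ∀ᵐ t ∂τ, t ∈ A)
    (hBl : ∀ t ∈ A, ∀ s ∈ A, Tendsto (fun n => B (r n t) (r n s)) atTop (𝓝 (B t s)))
    (hRl : ∀ t ∈ A, ∀ s ∈ A, Tendsto (fun n => R (r n t) (r n s)) atTop (𝓝 (R t s)))
    (hRd : ∀ t ∈ A, Tendsto (fun n => R (r n t) t) atTop (𝓝 (R t t))) {Q : Ω → ℝ}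
    (hQ : Q = fun ω => ∫ p, B p.1 p.2 * X p.1 ω * X p.2 ω ∂(τ.prod τ)) :
    HasQuadLaw P Q (mtrace2 τ B R) (mtrace4 τ B R) := by
  set m : ℝ≥0∞ := ofReal √c * gaussFour with hmdef
  have hmtop : m ≠ ∞ := mul_ne_top ofReal_ne_top gaussFour_ne_top
  have hm : ∀ t, eLpNorm (X t) 4 P ≤ m := eLpNorm_four_process hX h0 hR hRb.bound
  set Y : S × S → Ω → ℝ := fun p ω => B p.1 p.2 * X p.1 ω * X p.2 ω with hY
  set Yn : ℕ → S × S → Ω → ℝ := fun n p ω =>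
    B (r n p.1) (r n p.2) * X (r n p.1) ω * X (r n p.2) ω with hYn
  have hYmeas : Measurable fun q : (S × S) × Ω => Y q.1 q.2 :=
    ((hBb.meas.comp measurable_fst).mul
      (hXm.comp (by fun_prop : Measurable fun q : (S × S) × Ω => (q.1.1, q.2)))).mul
      (hXm.comp (by fun_prop : Measurable fun q : (S × S) × Ω => (q.1.2, q.2)))
  have hYnmeas : ∀ n, Measurable fun q : (S × S) × Ω => Yn n q.1 q.2 := fun n =>
    hYmeas.comp (f := fun q : (S × S) × Ω => ((r n q.1.1, r n q.1.2), q.2))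
      (by have := hr n; fun_prop)
  set K : ℝ≥0∞ := ofReal b * (m * m) with hK
  have hKtop : K ≠ ∞ := mul_ne_top ofReal_ne_top (mul_ne_top hmtop hmtop)
  have hBe : ∀ t s, ‖B t s‖ₑ ≤ ofReal b := fun t s => by
    rw [← ofReal_norm]
    exact ofReal_le_ofReal (hBb.bound t s)
  have hYK : ∀ p, eLpNorm (Y p) 2 P ≤ K := fun p =>
    (eLpNorm_quad_le hX hm _ _ _).trans (mul_le_mul' (hBe _ _) le_rfl)
  have hYnK : ∀ n p, eLpNorm (Yn n p) 2 P ≤ K := fun n p => hYK (r n p.1, r n p.2)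
  have hint := ae_integrable_of_eLpNorm_le (κ := τ.prod τ) hYmeas hKtop hYK
  have hintn := fun n => ae_integrable_of_eLpNorm_le (κ := τ.prod τ) (hYnmeas n) hKtop (hYnK n)
  have hmem : ∀ {Z : S × S → Ω → ℝ}, (Measurable fun q : (S × S) × Ω => Z q.1 q.2) →
      (∀ p, eLpNorm (Z p) 2 P ≤ K) → MemLp (fun ω => ∫ p, Z p ω ∂(τ.prod τ)) 2 P := by
    intro Z hZ hZK
    refine ⟨(measurable_integral_left hZ).aestronglyMeasurable, ?_⟩
    have h1 := eLpNorm_integral_sq_le (P := P) (κ := τ.prod τ) hZ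
    have h2 : (τ.prod τ) univ * ∫⁻ z, eLpNorm (Z z) 2 P ^ 2 ∂(τ.prod τ) < ∞ := by
      refine mul_lt_top (measure_lt_top _ _) ?_
      refine (lintegral_mono fun z => pow_le_pow_left' (hZK z) 2).trans_lt ?_
      rw [lintegral_const]
      exact mul_lt_top (ENNReal.pow_lt_top hKtop.lt_top) (measure_lt_top _ _)
    have h3 := h1.trans_lt h2
    by_contra h
    rw [not_lt, top_le_iff] at h
    rw [h] at h3
    simp at h3
  have hQmem : MemLp Q 2 P := hQ ▸ hmem hYmeas hYK
  have hlim : Tendsto (fun n => eLpNorm ((fun ω => ∫ p, Yn n p ω ∂(τ.prod τ)) - Q) 2 P)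
      atTop (𝓝 0) := by
    have hpt : ∀ t ∈ A, Tendsto (fun n => eLpNorm (X (r n t) - X t) 4 P) atTop (𝓝 0) := by
      intro t ht
      simp_rw [eLpNorm_four_process_sub hX h0 hR]
      have h1 : Tendsto (fun n => R (r n t) (r n t) - 2 * R (r n t) t + R t t) atTop (𝓝 0) := by
        have := ((hRl t ht t ht).sub ((hRd t ht).const_mul 2)).add_const (R t t)
        convert this using 2
        ring
      have h2 : Tendsto (fun n => ofReal √(R (r n t) (r n t) - 2 * R (r n t) t + R t t))
          atTop (𝓝 0) := by
        have := (ENNReal.continuous_ofReal.comp Real.continuous_sqrt).tendsto 0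
        simp only [Function.comp, Real.sqrt_zero, ENNReal.ofReal_zero] at this
        exact this.comp h1
      simpa using ENNReal.Tendsto.mul_const h2 (Or.inr gaussFour_ne_top)
    have hdiff : ∀ p ∈ A ×ˢ A, Tendsto (fun n => eLpNorm (fun ω => Yn n p ω - Y p ω) 2 P ^ 2)
        atTop (𝓝 0) := by
      rintro p ⟨hp1, hp2⟩
      have hBd : Tendsto (fun n => ‖B (r n p.1) (r n p.2) - B p.1 p.2‖ₑ) atTop (𝓝 0) := by
        have := (tendsto_sub_nhds_zero_iff.2 (hBl p.1 hp1 p.2 hp2)).enorm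
        simpa using this
      have h1 : Tendsto (fun n => ‖B (r n p.1) (r n p.2) - B p.1 p.2‖ₑ * (m * m) +
          ‖B p.1 p.2‖ₑ * (eLpNorm (X (r n p.1) - X p.1) 4 P * m +
            m * eLpNorm (X (r n p.2) - X p.2) 4 P)) atTop (𝓝 0) := by
        have a1 := ENNReal.Tendsto.mul_const hBd (Or.inr (mul_ne_top hmtop hmtop))
        have a2 := ENNReal.Tendsto.mul_const (hpt p.1 hp1) (Or.inr hmtop)
        have a3 := ENNReal.Tendsto.const_mul (hpt p.2 hp2) (Or.inr hmtop)
        have a4 := ENNReal.Tendsto.const_mul (a := ‖B p.1 p.2‖ₑ) (a2.add a3) (Or.inr (by simp))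
        simpa using a1.add a4
      have h2 := tendsto_of_tendsto_of_tendsto_of_le_of_le tendsto_const_nhds h1
        (fun n => bot_le) (fun n => eLpNorm_quad_sub_le hX hm (B p.1 p.2)
          (B (r n p.1) (r n p.2)) p.1 p.2 (r n p.1) (r n p.2))
      simpa using ENNReal.Tendsto.pow (n := 2) h2
    have hdmeas : ∀ n, Measurable fun q : (S × S) × Ω => Yn n q.1 q.2 - Y q.1 q.2 := fun n =>
      (hYnmeas n).sub hYmeas
    have hsq : Tendsto (fun n => (τ.prod τ) univ *
        ∫⁻ p, eLpNorm (fun ω => Yn n p ω - Y p ω) 2 P ^ 2 ∂(τ.prod τ)) atTop (𝓝 0) := by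
      have h1 : Tendsto (fun n => ∫⁻ p, eLpNorm (fun ω => Yn n p ω - Y p ω) 2 P ^ 2 ∂(τ.prod τ))
          atTop (𝓝 (∫⁻ _, 0 ∂(τ.prod τ))) := by
        refine tendsto_lintegral_of_dominated_convergence (fun _ => (K + K) ^ 2) (fun n => ?_)
          (fun n => ae_of_all _ fun p => ?_) ?_ ?_
        · simp_rw [eLpNorm_two_sq]
          have : Measurable fun q : (S × S) × Ω => ‖Yn n q.1 q.2 - Y q.1 q.2‖ₑ ^ 2 := by
            have := hdmeas n
            fun_prop
          exact this.lintegral_prod_right'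
        · refine pow_le_pow_left' ?_ 2
          refine (eLpNorm_sub_le ?_ ?_ (by norm_num)).trans (add_le_add (hYnK n p) (hYK p))
          · exact ((hYnmeas n).comp measurable_prodMk_left).aestronglyMeasurable
          · exact (hYmeas.comp measurable_prodMk_left).aestronglyMeasurable
        · rw [lintegral_const]
          exact mul_ne_top (pow_ne_top (by simp [hKtop])) (measure_ne_top _ _)
        · have : ∀ᵐ p ∂(τ.prod τ), p ∈ A ×ˢ A := by
            have h1 := Measure.quasiMeasurePreserving_fst (μ := τ) (ν := τ) |>.ae hA
            have h2 := Measure.quasiMeasurePreserving_snd (μ := τ) (ν := τ) |>.ae hA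
            filter_upwards [h1, h2] with p h1 h2 using ⟨h1, h2⟩
          filter_upwards [this] with p hp using hdiff p hp
      rw [lintegral_zero] at h1
      simpa using ENNReal.Tendsto.const_mul h1 (Or.inr (measure_ne_top _ _))
    have hsq2 : Tendsto (fun n => eLpNorm ((fun ω => ∫ p, Yn n p ω ∂(τ.prod τ)) - Q) 2 P ^ 2)
        atTop (𝓝 0) := by
      refine tendsto_of_tendsto_of_tendsto_of_le_of_le tendsto_const_nhds hsq
        (fun n => bot_le) (fun n => ?_)
      refine le_trans (le_of_eq ?_) (eLpNorm_integral_sq_le (P := P) (κ := τ.prod τ) (hdmeas n))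
      congr 1
      refine eLpNorm_congr_ae ?_
      filter_upwards [hint, hintn n] with ω h1 h2
      simp only [Pi.sub_apply, hQ]
      rw [integral_sub h2 h1]
    have h3 := (ENNReal.continuous_rpow_const (y := 2⁻¹)).tendsto 0 |>.comp hsq2
    have e : ∀ x : ℝ≥0∞, (x ^ 2) ^ (2⁻¹ : ℝ) = x := fun x => by
      rw [← ENNReal.rpow_natCast, ← ENNReal.rpow_mul]; norm_num
    simpa [Function.comp_def, e] using h3
  have hfin := fun n => quadForm_finite_range (τ := τ) hX h0 hR hB (hr n) (hI n) hBb
    (Q := fun ω => ∫ p, Yn n p ω ∂(τ.prod τ)) rfl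
  obtain ⟨hV, hC⟩ := tendsto_variance_charFun (fun n => (hfin n).1) hQmem hlim
  obtain ⟨t2, t4⟩ := tendsto_mtrace2_mtrace4 (τ := τ) hA (fun n => hBb.pullback (hr n))
    (fun n => hRb.pullback (hr n)) hb hc hBl hRl
  refine ⟨hQmem, ?_, fun θ => ?_⟩
  · simp_rw [(hfin _).2.1] at hV
    exact tendsto_nhds_unique hV (t2.const_mul 2)
  · have l1 := ((hC θ).sub ((Complex.continuous_exp.tendsto _).comp
      ((Complex.continuous_ofReal.tendsto _).comp (t2.const_mul (θ ^ 2))).neg)).norm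
    have l2 := ((Real.continuous_sqrt.tendsto _).comp (t2.mul t4)).const_mul (chiSqConst * |θ| ^ 3)
    exact le_of_tendsto_of_tendsto' l1 l2 fun n => (hfin n).2.2 θ

end Sampled

/-! ### Decay kernels -/

section Decay

variable {G : Type*} [NormedAddCommGroup G]

/-- The decay kernel `(1 + T ‖x‖)⁻¹`. -/
def decay (T : ℝ) (x : G) : ℝ≥0∞ := (1 + ofReal T * ‖x‖ₑ)⁻¹

variable {T : ℝ}

lemma decay_le_one (x : G) : decay T x ≤ 1 := by
  rw [decay, ENNReal.inv_le_one]; exact le_self_add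

lemma decay_ne_top (x : G) : decay T x ≠ ∞ := ne_top_of_le_ne_top ENNReal.one_ne_top (decay_le_one x)

lemma decay_ne_zero (x : G) : decay T x ≠ 0 := by
  rw [decay, ENNReal.inv_ne_zero]
  exact ENNReal.add_ne_top.2 ⟨by simp, mul_ne_top (by simp) (by simp)⟩

lemma decay_neg (x : G) : decay T (-x) = decay T x := by simp [decay]

lemma decay_sub_comm (x y : G) : decay T (x - y) = decay T (y - x) := by
  rw [← neg_sub, decay_neg]

lemma decay_norm (x : G) : decay T ‖x‖ = decay T x := by simp [decay]

lemma measurable_decay [MeasurableSpace G] [OpensMeasurableSpace G] :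
    Measurable (decay T : G → ℝ≥0∞) := by
  unfold decay; fun_prop

lemma decay_rpow_le_rpow (x : G) {a b : ℝ} (h : b ≤ a) : decay T x ^ a ≤ decay T x ^ b :=
  ENNReal.rpow_le_rpow_of_exponent_ge (decay_le_one x) h

lemma decay_le_two_mul_of_le {u v : G} (h : ‖v‖ ≤ 2 * ‖u‖) : decay T u ≤ 2 * decay T v := by
  have h' : ‖v‖ₑ ≤ 2 * ‖u‖ₑ := by
    rw [← ofReal_norm, ← ofReal_norm, ← ENNReal.ofReal_ofNat, ← ofReal_mul (by norm_num)]
    exact ofReal_le_ofReal h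
  rw [decay, decay, ← div_eq_mul_inv, le_div_iff_mul_le (by simp)
    (Or.inl (ENNReal.add_ne_top.2 ⟨by simp, mul_ne_top (by simp) (by simp)⟩)), mul_comm,
    ← div_eq_mul_inv]
  refine div_le_of_le_mul ?_
  calc 1 + ofReal T * ‖v‖ₑ ≤ 2 * 1 + ofReal T * (2 * ‖u‖ₑ) := by
        gcongr; norm_num
    _ = _ := by ring

/-- Products of decay kernels are controlled by the decay kernel of the sum. -/
lemma decay_mul_decay_le (u w : G) {a b θ s : ℝ} (hθ : 0 ≤ θ) (ha : θ ≤ a) (hb : θ ≤ b)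
    (hs : a + b = s + θ) : decay T u ^ a * decay T w ^ b ≤
      2 ^ θ * decay T (u + w) ^ θ * (decay T u ^ s + decay T w ^ s) := by
  wlog h : ‖w‖ ≤ ‖u‖ generalizing u w a b
  · have := this w u hb ha (by linarith) (le_of_not_ge h)
    rwa [mul_comm, add_comm w, add_comm (decay T w ^ s)] at this
  have h1 : decay T u ^ θ ≤ 2 ^ θ * decay T (u + w) ^ θ := by
    rw [← mul_rpow_of_nonneg _ _ hθ]
    refine ENNReal.rpow_le_rpow (decay_le_two_mul_of_le ?_) hθ
    linarith [norm_add_le u w]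
  have h2 : decay T u ≤ decay T w := by
    rw [decay, decay, ENNReal.inv_le_inv]
    gcongr
    rw [← ofReal_norm, ← ofReal_norm]
    exact ofReal_le_ofReal h
  calc decay T u ^ a * decay T w ^ b
      = decay T u ^ θ * (decay T u ^ (a - θ) * decay T w ^ b) := by
        rw [← mul_assoc, ← ENNReal.rpow_add _ _ (decay_ne_zero _) (decay_ne_top _)]; ring_nf
    _ ≤ (2 ^ θ * decay T (u + w) ^ θ) * (decay T w ^ (a - θ) * decay T w ^ b) := by gcongr
    _ = 2 ^ θ * decay T (u + w) ^ θ * decay T w ^ s := by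
        rw [← ENNReal.rpow_add _ _ (decay_ne_zero _) (decay_ne_top _)]
        congr 2; linarith
    _ ≤ _ := by gcongr; exact le_add_self

lemma decay_le_of_le_norm {x : G} {ε : ℝ} (hε : 0 < ε) (hT : 0 < T) (h : ε ≤ ‖x‖) :
    decay T x ≤ ofReal (1 + ε⁻¹) * (ofReal T)⁻¹ * decay 1 x := by
  have hx : 0 < ‖x‖ := hε.trans_le h
  have e : ∀ S : ℝ, 0 ≤ S → decay S x = ofReal ((1 + S * ‖x‖)⁻¹) := by
    intro S hS
    rw [decay, ofReal_inv_of_pos (by positivity), ENNReal.ofReal_add (by norm_num)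
      (by positivity), ofReal_mul hS, ofReal_norm, ENNReal.ofReal_one]
  rw [e _ hT.le, e _ zero_le_one, ← ofReal_inv_of_pos hT, ← ofReal_mul (by positivity),
    ← ofReal_mul (by positivity)]
  refine ofReal_le_ofReal ?_
  rw [inv_le_comm₀ (by positivity) (by positivity)]
  simp only [mul_inv, inv_inv]
  have h1 : 1 + 1 * ‖x‖ ≤ (1 + ε⁻¹) * ‖x‖ := by
    have : 1 ≤ ε⁻¹ * ‖x‖ := by rw [inv_mul_eq_div]; exact (one_le_div hε).2 h
    linarith
  calc (1 + ε⁻¹)⁻¹ * T * (1 + 1 * ‖x‖) ≤ (1 + ε⁻¹)⁻¹ * T * ((1 + ε⁻¹) * ‖x‖) := by gcongr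
    _ = T * ‖x‖ := by field_simp
    _ ≤ _ := by linarith

lemma decay_le_of_le_norm' {x : G} {ε : ℝ} (hε : 0 < ε) (hT : 0 < T) (h : ε ≤ ‖x‖) :
    decay T x ≤ ofReal (1 + ε⁻¹) * (ofReal T)⁻¹ := by
  refine (decay_le_of_le_norm hε hT h).trans ?_
  exact (mul_le_mul_right (decay_le_one x) _).trans (mul_one _).le

/-- The constant `∫ (1 + |t|)^{-5/4} dt`. -/
def decayConst : ℝ≥0∞ := ∫⁻ t : ℝ, decay 1 t ^ (5 / 4 : ℝ)

lemma decayConst_ne_top : decayConst ≠ ∞ := by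
  have := finite_integral_one_add_norm (E := ℝ) (μ := volume) (r := 5 / 4) (by norm_num)
  refine ne_top_of_le_ne_top this.ne (lintegral_mono fun t => ?_)
  rw [decay, ENNReal.inv_rpow, ← ENNReal.rpow_neg, ENNReal.ofReal_one, one_mul,
    ← ofReal_rpow_of_pos (by positivity), ENNReal.ofReal_add (by norm_num) (by positivity),
    ofReal_norm, ENNReal.ofReal_one]

lemma lintegral_decay_real (hT : 0 < T) :
    ∫⁻ t : ℝ, decay T t ^ (5 / 4 : ℝ) = decayConst * (ofReal T)⁻¹ := by
  have h := Real.map_volume_mul_left hT.ne'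
  have h2 : ∫⁻ t : ℝ, decay 1 (T * t) ^ (5 / 4 : ℝ) =
      ∫⁻ t, decay 1 t ^ (5 / 4 : ℝ) ∂(Measure.map (fun x => T * x) volume) := by
    rw [lintegral_map (measurable_decay.pow_const _) (measurable_const_mul T)]
  rw [h, lintegral_smul_measure, abs_of_pos (inv_pos.2 hT)] at h2
  rw [decayConst, mul_comm, ← ofReal_inv_of_pos hT, ← smul_eq_mul, ← h2]
  refine lintegral_congr fun t => ?_
  simp only [decay, ENNReal.ofReal_one, one_mul, enorm_mul]
  rw [Real.enorm_eq_ofReal hT.le]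

variable [MeasurableSpace G]

/-- Integrals of radial functions are dominated by those on the line. -/
def RadiallyDominated (μ : Measure G) : Prop :=
  ∀ ψ : ℝ → ℝ≥0∞, Measurable ψ → ∫⁻ x, ψ ‖x‖ ∂μ ≤ ∫⁻ t : ℝ, ψ |t|

variable [BorelSpace G] {μ : Measure G}

lemma lintegral_decay_le (hμ : RadiallyDominated μ) (hT : 0 < T) {s : ℝ} (hs : 5 / 4 ≤ s) :
    ∫⁻ x, decay T x ^ s ∂μ ≤ decayConst * (ofReal T)⁻¹ := by
  rw [← lintegral_decay_real hT]
  refine (lintegral_mono fun x => decay_rpow_le_rpow x hs).trans ?_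
  have := hμ (fun t => decay T t ^ (5 / 4 : ℝ)) (measurable_decay.pow_const _)
  simp only [decay_norm] at this
  refine this.trans (le_of_eq (lintegral_congr fun t => ?_))
  rw [← Real.norm_eq_abs, decay_norm]

lemma lintegral_decay_sq_far_le (hμ : RadiallyDominated μ) (hT : 0 < T) {ε : ℝ} (hε : 0 < ε) :
    ∫⁻ x, {x : G | ε ≤ ‖x‖}.indicator 1 x * decay T x ^ (2 : ℝ) ∂μ ≤
      ofReal (1 + ε⁻¹) ^ 2 * decayConst * (ofReal T)⁻¹ ^ 2 := by
  have h1 := lintegral_decay_le hμ one_pos (s := 2) (by norm_num)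
  simp only [ENNReal.ofReal_one, inv_one, mul_one] at h1
  calc _ ≤ ∫⁻ x, (ofReal (1 + ε⁻¹) * (ofReal T)⁻¹) ^ 2 * decay 1 x ^ (2 : ℝ) ∂μ := by
        refine lintegral_mono fun x => ?_
        by_cases hx : ε ≤ ‖x‖
        · rw [indicator_of_mem (by exact hx), Pi.one_apply, one_mul, ENNReal.rpow_two,
            ENNReal.rpow_two, ← mul_pow]
          exact pow_le_pow_left' (decay_le_of_le_norm hε hT hx) 2
        · rw [indicator_of_notMem (by exact hx), zero_mul]; exact bot_le
    _ ≤ (ofReal (1 + ε⁻¹) * (ofReal T)⁻¹) ^ 2 * decayConst := by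
        rw [lintegral_const_mul _ (measurable_decay.pow_const _)]
        gcongr
    _ = _ := by ring

variable [SecondCountableTopology G] [LocallyCompactSpace G] [μ.IsAddHaarMeasure]

lemma lintegral_decay_conv_le (hμ : RadiallyDominated μ) (hT : 0 < T) {a b θ : ℝ} (hθ : 0 ≤ θ)
    (hθ1 : θ ≤ 1) (ha : θ ≤ a) (hb : θ ≤ b) (hs : 5 / 4 + θ ≤ a + b) (x y : G) :
    ∫⁻ u, decay T (u - x) ^ a * decay T (y - u) ^ b ∂μ ≤
      4 * decayConst * (ofReal T)⁻¹ * decay T (y - x) ^ θ := by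
  have hI := lintegral_decay_le hμ hT (s := a + b - θ) (by linarith)
  calc _ ≤ ∫⁻ u, 2 ^ θ * decay T (y - x) ^ θ *
        (decay T (u - x) ^ (a + b - θ) + decay T (y - u) ^ (a + b - θ)) ∂μ := by
        refine lintegral_mono fun u => ?_
        have := decay_mul_decay_le (T := T) (u - x) (y - u) (s := a + b - θ) hθ ha hb (by ring)
        rwa [show u - x + (y - u) = y - x by abel] at this
    _ = 2 ^ θ * decay T (y - x) ^ θ * (∫⁻ u, decay T u ^ (a + b - θ) ∂μ +
          ∫⁻ u, decay T u ^ (a + b - θ) ∂μ) := by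
        have m1 : Measurable fun u : G => decay T (u - x) ^ (a + b - θ) :=
          (measurable_decay.comp (measurable_id.sub_const x)).pow_const _
        have m2 : Measurable fun u : G => decay T (y - u) ^ (a + b - θ) :=
          (measurable_decay.comp (measurable_id.const_sub y)).pow_const _
        have m3 : Measurable fun u : G => decay T (u - x) ^ (a + b - θ) +
          decay T (y - u) ^ (a + b - θ) := m1.add m2
        rw [lintegral_const_mul _ m3, lintegral_add_left m1,
          lintegral_sub_right_eq_self (fun u => decay T u ^ (a + b - θ)) x,
          lintegral_sub_left_eq_self (fun u => decay T u ^ (a + b - θ)) y]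
    _ ≤ 2 * decay T (y - x) ^ θ * (decayConst * (ofReal T)⁻¹ +
          decayConst * (ofReal T)⁻¹) := by
        gcongr
        calc (2 : ℝ≥0∞) ^ θ ≤ 2 ^ (1 : ℝ) := ENNReal.rpow_le_rpow_of_exponent_le (by norm_num) hθ1
          _ = 2 := ENNReal.rpow_one _
    _ = _ := by ring

end Decay

/-! ### Cyclic products of decay kernels -/

section Edge

variable {G : Type*} [NormedAddCommGroup G]

/-- The cyclic product `k(-z₁) k(z₁ - z₂) k(z₂ - z₃) k(z₃)`. -/
def edge {R : Type*} [Mul R] (k : G → R) (z : G × G × G) : R :=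
  k (-z.1) * k (z.1 - z.2.1) * k (z.2.1 - z.2.2) * k z.2.2

lemma exists_two_far_edges {z : G × G × G} {ε : ℝ} (h : 6 * ε ≤ ‖z‖) :
    (ε ≤ ‖-z.1‖ ∧ ε ≤ ‖z.1 - z.2.1‖) ∨ (ε ≤ ‖-z.1‖ ∧ ε ≤ ‖z.2.1 - z.2.2‖) ∨
    (ε ≤ ‖-z.1‖ ∧ ε ≤ ‖z.2.2‖) ∨ (ε ≤ ‖z.1 - z.2.1‖ ∧ ε ≤ ‖z.2.1 - z.2.2‖) ∨
    (ε ≤ ‖z.1 - z.2.1‖ ∧ ε ≤ ‖z.2.2‖) ∨ (ε ≤ ‖z.2.1 - z.2.2‖ ∧ ε ≤ ‖z.2.2‖) := by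
  obtain ⟨x, y, w⟩ := z
  simp only [norm_neg]
  have h1 : ‖x‖ ≤ ‖x - y‖ + ‖y - w‖ + ‖w‖ := by
    have := norm_add₃_le (a := x - y) (b := y - w) (c := w)
    rwa [show x - y + (y - w) + w = x by abel] at this
  have h2 : ‖x - y‖ ≤ ‖x‖ + ‖y - w‖ + ‖w‖ := by
    have := norm_sub_le x (y - w + w)
    have h' := norm_add_le (y - w) w
    rw [show x - (y - w + w) = x - y by abel] at this
    linarith
  have h3 : ‖y - w‖ ≤ ‖x‖ + ‖x - y‖ + ‖w‖ := by
    have := norm_sub_le x (x - y + w)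
    have h' := norm_add_le (x - y) w
    rw [show x - (x - y + w) = y - w by abel] at this
    linarith
  have h4 : ‖w‖ ≤ ‖x‖ + ‖x - y‖ + ‖y - w‖ := by
    have := norm_sub_le x (x - y + (y - w))
    have h' := norm_add_le (x - y) (y - w)
    rw [show x - (x - y + (y - w)) = w by abel] at this
    linarith
  have h5 : ‖y‖ ≤ ‖x‖ + ‖x - y‖ := by
    have := norm_sub_le x (x - y)
    rwa [show x - (x - y) = y by abel] at this
  have h6 : ‖y‖ ≤ ‖y - w‖ + ‖w‖ := by
    have := norm_add_le (y - w) w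
    rwa [show y - w + w = y by abel] at this
  have h7 : 6 * ε ≤ ‖x‖ ∨ 6 * ε ≤ ‖y‖ ∨ 6 * ε ≤ ‖w‖ := by
    rw [Prod.norm_def, Prod.norm_def] at h
    simpa [le_max_iff] using h
  have := norm_nonneg x
  have := norm_nonneg y
  have := norm_nonneg w
  have := norm_nonneg (x - y)
  have := norm_nonneg (y - w)
  clear h
  by_contra hc
  push Not at hc
  obtain ⟨c1, c2, c3, c4, c5, c6⟩ := hc
  rcases le_or_gt ε ‖x‖ with a1 | a1 <;> rcases le_or_gt ε ‖x - y‖ with a2 | a2 <;>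
    rcases le_or_gt ε ‖y - w‖ with a3 | a3 <;> rcases le_or_gt ε ‖w‖ with a4 | a4 <;>
    first
    | linarith [c1 a1]
    | linarith [c2 a1]
    | linarith [c3 a1]
    | linarith [c4 a2]
    | linarith [c5 a2]
    | linarith [c6 a3]
    | (rcases h7 with h7 | h7 | h7 <;> linarith)

variable [MeasurableSpace G] [BorelSpace G] [SecondCountableTopology G] {μ : Measure G}

lemma measurable_edge {R : Type*} [Mul R] [MeasurableSpace R] [MeasurableMul₂ R] {k : G → R}
    (hk : Measurable k) : Measurable (edge k) := by
  unfold edge; fun_prop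

variable [LocallyCompactSpace G] [μ.IsAddHaarMeasure]

lemma lintegral_edge_le (hμ : RadiallyDominated μ) {T : ℝ} (hT : 0 < T) :
    ∫⁻ z, edge (fun x => decay T x ^ (15 / 16 : ℝ)) z ∂μ.prod (μ.prod μ) ≤
      16 * decayConst ^ 3 * (ofReal T)⁻¹ ^ 3 := by
  set k : G → ℝ≥0∞ := fun x => decay T x ^ (15 / 16 : ℝ) with hk
  have hkm : Measurable k := measurable_decay.pow_const _
  have hke : ∀ x y, k (x - y) = k (y - x) := fun x y => by simp only [hk]; rw [decay_sub_comm]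
  rw [lintegral_prod _ (measurable_edge hkm).aemeasurable]
  have h1 : ∀ x, ∫⁻ z, edge k (x, z) ∂μ.prod μ =
      ∫⁻ y, k (-x) * k (x - y) * ∫⁻ w, k (y - w) * k w ∂μ ∂μ := by
    intro x
    rw [lintegral_prod (fun z => edge k (x, z))
      ((measurable_edge hkm).comp measurable_prodMk_left).aemeasurable]
    refine lintegral_congr fun y => ?_
    rw [← lintegral_const_mul _ (by fun_prop)]
    exact lintegral_congr fun w => by simp only [edge]; ring
  simp_rw [h1]
  have hm : Measurable fun y => ∫⁻ w, k (y - w) * k w ∂μ :=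
    Measurable.lintegral_prod_right' (f := fun p : G × G => k (p.1 - p.2) * k p.2) (by fun_prop)
  rw [lintegral_lintegral_swap (by fun_prop)]
  have h2 : ∀ y, ∫⁻ w, k (y - w) * k w ∂μ ≤
      4 * decayConst * (ofReal T)⁻¹ * decay T y ^ (5 / 8 : ℝ) := by
    intro y
    have := lintegral_decay_conv_le hμ hT (a := 15 / 16) (b := 15 / 16) (θ := 5 / 8) (by norm_num)
      (by norm_num) (by norm_num) (by norm_num) (by norm_num) 0 y
    simp only [sub_zero] at this
    refine le_trans (le_of_eq (lintegral_congr fun w => ?_)) this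
    rw [mul_comm]
  have h3 : ∀ y, ∫⁻ x, k (-x) * k (x - y) * ∫⁻ w, k (y - w) * k w ∂μ ∂μ ≤
      (4 * decayConst * (ofReal T)⁻¹) ^ 2 * decay T y ^ (5 / 4 : ℝ) := by
    intro y
    rw [lintegral_mul_const _ (by fun_prop)]
    have e : ∫⁻ x, k (-x) * k (x - y) ∂μ = ∫⁻ w, k (y - w) * k w ∂μ := by
      refine lintegral_congr fun x => ?_
      rw [hke x y, mul_comm, ← zero_sub, hke 0 x, sub_zero]
    rw [e, ← pow_two]
    refine (pow_le_pow_left' (h2 y) 2).trans (le_of_eq ?_)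
    rw [mul_pow, ← ENNReal.rpow_natCast (decay T y ^ (5 / 8 : ℝ)), ← ENNReal.rpow_mul]
    norm_num
  refine (lintegral_mono h3).trans ?_
  rw [lintegral_const_mul _ (measurable_decay.pow_const _)]
  refine (mul_le_mul_right (lintegral_decay_le hμ hT le_rfl) _).trans (le_of_eq ?_)
  ring

/-- The weight `T³ ∏ (1 + T |edge|)⁻¹`. -/
def weight (T : ℝ) (z : G × G × G) : ℝ≥0∞ := ofReal T ^ 3 * edge (decay T) z

lemma measurable_weight (T : ℝ) : Measurable (weight T : G × G × G → ℝ≥0∞) :=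
  (measurable_edge measurable_decay).const_mul _

lemma edge_decay_le (T : ℝ) (z : G × G × G) :
    edge (decay T) z ≤ edge (fun x => decay T x ^ (15 / 16 : ℝ)) z := by
  have h : ∀ x : G, decay T x ≤ decay T x ^ (15 / 16 : ℝ) := fun x => by
    simpa using decay_rpow_le_rpow (T := T) x (a := 1) (b := 15 / 16) (by norm_num)
  unfold edge
  gcongr <;> exact h _

lemma lintegral_weight_le (hμ : RadiallyDominated μ) {T : ℝ} (hT : 0 < T) :
    ∫⁻ z, weight T z ∂μ.prod (μ.prod μ) ≤ 16 * decayConst ^ 3 := by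
  unfold weight
  rw [lintegral_const_mul _ (measurable_edge measurable_decay)]
  calc _ ≤ ofReal T ^ 3 * (16 * decayConst ^ 3 * (ofReal T)⁻¹ ^ 3) := by
        gcongr
        exact (lintegral_mono (edge_decay_le T)).trans (lintegral_edge_le hμ hT)
    _ = 16 * decayConst ^ 3 * (ofReal T * (ofReal T)⁻¹) ^ 3 := by ring
    _ = _ := by rw [ENNReal.mul_inv_cancel (by simpa using hT) (by simp)]; ring

/-- The weight is concentrated near the origin. -/
lemma lintegral_weight_far_le (hμ : RadiallyDominated μ) {T : ℝ} (hT : 0 < T) {ε : ℝ}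
    (hε : 0 < ε) : ∫⁻ z in {z | 6 * ε ≤ ‖z‖}, weight T z ∂μ.prod (μ.prod μ) ≤
      (ofReal (1 + ε⁻¹) * (ofReal T)⁻¹) ^ (1 / 16 : ℝ) * (16 * decayConst ^ 3) := by
  set M := (ofReal (1 + ε⁻¹) * (ofReal T)⁻¹) ^ (1 / 16 : ℝ) with hM
  have hMf : ∀ x : G, ε ≤ ‖x‖ → decay T x ≤ M * decay T x ^ (15 / 16 : ℝ) := by
    intro x hx
    calc decay T x = decay T x ^ (1 / 16 : ℝ) * decay T x ^ (15 / 16 : ℝ) := by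
          rw [← ENNReal.rpow_add _ _ (decay_ne_zero _) (decay_ne_top _)]; norm_num
      _ ≤ _ := by
          exact mul_le_mul_left (ENNReal.rpow_le_rpow (decay_le_of_le_norm' hε hT hx)
            (by norm_num)) _
  have h : ∀ x : G, decay T x ≤ decay T x ^ (15 / 16 : ℝ) := fun x => by
    simpa using decay_rpow_le_rpow (T := T) x (a := 1) (b := 15 / 16) (by norm_num)
  have key : ∀ z : G × G × G, z ∈ {z | 6 * ε ≤ ‖z‖} →
      weight T z ≤ ofReal T ^ 3 * (M * edge (fun x => decay T x ^ (15 / 16 : ℝ)) z) := by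
    intro z hz
    unfold weight
    gcongr
    have hz' := exists_two_far_edges (by exact hz)
    have : ε ≤ ‖-z.1‖ ∨ ε ≤ ‖z.1 - z.2.1‖ ∨ ε ≤ ‖z.2.1 - z.2.2‖ := by tauto
    unfold edge
    rcases this with h1 | h1 | h1
    · calc _ ≤ (M * decay T (-z.1) ^ (15 / 16 : ℝ)) * decay T (z.1 - z.2.1) ^ (15 / 16 : ℝ) *
            decay T (z.2.1 - z.2.2) ^ (15 / 16 : ℝ) * decay T z.2.2 ^ (15 / 16 : ℝ) := by
            gcongr
            exacts [hMf _ h1, h _, h _, h _]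
        _ = _ := by ring
    · calc _ ≤ (decay T (-z.1) ^ (15 / 16 : ℝ)) * (M * decay T (z.1 - z.2.1) ^ (15 / 16 : ℝ)) *
            decay T (z.2.1 - z.2.2) ^ (15 / 16 : ℝ) * decay T z.2.2 ^ (15 / 16 : ℝ) := by
            gcongr
            exacts [h _, hMf _ h1, h _, h _]
        _ = _ := by ring
    · calc _ ≤ (decay T (-z.1) ^ (15 / 16 : ℝ)) * decay T (z.1 - z.2.1) ^ (15 / 16 : ℝ) *
            (M * decay T (z.2.1 - z.2.2) ^ (15 / 16 : ℝ)) * decay T z.2.2 ^ (15 / 16 : ℝ) := by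
            gcongr
            exacts [h _, h _, hMf _ h1, h _]
        _ = _ := by ring
  have hkm : Measurable (edge fun x : G => decay T x ^ (15 / 16 : ℝ)) :=
    measurable_edge (measurable_decay.pow_const _)
  calc _ ≤ ∫⁻ z in {z | 6 * ε ≤ ‖z‖}, ofReal T ^ 3 *
        (M * edge (fun x => decay T x ^ (15 / 16 : ℝ)) z) ∂μ.prod (μ.prod μ) :=
        setLIntegral_mono ((hkm.const_mul _).const_mul _) key
    _ ≤ ∫⁻ z, ofReal T ^ 3 *
        (M * edge (fun x => decay T x ^ (15 / 16 : ℝ)) z) ∂μ.prod (μ.prod μ) :=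
        setLIntegral_le_lintegral _ _
    _ ≤ ofReal T ^ 3 * (M * (16 * decayConst ^ 3 * (ofReal T)⁻¹ ^ 3)) := by
        rw [lintegral_const_mul _ (hkm.const_mul _), lintegral_const_mul _ hkm]
        gcongr
        exact lintegral_edge_le hμ hT
    _ = M * (16 * decayConst ^ 3) * (ofReal T * (ofReal T)⁻¹) ^ 3 := by ring
    _ = _ := by rw [ENNReal.mul_inv_cancel (by simpa using hT) (by simp)]; ring

lemma lintegral_three_edges {a b c : G → ℝ≥0∞} (ha : Measurable a) (hb : Measurable b)
    (hc : Measurable c) : (∫⁻ z, a (z.1 - z.2.1) * b (z.2.1 - z.2.2) * c z.2.2 ∂μ.prod (μ.prod μ) =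
      (∫⁻ x, a x ∂μ) * (∫⁻ x, b x ∂μ) * ∫⁻ x, c x ∂μ) ∧
    (∫⁻ z, a (-z.1) * b (z.2.1 - z.2.2) * c z.2.2 ∂μ.prod (μ.prod μ) =
      (∫⁻ x, a x ∂μ) * (∫⁻ x, b x ∂μ) * ∫⁻ x, c x ∂μ) ∧
    (∫⁻ z, a (-z.1) * b (z.1 - z.2.1) * c z.2.2 ∂μ.prod (μ.prod μ) =
      (∫⁻ x, a x ∂μ) * (∫⁻ x, b x ∂μ) * ∫⁻ x, c x ∂μ) := by
  refine ⟨?_, ?_, ?_⟩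
  · rw [lintegral_prod_symm _ (by fun_prop)]
    have : ∀ p : G × G, ∫⁻ x, a (x - p.1) * b (p.1 - p.2) * c p.2 ∂μ =
        (∫⁻ x, a x ∂μ) * (b (p.1 - p.2) * c p.2) := fun p => by
      simp only [mul_assoc]
      rw [lintegral_mul_const _ (by fun_prop), lintegral_sub_right_eq_self a]
    simp only [this]
    rw [lintegral_const_mul _ (by fun_prop), lintegral_prod_symm _ (by fun_prop)]
    have : ∀ w : G, ∫⁻ x, b (x - w) * c w ∂μ = (∫⁻ x, b x ∂μ) * c w := fun w => by
      rw [lintegral_mul_const _ (by fun_prop), lintegral_sub_right_eq_self b]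
    simp only [this]
    rw [lintegral_const_mul _ hc, mul_assoc]
  · rw [lintegral_prod_symm _ (by fun_prop)]
    have : ∀ p : G × G, ∫⁻ x, a (-x) * b (p.1 - p.2) * c p.2 ∂μ =
        (∫⁻ x, a x ∂μ) * (b (p.1 - p.2) * c p.2) := fun p => by
      simp only [mul_assoc]
      rw [lintegral_mul_const _ (by fun_prop), lintegral_neg_eq_self a]
    simp only [this]
    rw [lintegral_const_mul _ (by fun_prop), lintegral_prod_symm _ (by fun_prop)]
    have : ∀ w : G, ∫⁻ x, b (x - w) * c w ∂μ = (∫⁻ x, b x ∂μ) * c w := fun w => by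
      rw [lintegral_mul_const _ (by fun_prop), lintegral_sub_right_eq_self b]
    simp only [this]
    rw [lintegral_const_mul _ hc, mul_assoc]
  · rw [lintegral_prod _ (by fun_prop)]
    have : ∀ x : G, ∫⁻ p : G × G, a (-x) * b (x - p.1) * c p.2 ∂μ.prod μ =
        a (-x) * ((∫⁻ x, b x ∂μ) * ∫⁻ x, c x ∂μ) := fun x => by
      simp only [mul_assoc]
      rw [lintegral_const_mul _ (by fun_prop), lintegral_prod_mul
        (f := fun y => b (x - y)) (g := c) (by fun_prop) (by fun_prop),
        lintegral_sub_left_eq_self b]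
    simp only [this]
    rw [lintegral_mul_const _ (by fun_prop), lintegral_neg_eq_self a, mul_assoc]

/-- Away from the origin the weight is bounded in `L²`. -/
lemma lintegral_weight_sq_far_le (hμ : RadiallyDominated μ) {T : ℝ} (hT : 0 < T) {ε : ℝ}
    (hε : 0 < ε) : ∫⁻ z in {z | 6 * ε ≤ ‖z‖}, weight T z ^ 2 ∂μ.prod (μ.prod μ) ≤
      6 * (ofReal (1 + ε⁻¹) ^ 4 * decayConst ^ 3) := by
  set A := ofReal (1 + ε⁻¹) with hA
  set k : G → ℝ≥0∞ := fun x => decay T x ^ (2 : ℝ) with hk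
  set l : G → ℝ≥0∞ := fun x => {x : G | ε ≤ ‖x‖}.indicator 1 x * k x with hl
  have hkm : Measurable k := measurable_decay.pow_const _
  have hset : MeasurableSet {x : G | ε ≤ ‖x‖} := measurableSet_le measurable_const measurable_norm
  have hlm : Measurable l := (measurable_one.indicator hset).mul hkm
  have hl1 : ∀ x, ε ≤ ‖x‖ → l x = k x := fun x hx => by
    simp only [hl]; rw [indicator_of_mem (by exact hx)]; simp
  set m : ℝ≥0∞ := (A * (ofReal T)⁻¹) ^ 2 with hm
  have hkfar : ∀ x, ε ≤ ‖x‖ → k x ≤ m := fun x hx => by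
    simp only [hk, hm, ENNReal.rpow_two]
    exact pow_le_pow_left' (decay_le_of_le_norm' hε hT hx) 2
  have hIk : ∫⁻ x, k x ∂μ ≤ decayConst * (ofReal T)⁻¹ :=
    lintegral_decay_le hμ hT (by norm_num)
  have hIl : ∫⁻ x, l x ∂μ ≤ A ^ 2 * decayConst * (ofReal T)⁻¹ ^ 2 :=
    lintegral_decay_sq_far_le hμ hT hε
  set F : Fin 6 → G × G × G → ℝ≥0∞ := ![
    fun z => l (z.1 - z.2.1) * k (z.2.1 - z.2.2) * k z.2.2,
    fun z => k (z.1 - z.2.1) * l (z.2.1 - z.2.2) * k z.2.2,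
    fun z => k (z.1 - z.2.1) * k (z.2.1 - z.2.2) * l z.2.2,
    fun z => k (-z.1) * l (z.2.1 - z.2.2) * k z.2.2,
    fun z => k (-z.1) * k (z.2.1 - z.2.2) * l z.2.2,
    fun z => k (-z.1) * k (z.1 - z.2.1) * l z.2.2] with hF
  have hFm : ∀ i, Measurable (F i) := by
    intro i
    fin_cases i <;> simp only [hF] <;> simp <;> fun_prop
  have hFI : ∀ i, ∫⁻ z, F i z ∂μ.prod (μ.prod μ) ≤
      A ^ 2 * decayConst ^ 3 * (ofReal T)⁻¹ ^ 4 := by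
    have b1 : (∫⁻ x, l x ∂μ) * (∫⁻ x, k x ∂μ) * ∫⁻ x, k x ∂μ ≤
        A ^ 2 * decayConst ^ 3 * (ofReal T)⁻¹ ^ 4 := by
      refine (mul_le_mul' (mul_le_mul' hIl hIk) hIk).trans (le_of_eq ?_)
      ring
    have b2 : (∫⁻ x, k x ∂μ) * (∫⁻ x, l x ∂μ) * ∫⁻ x, k x ∂μ ≤
        A ^ 2 * decayConst ^ 3 * (ofReal T)⁻¹ ^ 4 := by rwa [mul_comm (∫⁻ x, k x ∂μ)]
    have b3 : (∫⁻ x, k x ∂μ) * (∫⁻ x, k x ∂μ) * ∫⁻ x, l x ∂μ ≤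
        A ^ 2 * decayConst ^ 3 * (ofReal T)⁻¹ ^ 4 := by rwa [mul_comm, ← mul_assoc]
    intro i
    fin_cases i
    · exact (lintegral_three_edges hlm hkm hkm).1.le.trans b1
    · exact (lintegral_three_edges hkm hlm hkm).1.le.trans b2
    · exact (lintegral_three_edges hkm hkm hlm).1.le.trans b3
    · exact (lintegral_three_edges hkm hlm hkm).2.1.le.trans b2
    · exact (lintegral_three_edges hkm hkm hlm).2.1.le.trans b3
    · exact (lintegral_three_edges hkm hkm hlm).2.2.le.trans b3
  have key : ∀ z : G × G × G, z ∈ {z | 6 * ε ≤ ‖z‖} →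
      weight T z ^ 2 ≤ ∑ i, ofReal T ^ 6 * m * F i z := by
    intro z hz
    have e : weight T z ^ 2 = ofReal T ^ 6 *
        (k (-z.1) * k (z.1 - z.2.1) * k (z.2.1 - z.2.2) * k z.2.2) := by
      simp only [weight, edge, hk, ENNReal.rpow_two]; ring
    have hi : ∀ i, k (-z.1) * k (z.1 - z.2.1) * k (z.2.1 - z.2.2) * k z.2.2 ≤ m * F i z →
        weight T z ^ 2 ≤ ∑ i, ofReal T ^ 6 * m * F i z := by
      intro i h
      rw [e]
      refine le_trans ?_ (Finset.single_le_sum (f := fun i => ofReal T ^ 6 * m * F i z)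
        (fun _ _ => bot_le) (Finset.mem_univ i))
      simp only [mul_assoc] at h ⊢
      gcongr
    rcases exists_two_far_edges (by exact hz) with ⟨h1, h2⟩ | ⟨h1, h2⟩ | ⟨h1, h2⟩ | ⟨h1, h2⟩ |
      ⟨h1, h2⟩ | ⟨h1, h2⟩
    · refine hi 0 ?_
      simp only [hF, Matrix.cons_val, hl1 _ h2, ← mul_assoc]
      gcongr; exact hkfar _ h1
    · refine hi 1 ?_
      simp only [hF, Matrix.cons_val, hl1 _ h2, ← mul_assoc]
      gcongr; exact hkfar _ h1
    · refine hi 2 ?_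
      simp only [hF, Matrix.cons_val, hl1 _ h2, ← mul_assoc]
      gcongr; exact hkfar _ h1
    · refine hi 3 ?_
      simp only [hF, Matrix.cons_val, hl1 _ h2, ← mul_assoc]
      rw [mul_comm (k (-z.1))]
      gcongr; exact hkfar _ h1
    · refine hi 4 ?_
      simp only [hF, Matrix.cons_val, hl1 _ h2, ← mul_assoc]
      rw [mul_comm (k (-z.1))]
      gcongr; exact hkfar _ h1
    · refine hi 5 ?_
      simp only [hF, Matrix.cons_val, hl1 _ h2, ← mul_assoc]
      rw [mul_comm _ (k (z.2.1 - z.2.2)), ← mul_assoc]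
      gcongr; exact hkfar _ h1
  calc _ ≤ ∫⁻ z in {z | 6 * ε ≤ ‖z‖}, ∑ i, ofReal T ^ 6 * m * F i z ∂μ.prod (μ.prod μ) :=
        setLIntegral_mono (Finset.measurable_fun_sum _ fun i _ => (hFm i).const_mul _) key
    _ ≤ ∫⁻ z, ∑ i, ofReal T ^ 6 * m * F i z ∂μ.prod (μ.prod μ) :=
        setLIntegral_le_lintegral _ _
    _ = ∑ i, ofReal T ^ 6 * m * ∫⁻ z, F i z ∂μ.prod (μ.prod μ) := by
        rw [lintegral_finsetSum _ fun i _ => (hFm i).const_mul _]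
        exact Finset.sum_congr rfl fun i _ => lintegral_const_mul _ (hFm i)
    _ ≤ ∑ _i : Fin 6, ofReal T ^ 6 * m * (A ^ 2 * decayConst ^ 3 * (ofReal T)⁻¹ ^ 4) :=
        Finset.sum_le_sum fun i _ => mul_le_mul_right (hFI i) _
    _ = 6 * (A ^ 4 * decayConst ^ 3) * (ofReal T * (ofReal T)⁻¹) ^ 6 := by
        simp only [Finset.sum_const, Finset.card_univ, Fintype.card_fin, nsmul_eq_mul, hm]
        push_cast
        ring
    _ = _ := by rw [ENNReal.mul_inv_cancel (by simpa using hT) (by simp)]; ring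

end Edge

/-! ### Limits of tapered cyclic integrals -/

lemma enorm_complex_ofReal (x : ℝ) : ‖(x : ℂ)‖ₑ = ‖x‖ₑ := by
  rw [← ofReal_norm, ← ofReal_norm, Complex.norm_real]

section Limit

variable {G : Type*} [NormedAddCommGroup G] [MeasurableSpace G] [BorelSpace G]
  [SecondCountableTopology G]

/-- A sequence of kernels that behave like the Fourier transforms of a taper of bounded variation
stretched to length `T n`. -/
structure TaperedKernels (μ : Measure G) (T : ℕ → ℝ) (H : ℕ → G → ℂ) (C : ℝ≥0) (c : ℝ) : Prop where
  one_le : ∀ n, 1 ≤ T n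
  tendsto : Tendsto T atTop atTop
  meas : ∀ n, Measurable (H n)
  conj_eq : ∀ n x, conj (H n x) = H n (-x)
  bound : ∀ n x, ‖H n x‖ₑ ≤ C * ofReal (T n) * decay (T n) x
  radial : RadiallyDominated μ
  pos : 0 < c
  limit : Tendsto (fun n => (T n : ℂ)⁻¹ * ∫ z, edge (H n) z ∂(μ.prod (μ.prod μ))) atTop (𝓝 c)

variable {μ : Measure G} {T : ℕ → ℝ} {H : ℕ → G → ℂ} {C : ℝ≥0} {c : ℝ}

lemma TaperedKernels.T_pos (h : TaperedKernels μ T H C c) (n : ℕ) : 0 < T n :=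
  one_pos.trans_le (h.one_le n)

lemma TaperedKernels.enorm_edge_le (h : TaperedKernels μ T H C c) (n : ℕ) (z : G × G × G) :
    ‖edge (H n) z‖ₑ ≤ C ^ 4 * (ofReal (T n) * weight (T n) z) := by
  simp only [edge, enorm_mul, weight]
  calc _ ≤ _ := mul_le_mul' (mul_le_mul' (mul_le_mul' (h.bound n _) (h.bound n _)) (h.bound n _))
        (h.bound n _)
    _ = _ := by ring

variable [LocallyCompactSpace G] [μ.IsAddHaarMeasure]

lemma TaperedKernels.tendsto_weight_far (h : TaperedKernels μ T H C c) {δ : ℝ} (hδ : 0 < δ) :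
    Tendsto (fun n => ∫⁻ z in {z | δ ≤ ‖z‖}, weight (T n) z ∂μ.prod (μ.prod μ)) atTop (𝓝 0) := by
  have h1 : Tendsto (fun n => (ofReal (1 + (δ / 6)⁻¹) * (ofReal (T n))⁻¹) ^
      (1 / 16 : ℝ) * (16 * decayConst ^ 3)) atTop (𝓝 0) := by
    have a1 : Tendsto (fun n => (ofReal (T n))⁻¹) atTop (𝓝 0) := by
      have := (ENNReal.tendsto_ofReal_atTop.comp h.tendsto).inv
      simpa using this
    have a2 := ENNReal.Tendsto.const_mul (a := ofReal (1 + (δ / 6)⁻¹)) a1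
      (Or.inr ofReal_ne_top)
    have a3 := ((ENNReal.continuous_rpow_const (y := 1 / 16)).tendsto _).comp a2
    have a4 := ENNReal.Tendsto.mul_const (b := 16 * decayConst ^ 3) a3
      (Or.inr (mul_ne_top (by norm_num) (pow_ne_top decayConst_ne_top)))
    simpa using a4
  refine tendsto_of_tendsto_of_tendsto_of_le_of_le tendsto_const_nhds h1 (fun n => bot_le)
    fun n => ?_
  have := lintegral_weight_far_le h.radial (h.T_pos n) (ε := δ / 6) (by positivity)
  rwa [show 6 * (δ / 6) = δ by ring] at this

lemma TaperedKernels.tendsto_bounded_far (h : TaperedKernels μ T H C c) {φ : G × G × G → ℝ}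
    {M : ℝ≥0∞} (hM : M ≠ ∞) (hφ : ∀ z, ‖φ z‖ₑ ≤ M) {δ : ℝ} (hδ : 0 < δ) :
    Tendsto (fun n => ∫⁻ z in {z | δ ≤ ‖z‖}, ‖φ z‖ₑ * weight (T n) z ∂μ.prod (μ.prod μ))
      atTop (𝓝 0) := by
  have h1 := ENNReal.Tendsto.const_mul (a := M) (h.tendsto_weight_far hδ) (Or.inr hM)
  rw [mul_zero] at h1
  refine tendsto_of_tendsto_of_tendsto_of_le_of_le tendsto_const_nhds h1 (fun n => bot_le)
    fun n => ?_
  dsimp only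
  rw [← lintegral_const_mul _ (measurable_weight _)]
  exact lintegral_mono fun z => mul_le_mul_left (hφ z) _

lemma TaperedKernels.tendsto_memLp_far (h : TaperedKernels μ T H C c) {φ : G × G × G → ℝ}
    (hφ : MemLp φ 2 (μ.prod (μ.prod μ))) {δ : ℝ} (hδ : 0 < δ) :
    Tendsto (fun n => ∫⁻ z in {z | δ ≤ ‖z‖}, ‖φ z‖ₑ * weight (T n) z ∂μ.prod (μ.prod μ))
      atTop (𝓝 0) := by
  set κ := μ.prod (μ.prod μ) with hκ
  set B : ℝ≥0∞ := 6 * (ofReal (1 + (δ / 6)⁻¹) ^ 4 * decayConst ^ 3) with hB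
  have hBt : B ≠ ∞ := mul_ne_top (by norm_num) (mul_ne_top
    (pow_ne_top ofReal_ne_top) (pow_ne_top decayConst_ne_top))
  have hW : ∀ n, ∫⁻ z in {z | δ ≤ ‖z‖}, weight (T n) z ^ 2 ∂κ ≤ B := fun n => by
    have := lintegral_weight_sq_far_le h.radial (h.T_pos n) (ε := δ / 6) (by positivity)
    rwa [show 6 * (δ / 6) = δ by ring] at this
  have hae : AEMeasurable (fun z => ‖φ z‖ₑ) κ := hφ.1.enorm
  have hφ2 : ∫⁻ z, ‖φ z‖ₑ ^ 2 ∂κ ≠ ∞ := by rw [← eLpNorm_two_sq]; exact pow_ne_top hφ.2.ne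
  have hset : MeasurableSet {z : G × G × G | δ ≤ ‖z‖} := measurableSet_le measurable_const
    measurable_norm
  set ψ : ℕ → G × G × G → ℝ≥0∞ := fun M z => if (M : ℝ≥0∞) < ‖φ z‖ₑ then ‖φ z‖ₑ else 0 with hψ
  have hψm : ∀ M, AEMeasurable (ψ M) κ := fun M => by
    have : Measurable fun x : ℝ≥0∞ => if (M : ℝ≥0∞) < x then x else 0 :=
      Measurable.ite measurableSet_Ioi measurable_id measurable_const
    exact this.comp_aemeasurable hae
  have htail : Tendsto (fun M : ℕ => ∫⁻ z, ψ M z ^ 2 ∂κ) atTop (𝓝 0) := by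
    have := tendsto_lintegral_of_dominated_convergence' (μ := κ) (F := fun M z => ψ M z ^ 2)
      (f := fun _ => 0) (fun z => ‖φ z‖ₑ ^ 2) (fun M => (hψm M).pow_const 2) (fun M => ?_) hφ2 ?_
    · simpa using this
    · refine ae_of_all _ fun z => pow_le_pow_left' ?_ 2
      simp only [hψ]; split_ifs <;> simp
    · refine ae_of_all _ fun z => tendsto_const_nhds.congr' ?_
      obtain ⟨M0, hM0⟩ := ENNReal.exists_nat_gt (enorm_ne_top (x := φ z))
      filter_upwards [eventually_ge_atTop M0] with M hM
      have : ¬ ((M : ℝ≥0∞) < ‖φ z‖ₑ) := by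
        rw [not_lt]
        exact hM0.le.trans (by exact_mod_cast hM)
      simp [hψ, this]
  have htail2 := ENNReal.Tendsto.mul_const (b := B) htail (Or.inr hBt)
  rw [zero_mul] at htail2
  rw [ENNReal.tendsto_nhds_zero]
  intro ε hε
  rcases eq_or_ne ε ∞ with rfl | hεt
  · exact Eventually.of_forall fun _ => le_top
  have hε2 : 0 < ε / 2 := ENNReal.half_pos hε.ne'
  obtain ⟨M, hM⟩ := ((tendsto_order.1 htail2).2 ((ε / 2) ^ 2) (by positivity)).exists
  have h1 := ENNReal.Tendsto.const_mul (a := (M : ℝ≥0∞)) (h.tendsto_weight_far hδ)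
    (Or.inr (by simp))
  rw [mul_zero] at h1
  filter_upwards [(tendsto_order.1 h1).2 _ hε2] with n hn
  have hsq : ∫⁻ z in {z | δ ≤ ‖z‖}, ψ M z * weight (T n) z ∂κ ≤ ε / 2 := by
    have := lintegral_mul_sq_le (κ.restrict {z | δ ≤ ‖z‖}) (hψm M).restrict
      (measurable_weight (T n)).aemeasurable
    have h2 : (∫⁻ z in {z | δ ≤ ‖z‖}, ψ M z * weight (T n) z ∂κ) ^ 2 ≤ (ε / 2) ^ 2 :=
      this.trans ((mul_le_mul' (setLIntegral_le_lintegral _ _) (hW n)).trans hM.le)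
    by_contra hc
    exact absurd h2 (not_le.2 (ENNReal.pow_lt_pow_left two_ne_zero (not_le.1 hc)))
  calc _ ≤ ∫⁻ z in {z | δ ≤ ‖z‖}, (M * weight (T n) z + ψ M z * weight (T n) z) ∂κ := by
        refine lintegral_mono fun z => ?_
        dsimp only
        rw [← add_mul]
        refine mul_le_mul_left ?_ _
        simp only [hψ]
        split_ifs with hz
        · exact le_add_self
        · rw [add_zero]; exact not_lt.1 hz
    _ = M * ∫⁻ z in {z | δ ≤ ‖z‖}, weight (T n) z ∂κ +
          ∫⁻ z in {z | δ ≤ ‖z‖}, ψ M z * weight (T n) z ∂κ := by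
        rw [lintegral_add_left ((measurable_weight _).const_mul _),
          lintegral_const_mul _ (measurable_weight _)]
    _ ≤ ε / 2 + ε / 2 := add_le_add hn.le hsq
    _ = ε := ENNReal.add_halves ε

/-- The tapered cyclic products act as an approximate identity. -/
lemma TaperedKernels.tendsto_integral_mul_edge (h : TaperedKernels μ T H C c)
    {φ : G × G × G → ℝ} (hφm : AEStronglyMeasurable φ (μ.prod (μ.prod μ)))
    (hφc : ContinuousAt φ 0)
    (hfar : ∀ δ > 0, Tendsto (fun n => ∫⁻ z in {z | δ ≤ ‖z‖}, ‖φ z‖ₑ * weight (T n) z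
      ∂μ.prod (μ.prod μ)) atTop (𝓝 0)) :
    Tendsto (fun n => (T n : ℂ)⁻¹ * ∫ z, (φ z : ℂ) * edge (H n) z ∂(μ.prod (μ.prod μ)))
      atTop (𝓝 ((c * φ 0 : ℝ) : ℂ)) := by
  set κ := μ.prod (μ.prod μ) with hκ
  set K : ℝ≥0∞ := 16 * decayConst ^ 3 with hK
  have hKt : K ≠ ∞ := mul_ne_top (by norm_num) (pow_ne_top decayConst_ne_top)
  have hKW : ∀ n, ∫⁻ z, weight (T n) z ∂κ ≤ K := fun n => lintegral_weight_le h.radial (h.T_pos n)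
  have hae : AEMeasurable (fun z => ‖φ z - φ 0‖ₑ) κ := (hφm.sub aestronglyMeasurable_const).enorm
  have hedge : ∀ n, Measurable (edge (H n)) := fun n => measurable_edge (h.meas n)
  have hset : ∀ δ : ℝ, MeasurableSet {z : G × G × G | δ ≤ ‖z‖} := fun δ =>
    measurableSet_le measurable_const measurable_norm
  have hbound : ∀ η : ℝ≥0∞, 0 < η → ∀ᶠ n in atTop,
      ∫⁻ z, ‖φ z - φ 0‖ₑ * weight (T n) z ∂κ ≤ η * K + η := by
    intro η hη
    have h1 : Tendsto (fun z => ‖φ z - φ 0‖ₑ) (𝓝 0) (𝓝 0) := by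
      have := (tendsto_sub_nhds_zero_iff.2 hφc).enorm
      simpa using this
    obtain ⟨δ, hδ, hball⟩ := Metric.eventually_nhds_iff.1 ((tendsto_order.1 h1).2 η hη)
    have h2 := (hfar δ hδ).add (ENNReal.Tendsto.const_mul (a := ‖φ 0‖ₑ)
      (h.tendsto_weight_far hδ) (Or.inr (by simp)))
    rw [mul_zero, add_zero] at h2
    filter_upwards [(tendsto_order.1 h2).2 η hη] with n hn
    rw [← lintegral_add_compl _ (hset δ), add_comm]
    refine add_le_add ?_ (le_trans ?_ hn.le)
    · calc _ ≤ ∫⁻ z in {z | δ ≤ ‖z‖}ᶜ, η * weight (T n) z ∂κ := by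
            refine setLIntegral_mono ((measurable_weight _).const_mul _) fun z hz => ?_
            refine mul_le_mul_left (hball ?_).le _
            simpa using hz
        _ ≤ ∫⁻ z, η * weight (T n) z ∂κ := setLIntegral_le_lintegral _ _
        _ ≤ η * K := by
            rw [lintegral_const_mul _ (measurable_weight _)]
            exact mul_le_mul_right (hKW n) _
    · rw [← lintegral_const_mul _ (measurable_weight _),
        ← lintegral_add_right _ ((measurable_weight _).const_mul _)]
      refine lintegral_mono fun z => ?_
      dsimp only
      rw [← add_mul]
      exact mul_le_mul_left enorm_sub_le _
  have hto : Tendsto (fun n => ∫⁻ z, ‖φ z - φ 0‖ₑ * weight (T n) z ∂κ) atTop (𝓝 0) := by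
    rw [ENNReal.tendsto_nhds_zero]
    intro ε hε
    have hK1 : K + 1 ≠ ∞ := by simp [hKt]
    filter_upwards [hbound (ε / (K + 1)) (ENNReal.div_pos hε.ne' hK1)] with n hn
    refine hn.trans (le_of_eq ?_)
    calc ε / (K + 1) * K + ε / (K + 1) = ε / (K + 1) * (K + 1) := by ring
      _ = ε := ENNReal.div_mul_cancel (by simp) hK1
  have hint0 : ∀ n, Integrable (edge (H n)) κ := fun n => by
    refine ⟨(hedge n).aestronglyMeasurable, ?_⟩
    refine (lintegral_mono (h.enorm_edge_le n)).trans_lt ?_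
    rw [lintegral_const_mul _ ((measurable_weight _).const_mul _),
      lintegral_const_mul _ (measurable_weight _)]
    exact mul_lt_top (ENNReal.pow_lt_top ENNReal.coe_lt_top) (mul_lt_top
      ofReal_lt_top ((hKW n).trans_lt hKt.lt_top))
  have hdiff_le : ∀ n z, ‖((φ z - φ 0 : ℝ) : ℂ) * edge (H n) z‖ₑ ≤
      C ^ 4 * ofReal (T n) * (‖φ z - φ 0‖ₑ * weight (T n) z) := by
    intro n z
    rw [enorm_mul, enorm_complex_ofReal]
    calc _ ≤ _ := mul_le_mul_right (h.enorm_edge_le n z) _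
      _ = _ := by ring
  have hlin_le : ∀ n, ∫⁻ z, ‖((φ z - φ 0 : ℝ) : ℂ) * edge (H n) z‖ₑ ∂κ ≤
      C ^ 4 * ofReal (T n) * ∫⁻ z, ‖φ z - φ 0‖ₑ * weight (T n) z ∂κ := fun n => by
    exact (lintegral_mono (hdiff_le n)).trans
      (lintegral_const_mul'' _ (hae.mul (measurable_weight (T n)).aemeasurable)).le
  have hmeasd : ∀ n, AEStronglyMeasurable (fun z => ((φ z - φ 0 : ℝ) : ℂ) * edge (H n) z) κ :=
    fun n => (Complex.continuous_ofReal.comp_aestronglyMeasurable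
      (hφm.sub aestronglyMeasurable_const)).mul (hedge n).aestronglyMeasurable
  have hmain : Tendsto (fun n => (T n : ℂ)⁻¹ * ∫ z, ((φ z - φ 0 : ℝ) : ℂ) * edge (H n) z ∂κ)
      atTop (𝓝 0) := by
    rw [tendsto_zero_iff_enorm_tendsto_zero]
    have h1 := ENNReal.Tendsto.const_mul (a := (C : ℝ≥0∞) ^ 4) hto
      (Or.inr (pow_ne_top coe_ne_top))
    rw [mul_zero] at h1
    refine tendsto_of_tendsto_of_tendsto_of_le_of_le tendsto_const_nhds h1 (fun n => bot_le)
      fun n => ?_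
    dsimp only
    rw [enorm_mul]
    have hTn : ‖(T n : ℂ)⁻¹‖ₑ = (ofReal (T n))⁻¹ := by
      have hT : (T n : ℂ) ≠ 0 := by exact_mod_cast (h.T_pos n).ne'
      rw [enorm_inv hT, enorm_complex_ofReal, Real.enorm_eq_ofReal (h.T_pos n).le]
    rw [hTn]
    calc _ ≤ (ofReal (T n))⁻¹ * (C ^ 4 * ofReal (T n) * ∫⁻ z, ‖φ z - φ 0‖ₑ * weight (T n) z ∂κ) :=
          mul_le_mul_right ((enorm_integral_le_lintegral_enorm _).trans (hlin_le n)) _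
      _ = C ^ 4 * (∫⁻ z, ‖φ z - φ 0‖ₑ * weight (T n) z ∂κ) *
          (ofReal (T n) * (ofReal (T n))⁻¹) := by ring
      _ = _ := by rw [ENNReal.mul_inv_cancel (by simpa using h.T_pos n) (by simp), mul_one]
  have hconst := h.limit.const_mul (φ 0 : ℂ)
  have hsum := hmain.add hconst
  rw [zero_add] at hsum
  have e : ((c * φ 0 : ℝ) : ℂ) = (φ 0 : ℂ) * c := by push_cast; ring
  rw [e]
  refine hsum.congr' ?_
  filter_upwards [(tendsto_order.1 hto).2 1 one_pos] with n hn
  have hi : Integrable (fun z => ((φ z - φ 0 : ℝ) : ℂ) * edge (H n) z) κ := by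
    refine ⟨hmeasd n, (hlin_le n).trans_lt ?_⟩
    exact mul_lt_top (mul_lt_top (ENNReal.pow_lt_top ENNReal.coe_lt_top)
      ofReal_lt_top) (hn.trans ENNReal.one_lt_top)
  have : ∫ z, (φ z : ℂ) * edge (H n) z ∂κ = ∫ z, ((φ z - φ 0 : ℝ) : ℂ) * edge (H n) z ∂κ +
      (φ 0 : ℂ) * ∫ z, edge (H n) z ∂κ := by
    rw [← integral_const_mul, ← integral_add hi ((hint0 n).const_mul _)]
    refine integral_congr_ae (ae_of_all _ fun z => ?_)
    push_cast; ring
  rw [this]; ring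

end Limit

/-! ### Cyclic forms -/

section Cyclic

variable {G : Type*} [NormedAddCommGroup G]

/-- The cyclic product over the four differences of `(x, u, y, v)`. -/
def cyc {R : Type*} [Mul R] (k : G → R) (q : G × G × G × G) : R :=
  k (q.2.1 - q.1) * k (q.2.2.1 - q.2.1) * k (q.2.2.2 - q.2.2.1) * k (q.1 - q.2.2.2)

/-- The tensor product of four functions. -/
def tens4 {R : Type*} [Mul R] (f₁ g₁ f₂ g₂ : G → R) (q : G × G × G × G) : R :=
  f₁ q.1 * g₁ q.2.1 * f₂ q.2.2.1 * g₂ q.2.2.2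

/-- Change of variables to differences. -/
def diffMap (q : G × G × G × G) : G × G × G × G := (q.1, (q.1, q.1, q.1) - q.2)

/-- The map `((x, y), (u, v)) ↦ (x, u, y, v)`. -/
def midSwap (q : (G × G) × (G × G)) : G × G × G × G := (q.1.1, q.2.1, q.1.2, q.2.2)

/-- The map `(x, u, y, v) ↦ (u, y, v, x)`. -/
def rotate4 (q : G × G × G × G) : G × G × G × G := (q.2.1, q.2.2.1, q.2.2.2, q.1)

lemma cyc_diffMap {R : Type*} [Mul R] (k : G → R) (q : G × G × G × G) :
    cyc k (diffMap q) = edge k q.2 := by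
  simp only [cyc, diffMap, edge, Prod.fst_sub, Prod.snd_sub]
  rw [sub_sub_cancel_left, sub_sub_sub_cancel_left, sub_sub_sub_cancel_left, sub_sub_cancel]

variable [MeasurableSpace G] [BorelSpace G] [SecondCountableTopology G] {μ : Measure G}

lemma measurable_cyc {R : Type*} [Mul R] [MeasurableSpace R] [MeasurableMul₂ R] {k : G → R}
    (hk : Measurable k) : Measurable (cyc k) := by
  unfold cyc; fun_prop

lemma measurable_tens4 {R : Type*} [Mul R] [MeasurableSpace R] [MeasurableMul₂ R]
    {f₁ g₁ f₂ g₂ : G → R} (hf₁ : Measurable f₁) (hg₁ : Measurable g₁) (hf₂ : Measurable f₂)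
    (hg₂ : Measurable g₂) : Measurable (tens4 f₁ g₁ f₂ g₂) := by
  unfold tens4; fun_prop

variable (μ) in
/-- `∫ f₁(u) g₁(u - z₁) f₂(u - z₂) g₂(u - z₃) du`. -/
def conv4 (f₁ g₁ f₂ g₂ : G → ℝ) (z : G × G × G) : ℝ :=
  ∫ u, f₁ u * g₁ (u - z.1) * f₂ (u - z.2.1) * g₂ (u - z.2.2) ∂μ

variable (μ) in
/-- The cyclic form of four functions with kernel `H`. -/
def cycForm (H : G → ℂ) (f₁ g₁ f₂ g₂ : G → ℝ) : ℂ :=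
  ∫ q, ((tens4 f₁ g₁ f₂ g₂ q : ℝ) : ℂ) * cyc H q ∂(μ.prod (μ.prod (μ.prod μ)))

variable (μ) in
/-- The integral kernel `∫ g(u) H(u - x) H(y - u) du`. -/
def transform (H : G → ℂ) (g : G → ℝ) (x y : G) : ℂ :=
  ∫ u, (g u : ℂ) * (H (u - x) * H (y - u)) ∂μ

variable (μ) in
/-- The majorant of the cyclic forms. -/
def decayForm (T : ℝ) (f₁ g₁ f₂ g₂ : G → ℝ≥0∞) : ℝ≥0∞ :=
  ofReal T ^ 3 * ∫⁻ q, tens4 f₁ g₁ f₂ g₂ q * cyc (decay T) q ∂(μ.prod (μ.prod (μ.prod μ)))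

variable (μ) in
/-- The integral kernel `∫ g(u) k(u - x) k(y - u) du` with decay kernels `k`. -/
def decayTransform (T : ℝ) (g : G → ℝ≥0∞) (x y : G) : ℝ≥0∞ :=
  ∫⁻ u, g u * (decay T (u - x) * decay T (y - u)) ∂μ

lemma measurable_decayTransform [SFinite μ] (T : ℝ) {g : G → ℝ≥0∞} (hg : Measurable g) :
    Measurable fun p : G × G => decayTransform μ T g p.1 p.2 := by
  have hk : Measurable (decay T : G → ℝ≥0∞) := measurable_decay
  exact Measurable.lintegral_prod_right' (f := fun q : (G × G) × G =>
    g q.2 * (decay T (q.2 - q.1.1) * decay T (q.1.2 - q.2))) (by fun_prop)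

lemma measurable_transform [SFinite μ] {H : G → ℂ} (hH : Measurable H) {g : G → ℝ}
    (hg : Measurable g) : Measurable fun p : G × G => transform μ H g p.1 p.2 := by
  have : Measurable fun q : (G × G) × G =>
    (g q.2 : ℂ) * (H (q.2 - q.1.1) * H (q.1.2 - q.2)) := by fun_prop
  exact this.stronglyMeasurable.integral_prod_right'.measurable

lemma measurable_conv4 [SFinite μ] {f₁ g₁ f₂ g₂ : G → ℝ} (hf₁ : Measurable f₁)
    (hg₁ : Measurable g₁) (hf₂ : Measurable f₂) (hg₂ : Measurable g₂) :
    Measurable (conv4 μ f₁ g₁ f₂ g₂) := by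
  have : Measurable fun q : (G × G × G) × G =>
    f₁ q.2 * g₁ (q.2 - q.1.1) * f₂ (q.2 - q.1.2.1) * g₂ (q.2 - q.1.2.2) := by fun_prop
  exact this.stronglyMeasurable.integral_prod_right'.measurable

lemma norm_transform_le {H : G → ℂ} {b : ℝ} (hb : ∀ x, ‖H x‖ ≤ b) {g : G → ℝ}
    (hg : Integrable g μ) (x y : G) : ‖transform μ H g x y‖ ≤ (∫ u, |g u| ∂μ) * (b * b) := by
  have hb0 : 0 ≤ b := (norm_nonneg _).trans (hb 0)
  rw [← integral_mul_const]
  refine norm_integral_le_of_norm_le (hg.abs.mul_const _) (ae_of_all _ fun u => ?_)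
  rw [norm_mul, norm_mul, Complex.norm_real, Real.norm_eq_abs]
  gcongr
  exacts [hb _, hb _]

lemma conj_transform {H : G → ℂ} (hH : ∀ x, conj (H x) = H (-x)) (g : G → ℝ) (x y : G) :
    conj (transform μ H g x y) = transform μ H g y x := by
  unfold transform
  rw [← integral_conj]
  refine integral_congr_ae (ae_of_all _ fun u => ?_)
  simp only [map_mul, Complex.conj_ofReal, hH, neg_sub]
  ring

lemma enorm_transform_le {H : G → ℂ} {B : ℝ≥0∞} {T : ℝ}
    (hb : ∀ x, ‖H x‖ₑ ≤ B * decay T x) (g : G → ℝ) (x y : G) :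
    ‖transform μ H g x y‖ₑ ≤ ∫⁻ u, ‖g u‖ₑ * (B ^ 2 * (decay T (u - x) * decay T (y - u))) ∂μ := by
  refine (enorm_integral_le_lintegral_enorm _).trans (lintegral_mono fun u => ?_)
  dsimp only
  rw [enorm_mul, enorm_mul, enorm_complex_ofReal]
  refine mul_le_mul_right ((mul_le_mul' (hb _) (hb _)).trans (le_of_eq ?_)) _
  ring

variable [LocallyCompactSpace G] [μ.IsAddHaarMeasure]

lemma measurePreserving_diffMap : MeasurePreserving (diffMap (G := G))
    (μ.prod (μ.prod (μ.prod μ))) (μ.prod (μ.prod (μ.prod μ))) := by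
  refine MeasurePreserving.skew_product (f := id) (g := fun x z => (x, x, x) - z)
    (MeasurePreserving.id μ) (by fun_prop) (ae_of_all _ fun x => ?_)
  have h := Measure.measurePreserving_sub_left μ x
  exact (h.prod (h.prod h)).map_eq

lemma measurePreserving_midSwap [SFinite μ] : MeasurePreserving (midSwap (G := G))
    ((μ.prod μ).prod (μ.prod μ)) (μ.prod (μ.prod (μ.prod μ))) := by
  have h1 : MeasurePreserving (MeasurableEquiv.prodAssoc : (G × G) × (G × G) ≃ᵐ G × G × G × G)
    ((μ.prod μ).prod (μ.prod μ)) _ := measurePreserving_prodAssoc μ μ (μ.prod μ)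
  have h2 : MeasurePreserving (MeasurableEquiv.prodAssoc : (G × G) × G ≃ᵐ G × G × G)
    ((μ.prod μ).prod μ) _ := measurePreserving_prodAssoc μ μ μ
  have h3 : MeasurePreserving (Prod.map Prod.swap id : (G × G) × G → (G × G) × G)
      ((μ.prod μ).prod μ) ((μ.prod μ).prod μ) :=
    Measure.measurePreserving_swap.prod (MeasurePreserving.id μ)
  exact ((MeasurePreserving.id μ).prod ((h2.comp h3).comp (h2.symm _))).comp h1

lemma measurePreserving_rotate4 [SFinite μ] : MeasurePreserving (rotate4 (G := G))
    (μ.prod (μ.prod (μ.prod μ))) (μ.prod (μ.prod (μ.prod μ))) := by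
  have h1 : MeasurePreserving (MeasurableEquiv.prodAssoc : (G × G × G) × G ≃ᵐ G × (G × G) × G)
    ((μ.prod (μ.prod μ)).prod μ) _ := measurePreserving_prodAssoc μ (μ.prod μ) μ
  have h2 : MeasurePreserving (MeasurableEquiv.prodAssoc : (G × G) × G ≃ᵐ G × G × G)
    ((μ.prod μ).prod μ) _ := measurePreserving_prodAssoc μ μ μ
  have h3 : MeasurePreserving (Prod.swap : G × G × G × G → (G × G × G) × G)
    (μ.prod (μ.prod (μ.prod μ))) _ := Measure.measurePreserving_swap
  exact (((MeasurePreserving.id μ).prod h2).comp h1).comp h3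

/-! #### Majorants -/

section Majorant

variable {T : ℝ} {f₁ g₁ f₂ g₂ : G → ℝ≥0∞} (hf₁ : Measurable f₁) (hg₁ : Measurable g₁)
  (hf₂ : Measurable f₂) (hg₂ : Measurable g₂)

include hf₁ hg₁ hf₂ hg₂

lemma decayForm_eq_weight : decayForm μ T f₁ g₁ f₂ g₂ = ∫⁻ z, weight T z *
    ∫⁻ u, f₁ u * g₁ (u - z.1) * f₂ (u - z.2.1) * g₂ (u - z.2.2) ∂μ ∂(μ.prod (μ.prod μ)) := by
  have hk : Measurable (decay T : G → ℝ≥0∞) := measurable_decay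
  have hm : Measurable fun q => tens4 f₁ g₁ f₂ g₂ q * cyc (decay T) q :=
    (measurable_tens4 hf₁ hg₁ hf₂ hg₂).mul (measurable_cyc hk)
  have hm1 : Measurable fun p : (G × G × G) × G =>
    f₁ p.2 * g₁ (p.2 - p.1.1) * f₂ (p.2 - p.1.2.1) * g₂ (p.2 - p.1.2.2) := by fun_prop
  rw [decayForm, ← (measurePreserving_diffMap (μ := μ)).lintegral_comp hm,
    lintegral_prod_symm (fun q => tens4 f₁ g₁ f₂ g₂ (diffMap q) * cyc (decay T) (diffMap q))
      (hm.comp (measurePreserving_diffMap (μ := μ)).measurable).aemeasurable, ← lintegral_const_mul]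
  · refine lintegral_congr fun z => ?_
    have e : ∀ u, tens4 f₁ g₁ f₂ g₂ (diffMap (u, z)) * cyc (decay T) (diffMap (u, z)) =
        edge (decay T) z * (f₁ u * g₁ (u - z.1) * f₂ (u - z.2.1) * g₂ (u - z.2.2)) := fun u => by
      rw [cyc_diffMap, mul_comm]; rfl
    simp_rw [e]
    rw [lintegral_const_mul _ (by fun_prop), weight, mul_assoc]
  · exact Measurable.lintegral_prod_left' (hm.comp (measurePreserving_diffMap (μ := μ)).measurable)

lemma decayForm_eq_transform [SigmaFinite μ] : decayForm μ T f₁ g₁ f₂ g₂ =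
    ofReal T ^ 3 * ∫⁻ p, f₁ p.1 * f₂ p.2 *
      (decayTransform μ T g₁ p.1 p.2 * decayTransform μ T g₂ p.1 p.2) ∂(μ.prod μ) := by
  have hk : Measurable (decay T : G → ℝ≥0∞) := measurable_decay
  have hm : Measurable fun q => tens4 f₁ g₁ f₂ g₂ q * cyc (decay T) q :=
    (measurable_tens4 hf₁ hg₁ hf₂ hg₂).mul (measurable_cyc hk)
  rw [decayForm, ← (measurePreserving_midSwap (μ := μ)).lintegral_comp hm,
    lintegral_prod (fun q => tens4 f₁ g₁ f₂ g₂ (midSwap q) * cyc (decay T) (midSwap q))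
      (hm.comp (measurePreserving_midSwap (μ := μ)).measurable).aemeasurable]
  congr 1
  refine lintegral_congr fun p => ?_
  have e : ∀ w : G × G, tens4 f₁ g₁ f₂ g₂ (midSwap (p, w)) * cyc (decay T) (midSwap (p, w)) =
      f₁ p.1 * f₂ p.2 * ((g₁ w.1 * (decay T (w.1 - p.1) * decay T (p.2 - w.1))) *
        (g₂ w.2 * (decay T (w.2 - p.1) * decay T (p.2 - w.2)))) := fun w => by
    simp only [tens4, cyc, midSwap]
    rw [decay_sub_comm w.2 p.2, decay_sub_comm p.1 w.2]
    ring
  simp_rw [e]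
  rw [lintegral_const_mul _ (by fun_prop), decayTransform, decayTransform,
    ← lintegral_prod_mul (by fun_prop) (by fun_prop)]

lemma decayForm_rotate [SigmaFinite μ] :
    decayForm μ T f₁ g₁ f₂ g₂ = decayForm μ T g₁ f₂ g₂ f₁ := by
  have hm : Measurable fun q : G × G × G × G => tens4 g₁ f₂ g₂ f₁ q * cyc (decay T) q :=
    (measurable_tens4 hg₁ hf₂ hg₂ hf₁).mul (measurable_cyc measurable_decay)
  rw [decayForm, decayForm, ← (measurePreserving_rotate4 (μ := μ)).lintegral_comp hm]
  congr 1
  refine lintegral_congr fun q => ?_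
  simp only [tens4, cyc, rotate4]
  ring

lemma decayForm_sq_le [SigmaFinite μ] : decayForm μ T f₁ g₁ f₂ g₂ ^ 2 ≤
    decayForm μ T f₁ g₁ f₂ g₁ * decayForm μ T f₁ g₂ f₂ g₂ := by
  have m1 := measurable_decayTransform (μ := μ) T hg₁
  have m2 := measurable_decayTransform (μ := μ) T hg₂
  have mw : Measurable fun p : G × G => f₁ p.1 * f₂ p.2 := by fun_prop
  have e : ∀ F : G × G → ℝ≥0∞, Measurable F → ∫⁻ p, f₁ p.1 * f₂ p.2 * F p ∂(μ.prod μ) =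
      ∫⁻ p, F p ∂((μ.prod μ).withDensity fun p => f₁ p.1 * f₂ p.2) := fun F hF =>
    (lintegral_withDensity_eq_lintegral_mul _ mw hF).symm
  rw [decayForm_eq_transform hf₁ hg₁ hf₂ hg₂, decayForm_eq_transform hf₁ hg₁ hf₂ hg₁,
    decayForm_eq_transform hf₁ hg₂ hf₂ hg₂, 
    e (fun _ => _ * _) (m1.mul m2), e (fun _ => _ * _) (m1.mul m1), e (fun _ => _ * _) (m2.mul m2)]
  have := lintegral_mul_sq_le ((μ.prod μ).withDensity fun p => f₁ p.1 * f₂ p.2)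
    m1.aemeasurable m2.aemeasurable
  simp only [pow_two] at this ⊢
  calc _ = ofReal T ^ 3 * ofReal T ^ 3 * _ := mul_mul_mul_comm _ _ _ _
    _ ≤ ofReal T ^ 3 * ofReal T ^ 3 * _ := mul_le_mul_right this _
    _ = _ := (mul_mul_mul_comm _ _ _ _).symm

lemma decayForm_sq_le' [SigmaFinite μ] : decayForm μ T f₁ g₁ f₂ g₂ ^ 2 ≤
    decayForm μ T f₁ g₁ f₁ g₂ * decayForm μ T f₂ g₁ f₂ g₂ := by
  rw [decayForm_rotate hf₁ hg₁ hf₂ hg₂, decayForm_rotate hf₁ hg₁ hf₁ hg₂,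
    decayForm_rotate hf₂ hg₁ hf₂ hg₂, mul_comm]
  exact decayForm_sq_le hg₁ hf₂ hg₂ hf₁

end Majorant

lemma decayForm_mono {T : ℝ} {f₁ g₁ f₂ g₂ f₁' g₁' f₂' g₂' : G → ℝ≥0∞} (h₁ : f₁ ≤ f₁')
    (h₂ : g₁ ≤ g₁') (h₃ : f₂ ≤ f₂') (h₄ : g₂ ≤ g₂') :
    decayForm μ T f₁ g₁ f₂ g₂ ≤ decayForm μ T f₁' g₁' f₂' g₂' := by
  refine mul_le_mul_right (lintegral_mono fun q => mul_le_mul_left ?_ _) _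
  exact mul_le_mul' (mul_le_mul' (mul_le_mul' (h₁ _) (h₂ _)) (h₃ _)) (h₄ _)

/-! #### Identities for cyclic forms -/

section Identities

variable {H : G → ℂ} {b : ℝ} {f₁ g₁ f₂ g₂ : G → ℝ}

lemma integrable_tens4 [SigmaFinite μ] (hf₁ : Integrable f₁ μ) (hg₁ : Integrable g₁ μ)
    (hf₂ : Integrable f₂ μ) (hg₂ : Integrable g₂ μ) :
    Integrable (tens4 f₁ g₁ f₂ g₂) (μ.prod (μ.prod (μ.prod μ))) := by
  refine (hf₁.mul_prod (hg₁.mul_prod (hf₂.mul_prod hg₂))).congr (ae_of_all _ fun q => ?_)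
  simp only [tens4, mul_assoc]

lemma integrable_tens4_cyc [SigmaFinite μ] (hH : Measurable H) (hb : ∀ x, ‖H x‖ ≤ b)
    (hf₁ : Integrable f₁ μ) (hg₁ : Integrable g₁ μ)
    (hf₂ : Integrable f₂ μ) (hg₂ : Integrable g₂ μ) :
    Integrable (fun q => ((tens4 f₁ g₁ f₂ g₂ q : ℝ) : ℂ) * cyc H q) (μ.prod (μ.prod (μ.prod μ))) := by
  have hb0 : 0 ≤ b := (norm_nonneg _).trans (hb 0)
  refine (integrable_tens4 hf₁ hg₁ hf₂ hg₂).ofReal.mul_bdd (c := b * b * b * b)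
    (measurable_cyc hH).aestronglyMeasurable (ae_of_all _ fun q => ?_)
  simp only [cyc, norm_mul]
  gcongr <;> exact hb _

lemma cycForm_eq_conv4 (hH : Measurable H) (hb : ∀ x, ‖H x‖ ≤ b)
    (hf₁ : Integrable f₁ μ) (hg₁ : Integrable g₁ μ)
    (hf₂ : Integrable f₂ μ) (hg₂ : Integrable g₂ μ) :
    cycForm μ H f₁ g₁ f₂ g₂ = ∫ z, (conv4 μ f₁ g₁ f₂ g₂ z : ℂ) * edge H z ∂(μ.prod (μ.prod μ)) := by
  have hi := integrable_tens4_cyc hH hb hf₁ hg₁ hf₂ hg₂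
  have hmp := measurePreserving_diffMap (μ := μ)
  have h1 : cycForm μ H f₁ g₁ f₂ g₂ =
      ∫ q, ((tens4 f₁ g₁ f₂ g₂ (diffMap q) : ℝ) : ℂ) * cyc H (diffMap q)
        ∂(μ.prod (μ.prod (μ.prod μ))) := by
    have := integral_map (μ := μ.prod (μ.prod (μ.prod μ))) hmp.measurable.aemeasurable
      (f := fun q => ((tens4 f₁ g₁ f₂ g₂ q : ℝ) : ℂ) * cyc H q) (by rw [hmp.map_eq]; exact hi.1)
    rw [hmp.map_eq] at this
    exact this
  have hi2 : Integrable (fun q => ((tens4 f₁ g₁ f₂ g₂ (diffMap q) : ℝ) : ℂ) *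
      cyc H (diffMap q)) (μ.prod (μ.prod (μ.prod μ))) := hmp.integrable_comp_of_integrable hi
  rw [h1, integral_prod_symm _ hi2]
  refine integral_congr_ae (ae_of_all _ fun z => ?_)
  simp only [cyc_diffMap]
  rw [integral_mul_const, conv4, ← integral_complex_ofReal]
  rfl

lemma cycForm_eq_transform [SigmaFinite μ] (hH : Measurable H) (hb : ∀ x, ‖H x‖ ≤ b)
    (hc : ∀ x, conj (H x) = H (-x)) (hf₁ : Integrable f₁ μ) (hg₁ : Integrable g₁ μ)
    (hf₂ : Integrable f₂ μ) (hg₂ : Integrable g₂ μ) :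
    cycForm μ H f₁ g₁ f₂ g₂ = ∫ p, ((f₁ p.1 * f₂ p.2 : ℝ) : ℂ) *
      (transform μ H g₁ p.1 p.2 * conj (transform μ H g₂ p.1 p.2)) ∂(μ.prod μ) := by
  have hi := integrable_tens4_cyc hH hb hf₁ hg₁ hf₂ hg₂
  have hmp := measurePreserving_midSwap (μ := μ)
  have h1 : cycForm μ H f₁ g₁ f₂ g₂ =
      ∫ q, ((tens4 f₁ g₁ f₂ g₂ (midSwap q) : ℝ) : ℂ) * cyc H (midSwap q)
        ∂((μ.prod μ).prod (μ.prod μ)) := by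
    have := integral_map (μ := (μ.prod μ).prod (μ.prod μ)) hmp.measurable.aemeasurable
      (f := fun q => ((tens4 f₁ g₁ f₂ g₂ q : ℝ) : ℂ) * cyc H q) (by rw [hmp.map_eq]; exact hi.1)
    rw [hmp.map_eq] at this
    exact this
  have hi2 : Integrable (fun q => ((tens4 f₁ g₁ f₂ g₂ (midSwap q) : ℝ) : ℂ) *
      cyc H (midSwap q)) ((μ.prod μ).prod (μ.prod μ)) := hmp.integrable_comp_of_integrable hi
  rw [h1, integral_prod _ hi2]
  refine integral_congr_ae (ae_of_all _ fun p => ?_)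
  have e : ∀ w : G × G, ((tens4 f₁ g₁ f₂ g₂ (midSwap (p, w)) : ℝ) : ℂ) * cyc H (midSwap (p, w)) =
      ((f₁ p.1 * f₂ p.2 : ℝ) : ℂ) * (((g₁ w.1 : ℂ) * (H (w.1 - p.1) * H (p.2 - w.1))) *
        ((g₂ w.2 : ℂ) * (H (w.2 - p.2) * H (p.1 - w.2)))) := fun w => by
    simp only [tens4, cyc, midSwap]
    push_cast
    ring
  simp_rw [e]
  rw [integral_const_mul, conj_transform hc, transform, transform, ← integral_prod_mul]

end Identities

end Cyclic

section Group

variable {G : Type*} [NormedAddCommGroup G] [MeasurableSpace G] [BorelSpace G]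
  [SecondCountableTopology G] [LocallyCompactSpace G] {μ : Measure G} [μ.IsAddHaarMeasure]

/-! ### Limits of cyclic forms of bounded functions -/

section Bounded

/-- Translations are continuous in `L^p`. -/
lemma tendsto_eLpNorm_translate {p : ℝ≥0∞} (hp1 : 1 ≤ p) (hp : p ≠ ∞) {g : G → ℝ}
    (hg : MemLp g p μ) :
    Tendsto (fun x => eLpNorm (fun u => g (u - x) - g u) p μ) (𝓝 0) (𝓝 0) := by
  have : Fact (1 ≤ p) := ⟨hp1⟩
  set τ : C(G, C(G, G)) := (ContinuousMap.mk (fun a : G × G => a.2 - a.1) (by fun_prop)).curry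
  have hτ : ∀ x, MeasurePreserving (τ x) μ μ := fun x => measurePreserving_sub_right μ x
  have h := Filter.Tendsto.compMeasurePreservingLp (μ := μ) (ν := μ) (l := 𝓝 (0 : G))
    (f := fun _ => hg.toLp g) (g := τ) tendsto_const_nhds (τ.continuous.tendsto 0) hτ (hτ 0) hp
  simp only [Lp.toLp_compMeasurePreserving] at h
  rw [Lp.tendsto_Lp_iff_tendsto_eLpNorm''] at h
  refine h.congr fun x => eLpNorm_congr_ae (ae_of_all _ fun u => ?_)
  simp [τ]

lemma tendsto_lintegral_translate {g : G → ℝ} (hg : Integrable g μ) :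
    Tendsto (fun x => ∫⁻ u, ‖g (u - x) - g u‖ₑ ∂μ) (𝓝 0) (𝓝 0) := by
  have := tendsto_eLpNorm_translate le_rfl ENNReal.one_ne_top (memLp_one_iff_integrable.2 hg)
  simpa only [eLpNorm_one_eq_lintegral_enorm] using this

variable {f₁ g₁ f₂ g₂ : G → ℝ} {M : ℝ≥0}

lemma integrable_conv4 (hf₁m : Measurable f₁) (hf₂m : Measurable f₂) (hg₂m : Measurable g₂)
    (hf₁ : ∀ x, ‖f₁ x‖ ≤ M) (hf₂ : ∀ x, ‖f₂ x‖ ≤ M) (hg₂ : ∀ x, ‖g₂ x‖ ≤ M)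
    (hg₁ : Integrable g₁ μ) (z : G × G × G) :
    Integrable (fun u => f₁ u * g₁ (u - z.1) * f₂ (u - z.2.1) * g₂ (u - z.2.2)) μ := by
  have h := hg₁.comp_sub_right z.1
  refine ((h.bdd_mul (c := M) hf₁m.aestronglyMeasurable (ae_of_all _ hf₁)).mul_bdd (c := M)
    (hf₂m.comp (measurable_sub_const _)).aestronglyMeasurable (ae_of_all _ fun u => hf₂ _)).mul_bdd
    (c := M) (hg₂m.comp (measurable_sub_const _)).aestronglyMeasurable (ae_of_all _ fun u => hg₂ _)

lemma enorm_conv4_le (hf₁ : ∀ x, ‖f₁ x‖ ≤ M) (hf₂ : ∀ x, ‖f₂ x‖ ≤ M) (hg₂ : ∀ x, ‖g₂ x‖ ≤ M)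
    (g₁ : G → ℝ) (z : G × G × G) :
    ‖conv4 μ f₁ g₁ f₂ g₂ z‖ₑ ≤ M ^ 3 * ∫⁻ u, ‖g₁ u‖ₑ ∂μ := by
  have e : ∀ {f : G → ℝ}, (∀ x, ‖f x‖ ≤ M) → ∀ x, ‖f x‖ₑ ≤ M := fun h x => by
    rw [← ofReal_norm, ← ofReal_coe_nnreal]
    exact ofReal_le_ofReal (h x)
  refine (enorm_integral_le_lintegral_enorm _).trans ?_
  rw [← lintegral_sub_right_eq_self (fun u => ‖g₁ u‖ₑ) z.1,
    ← lintegral_const_mul' _ _ (pow_ne_top coe_ne_top)]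
  refine lintegral_mono fun u => ?_
  simp only [enorm_mul]
  calc _ ≤ (M : ℝ≥0∞) * ‖g₁ (u - z.1)‖ₑ * M * M := by
        gcongr
        exacts [e hf₁ _, e hf₂ _, e hg₂ _]
    _ = _ := by ring

lemma conv4_sub (hf₁m : Measurable f₁) (hf₂m : Measurable f₂) (hg₂m : Measurable g₂)
    (hf₁ : ∀ x, ‖f₁ x‖ ≤ M) (hf₂ : ∀ x, ‖f₂ x‖ ≤ M) (hg₂ : ∀ x, ‖g₂ x‖ ≤ M)
    {g g' : G → ℝ} (hg : Integrable g μ) (hg' : Integrable g' μ) (z : G × G × G) :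
    conv4 μ f₁ g f₂ g₂ z - conv4 μ f₁ g' f₂ g₂ z = conv4 μ f₁ (fun x => g x - g' x) f₂ g₂ z := by
  rw [conv4, conv4, ← integral_sub (integrable_conv4 hf₁m hf₂m hg₂m hf₁ hf₂ hg₂ hg z)
    (integrable_conv4 hf₁m hf₂m hg₂m hf₁ hf₂ hg₂ hg' z)]
  refine integral_congr_ae (ae_of_all _ fun u => ?_)
  simp only; ring

lemma continuousAt_conv4_of_bounded (hf₁m : Measurable f₁) (hf₂m : Measurable f₂)
    (hg₂m : Measurable g₂) (hf₁ : ∀ x, ‖f₁ x‖ ≤ M)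
    (hf₂ : ∀ x, ‖f₂ x‖ ≤ M) (hg₂ : ∀ x, ‖g₂ x‖ ≤ M) (hg₁ : ∀ x, ‖g₁ x‖ ≤ M)
    (hg₁i : Integrable g₁ μ) (hf₂i : Integrable f₂ μ) (hg₂i : Integrable g₂ μ) :
    ContinuousAt (conv4 μ f₁ g₁ f₂ g₂) 0 := by
  have e : ∀ {f : G → ℝ}, (∀ x, ‖f x‖ ≤ M) → ∀ x, ‖f x‖ₑ ≤ M := fun h x => by
    rw [← ofReal_norm, ← ofReal_coe_nnreal]
    exact ofReal_le_ofReal (h x)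
  have hint := integrable_conv4 hf₁m hf₂m hg₂m hf₁ hf₂ hg₂ hg₁i
  rw [ContinuousAt, ← tendsto_sub_nhds_zero_iff, tendsto_zero_iff_enorm_tendsto_zero]
  have t1 := (tendsto_lintegral_translate hg₁i).comp
    (continuous_fst.tendsto (0 : G × G × G))
  have t2 := (tendsto_lintegral_translate hf₂i).comp
    ((continuous_fst.comp continuous_snd).tendsto (0 : G × G × G))
  have t3 := (tendsto_lintegral_translate hg₂i).comp
    ((continuous_snd.comp continuous_snd).tendsto (0 : G × G × G))
  have t := ENNReal.Tendsto.const_mul (a := (M : ℝ≥0∞) ^ 3) ((t1.add t2).add t3)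
    (Or.inr (pow_ne_top coe_ne_top))
  simp only [add_zero, mul_zero] at t
  refine tendsto_of_tendsto_of_tendsto_of_le_of_le tendsto_const_nhds t (fun n => bot_le)
    fun z => ?_
  have mt : ∀ {g : G → ℝ}, Integrable g μ → ∀ x : G,
      AEMeasurable (fun u => ‖g (u - x) - g u‖ₑ) μ := fun hg x =>
    ((hg.comp_sub_right x).1.sub hg.1).enorm
  have e1 : conv4 μ f₁ g₁ f₂ g₂ z - conv4 μ f₁ g₁ f₂ g₂ 0 =
      ∫ u, (f₁ u * g₁ (u - z.1) * f₂ (u - z.2.1) * g₂ (u - z.2.2) -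
        f₁ u * g₁ u * f₂ u * g₂ u) ∂μ := by
    rw [integral_sub (hint z) (by simpa using hint 0)]
    simp [conv4]
  rw [e1]
  refine (enorm_integral_le_lintegral_enorm _).trans ?_
  simp only [Function.comp]
  rw [← lintegral_add_left' (mt hg₁i _), ← lintegral_add_left'
    (f := fun u => ‖g₁ (u - z.1) - g₁ u‖ₑ + ‖f₂ (u - z.2.1) - f₂ u‖ₑ)
    ((mt hg₁i _).add (mt hf₂i _)), ← lintegral_const_mul' _ _ (pow_ne_top coe_ne_top)]
  refine lintegral_mono fun u => ?_
  dsimp only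
  rw [show f₁ u * g₁ (u - z.1) * f₂ (u - z.2.1) * g₂ (u - z.2.2) - f₁ u * g₁ u * f₂ u * g₂ u =
    f₁ u * (g₁ (u - z.1) - g₁ u) * f₂ (u - z.2.1) * g₂ (u - z.2.2) +
    f₁ u * g₁ u * (f₂ (u - z.2.1) - f₂ u) * g₂ (u - z.2.2) +
    f₁ u * g₁ u * f₂ u * (g₂ (u - z.2.2) - g₂ u) by ring]
  refine (enorm_add_le _ _).trans ((add_le_add_left (enorm_add_le _ _) _).trans ?_)
  simp only [enorm_mul]
  calc _ ≤ (M : ℝ≥0∞) * ‖g₁ (u - z.1) - g₁ u‖ₑ * M * M +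
        M * M * ‖f₂ (u - z.2.1) - f₂ u‖ₑ * M + M * M * M * ‖g₂ (u - z.2.2) - g₂ u‖ₑ := by
        gcongr
        exacts [e hf₁ _, e hf₂ _, e hg₂ _, e hf₁ _, e hg₁ _, e hg₂ _, e hf₁ _, e hg₁ _, e hf₂ _]
    _ = _ := by ring

/-- Truncation of a function at level `k`. -/
def trunc (k : ℝ) (g : G → ℝ) (x : G) : ℝ := if |g x| ≤ k then g x else 0

lemma measurable_trunc {g : G → ℝ} (hg : Measurable g) (k : ℝ) : Measurable (trunc k g) :=
  Measurable.ite (measurableSet_le hg.abs measurable_const) hg measurable_const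

lemma norm_trunc_le {k : ℝ} (hk : 0 ≤ k) (g : G → ℝ) (x : G) : ‖trunc k g x‖ ≤ k := by
  unfold trunc
  split_ifs with h
  · exact h
  · simpa using hk

lemma abs_trunc_le (k : ℝ) (g : G → ℝ) (x : G) : |trunc k g x| ≤ |g x| := by
  unfold trunc; split_ifs <;> simp

lemma trunc_eq {k : ℝ} {g : G → ℝ} {x : G} (h : |g x| ≤ k) : trunc k g x = g x := if_pos h

lemma integrable_trunc {g : G → ℝ} (hgm : Measurable g) (hg : Integrable g μ) (k : ℝ) :
    Integrable (trunc k g) μ :=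
  hg.mono (measurable_trunc hgm k).aestronglyMeasurable (ae_of_all _ fun x => abs_trunc_le k g x)

lemma tendsto_lintegral_sub_trunc {g : G → ℝ} (hgm : Measurable g) (hg : Integrable g μ) :
    Tendsto (fun k : ℕ => ∫⁻ x, ‖g x - trunc k g x‖ₑ ∂μ) atTop (𝓝 0) := by
  have := tendsto_lintegral_of_dominated_convergence (μ := μ)
    (F := fun (k : ℕ) x => ‖g x - trunc k g x‖ₑ) (f := fun _ => 0) (fun x => ‖g x‖ₑ)
    (fun k => (hgm.sub (measurable_trunc hgm k)).enorm) (fun k => ae_of_all _ fun x => ?_)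
    hg.2.ne (ae_of_all _ fun x => ?_)
  · simpa using this
  · simp only [trunc]; split_ifs <;> simp
  · obtain ⟨k0, hk0⟩ := exists_nat_ge |g x|
    refine tendsto_const_nhds.congr' ?_
    filter_upwards [eventually_ge_atTop k0] with k hk
    rw [trunc_eq (hk0.trans (by exact_mod_cast hk))]
    simp

lemma continuousAt_conv4 (hf₁m : Measurable f₁) (hg₁m : Measurable g₁) (hf₂m : Measurable f₂)
    (hg₂m : Measurable g₂) (hf₁ : ∀ x, ‖f₁ x‖ ≤ M) (hf₂ : ∀ x, ‖f₂ x‖ ≤ M)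
    (hg₂ : ∀ x, ‖g₂ x‖ ≤ M) (hg₁i : Integrable g₁ μ) (hf₂i : Integrable f₂ μ)
    (hg₂i : Integrable g₂ μ) : ContinuousAt (conv4 μ f₁ g₁ f₂ g₂) 0 := by
  have h1 := tendsto_lintegral_sub_trunc (μ := μ) hg₁m hg₁i
  have h2 := ENNReal.Tendsto.const_mul (a := (M : ℝ≥0∞) ^ 3) h1
    (Or.inr (pow_ne_top coe_ne_top))
  rw [mul_zero] at h2
  refine continuousAt_of_locally_uniform_approx_of_continuousAt fun V hV => ?_
  obtain ⟨ε, hε, hεV⟩ := Metric.mem_uniformity_dist.1 hV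
  obtain ⟨k, hk⟩ := ((tendsto_order.1 h2).2 (ofReal ε) (by simpa using hε)).exists
  refine ⟨univ, univ_mem, conv4 μ f₁ (trunc k g₁) f₂ g₂, ?_, fun z _ => hεV ?_⟩
  · have hk' : ∀ x, ‖trunc k g₁ x‖ ≤ (max M k : ℝ≥0) := fun x => by
      refine (norm_trunc_le (Nat.cast_nonneg k) g₁ x).trans ?_
      push_cast
      exact le_max_right _ _
    have hM : (M : ℝ) ≤ (max M k : ℝ≥0) := by push_cast; exact le_max_left _ _
    exact continuousAt_conv4_of_bounded hf₁m hf₂m hg₂m (fun x => (hf₁ x).trans hM)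
      (fun x => (hf₂ x).trans hM) (fun x => (hg₂ x).trans hM) hk' (integrable_trunc hg₁m hg₁i k)
      hf₂i hg₂i
  · rw [dist_eq_norm, conv4_sub hf₁m hf₂m hg₂m hf₁ hf₂ hg₂ hg₁i (integrable_trunc hg₁m hg₁i k)]
    have := (enorm_conv4_le (μ := μ) hf₁ hf₂ hg₂ (fun x => g₁ x - trunc k g₁ x) z).trans_lt hk
    rw [← ofReal_norm] at this
    exact (ENNReal.ofReal_lt_ofReal_iff hε).1 this

variable {T : ℕ → ℝ} {H : ℕ → G → ℂ} {C : ℝ≥0} {c : ℝ}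

lemma TaperedKernels.norm_le (h : TaperedKernels μ T H C c) (n : ℕ) (x : G) :
    ‖H n x‖ ≤ C * T n := by
  have h1 := (h.bound n x).trans (mul_le_mul_right (decay_le_one x) _)
  rw [mul_one, ← ofReal_norm, ← ofReal_coe_nnreal, ← ofReal_mul C.coe_nonneg] at h1
  exact (ENNReal.ofReal_le_ofReal_iff (mul_nonneg C.coe_nonneg (h.T_pos n).le)).1 h1

/-- The normalized cyclic forms. -/
def normForm (μ : Measure G) (T : ℕ → ℝ) (H : ℕ → G → ℂ) (n : ℕ)
    (f₁ g₁ f₂ g₂ : G → ℝ) : ℂ := (T n : ℂ)⁻¹ * cycForm μ (H n) f₁ g₁ f₂ g₂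

lemma TaperedKernels.tendsto_normForm_of_conv4 (h : TaperedKernels μ T H C c)
    (hf₁m : Measurable f₁) (hg₁m : Measurable g₁) (hf₂m : Measurable f₂) (hg₂m : Measurable g₂)
    (hf₁i : Integrable f₁ μ) (hg₁i : Integrable g₁ μ) (hf₂i : Integrable f₂ μ)
    (hg₂i : Integrable g₂ μ) (hc : ContinuousAt (conv4 μ f₁ g₁ f₂ g₂) 0)
    (hfar : ∀ δ > 0, Tendsto (fun n => ∫⁻ z in {z | δ ≤ ‖z‖}, ‖conv4 μ f₁ g₁ f₂ g₂ z‖ₑ *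
      weight (T n) z ∂μ.prod (μ.prod μ)) atTop (𝓝 0)) :
    Tendsto (fun n => normForm μ T H n f₁ g₁ f₂ g₂) atTop
      (𝓝 ((c * ∫ u, f₁ u * g₁ u * f₂ u * g₂ u ∂μ : ℝ) : ℂ)) := by
  have h1 := h.tendsto_integral_mul_edge
    (measurable_conv4 hf₁m hg₁m hf₂m hg₂m).aestronglyMeasurable hc hfar
  have e : conv4 μ f₁ g₁ f₂ g₂ 0 = ∫ u, f₁ u * g₁ u * f₂ u * g₂ u ∂μ := by simp [conv4]
  rw [e] at h1
  refine h1.congr fun n => ?_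
  rw [normForm, cycForm_eq_conv4 (h.meas n) (h.norm_le n) hf₁i hg₁i hf₂i hg₂i]

/-- Three bounded functions and one integrable function. -/
lemma TaperedKernels.tendsto_normForm (h : TaperedKernels μ T H C c)
    (hf₁m : Measurable f₁) (hg₁m : Measurable g₁) (hf₂m : Measurable f₂) (hg₂m : Measurable g₂)
    (hf₁i : Integrable f₁ μ) (hg₁i : Integrable g₁ μ) (hf₂i : Integrable f₂ μ)
    (hg₂i : Integrable g₂ μ) (hf₁ : ∀ x, ‖f₁ x‖ ≤ M) (hf₂ : ∀ x, ‖f₂ x‖ ≤ M)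
    (hg₂ : ∀ x, ‖g₂ x‖ ≤ M) :
    Tendsto (fun n => normForm μ T H n f₁ g₁ f₂ g₂) atTop
      (𝓝 ((c * ∫ u, f₁ u * g₁ u * f₂ u * g₂ u ∂μ : ℝ) : ℂ)) := by
  refine h.tendsto_normForm_of_conv4 hf₁m hg₁m hf₂m hg₂m hf₁i hg₁i hf₂i hg₂i
    (continuousAt_conv4 hf₁m hg₁m hf₂m hg₂m hf₁ hf₂ hg₂ hg₁i hf₂i hg₂i) fun δ hδ => ?_
  exact h.tendsto_bounded_far (mul_ne_top (pow_ne_top coe_ne_top) hg₁i.2.ne)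
    (enorm_conv4_le hf₁ hf₂ hg₂ g₁) hδ

lemma TaperedKernels.enorm_normForm_sub_le (h : TaperedKernels μ T H C c) (n : ℕ)
    {f₁' g₁' f₂' g₂' : G → ℝ} (hf₁i : Integrable f₁ μ) (hg₁i : Integrable g₁ μ)
    (hf₂i : Integrable f₂ μ) (hg₂i : Integrable g₂ μ) (hf₁i' : Integrable f₁' μ)
    (hg₁i' : Integrable g₁' μ) (hf₂i' : Integrable f₂' μ) (hg₂i' : Integrable g₂' μ) :
    ‖normForm μ T H n f₁ g₁ f₂ g₂ - normForm μ T H n f₁' g₁' f₂' g₂'‖ₑ ≤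
      C ^ 4 * (ofReal (T n) ^ 3 * ∫⁻ q, ‖tens4 f₁ g₁ f₂ g₂ q - tens4 f₁' g₁' f₂' g₂' q‖ₑ *
        cyc (decay (T n)) q ∂(μ.prod (μ.prod (μ.prod μ)))) := by
  have hT : (T n : ℂ) ≠ 0 := by exact_mod_cast (h.T_pos n).ne'
  rw [normForm, normForm, ← mul_sub, cycForm, cycForm, ← integral_sub
    (integrable_tens4_cyc (h.meas n) (h.norm_le n) hf₁i hg₁i hf₂i hg₂i)
    (integrable_tens4_cyc (h.meas n) (h.norm_le n) hf₁i' hg₁i' hf₂i' hg₂i'), enorm_mul,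
    enorm_inv hT, enorm_complex_ofReal, Real.enorm_eq_ofReal (h.T_pos n).le]
  have hle : ∀ q : G × G × G × G, ‖((tens4 f₁ g₁ f₂ g₂ q : ℝ) : ℂ) * cyc (H n) q -
      ((tens4 f₁' g₁' f₂' g₂' q : ℝ) : ℂ) * cyc (H n) q‖ₑ ≤
      C ^ 4 * ofReal (T n) ^ 4 * (‖tens4 f₁ g₁ f₂ g₂ q - tens4 f₁' g₁' f₂' g₂' q‖ₑ *
        cyc (decay (T n)) q) := by
    intro q
    rw [← sub_mul, enorm_mul, ← Complex.ofReal_sub, enorm_complex_ofReal]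
    simp only [cyc, enorm_mul]
    calc _ ≤ _ := mul_le_mul_right (mul_le_mul' (mul_le_mul' (mul_le_mul' (h.bound n _)
          (h.bound n _)) (h.bound n _)) (h.bound n _)) _
      _ = _ := by ring
  calc _ ≤ (ofReal (T n))⁻¹ * (C ^ 4 * ofReal (T n) ^ 4 *
        ∫⁻ q, ‖tens4 f₁ g₁ f₂ g₂ q - tens4 f₁' g₁' f₂' g₂' q‖ₑ *
        cyc (decay (T n)) q ∂(μ.prod (μ.prod (μ.prod μ)))) := by
        refine mul_le_mul_right ((enorm_integral_le_lintegral_enorm _).trans ?_) _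
        rw [← lintegral_const_mul' _ _ (mul_ne_top (pow_ne_top coe_ne_top)
          (pow_ne_top ofReal_ne_top))]
        exact lintegral_mono hle
    _ = C ^ 4 * (ofReal (T n) ^ 3 * ∫⁻ q, ‖tens4 f₁ g₁ f₂ g₂ q - tens4 f₁' g₁' f₂' g₂' q‖ₑ *
        cyc (decay (T n)) q ∂(μ.prod (μ.prod (μ.prod μ)))) *
          (ofReal (T n) * (ofReal (T n))⁻¹) := by ring
    _ = _ := by rw [ENNReal.mul_inv_cancel (by simpa using h.T_pos n) (by simp), mul_one]

end Bounded

/-! ### Hilbert-Schmidt norms of integral kernels -/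

section HilbertSchmidt

variable {S : Type*} [MeasurableSpace S] {ν : Measure S} [IsFiniteMeasure ν]

variable (ν) in
/-- The square of the Hilbert-Schmidt norm of an integral kernel. -/
def hsq (K : S → S → ℂ) : ℝ≥0∞ := ∫⁻ p, ‖K p.1 p.2‖ₑ ^ 2 ∂(ν.prod ν)

lemma hsq_mcomp_le {K L : S → S → ℂ} {a b : ℝ} (hK : BddKernel K a) (hL : BddKernel L b) :
    hsq ν (mcomp ν K L) ≤ hsq ν K * hsq ν L := by
  have mK : Measurable fun p : S × S => ‖K p.1 p.2‖ₑ ^ 2 := hK.meas.enorm.pow_const 2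
  have mL : Measurable fun p : S × S => ‖L p.2 p.1‖ₑ ^ 2 :=
    (hL.meas.comp measurable_swap).enorm.pow_const 2
  calc hsq ν (mcomp ν K L) ≤ ∫⁻ p, (∫⁻ z, ‖K p.1 z‖ₑ ^ 2 ∂ν) * (∫⁻ z, ‖L z p.2‖ₑ ^ 2 ∂ν)
        ∂(ν.prod ν) := by
        refine lintegral_mono fun p => ?_
        refine le_trans ?_ (lintegral_mul_sq_le ν (f := fun z => ‖K p.1 z‖ₑ)
          (g := fun z => ‖L z p.2‖ₑ) (hK.meas.comp measurable_prodMk_left).enorm.aemeasurable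
          (hL.meas.comp measurable_prodMk_right).enorm.aemeasurable)
        refine pow_le_pow_left' ((enorm_integral_le_lintegral_enorm _).trans (le_of_eq ?_)) 2
        simp only [enorm_mul]
    _ = (∫⁻ x, ∫⁻ z, ‖K x z‖ₑ ^ 2 ∂ν ∂ν) * ∫⁻ y, ∫⁻ z, ‖L z y‖ₑ ^ 2 ∂ν ∂ν :=
        lintegral_prod_mul mK.lintegral_prod_right'.aemeasurable
          mL.lintegral_prod_right'.aemeasurable
    _ = _ := by
        rw [hsq, hsq, lintegral_prod _ mK.aemeasurable,
          lintegral_prod_symm _ (hL.meas.enorm.pow_const 2).aemeasurable]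

lemma hsq_mcomp_le_of_schur {N L : S → S → ℂ} {a b : ℝ} {B : ℝ≥0∞} (hN : BddKernel N a)
    (hL : BddKernel L b) (h1 : ∀ x, ∫⁻ z, ‖N x z‖ₑ ∂ν ≤ B) (h2 : ∀ z, ∫⁻ x, ‖N x z‖ₑ ∂ν ≤ B) :
    hsq ν (mcomp ν N L) ≤ B ^ 2 * hsq ν L := by
  have mN : Measurable fun p : S × S => ‖N p.1 p.2‖ₑ := hN.meas.enorm
  have mL : Measurable fun p : S × S => ‖L p.1 p.2‖ₑ ^ 2 := hL.meas.enorm.pow_const 2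
  have hpt : ∀ x y, ‖mcomp ν N L x y‖ₑ ^ 2 ≤ B * ∫⁻ z, ‖N x z‖ₑ * ‖L z y‖ₑ ^ 2 ∂ν := by
    intro x y
    have mx : Measurable fun z => ‖N x z‖ₑ := mN.comp measurable_prodMk_left
    have my : Measurable fun z => ‖L z y‖ₑ := hL.meas.enorm.comp measurable_prodMk_right
    have hcs := lintegral_mul_sq_le (ν.withDensity fun z => ‖N x z‖ₑ) (f := 1)
      (g := fun z => ‖L z y‖ₑ) aemeasurable_const my.aemeasurable
    simp only [Pi.one_apply, one_mul, one_pow, lintegral_const, withDensity_apply _ .univ,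
      Measure.restrict_univ] at hcs
    rw [lintegral_withDensity_eq_lintegral_mul _ mx my,
      lintegral_withDensity_eq_lintegral_mul _ mx (my.pow_const 2)] at hcs
    refine (pow_le_pow_left' ((enorm_integral_le_lintegral_enorm _).trans (le_of_eq ?_)) 2).trans
      (hcs.trans (mul_le_mul_left (h1 x) _))
    simp only [enorm_mul, Pi.mul_apply]
  have m3 : Measurable fun q : (S × S) × S => ‖N q.1.1 q.2‖ₑ * ‖L q.2 q.1.2‖ₑ ^ 2 :=
    (mN.comp (by fun_prop : Measurable fun q : (S × S) × S => (q.1.1, q.2))).mul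
      (mL.comp (by fun_prop : Measurable fun q : (S × S) × S => (q.2, q.1.2)))
  calc hsq ν (mcomp ν N L) ≤ ∫⁻ p, B * ∫⁻ z, ‖N p.1 z‖ₑ * ‖L z p.2‖ₑ ^ 2 ∂ν ∂(ν.prod ν) :=
        lintegral_mono fun p => hpt p.1 p.2
    _ = B * ∫⁻ y, ∫⁻ x, ∫⁻ z, ‖N x z‖ₑ * ‖L z y‖ₑ ^ 2 ∂ν ∂ν ∂ν := by
        rw [lintegral_const_mul _ m3.lintegral_prod_right',
          lintegral_prod_symm _ m3.lintegral_prod_right'.aemeasurable]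
    _ ≤ B * ∫⁻ y, B * ∫⁻ z, ‖L z y‖ₑ ^ 2 ∂ν ∂ν := by
        refine mul_le_mul_right (lintegral_mono fun y => ?_) _
        dsimp only
        have m4 : Measurable fun p : S × S => ‖N p.1 p.2‖ₑ * ‖L p.2 y‖ₑ ^ 2 :=
          m3.comp (by fun_prop : Measurable fun p : S × S => ((p.1, y), p.2))
        rw [lintegral_lintegral_swap (f := fun x z => ‖N x z‖ₑ * ‖L z y‖ₑ ^ 2) m4.aemeasurable,
          ← lintegral_const_mul (f := fun z => ‖L z y‖ₑ ^ 2) _ (mL.comp measurable_prodMk_right)]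
        refine lintegral_mono fun z => ?_
        dsimp only
        rw [lintegral_mul_const (f := fun x => ‖N x z‖ₑ) _ (mN.comp measurable_prodMk_right)]
        exact mul_le_mul_left (h2 z) _
    _ = B ^ 2 * hsq ν L := by
        have mL' : Measurable fun y => ∫⁻ z, ‖L z y‖ₑ ^ 2 ∂ν := mL.lintegral_prod_left'
        rw [lintegral_const_mul _ mL', hsq, lintegral_prod_symm _ mL.aemeasurable]
        ring

lemma hsq_mcomp_self_le {K N E : S → S → ℂ} {a b d : ℝ} {B : ℝ≥0∞} (hK : BddKernel K a)
    (hN : BddKernel N b) (hE : BddKernel E d) (hKNE : ∀ x y, K x y = N x y + E x y)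
    (h1 : ∀ x, ∫⁻ z, ‖N x z‖ₑ ∂ν ≤ B) (h2 : ∀ z, ∫⁻ x, ‖N x z‖ₑ ∂ν ≤ B) :
    hsq ν (mcomp ν K K) ≤ 2 * (B ^ 2 + hsq ν E) * hsq ν K := by
  have hsplit : ∀ x y, mcomp ν K K x y = mcomp ν N K x y + mcomp ν E K x y := by
    intro x y
    have hi : ∀ {F : S → S → ℂ} {m : ℝ}, BddKernel F m →
        Integrable (fun z => F x z * K z y) ν := by
      intro F m hF
      refine (integrable_const (m * a)).mono' ((hF.meas.comp measurable_prodMk_left).mul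
        (hK.meas.comp measurable_prodMk_right)).aestronglyMeasurable (ae_of_all _ fun z => ?_)
      rw [norm_mul]
      exact mul_le_mul (hF.bound _ _) (hK.bound _ _) (norm_nonneg _)
        ((norm_nonneg _).trans (hF.bound x z))
    rw [mcomp, mcomp, mcomp, ← integral_add (hi hN) (hi hE)]
    refine integral_congr_ae (ae_of_all _ fun z => ?_)
    simp only [hKNE x z]; ring
  have hadd : ∀ s t : ℝ≥0∞, (s + t) ^ 2 ≤ 2 * s ^ 2 + 2 * t ^ 2 := fun s t => by
    have := ENNReal.rpow_add_le_mul_rpow_add_rpow s t (p := 2) (by norm_num)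
    norm_num at this
    rwa [mul_add] at this
  have mNK : Measurable fun p : S × S => mcomp ν N K p.1 p.2 :=
    (BddKernel.comp (τ := ν) (b := |b|) ⟨hN.meas, fun t s => (hN.bound t s).trans (le_abs_self b)⟩
      hK (abs_nonneg b)).meas
  calc hsq ν (mcomp ν K K) ≤ ∫⁻ p, (2 * ‖mcomp ν N K p.1 p.2‖ₑ ^ 2 +
        2 * ‖mcomp ν E K p.1 p.2‖ₑ ^ 2) ∂(ν.prod ν) := by
        refine lintegral_mono fun p => ?_
        rw [hsplit]
        exact (pow_le_pow_left' (enorm_add_le _ _) 2).trans (hadd _ _)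
    _ = 2 * hsq ν (mcomp ν N K) + 2 * hsq ν (mcomp ν E K) := by
        rw [lintegral_add_left ((mNK.enorm.pow_const 2).const_mul 2), lintegral_const_mul' _ _
          (by norm_num), lintegral_const_mul' _ _ (by norm_num)]
        rfl
    _ ≤ 2 * (B ^ 2 * hsq ν K) + 2 * (hsq ν E * hsq ν K) := by
        gcongr
        · exact hsq_mcomp_le_of_schur hN hK h1 h2
        · exact hsq_mcomp_le hE hK
    _ = _ := by ring

end HilbertSchmidt

/-! ### Energies and truncation -/

section Energy

/-- The finite measure with density `f`. -/
def densityMeasure (μ : Measure G) (f : G → ℝ) : Measure G :=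
  μ.withDensity fun x => ofReal (f x)

lemma isFiniteMeasure_densityMeasure {f : G → ℝ} (hf : Integrable f μ) :
    IsFiniteMeasure (densityMeasure μ f) :=
  isFiniteMeasure_withDensity_ofReal hf.2

lemma lintegral_densityMeasure_prod {f : G → ℝ} (hfm : Measurable f) (hf0 : ∀ x, 0 ≤ f x)
    (hf : Integrable f μ) {F : G × G → ℝ≥0∞} (hF : Measurable F) :
    ∫⁻ p, F p ∂(densityMeasure μ f).prod (densityMeasure μ f) =
      ∫⁻ p, ofReal (f p.1 * f p.2) * F p ∂(μ.prod μ) := by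
  have := isFiniteMeasure_densityMeasure hf
  rw [densityMeasure, prod_withDensity (hfm.ennreal_ofReal) (hfm.ennreal_ofReal),
    lintegral_withDensity_eq_lintegral_mul _ (by fun_prop) hF]
  refine lintegral_congr fun p => ?_
  rw [Pi.mul_apply, ofReal_mul (hf0 _)]

/-- The normalized energy `T⁻¹ ∫∫ f₁(x) f₂(y) |D(x, y)|²`. -/
def energy (μ : Measure G) (T : ℕ → ℝ) (H : ℕ → G → ℂ) (n : ℕ) (f g : G → ℝ) : ℝ :=
  (T n)⁻¹ * ∫ p, f p.1 * f p.2 * ‖transform μ (H n) g p.1 p.2‖ ^ 2 ∂(μ.prod μ)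

/-- The indicator function of `|f| ≤ k`. -/
def cut (k : ℝ) (f : G → ℝ) (x : G) : ℝ := if |f x| ≤ k then 1 else 0

lemma mul_cut (k : ℝ) (f : G → ℝ) (x : G) : f x * cut k f x = trunc k f x := by
  simp [cut, trunc]

lemma cut_mul_cut (k : ℝ) (f : G → ℝ) (x : G) : cut k f x * cut k f x = cut k f x := by
  simp [cut]

lemma measurable_cut {f : G → ℝ} (hf : Measurable f) (k : ℝ) : Measurable (cut k f) :=
  Measurable.ite (measurableSet_le hf.abs measurable_const) measurable_const measurable_const

lemma cut_nonneg (k : ℝ) (f : G → ℝ) (x : G) : 0 ≤ cut k f x := by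
  unfold cut; split_ifs <;> norm_num

lemma cut_le_one (k : ℝ) (f : G → ℝ) (x : G) : cut k f x ≤ 1 := by
  unfold cut; split_ifs <;> norm_num

/-- The truncated kernel. -/
def cutKernel (μ : Measure G) (H : G → ℂ) (k : ℝ) (f g : G → ℝ) (x y : G) : ℂ :=
  ((cut k f x * cut k f y : ℝ) : ℂ) * transform μ H (trunc k g) x y

variable {T : ℕ → ℝ} {H : ℕ → G → ℂ} {C : ℝ≥0} {c : ℝ} {f g : G → ℝ}

lemma bddKernel_transform (h : TaperedKernels μ T H C c) (n : ℕ) (hgm : Measurable g)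
    (hg : Integrable g μ) :
    BddKernel (transform μ (H n) g) ((∫ u, |g u| ∂μ) * ((C * T n) * (C * T n))) :=
  ⟨measurable_transform (h.meas n) hgm, norm_transform_le (h.norm_le n) hg⟩

lemma bddKernel_cutKernel (h : TaperedKernels μ T H C c) (n : ℕ) (k : ℝ) (hfm : Measurable f)
    (hgm : Measurable g) (hg : Integrable g μ) : BddKernel (cutKernel μ (H n) k f g)
      ((∫ u, |trunc k g u| ∂μ) * ((C * T n) * (C * T n))) := by
  have hb := bddKernel_transform h n (measurable_trunc hgm k) (integrable_trunc hgm hg k)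
  have hc := measurable_cut hfm k
  refine ⟨?_, fun x y => ?_⟩
  · have : Measurable fun p : G × G => cut k f p.1 * cut k f p.2 := by fun_prop
    exact (Complex.measurable_ofReal.comp this).mul hb.meas
  · rw [cutKernel, norm_mul, Complex.norm_real, Real.norm_eq_abs,
      abs_of_nonneg (mul_nonneg (cut_nonneg _ _ _) (cut_nonneg _ _ _))]
    calc _ ≤ 1 * ‖transform μ (H n) (trunc k g) x y‖ := by
          gcongr
          exact mul_le_one₀ (cut_le_one _ _ _) (cut_nonneg _ _ _) (cut_le_one _ _ _)
      _ ≤ _ := by rw [one_mul]; exact hb.bound x y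

lemma integrable_mul_kernel {f₁ f₂ : G → ℝ} (hf₁ : Integrable f₁ μ) (hf₂ : Integrable f₂ μ)
    {F : G × G → ℂ} (hF : Measurable F) {b : ℝ} (hb : ∀ p, ‖F p‖ ≤ b) :
    Integrable (fun p : G × G => ((f₁ p.1 * f₂ p.2 : ℝ) : ℂ) * F p) (μ.prod μ) :=
  (hf₁.mul_prod hf₂).ofReal.mul_bdd hF.aestronglyMeasurable (ae_of_all _ hb)

lemma normForm_self (h : TaperedKernels μ T H C c) (n : ℕ) (hf : Integrable f μ)
    (hg : Integrable g μ) : normForm μ T H n f g f g = (energy μ T H n f g : ℂ) := by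
  rw [normForm, cycForm_eq_transform (h.meas n) (h.norm_le n) (h.conj_eq n) hf hg hf hg, energy]
  push_cast
  rw [← integral_complex_ofReal]
  congr 1
  refine integral_congr_ae (ae_of_all _ fun p => ?_)
  simp only [Complex.mul_conj, Complex.normSq_eq_norm_sq]
  push_cast
  ring

/-- The energy of the truncation error. -/
lemma energy_sub_cutKernel (h : TaperedKernels μ T H C c) (n : ℕ) (k : ℝ) (hfm : Measurable f)
    (hgm : Measurable g) (hf : Integrable f μ) (hg : Integrable g μ) :
    (T n)⁻¹ * ∫ p, f p.1 * f p.2 * ‖transform μ (H n) g p.1 p.2 -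
        cutKernel μ (H n) k f g p.1 p.2‖ ^ 2 ∂(μ.prod μ) = energy μ T H n f g -
        2 * (normForm μ T H n (trunc k f) g (trunc k f) (trunc k g)).re +
        energy μ T H n (trunc k f) (trunc k g) := by
  have hfk := integrable_trunc hfm hf k
  have hgk := integrable_trunc hgm hg k
  have b1 := bddKernel_transform h n hgm hg
  have b2 := bddKernel_transform h n (measurable_trunc hgm k) hgk
  set D := transform μ (H n) g with hD
  set D' := transform μ (H n) (trunc k g) with hD'
  set b := (∫ u, |g u| ∂μ) * ((C * T n) * (C * T n))
  set b' := (∫ u, |trunc k g u| ∂μ) * ((C * T n) * (C * T n))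
  have hb0 : 0 ≤ b := (norm_nonneg _).trans (b1.bound 0 0)
  have hb0' : 0 ≤ b' := (norm_nonneg _).trans (b2.bound 0 0)
  have i1 : Integrable (fun p : G × G => f p.1 * f p.2 * ‖D p.1 p.2‖ ^ 2) (μ.prod μ) := by
    refine (hf.mul_prod hf).mul_bdd (c := b ^ 2) (b1.meas.norm.pow_const 2).aestronglyMeasurable
      (ae_of_all _ fun p => ?_)
    rw [Real.norm_of_nonneg (by positivity)]
    exact pow_le_pow_left₀ (norm_nonneg _) (b1.bound _ _) 2
  have i3 : Integrable (fun p : G × G => trunc k f p.1 * trunc k f p.2 * ‖D' p.1 p.2‖ ^ 2)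
      (μ.prod μ) := by
    refine (hfk.mul_prod hfk).mul_bdd (c := b' ^ 2)
      (b2.meas.norm.pow_const 2).aestronglyMeasurable (ae_of_all _ fun p => ?_)
    rw [Real.norm_of_nonneg (by positivity)]
    exact pow_le_pow_left₀ (norm_nonneg _) (b2.bound _ _) 2
  have i2c : Integrable (fun p : G × G => ((trunc k f p.1 * trunc k f p.2 : ℝ) : ℂ) *
      (D p.1 p.2 * conj (D' p.1 p.2))) (μ.prod μ) := by
    refine integrable_mul_kernel (b := b * b') hfk hfk
      (b1.meas.mul (Complex.continuous_conj.measurable.comp b2.meas)) fun p => ?_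
    rw [norm_mul, RCLike.norm_conj]
    exact mul_le_mul (b1.bound _ _) (b2.bound _ _) (norm_nonneg _) hb0
  have e2 : (normForm μ T H n (trunc k f) g (trunc k f) (trunc k g)).re = (T n)⁻¹ *
      ∫ p, trunc k f p.1 * trunc k f p.2 * (D p.1 p.2 * conj (D' p.1 p.2)).re ∂(μ.prod μ) := by
    rw [normForm, cycForm_eq_transform (h.meas n) (h.norm_le n) (h.conj_eq n) hfk hg hfk hgk,
      ← Complex.ofReal_inv, Complex.re_ofReal_mul]
    congr 1
    have := integral_re i2c
    simp only [RCLike.re_eq_complex_re, Complex.re_ofReal_mul] at this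
    exact this.symm
  have i2 : Integrable (fun p : G × G => trunc k f p.1 * trunc k f p.2 *
      (D p.1 p.2 * conj (D' p.1 p.2)).re) (μ.prod μ) := by
    have := i2c.re
    simpa only [RCLike.re_eq_complex_re, Complex.re_ofReal_mul] using this
  rw [e2, energy, energy, ← mul_assoc, mul_comm 2, mul_assoc, ← mul_sub, ← mul_add]
  congr 1
  have i12 : Integrable (fun p : G × G => f p.1 * f p.2 * ‖D p.1 p.2‖ ^ 2 -
    2 * (trunc k f p.1 * trunc k f p.2 * (D p.1 p.2 * conj (D' p.1 p.2)).re)) (μ.prod μ) :=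
    i1.sub (i2.const_mul 2)
  rw [← integral_const_mul, ← integral_sub i1 (i2.const_mul 2), ← integral_add i12 i3]
  refine integral_congr_ae (ae_of_all _ fun p => ?_)
  simp only [cutKernel, ← hD', ← mul_cut]
  have key : ∀ (a b : ℂ) (s : ℝ), ‖a - (s : ℂ) * b‖ ^ 2 =
      ‖a‖ ^ 2 - 2 * s * (a * conj b).re + s * s * ‖b‖ ^ 2 := by
    intro a b s
    rw [← Complex.normSq_eq_norm_sq, ← Complex.normSq_eq_norm_sq, ← Complex.normSq_eq_norm_sq,
      Complex.normSq_sub, Complex.normSq_mul, Complex.normSq_ofReal, map_mul, Complex.conj_ofReal,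
      show a * ((s : ℂ) * conj b) = (s : ℂ) * (a * conj b) by ring, Complex.re_ofReal_mul]
    ring
  rw [key]
  have c1 := cut_mul_cut k f p.1
  have c2 := cut_mul_cut k f p.2
  have c3 : cut k f p.1 * cut k f p.2 * (cut k f p.1 * cut k f p.2) =
      cut k f p.1 * cut k f p.2 := by
    rw [mul_mul_mul_comm, c1, c2]
  rw [c3]
  ring

end Energy

section Energy

variable {T : ℕ → ℝ} {H : ℕ → G → ℂ} {C : ℝ≥0} {c : ℝ} {f g : G → ℝ}

/-- The integral in the asymptotic variance, truncated. -/
def truncInt (μ : Measure G) (k : ℝ) (f g : G → ℝ) : ℝ :=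
  ∫ u, trunc k f u ^ 2 * trunc k g u ^ 2 ∂μ

lemma trunc_mul_self (k : ℝ) (g : G → ℝ) (x : G) : g x * trunc k g x = trunc k g x ^ 2 := by
  unfold trunc; split_ifs <;> ring

lemma TaperedKernels.tendsto_energy_trunc (h : TaperedKernels μ T H C c) (hfm : Measurable f)
    (hgm : Measurable g) (hf : Integrable f μ) (hg : Integrable g μ) {k : ℝ} (hk : 0 ≤ k) :
    Tendsto (fun n => energy μ T H n (trunc k f) (trunc k g)) atTop (𝓝 (c * truncInt μ k f g)) := by
  have hfk := integrable_trunc hfm hf k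
  have hgk := integrable_trunc hgm hg k
  have := h.tendsto_normForm (M := ⟨k, hk⟩) (measurable_trunc hfm k) (measurable_trunc hgm k)
    (measurable_trunc hfm k) (measurable_trunc hgm k) hfk hgk hfk hgk (norm_trunc_le hk f)
    (norm_trunc_le hk f) (norm_trunc_le hk g)
  simp_rw [normForm_self h _ hfk hgk] at this
  have h2 := (Complex.continuous_re.tendsto _).comp this
  simp only [Complex.ofReal_re, Function.comp_def] at h2
  convert h2 using 4
  exact integral_congr_ae (ae_of_all _ fun u => by simp only; ring)

lemma TaperedKernels.tendsto_re_normForm_trunc (h : TaperedKernels μ T H C c) (hfm : Measurable f)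
    (hgm : Measurable g) (hf : Integrable f μ) (hg : Integrable g μ) {k : ℝ} (hk : 0 ≤ k) :
    Tendsto (fun n => (normForm μ T H n (trunc k f) g (trunc k f) (trunc k g)).re) atTop
      (𝓝 (c * truncInt μ k f g)) := by
  have hfk := integrable_trunc hfm hf k
  have hgk := integrable_trunc hgm hg k
  have := h.tendsto_normForm (M := ⟨k, hk⟩) (measurable_trunc hfm k) hgm
    (measurable_trunc hfm k) (measurable_trunc hgm k) hfk hg hfk hgk (norm_trunc_le hk f)
    (norm_trunc_le hk f) (norm_trunc_le hk g)
  have h2 := (Complex.continuous_re.tendsto _).comp this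
  simp only [Complex.ofReal_re, Function.comp_def] at h2
  convert h2 using 4
  refine integral_congr_ae (ae_of_all _ fun u => ?_)
  simp only [← trunc_mul_self k g]; ring

lemma TaperedKernels.tendsto_energy_sub_cutKernel (h : TaperedKernels μ T H C c)
    (hfm : Measurable f) (hgm : Measurable g) (hf : Integrable f μ) (hg : Integrable g μ) {L : ℝ}
    (hL : Tendsto (fun n => energy μ T H n f g) atTop (𝓝 L)) {k : ℝ} (hk : 0 ≤ k) :
    Tendsto (fun n => (T n)⁻¹ * ∫ p, f p.1 * f p.2 * ‖transform μ (H n) g p.1 p.2 -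
        cutKernel μ (H n) k f g p.1 p.2‖ ^ 2 ∂(μ.prod μ)) atTop
      (𝓝 (L - c * truncInt μ k f g)) := by
  simp_rw [energy_sub_cutKernel h _ k hfm hgm hf hg]
  convert (hL.sub ((h.tendsto_re_normForm_trunc hfm hgm hf hg hk).const_mul 2)).add
    (h.tendsto_energy_trunc hfm hgm hf hg hk) using 2
  ring

lemma integrable_trunc_sq (hfm : Measurable f) (hgm : Measurable g) (hg : Integrable g μ)
    {k : ℝ} (hk : 0 ≤ k) :
    Integrable (fun u => trunc k f u ^ 2 * trunc k g u ^ 2) μ := by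
  have : Integrable (fun u => (trunc k f u ^ 2 * trunc k g u) * trunc k g u) μ := by
    refine (integrable_trunc hgm hg k).bdd_mul (c := k ^ 2 * k)
      (((measurable_trunc hfm k).pow_const 2).mul (measurable_trunc hgm k)).aestronglyMeasurable
      (ae_of_all _ fun u => ?_)
    rw [norm_mul, norm_pow]
    exact mul_le_mul (pow_le_pow_left₀ (norm_nonneg _) (norm_trunc_le hk f u) 2)
      (norm_trunc_le hk g u) (norm_nonneg _) (by positivity)
  refine this.congr (ae_of_all _ fun u => ?_)
  simp only; ring

lemma lintegral_sq_le_liminf_truncInt (hfm : Measurable f) (hgm : Measurable g)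
    (hg : Integrable g μ) : ∫⁻ u, ofReal (f u ^ 2 * g u ^ 2) ∂μ ≤
      liminf (fun k : ℕ => ofReal (truncInt μ k f g)) atTop := by
  have e : ∀ k : ℕ, ofReal (truncInt μ k f g) =
      ∫⁻ u, ofReal (trunc k f u ^ 2 * trunc k g u ^ 2) ∂μ := fun k =>
    ofReal_integral_eq_lintegral_ofReal (integrable_trunc_sq hfm hgm hg (Nat.cast_nonneg k))
      (ae_of_all _ fun u => by positivity)
  simp_rw [e]
  refine le_trans (lintegral_mono fun u => ?_) (lintegral_liminf_le fun k =>
    (((measurable_trunc hfm k).pow_const 2).mul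
      ((measurable_trunc hgm k).pow_const 2)).ennreal_ofReal)
  refine le_liminf_of_le (by isBoundedDefault) ?_
  obtain ⟨k0, hk0⟩ := exists_nat_ge (max |f u| |g u|)
  filter_upwards [eventually_ge_atTop k0] with k hk
  have hk' : max |f u| |g u| ≤ k := hk0.trans (by exact_mod_cast hk)
  rw [trunc_eq ((le_max_left _ _).trans hk'), trunc_eq ((le_max_right _ _).trans hk')]

lemma tendsto_truncInt (hfm : Measurable f) (hgm : Measurable g)
    (hI : Integrable (fun u => f u ^ 2 * g u ^ 2) μ) :
    Tendsto (fun k : ℕ => truncInt μ k f g) atTop (𝓝 (∫ u, f u ^ 2 * g u ^ 2 ∂μ)) := by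
  refine tendsto_integral_of_dominated_convergence (fun u => f u ^ 2 * g u ^ 2)
    (fun k => (((measurable_trunc hfm k).pow_const 2).mul
      ((measurable_trunc hgm k).pow_const 2)).aestronglyMeasurable) hI
    (fun k => ae_of_all _ fun u => ?_) (ae_of_all _ fun u => ?_)
  · rw [Real.norm_of_nonneg (by positivity)]
    have h1 := abs_trunc_le k f u
    have h2 := abs_trunc_le k g u
    exact mul_le_mul (sq_le_sq.2 h1) (sq_le_sq.2 h2) (by positivity) (by positivity)
  · obtain ⟨k0, hk0⟩ := exists_nat_ge (max |f u| |g u|)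
    refine tendsto_const_nhds.congr' ?_
    filter_upwards [eventually_ge_atTop k0] with k hk
    have hk' : max |f u| |g u| ≤ k := hk0.trans (by exact_mod_cast hk)
    rw [trunc_eq ((le_max_left _ _).trans hk'), trunc_eq ((le_max_right _ _).trans hk')]

/-- If the energies converge, then `f² g²` is integrable. -/
lemma TaperedKernels.integrable_of_tendsto_energy (h : TaperedKernels μ T H C c)
    (hfm : Measurable f) (hgm : Measurable g) (hf : Integrable f μ) (hg : Integrable g μ)
    (hf0 : ∀ x, 0 ≤ f x) {L : ℝ}
    (hL : Tendsto (fun n => energy μ T H n f g) atTop (𝓝 L)) :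
    Integrable (fun u => f u ^ 2 * g u ^ 2) μ := by
  have hk : ∀ k : ℕ, truncInt μ k f g ≤ L / c := fun k => by
    rw [le_div_iff₀' h.pos, ← sub_nonneg]
    refine ge_of_tendsto' (h.tendsto_energy_sub_cutKernel hfm hgm hf hg hL (Nat.cast_nonneg k))
      fun n => ?_
    refine mul_nonneg (inv_nonneg.2 (h.T_pos n).le) (integral_nonneg fun p => ?_)
    exact mul_nonneg (mul_nonneg (hf0 _) (hf0 _)) (by positivity)
  refine ⟨((hfm.pow_const 2).mul (hgm.pow_const 2)).aestronglyMeasurable, ?_⟩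
  rw [hasFiniteIntegral_iff_ofReal (ae_of_all _ fun u => by positivity)]
  refine (lintegral_sq_le_liminf_truncInt hfm hgm hg).trans_lt ?_
  refine (liminf_le_of_frequently_le' (x := ofReal (L / c)) ?_).trans_lt
    ofReal_lt_top
  exact Frequently.of_forall fun k => ofReal_le_ofReal (hk k)

lemma hsq_densityMeasure (hfm : Measurable f) (hf : Integrable f μ) (hf0 : ∀ x, 0 ≤ f x)
    {K : G → G → ℂ} {b : ℝ} (hK : BddKernel K b) :
    hsq (densityMeasure μ f) K = ofReal (∫ p, f p.1 * f p.2 * ‖K p.1 p.2‖ ^ 2 ∂(μ.prod μ)) := by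
  rw [hsq, lintegral_densityMeasure_prod hfm hf0 hf (hK.meas.enorm.pow_const 2),
    ofReal_integral_eq_lintegral_ofReal]
  · refine lintegral_congr fun p => ?_
    rw [ofReal_mul (mul_nonneg (hf0 _) (hf0 _)), ENNReal.ofReal_pow (norm_nonneg _), ofReal_norm]
  · refine (hf.mul_prod hf).mul_bdd (c := b ^ 2) (hK.meas.norm.pow_const 2).aestronglyMeasurable
      (ae_of_all _ fun p => ?_)
    rw [Real.norm_of_nonneg (by positivity)]
    exact pow_le_pow_left₀ (norm_nonneg _) (hK.bound _ _) 2
  · exact ae_of_all _ fun p => mul_nonneg (mul_nonneg (hf0 _) (hf0 _)) (by positivity)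

/-- The Schur bound for the truncated kernels. -/
lemma lintegral_cutKernel_le (h : TaperedKernels μ T H C c) (n k : ℕ) (hfm : Measurable f)
    (hf0 : ∀ x, 0 ≤ f x) (g : G → ℝ) (x : G) {N : G → ℝ≥0∞}
    (hN : ∀ z, N z ≤ ofReal (cut k f z) * ∫⁻ u, ‖trunc k g u‖ₑ *
      ((C * ofReal (T n)) ^ 2 * (decay (T n) (u - x) * decay (T n) (z - u))) ∂μ) :
    ∫⁻ z, N z ∂(densityMeasure μ f) ≤
      k * ((C * ofReal (T n)) ^ 2 * (4 * decayConst * (ofReal (T n))⁻¹)) *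
      ((∫⁻ z, ofReal (trunc k f z) ^ (5 / 2 : ℝ) ∂μ) ^ (2 / 5 : ℝ) *
        (decayConst * (ofReal (T n))⁻¹) ^ (3 / 5 : ℝ)) := by
  have hT := h.T_pos n
  set A : ℝ≥0∞ := k * ((C * ofReal (T n)) ^ 2 * (4 * decayConst * (ofReal (T n))⁻¹)) with hA
  have hDm : ∀ z : G, Measurable fun u => decay (T n) (u - x) * decay (T n) (z - u) := fun z => by
    have hk : Measurable (decay (T n) : G → ℝ≥0∞) := measurable_decay
    fun_prop
  have hN2 : ∀ z, N z ≤ ofReal (cut k f z) * (A * decay (T n) (z - x) ^ (3 / 4 : ℝ)) := by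
    intro z
    refine (hN z).trans (mul_le_mul_right ?_ _)
    calc _ ≤ ∫⁻ u, (k * (C * ofReal (T n)) ^ 2) *
          (decay (T n) (u - x) * decay (T n) (z - u)) ∂μ := by
          refine lintegral_mono fun u => ?_
          dsimp only
          rw [← mul_assoc]
          gcongr
          rw [← ofReal_norm, ← ENNReal.ofReal_natCast]
          exact ofReal_le_ofReal (norm_trunc_le (Nat.cast_nonneg k) g u)
      _ ≤ (k * (C * ofReal (T n)) ^ 2) * (4 * decayConst * (ofReal (T n))⁻¹ *
            decay (T n) (z - x) ^ (3 / 4 : ℝ)) := by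
          rw [lintegral_const_mul _ (hDm z)]
          gcongr
          have := lintegral_decay_conv_le (μ := μ) h.radial hT (a := 1) (b := 1) (θ := 3 / 4)
            (by norm_num) (by norm_num) (by norm_num) (by norm_num) (by norm_num) x z
          simpa using this
      _ = _ := by rw [hA]; ring
  have hm1 : Measurable fun z => ofReal (trunc k f z) :=
    (measurable_trunc hfm k).ennreal_ofReal
  have hm2 : Measurable fun z : G => decay (T n) (z - x) ^ (3 / 4 : ℝ) :=
    (measurable_decay.comp (measurable_sub_const x)).pow_const _
  calc ∫⁻ z, N z ∂(densityMeasure μ f)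
      ≤ ∫⁻ z, ofReal (cut k f z) * (A * decay (T n) (z - x) ^ (3 / 4 : ℝ))
          ∂(densityMeasure μ f) := lintegral_mono hN2
    _ = ∫⁻ z, A * (ofReal (trunc k f z) * decay (T n) (z - x) ^ (3 / 4 : ℝ)) ∂μ := by
        rw [densityMeasure, lintegral_withDensity_eq_lintegral_mul
          (g := fun z => ofReal (cut k f z) * (A * decay (T n) (z - x) ^ (3 / 4 : ℝ))) _
          hfm.ennreal_ofReal ((measurable_cut hfm k).ennreal_ofReal.mul (hm2.const_mul A))]
        refine lintegral_congr fun z => ?_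
        simp only [Pi.mul_apply]
        rw [← mul_cut, ofReal_mul (hf0 z)]
        ring
    _ ≤ A * _ := by
        rw [lintegral_const_mul (f := fun z => ofReal (trunc k f z) *
          decay (T n) (z - x) ^ (3 / 4 : ℝ)) _ (hm1.mul hm2)]
        refine mul_le_mul_right ?_ _
        have hh := ENNReal.lintegral_mul_le_Lp_mul_Lq μ (p := 5 / 2) (q := 5 / 3)
          ⟨by norm_num, by norm_num, by norm_num⟩ hm1.aemeasurable hm2.aemeasurable
        refine hh.trans (le_of_eq_of_le (b := (∫⁻ z, ofReal (trunc k f z) ^ (5 / 2 : ℝ) ∂μ) ^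
          (2 / 5 : ℝ) * (∫⁻ z, decay (T n) (z - x) ^ (5 / 4 : ℝ) ∂μ) ^ (3 / 5 : ℝ)) ?_ ?_)
        · simp only [← ENNReal.rpow_mul]
          norm_num
        · gcongr
          rw [lintegral_sub_right_eq_self (fun z => decay (T n) z ^ (5 / 4 : ℝ)) x]
          exact lintegral_decay_le h.radial hT le_rfl

/-- If the energies converge to the right limit, then the fourth order traces are negligible. -/
theorem TaperedKernels.tendsto_hsq (h : TaperedKernels μ T H C c)
    (hfm : Measurable f) (hgm : Measurable g) (hf : Integrable f μ) (hg : Integrable g μ)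
    (hf0 : ∀ x, 0 ≤ f x) (hI : Integrable (fun u => f u ^ 2 * g u ^ 2) μ)
    (hE : Tendsto (fun n => energy μ T H n f g) atTop (𝓝 (c * ∫ u, f u ^ 2 * g u ^ 2 ∂μ))) :
    Tendsto (fun n => hsq (densityMeasure μ f) (mcomp (densityMeasure μ f)
      (transform μ (H n) g) (transform μ (H n) g)) * (ofReal (T n))⁻¹ ^ 2)
      atTop (𝓝 0) := by
  have := isFiniteMeasure_densityMeasure hf
  set ν := densityMeasure μ f with hν
  set I := ∫ u, f u ^ 2 * g u ^ 2 ∂μ with hIdef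
  set s : ℕ → ℝ≥0∞ := fun n => (ofReal (T n))⁻¹ with hs
  have hsT : ∀ n, ofReal (T n) * s n = 1 := fun n =>
    ENNReal.mul_inv_cancel (by simpa using h.T_pos n) (by simp)
  have hst : ∀ n, s n ≠ ∞ := fun n => by simpa [hs] using h.T_pos n
  have hs0 : Tendsto s atTop (𝓝 0) := by
    simpa using (ENNReal.tendsto_ofReal_atTop.comp h.tendsto).inv
  set F : ℕ → ℝ≥0∞ := fun k => (∫⁻ z, ofReal (trunc k f z) ^ (5 / 2 : ℝ) ∂μ) with hF
  have hFt : ∀ k, F k ≠ ∞ := by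
    intro k
    have h1 : ∫⁻ z, (k : ℝ≥0∞) ^ (3 / 2 : ℝ) * ‖f z‖ₑ ∂μ ≠ ∞ := by
      rw [lintegral_const_mul _ hfm.enorm]
      exact mul_ne_top (rpow_ne_top_of_nonneg (by norm_num) (by simp)) hf.2.ne
    refine ne_top_of_le_ne_top h1 (lintegral_mono fun z => ?_)
    have h2 : ofReal (trunc k f z) ≤ k := by
      rw [← ENNReal.ofReal_natCast]
      exact ofReal_le_ofReal ((le_abs_self _).trans (norm_trunc_le (Nat.cast_nonneg k) f z))
    have h3 : ofReal (trunc k f z) ≤ ‖f z‖ₑ := by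
      rw [← ofReal_norm]
      exact ofReal_le_ofReal ((le_abs_self _).trans (abs_trunc_le k f z))
    calc ofReal (trunc k f z) ^ (5 / 2 : ℝ) =
          ofReal (trunc k f z) ^ (3 / 2 : ℝ) * ofReal (trunc k f z) := by
          nth_rw 3 [← ENNReal.rpow_one (ofReal (trunc k f z))]
          rw [← ENNReal.rpow_add_of_nonneg _ _ (by norm_num) (by norm_num)]
          norm_num
      _ ≤ _ := by gcongr
  set B : ℕ → ℕ → ℝ≥0∞ := fun k n =>
    k * ((C * ofReal (T n)) ^ 2 * (4 * decayConst * s n)) *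
      (F k ^ (2 / 5 : ℝ) * (decayConst * s n) ^ (3 / 5 : ℝ)) with hB
  set A : ℕ → ℝ≥0∞ := fun k => (k * C ^ 2 * 4 * decayConst * F k ^ (2 / 5 : ℝ) *
    decayConst ^ (3 / 5 : ℝ)) ^ 2 with hAdef
  have hAt : ∀ k, A k ≠ ∞ := fun k => by
    refine pow_ne_top (mul_ne_top (mul_ne_top (mul_ne_top
      (mul_ne_top (mul_ne_top (by simp) (by simp)) (by norm_num))
      decayConst_ne_top) ?_) ?_)
    · exact rpow_ne_top_of_nonneg (by norm_num) (hFt k)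
    · exact rpow_ne_top_of_nonneg (by norm_num) decayConst_ne_top
  have hBs : ∀ k n, B k n ^ 2 * s n = A k * s n ^ (1 / 5 : ℝ) := by
    intro k n
    have e1 : (s n ^ (3 / 5 : ℝ)) ^ 2 = s n * s n ^ (1 / 5 : ℝ) := by
      nth_rw 2 [← ENNReal.rpow_one (s n)]
      rw [← ENNReal.rpow_natCast, ← ENNReal.rpow_mul,
        ← ENNReal.rpow_add_of_nonneg _ _ (by norm_num) (by norm_num)]
      norm_num
    calc B k n ^ 2 * s n = A k * (ofReal (T n)) ^ 4 * s n ^ 3 * (s n ^ (3 / 5 : ℝ)) ^ 2 := by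
          simp only [hB, hAdef]
          rw [mul_rpow_of_nonneg _ _ (by norm_num)]
          ring
      _ = A k * (ofReal (T n) * s n) ^ 4 * s n ^ (1 / 5 : ℝ) := by rw [e1]; ring
      _ = _ := by rw [hsT]; ring
  set err : ℕ → ℕ → ℝ := fun k n => (T n)⁻¹ * ∫ p, f p.1 * f p.2 * ‖transform μ (H n) g p.1 p.2 -
        cutKernel μ (H n) k f g p.1 p.2‖ ^ 2 ∂(μ.prod μ) with herr
  have hD := fun n => bddKernel_transform h n hgm hg
  have hN := fun (k n : ℕ) => bddKernel_cutKernel h n k hfm hgm hg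
  have hEk : ∀ k n : ℕ, BddKernel (fun x y => transform μ (H n) g x y - cutKernel μ (H n) k f g x y)
      (((∫ u, |g u| ∂μ) * ((C * T n) * (C * T n))) +
        ((∫ u, |trunc k g u| ∂μ) * ((C * T n) * (C * T n)))) := fun k n =>
    ⟨(hD n).meas.sub (hN k n).meas, fun x y => (norm_sub_le _ _).trans
      (add_le_add ((hD n).bound x y) ((hN k n).bound x y))⟩
  have hscale : ∀ n (x : ℝ), ofReal x * s n = ofReal ((T n)⁻¹ * x) := fun n x => by
    rw [hs, ofReal_mul (inv_nonneg.2 (h.T_pos n).le), ofReal_inv_of_pos (h.T_pos n), mul_comm]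
  have key : ∀ k n, hsq ν (mcomp ν (transform μ (H n) g) (transform μ (H n) g)) * s n ^ 2 ≤
      2 * (A k * s n ^ (1 / 5 : ℝ) + ofReal (err k n)) *
        ofReal (energy μ T H n f g) := by
    intro k n
    have hpt : ∀ x z, ‖cutKernel μ (H n) k f g x z‖ₑ ≤ ofReal (cut k f x) *
        ofReal (cut k f z) * ‖transform μ (H n) (trunc k g) x z‖ₑ := fun x z => by
      rw [cutKernel, enorm_mul, enorm_complex_ofReal, Real.enorm_eq_ofReal
        (mul_nonneg (cut_nonneg _ _ _) (cut_nonneg _ _ _)), ofReal_mul (cut_nonneg _ _ _)]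
    have hcut1 : ∀ x, ofReal (cut k f x) ≤ 1 := fun x => by
      rw [← ENNReal.ofReal_one]; exact ofReal_le_ofReal (cut_le_one _ _ _)
    have hD' := fun x z => enorm_transform_le (μ := μ) (h.bound n) (trunc k g) x z
    have h1 : ∀ x, ∫⁻ z, ‖cutKernel μ (H n) k f g x z‖ₑ ∂ν ≤ B k n := fun x => by
      refine lintegral_cutKernel_le h n k hfm hf0 g x fun z => (hpt x z).trans ?_
      refine mul_le_mul' ?_ (hD' x z)
      exact (mul_le_mul_left (hcut1 x) _).trans (one_mul _).le
    have h2 : ∀ z, ∫⁻ x, ‖cutKernel μ (H n) k f g x z‖ₑ ∂ν ≤ B k n := fun z => by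
      refine lintegral_cutKernel_le h n k hfm hf0 g z fun x => (hpt x z).trans ?_
      refine mul_le_mul' ?_ ((hD' x z).trans (le_of_eq (lintegral_congr fun u => ?_)))
      · exact (mul_le_mul_right (hcut1 z) _).trans (mul_one _).le
      · rw [decay_sub_comm z u, decay_sub_comm u x]; ring
    have h3 := hsq_mcomp_self_le (ν := ν) (hD n) (hN k n) (hEk k n) (fun x y => by ring) h1 h2
    calc _ ≤ 2 * (B k n ^ 2 + hsq ν fun x y => transform μ (H n) g x y -
            cutKernel μ (H n) k f g x y) * hsq ν (transform μ (H n) g) * s n ^ 2 :=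
          mul_le_mul_left h3 _
      _ = 2 * (B k n ^ 2 * s n + (hsq ν fun x y => transform μ (H n) g x y -
            cutKernel μ (H n) k f g x y) * s n) * (hsq ν (transform μ (H n) g) * s n) := by ring
      _ = _ := by
          rw [hBs, hν, hsq_densityMeasure hfm hf hf0 (hEk k n),
            hsq_densityMeasure hfm hf hf0 (hD n), hscale, hscale]
          rfl
  have hlim : ∀ k : ℕ, Tendsto (fun n => 2 * (A k * s n ^ (1 / 5 : ℝ) + ofReal (err k n)) *
      ofReal (energy μ T H n f g)) atTop
      (𝓝 (2 * ofReal (c * I - c * truncInt μ k f g) * ofReal (c * I))) := by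
    intro k
    have t1 : Tendsto (fun n => A k * s n ^ (1 / 5 : ℝ)) atTop (𝓝 0) := by
      have := ((ENNReal.continuous_rpow_const (y := 1 / 5)).tendsto 0).comp hs0
      rw [ENNReal.zero_rpow_of_pos (by norm_num)] at this
      simpa using ENNReal.Tendsto.const_mul (a := A k) this (Or.inr (hAt k))
    have t2 := ENNReal.tendsto_ofReal
      (h.tendsto_energy_sub_cutKernel hfm hgm hf hg hE (Nat.cast_nonneg k))
    have t3 := ENNReal.Tendsto.const_mul (a := 2) (t1.add t2) (Or.inr (by norm_num))
    rw [zero_add] at t3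
    exact ENNReal.Tendsto.mul t3 (Or.inr ofReal_ne_top) (ENNReal.tendsto_ofReal hE)
      (Or.inr (mul_ne_top (by norm_num) ofReal_ne_top))
  have hk0 : Tendsto (fun k : ℕ => 2 * ofReal (c * I - c * truncInt μ k f g) *
      ofReal (c * I)) atTop (𝓝 0) := by
    have t1 := ENNReal.tendsto_ofReal
      (((tendsto_truncInt hfm hgm hI).const_mul c).const_sub (c * I))
    rw [sub_self, ENNReal.ofReal_zero] at t1
    have t2 := ENNReal.Tendsto.const_mul (a := 2) t1 (Or.inr (by norm_num))
    simpa using ENNReal.Tendsto.mul_const (b := ofReal (c * I)) t2 (Or.inr (by simp))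
  rw [ENNReal.tendsto_nhds_zero]
  intro ε hε
  obtain ⟨k, hk⟩ := ((tendsto_order.1 hk0).2 ε hε).exists
  filter_upwards [(tendsto_order.1 (hlim k)).2 ε hk] with n hn
  exact (key k n).trans hn.le

end Energy

/-! ### Tight pairs -/

section Tight

variable {T : ℕ → ℝ} {H : ℕ → G → ℂ} {C : ℝ≥0} {c : ℝ} {f g : G → ℝ}

/-- The majorant of the energy of `f` and `g`. -/
def decayEnergy (μ : Measure G) (t : ℝ) (f g : G → ℝ) : ℝ≥0∞ :=
  decayForm μ t (fun x => ‖f x‖ₑ) (fun x => ‖g x‖ₑ) (fun x => ‖f x‖ₑ) (fun x => ‖g x‖ₑ)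

lemma decayEnergy_comm (hfm : Measurable f) (hgm : Measurable g) (t : ℝ) :
    decayEnergy μ t f g = decayEnergy μ t g f :=
  decayForm_rotate hfm.enorm hgm.enorm hfm.enorm hgm.enorm

lemma TaperedKernels.enorm_energy_le (h : TaperedKernels μ T H C c) (n : ℕ)
    (hf : Integrable f μ) (hg : Integrable g μ) :
    ‖energy μ T H n f g‖ₑ ≤ C ^ 4 * decayEnergy μ (T n) f g := by
  have h0 : Integrable (fun _ : G => (0 : ℝ)) μ := integrable_zero _ _ _
  have h1 := h.enorm_normForm_sub_le n hf hg hf hg h0 h0 h0 h0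
  have e : normForm μ T H n (fun _ => 0) (fun _ => 0) (fun _ => 0) (fun _ => 0) = 0 := by
    simp [normForm, cycForm, tens4]
  rw [e, sub_zero, normForm_self h n hf hg, enorm_complex_ofReal] at h1
  refine h1.trans (le_of_eq ?_)
  simp only [decayEnergy, decayForm, tens4, mul_zero, sub_zero, enorm_mul]

/-- A bound on the energy majorants bounds the integral of `f² g²`. -/
lemma TaperedKernels.lintegral_sq_mul_sq_le (h : TaperedKernels μ T H C c) (hfm : Measurable f)
    (hgm : Measurable g) (hf : Integrable f μ) (hg : Integrable g μ) {E : ℝ≥0∞}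
    (hE : ∀ᶠ n in atTop, decayEnergy μ (T n) f g ≤ E) :
    ofReal c * ∫⁻ u, ofReal (f u ^ 2 * g u ^ 2) ∂μ ≤ C ^ 4 * E := by
  have hk : ∀ k : ℕ, ofReal c * ofReal (truncInt μ k f g) ≤ C ^ 4 * E := by
    intro k
    have h1 := (h.tendsto_energy_trunc hfm hgm hf hg (k := k) (Nat.cast_nonneg k)).enorm
    have h2 : ofReal c * ofReal (truncInt μ k f g) = ‖c * truncInt μ k f g‖ₑ := by
      rw [← ofReal_mul h.pos.le, Real.enorm_eq_ofReal]
      exact mul_nonneg h.pos.le (integral_nonneg fun u => by positivity)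
    rw [h2]
    refine le_of_tendsto h1 ?_
    filter_upwards [hE] with n hn
    refine (h.enorm_energy_le n (integrable_trunc hfm hf k) (integrable_trunc hgm hg k)).trans
      (mul_le_mul_right (le_trans ?_ hn) _)
    have a : ∀ {g : G → ℝ}, (fun x => ‖trunc k g x‖ₑ) ≤ fun x => ‖g x‖ₑ := fun {g} x => by
      simp only
      rw [← ofReal_norm, ← ofReal_norm]
      exact ofReal_le_ofReal (abs_trunc_le k g x)
    exact decayForm_mono a a a a
  have hc0 : ofReal c ≠ 0 := by simpa using h.pos
  rw [mul_comm, ← le_div_iff_mul_le (Or.inl hc0) (Or.inl ofReal_ne_top)]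
  refine (lintegral_sq_le_liminf_truncInt hfm hgm hg).trans
    (liminf_le_of_frequently_le' (Frequently.of_forall fun k => ?_))
  rw [le_div_iff_mul_le (Or.inl hc0) (Or.inl ofReal_ne_top), mul_comm]
  exact hk k

lemma enorm_mul4_sub_le (a b d e a' b' d' e' : ℝ) (ha : ‖a'‖ₑ ≤ ‖a‖ₑ) (hb : ‖b'‖ₑ ≤ ‖b‖ₑ)
    (hd : ‖d'‖ₑ ≤ ‖d‖ₑ) : ‖a * b * d * e - a' * b' * d' * e'‖ₑ ≤ ‖a - a'‖ₑ * ‖b‖ₑ * ‖d‖ₑ * ‖e‖ₑ +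
      ‖a‖ₑ * ‖b - b'‖ₑ * ‖d‖ₑ * ‖e‖ₑ + ‖a‖ₑ * ‖b‖ₑ * ‖d - d'‖ₑ * ‖e‖ₑ +
      ‖a‖ₑ * ‖b‖ₑ * ‖d‖ₑ * ‖e - e'‖ₑ := by
  rw [show a * b * d * e - a' * b' * d' * e' = (a - a') * b * d * e + a' * (b - b') * d * e +
    a' * b' * (d - d') * e + a' * b' * d' * (e - e') by ring]
  refine (enorm_add_le _ _).trans (add_le_add ((enorm_add_le _ _).trans (add_le_add
    ((enorm_add_le _ _).trans (add_le_add ?_ ?_)) ?_)) ?_)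
  all_goals simp only [enorm_mul]
  · exact le_rfl
  all_goals gcongr

/-- Convergence of the energies for pairs that are, up to small energy, bounded. -/
theorem TaperedKernels.tendsto_energy_of_tight (h : TaperedKernels μ T H C c)
    (hfm : Measurable f) (hgm : Measurable g) (hf : Integrable f μ) (hg : Integrable g μ)
    {E : ℝ≥0∞} (hEt : E ≠ ∞) (hE : ∀ᶠ n in atTop, decayEnergy μ (T n) f g ≤ E)
    (hs : ∀ ε : ℝ≥0∞, 0 < ε → ∃ (A B : Set G) (M : ℝ≥0), MeasurableSet A ∧ MeasurableSet B ∧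
      (∀ x ∉ A, ‖f x‖ ≤ M) ∧ (∀ x ∉ B, ‖g x‖ ≤ M) ∧
      ∀ᶠ n in atTop, decayEnergy μ (T n) (A.indicator f) g ≤ ε ∧
        decayEnergy μ (T n) f (B.indicator g) ≤ ε) :
    Integrable (fun u => f u ^ 2 * g u ^ 2) μ ∧
      Tendsto (fun n => energy μ T H n f g) atTop (𝓝 (c * ∫ u, f u ^ 2 * g u ^ 2 ∂μ)) := by
  have hc0 : ofReal c ≠ 0 := by simpa using h.pos
  have hmm : Measurable fun u => f u ^ 2 * g u ^ 2 := (hfm.pow_const 2).mul (hgm.pow_const 2)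
  have hI : Integrable (fun u => f u ^ 2 * g u ^ 2) μ := by
    refine ⟨hmm.aestronglyMeasurable, ?_⟩
    rw [hasFiniteIntegral_iff_ofReal (ae_of_all _ fun u => by positivity)]
    have h1 := h.lintegral_sq_mul_sq_le hfm hgm hf hg hE
    by_contra hc
    rw [not_lt, top_le_iff] at hc
    rw [hc, ENNReal.mul_top hc0, top_le_iff] at h1
    exact mul_ne_top (pow_ne_top coe_ne_top) hEt h1
  refine ⟨hI, ?_⟩
  rw [← tendsto_sub_nhds_zero_iff, tendsto_zero_iff_enorm_tendsto_zero]
  have main : ∀ ε : ℝ≥0∞, 0 < ε → ε ≠ ∞ → ∀ᶠ n in atTop,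
      ‖energy μ T H n f g - c * ∫ u, f u ^ 2 * g u ^ 2 ∂μ‖ₑ ≤
        C ^ 4 * (4 * (E * ε) ^ (1 / 2 : ℝ)) + ε + 2 * (C ^ 4 * ε) := by
    intro ε hε hεt
    obtain ⟨A, B, M, hA, hB, hfM, hgM, hAB⟩ := hs ε hε
    set f' := Aᶜ.indicator f with hf'
    set g' := Bᶜ.indicator g with hg'
    have hf'm : Measurable f' := hfm.indicator hA.compl
    have hg'm : Measurable g' := hgm.indicator hB.compl
    have hf'i : Integrable f' μ := hf.indicator hA.compl
    have hg'i : Integrable g' μ := hg.indicator hB.compl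
    have hf'M : ∀ x, ‖f' x‖ ≤ M := fun x => by
      by_cases hx : x ∈ A
      · rw [hf', indicator_of_notMem (by simpa using hx)]; simp
      · rw [hf', indicator_of_mem (by simpa using hx)]; exact hfM x hx
    have hg'M : ∀ x, ‖g' x‖ ≤ M := fun x => by
      by_cases hx : x ∈ B
      · rw [hg', indicator_of_notMem (by simpa using hx)]; simp
      · rw [hg', indicator_of_mem (by simpa using hx)]; exact hgM x hx
    have hfs : ∀ x, f x - f' x = A.indicator f x := fun x => by
      have := congrFun (indicator_self_add_compl A f) x
      simp only [Pi.add_apply] at this; rw [hf']; linarith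
    have hgs : ∀ x, g x - g' x = B.indicator g x := fun x => by
      have := congrFun (indicator_self_add_compl B g) x
      simp only [Pi.add_apply] at this; rw [hg']; linarith
    have hfle : ∀ x, ‖f' x‖ₑ ≤ ‖f x‖ₑ := fun x => enorm_indicator_le_enorm_self _ _
    have hgle : ∀ x, ‖g' x‖ₑ ≤ ‖g x‖ₑ := fun x => enorm_indicator_le_enorm_self _ _
    have hlim : Tendsto (fun n => energy μ T H n f' g') atTop
        (𝓝 (c * ∫ u, f' u ^ 2 * g' u ^ 2 ∂μ)) := by
      have := h.tendsto_normForm hf'm hg'm hf'm hg'm hf'i hg'i hf'i hg'i hf'M hf'M hg'M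
      simp_rw [normForm_self h _ hf'i hg'i] at this
      have h2 := (Complex.continuous_re.tendsto _).comp this
      simp only [Complex.ofReal_re, Function.comp_def] at h2
      convert h2 using 4
      funext u; ring
    have hlim2 : Tendsto (fun n => ‖energy μ T H n f' g' - c * ∫ u, f' u ^ 2 * g' u ^ 2 ∂μ‖ₑ) atTop
        (𝓝 0) := by
      simpa using (tendsto_sub_nhds_zero_iff.2 hlim).enorm
    have hcI : ‖c * ∫ u, f' u ^ 2 * g' u ^ 2 ∂μ - c * ∫ u, f u ^ 2 * g u ^ 2 ∂μ‖ₑ ≤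
        2 * (C ^ 4 * ε) := by
      have i' : Integrable (fun u => f' u ^ 2 * g' u ^ 2) μ := by
        refine hI.mono ((hf'm.pow_const 2).mul (hg'm.pow_const 2)).aestronglyMeasurable
          (ae_of_all _ fun u => ?_)
        rw [← enorm_le_iff_norm_le, enorm_mul, enorm_mul, enorm_pow, enorm_pow, enorm_pow,
          enorm_pow]
        gcongr
        exacts [hfle u, hgle u]
      have l1 := h.lintegral_sq_mul_sq_le (hfm.indicator hA) hgm (hf.indicator hA) hg
        (hAB.mono fun n hn => hn.1)
      have l2 := h.lintegral_sq_mul_sq_le hfm (hgm.indicator hB) hf (hg.indicator hB)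
        (hAB.mono fun n hn => hn.2)
      have m1 : Measurable fun u => ofReal (A.indicator f u ^ 2 * g u ^ 2) :=
        (((hfm.indicator hA).pow_const 2).mul (hgm.pow_const 2)).ennreal_ofReal
      rw [← mul_sub, enorm_mul, ← integral_sub i' hI, Real.enorm_eq_ofReal h.pos.le]
      calc _ ≤ ofReal c * (∫⁻ u, ofReal (A.indicator f u ^ 2 * g u ^ 2) ∂μ +
            ∫⁻ u, ofReal (f u ^ 2 * B.indicator g u ^ 2) ∂μ) := by
            refine mul_le_mul_right ((enorm_integral_le_lintegral_enorm _).trans ?_) _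
            rw [← lintegral_add_left m1]
            refine lintegral_mono fun u => ?_
            dsimp only
            rw [← ENNReal.ofReal_add (by positivity) (by positivity), ← ofReal_norm]
            refine ofReal_le_ofReal ?_
            by_cases hx : u ∈ A
            · have : f' u = 0 := by rw [hf', indicator_of_notMem (by simpa using hx)]
              rw [this, indicator_of_mem hx, Real.norm_eq_abs]
              simp only [ne_eq, OfNat.ofNat_ne_zero, not_false_eq_true, zero_pow, zero_mul,
                zero_sub, abs_neg]
              rw [abs_of_nonneg (by positivity)]
              have : 0 ≤ f u ^ 2 * B.indicator g u ^ 2 := by positivity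
              linarith
            · have h1 : f' u = f u := by rw [hf', indicator_of_mem (by simpa using hx)]
              rw [h1, indicator_of_notMem hx]
              by_cases hy : u ∈ B
              · have : g' u = 0 := by rw [hg', indicator_of_notMem (by simpa using hy)]
                rw [this, indicator_of_mem hy, Real.norm_eq_abs]
                simp only [ne_eq, OfNat.ofNat_ne_zero, not_false_eq_true, zero_pow, zero_mul,
                  mul_zero, zero_sub, abs_neg, zero_add]
                rw [abs_of_nonneg (by positivity)]
              · have h2 : g' u = g u := by rw [hg', indicator_of_mem (by simpa using hy)]
                rw [h2, indicator_of_notMem hy]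
                simp
        _ ≤ C ^ 4 * ε + C ^ 4 * ε := by rw [mul_add]; exact add_le_add l1 l2
        _ = _ := by ring
    filter_upwards [hE, hAB, (tendsto_order.1 hlim2).2 ε hε] with n hn1 hn2 hn3
    obtain ⟨hnA, hnB⟩ := hn2
    have hroot : ∀ {X Y : ℝ≥0∞}, X ^ 2 ≤ E * Y → Y ≤ ε → X ≤ (E * ε) ^ (1 / 2 : ℝ) := by
      intro X Y hX hY
      rw [← ENNReal.rpow_two] at hX
      rw [one_div, ENNReal.le_rpow_inv_iff (by norm_num)]
      exact hX.trans (mul_le_mul_right hY _)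
    set F : G → ℝ≥0∞ := fun x => ‖f x‖ₑ
    set K : G → ℝ≥0∞ := fun x => ‖g x‖ₑ
    set FA : G → ℝ≥0∞ := fun x => ‖A.indicator f x‖ₑ
    set KB : G → ℝ≥0∞ := fun x => ‖B.indicator g x‖ₑ
    have mF : Measurable F := hfm.enorm
    have mK : Measurable K := hgm.enorm
    have mFA : Measurable FA := (hfm.indicator hA).enorm
    have mKB : Measurable KB := (hgm.indicator hB).enorm
    have t1 : decayForm μ (T n) FA K F K ≤ (E * ε) ^ (1 / 2 : ℝ) := by
      refine hroot (Y := decayEnergy μ (T n) (A.indicator f) g) ?_ hnA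
      refine (decayForm_sq_le' mFA mK mF mK).trans ?_
      rw [mul_comm]
      exact mul_le_mul_left hn1 _
    have t2 : decayForm μ (T n) F KB F K ≤ (E * ε) ^ (1 / 2 : ℝ) := by
      refine hroot (Y := decayEnergy μ (T n) f (B.indicator g)) ?_ hnB
      refine (decayForm_sq_le mF mKB mF mK).trans ?_
      rw [mul_comm]
      exact mul_le_mul_left hn1 _
    have t3 : decayForm μ (T n) F K FA K ≤ (E * ε) ^ (1 / 2 : ℝ) := by
      refine hroot (Y := decayEnergy μ (T n) (A.indicator f) g) ?_ hnA
      exact (decayForm_sq_le' mF mK mFA mK).trans (mul_le_mul_left hn1 _)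
    have t4 : decayForm μ (T n) F K F KB ≤ (E * ε) ^ (1 / 2 : ℝ) := by
      refine hroot (Y := decayEnergy μ (T n) f (B.indicator g)) ?_ hnB
      exact (decayForm_sq_le mF mK mF mKB).trans (mul_le_mul_left hn1 _)
    have hdiff : ‖energy μ T H n f g - energy μ T H n f' g'‖ₑ ≤
        C ^ 4 * (4 * (E * ε) ^ (1 / 2 : ℝ)) := by
      have h1 := h.enorm_normForm_sub_le n hf hg hf hg hf'i hg'i hf'i hg'i
      rw [normForm_self h n hf hg, normForm_self h n hf'i hg'i, ← Complex.ofReal_sub,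
        enorm_complex_ofReal] at h1
      refine h1.trans (mul_le_mul_right ?_ _)
      have mc : Measurable (cyc (decay (T n)) : G × G × G × G → ℝ≥0∞) :=
        measurable_cyc measurable_decay
      have q1 := (measurable_tens4 mFA mK mF mK).mul mc
      have q2 := (measurable_tens4 mF mKB mF mK).mul mc
      have q3 := (measurable_tens4 mF mK mFA mK).mul mc
      calc _ ≤ ofReal (T n) ^ 3 * ∫⁻ q, (tens4 FA K F K q * cyc (decay (T n)) q +
            tens4 F KB F K q * cyc (decay (T n)) q + tens4 F K FA K q * cyc (decay (T n)) q +
            tens4 F K F KB q * cyc (decay (T n)) q) ∂(μ.prod (μ.prod (μ.prod μ))) := by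
            refine mul_le_mul_right (lintegral_mono fun q => ?_) _
            dsimp only
            rw [← add_mul, ← add_mul, ← add_mul]
            refine mul_le_mul_left ?_ _
            have := enorm_mul4_sub_le (f q.1) (g q.2.1) (f q.2.2.1) (g q.2.2.2) (f' q.1) (g' q.2.1)
              (f' q.2.2.1) (g' q.2.2.2) (hfle _) (hgle _) (hfle _)
            simp only [hfs, hgs] at this
            exact this
        _ = decayForm μ (T n) FA K F K + decayForm μ (T n) F KB F K + decayForm μ (T n) F K FA K +
            decayForm μ (T n) F K F KB := by
            simp only [decayForm, ← mul_add]
            congr 1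
            rw [← lintegral_add_left (by exact q1), ← lintegral_add_left (by exact q1.add q2),
              ← lintegral_add_left (by exact (q1.add q2).add q3)]
        _ ≤ (E * ε) ^ (1 / 2 : ℝ) + (E * ε) ^ (1 / 2 : ℝ) + (E * ε) ^ (1 / 2 : ℝ) +
            (E * ε) ^ (1 / 2 : ℝ) := add_le_add (add_le_add (add_le_add t1 t2) t3) t4
        _ = _ := by ring
    rw [show energy μ T H n f g - c * ∫ u, f u ^ 2 * g u ^ 2 ∂μ =
      (energy μ T H n f g - energy μ T H n f' g') +
      (energy μ T H n f' g' - c * ∫ u, f' u ^ 2 * g' u ^ 2 ∂μ) +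
      (c * ∫ u, f' u ^ 2 * g' u ^ 2 ∂μ - c * ∫ u, f u ^ 2 * g u ^ 2 ∂μ) by ring]
    exact (enorm_add_le _ _).trans (add_le_add ((enorm_add_le _ _).trans
      (add_le_add hdiff hn3.le)) hcI)
  have hcont : Tendsto (fun ε : ℝ≥0∞ => (C : ℝ≥0∞) ^ 4 * (4 * (E * ε) ^ (1 / 2 : ℝ)) + ε +
      2 * (C ^ 4 * ε)) (𝓝 0) (𝓝 0) := by
    have hC : (C : ℝ≥0∞) ^ 4 ≠ ∞ := pow_ne_top coe_ne_top
    have a1 : Tendsto (fun ε : ℝ≥0∞ => E * ε) (𝓝 0) (𝓝 (E * 0)) :=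
      ENNReal.Tendsto.const_mul tendsto_id (Or.inr hEt)
    have a2 := ((ENNReal.continuous_rpow_const (y := 1 / 2)).tendsto (E * 0)).comp a1
    have a3 := ENNReal.Tendsto.const_mul (a := (C : ℝ≥0∞) ^ 4)
      (ENNReal.Tendsto.const_mul (a := 4) a2 (Or.inr (by norm_num))) (Or.inr hC)
    have a0 : Tendsto (fun ε : ℝ≥0∞ => (C : ℝ≥0∞) ^ 4 * ε) (𝓝 0) (𝓝 ((C : ℝ≥0∞) ^ 4 * 0)) :=
      ENNReal.Tendsto.const_mul tendsto_id (Or.inr hC)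
    have a4 := ENNReal.Tendsto.const_mul (a := 2) a0 (Or.inr (by norm_num))
    have a5 := (a3.add tendsto_id).add a4
    simpa using a5
  rw [ENNReal.tendsto_nhds_zero]
  intro η hη
  obtain ⟨δ, hδ, hδ'⟩ := (ENNReal.nhds_zero_basis.eventually_iff).1 (ENNReal.tendsto_nhds_zero.1 hcont η hη)
  obtain ⟨ε, hε0, hεδ⟩ := exists_between hδ
  filter_upwards [main ε hε0 (hεδ.trans_le le_top).ne] with n hn
  exact hn.trans (hδ' hεδ)

/-- Domination of `f(x)² g(u)²` by a sum bounds the energy majorants. -/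
lemma decayEnergy_le_of_dom (hμ : RadiallyDominated μ) {t : ℝ} (ht : 0 < t) (hfm : Measurable f)
    (hgm : Measurable g) {P R : G → ℝ≥0∞} (hP : Measurable P) (hR : Measurable R)
    (hd : ∀ x u, ‖f x‖ₑ ^ 2 * ‖g u‖ₑ ^ 2 ≤ P x + R u) :
    decayEnergy μ t f g ≤ 16 * decayConst ^ 3 * (2 * (∫⁻ x, P x ∂μ + ∫⁻ x, R x ∂μ)) := by
  rw [decayEnergy, decayForm_eq_weight hfm.enorm hgm.enorm hfm.enorm hgm.enorm]
  have hmul : ∀ a b : ℝ≥0∞, a * b ≤ a ^ 2 + b ^ 2 := fun a b => by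
    rcases le_total a b with hab | hab
    · exact (mul_le_mul_left hab b).trans (by rw [← pow_two]; exact le_add_self)
    · exact (mul_le_mul_right hab a).trans (by rw [← pow_two]; exact le_self_add)
  have hin : ∀ z : G × G × G, ∫⁻ u, ‖f u‖ₑ * ‖g (u - z.1)‖ₑ * ‖f (u - z.2.1)‖ₑ *
      ‖g (u - z.2.2)‖ₑ ∂μ ≤ 2 * (∫⁻ x, P x ∂μ + ∫⁻ x, R x ∂μ) := by
    intro z
    calc _ ≤ ∫⁻ u, (P u + R (u - z.1) + (P (u - z.2.1) + R (u - z.2.2))) ∂μ := by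
          refine lintegral_mono fun u => ?_
          dsimp only
          rw [mul_assoc (‖f u‖ₑ * _)]
          refine (hmul _ _).trans (add_le_add ?_ ?_)
          · rw [mul_pow]; exact hd _ _
          · rw [mul_pow]; exact hd _ _
      _ = _ := by
          have m : ∀ {Q : G → ℝ≥0∞}, Measurable Q → ∀ w : G, Measurable fun u => Q (u - w) :=
            fun hQ w => hQ.comp (measurable_sub_const w)
          rw [lintegral_add_left (by exact hP.add (m hR _)), lintegral_add_left hP,
            lintegral_add_left (by exact m hP _), lintegral_sub_right_eq_self R,
            lintegral_sub_right_eq_self P, lintegral_sub_right_eq_self R]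
          ring
  calc _ ≤ ∫⁻ z, weight t z * (2 * (∫⁻ x, P x ∂μ + ∫⁻ x, R x ∂μ)) ∂(μ.prod (μ.prod μ)) :=
        lintegral_mono fun z => mul_le_mul_right (hin z) _
    _ ≤ _ := by
        rw [lintegral_mul_const _ (measurable_weight t)]
        exact mul_le_mul_left (lintegral_weight_le hμ ht) _

lemma sq_add_le_two_mul (a b : ℝ≥0∞) : (a + b) ^ 2 ≤ 2 * a ^ 2 + 2 * b ^ 2 := by
  have := ENNReal.rpow_add_le_mul_rpow_add_rpow a b (p := 2) (by norm_num)
  norm_num at this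
  rwa [mul_add] at this

/-- A uniform bound on the energy majorants from a splitting of `f`. -/
lemma decayEnergy_le_of_split (hμ : RadiallyDominated μ) {t : ℝ} (ht : 0 < t) (hfm : Measurable f)
    (hgm : Measurable g) {A : Set G} (hA : MeasurableSet A) {M : ℝ≥0}
    (hM : ∀ x ∉ A, ‖f x‖ ≤ M) {E : ℝ≥0∞} (hE : decayEnergy μ t (A.indicator f) g ≤ E) :
    decayEnergy μ t f g ≤
      4 * E + 4 * (16 * decayConst ^ 3 * (2 * (M ^ 2 * ∫⁻ x, ‖g x‖ₑ ^ 2 ∂μ))) := by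
  set f' := Aᶜ.indicator f with hf'
  set f'' := A.indicator f with hf''
  have mf' : Measurable f' := hfm.indicator hA.compl
  have mf'' : Measurable f'' := hfm.indicator hA
  have hb : decayEnergy μ t f' g ≤
      16 * decayConst ^ 3 * (2 * (M ^ 2 * ∫⁻ x, ‖g x‖ₑ ^ 2 ∂μ)) := by
    have := decayEnergy_le_of_dom (μ := μ) hμ ht mf' hgm (P := fun _ => 0)
      (R := fun u => (M : ℝ≥0∞) ^ 2 * ‖g u‖ₑ ^ 2) measurable_const
      ((hgm.enorm.pow_const 2).const_mul _) (fun x u => ?_)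
    · rwa [lintegral_zero, zero_add, lintegral_const_mul _ (hgm.enorm.pow_const 2)] at this
    · rw [zero_add]
      gcongr
      by_cases hx : x ∈ A
      · rw [hf', indicator_of_notMem (by simpa using hx)]; simp
      · rw [hf', indicator_of_mem (by simpa using hx), ← ofReal_norm, ← ofReal_coe_nnreal]
        exact ofReal_le_ofReal (hM x hx)
  have hsum : ∀ x, ‖f x‖ₑ ≤ ‖f'' x‖ₑ + ‖f' x‖ₑ := fun x => by
    have : f x = f'' x + f' x := (congrFun (indicator_self_add_compl A f) x).symm
    rw [this]; exact enorm_add_le _ _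
  have hcross : ∀ {X Y Z : ℝ≥0∞}, X ^ 2 ≤ Y * Z → X ≤ Y + Z := by
    intro X Y Z hX
    by_contra hc
    rw [not_le] at hc
    have := ENNReal.pow_lt_pow_left two_ne_zero hc
    refine absurd (this.trans_le hX) (not_lt.2 ?_)
    rw [pow_two]
    exact mul_le_mul' le_self_add le_add_self
  set K : G → ℝ≥0∞ := fun x => ‖g x‖ₑ
  set F' : G → ℝ≥0∞ := fun x => ‖f' x‖ₑ
  set F'' : G → ℝ≥0∞ := fun x => ‖f'' x‖ₑ
  have mK : Measurable K := hgm.enorm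
  have mF' : Measurable F' := mf'.enorm
  have mF'' : Measurable F'' := mf''.enorm
  have mc : Measurable (cyc (decay t) : G × G × G × G → ℝ≥0∞) := measurable_cyc measurable_decay
  have c1 := hcross (decayForm_sq_le' (μ := μ) (T := t) mF'' mK mF' mK)
  have c2 := hcross (decayForm_sq_le' (μ := μ) (T := t) mF' mK mF'' mK)
  have q1 := (measurable_tens4 mF'' mK mF'' mK).mul mc
  have q2 := (measurable_tens4 mF'' mK mF' mK).mul mc
  have q3 := (measurable_tens4 mF' mK mF'' mK).mul mc
  calc decayEnergy μ t f g ≤ ofReal t ^ 3 * ∫⁻ q, (tens4 F'' K F'' K q * cyc (decay t) q +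
        tens4 F'' K F' K q * cyc (decay t) q + tens4 F' K F'' K q * cyc (decay t) q +
        tens4 F' K F' K q * cyc (decay t) q) ∂(μ.prod (μ.prod (μ.prod μ))) := by
        refine mul_le_mul_right (lintegral_mono fun q => ?_) _
        dsimp only
        rw [← add_mul, ← add_mul, ← add_mul]
        refine mul_le_mul_left ?_ _
        simp only [tens4]
        calc _ ≤ (F'' q.1 + F' q.1) * K q.2.1 * (F'' q.2.2.1 + F' q.2.2.1) * K q.2.2.2 := by
              gcongr
              exacts [hsum _, hsum _]
          _ = _ := by ring
    _ = decayForm μ t F'' K F'' K + decayForm μ t F'' K F' K + decayForm μ t F' K F'' K +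
          decayForm μ t F' K F' K := by
        simp only [decayForm, ← mul_add]
        congr 1
        rw [← lintegral_add_left (by exact q1), ← lintegral_add_left (by exact q1.add q2),
          ← lintegral_add_left (by exact (q1.add q2).add q3)]
    _ ≤ decayForm μ t F'' K F'' K + (decayForm μ t F'' K F'' K + decayForm μ t F' K F' K) +
          (decayForm μ t F' K F' K + decayForm μ t F'' K F'' K) + decayForm μ t F' K F' K := by
        gcongr
    _ = 3 * decayEnergy μ t f'' g + 3 * decayEnergy μ t f' g := by simp only [decayEnergy]; ring
    _ ≤ 4 * E + 4 * (16 * decayConst ^ 3 * (2 * (M ^ 2 * ∫⁻ x, ‖g x‖ₑ ^ 2 ∂μ))) := by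
        gcongr
        · norm_num
        · norm_num

end Tight

/-! ### Conditions on the convolutions -/

section Shift

variable {T : ℕ → ℝ} {H : ℕ → G → ℂ} {C : ℝ≥0} {c : ℝ} {f g : G → ℝ}

/-- Convergence of the energies when the convolution is continuous at the origin. -/
theorem TaperedKernels.tendsto_energy_of_conv4 (h : TaperedKernels μ T H C c)
    (hfm : Measurable f) (hgm : Measurable g) (hf : Integrable f μ) (hg : Integrable g μ)
    (hf0 : ∀ x, 0 ≤ f x) (h2 : MemLp (conv4 μ f g f g) 2 (μ.prod (μ.prod μ)))
    (hc : ContinuousAt (conv4 μ f g f g) 0) :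
    Integrable (fun u => f u ^ 2 * g u ^ 2) μ ∧
      Tendsto (fun n => energy μ T H n f g) atTop (𝓝 (c * ∫ u, f u ^ 2 * g u ^ 2 ∂μ)) := by
  have h1 := h.tendsto_normForm_of_conv4 hfm hgm hfm hgm hf hg hf hg hc
    fun δ hδ => h.tendsto_memLp_far h2 hδ
  simp_rw [normForm_self h _ hf hg] at h1
  have h3 := (Complex.continuous_re.tendsto _).comp h1
  simp only [Complex.ofReal_re, Function.comp_def] at h3
  have h4 : Tendsto (fun n => energy μ T H n f g) atTop (𝓝 (c * ∫ u, f u ^ 2 * g u ^ 2 ∂μ)) := by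
    convert h3 using 4
    funext u; ring
  exact ⟨h.integrable_of_tendsto_energy hfm hgm hf hg hf0 h4, h4⟩

lemma memLp_conv4 (hfm : Measurable f) (hgm : Measurable g) (hf : Integrable f μ)
    (hf2 : MemLp f 2 μ) (hg2 : MemLp g 2 μ) :
    MemLp (conv4 μ f g f g) 2 (μ.prod (μ.prod μ)) := by
  refine ⟨(measurable_conv4 hfm hgm hfm hgm).aestronglyMeasurable, ?_⟩
  have hfin : ∀ {k : G → ℝ}, MemLp k 2 μ → ∫⁻ u, ‖k u‖ₑ ^ 2 ∂μ ≠ ∞ := fun hk => by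
    rw [← eLpNorm_two_sq]; exact pow_ne_top hk.2.ne
  suffices hs : eLpNorm (conv4 μ f g f g) 2 (μ.prod (μ.prod μ)) ^ 2 < ∞ by
    by_contra hc
    rw [not_lt, top_le_iff] at hc
    simp [hc] at hs
  have m2 : Measurable fun u => ‖f u‖ₑ ^ 2 := hfm.enorm.pow_const 2
  have n2 : Measurable fun u => ‖g u‖ₑ ^ 2 := hgm.enorm.pow_const 2
  rw [eLpNorm_two_sq]
  calc _ ≤ ∫⁻ z : G × G × G, (∫⁻ u, ‖f u‖ₑ ∂μ) * ∫⁻ u, ‖f u‖ₑ * (‖g (u - z.1)‖ₑ ^ 2 *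
        (‖f (u - z.2.1)‖ₑ ^ 2 * ‖g (u - z.2.2)‖ₑ ^ 2)) ∂μ ∂(μ.prod (μ.prod μ)) := by
        refine lintegral_mono fun z => ?_
        have hm : Measurable fun u => ‖g (u - z.1)‖ₑ * (‖f (u - z.2.1)‖ₑ * ‖g (u - z.2.2)‖ₑ) := by
          fun_prop
        have hr : ∀ a : ℝ≥0∞, (a ^ (1 / 2 : ℝ)) ^ 2 = a := fun a => by
          rw [← ENNReal.rpow_two, ← ENNReal.rpow_mul]; norm_num
        have := lintegral_mul_sq_le μ (f := fun u => ‖f u‖ₑ ^ (1 / 2 : ℝ))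
          (g := fun u => ‖f u‖ₑ ^ (1 / 2 : ℝ) * (‖g (u - z.1)‖ₑ * (‖f (u - z.2.1)‖ₑ *
            ‖g (u - z.2.2)‖ₑ))) (hfm.enorm.pow_const _).aemeasurable
          ((hfm.enorm.pow_const _).mul hm).aemeasurable
        simp only [mul_pow, hr] at this
        refine le_trans (pow_le_pow_left' ((enorm_integral_le_lintegral_enorm _).trans
          (le_of_eq (lintegral_congr fun u => ?_))) 2) this
        rw [← mul_assoc, ← pow_two, hr]
        simp only [enorm_mul, mul_assoc]
    _ = (∫⁻ u, ‖f u‖ₑ ∂μ) * ∫⁻ u, ‖f u‖ₑ * ((∫⁻ x, ‖g x‖ₑ ^ 2 ∂μ) *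
        ((∫⁻ x, ‖f x‖ₑ ^ 2 ∂μ) * ∫⁻ x, ‖g x‖ₑ ^ 2 ∂μ)) ∂μ := by
        have hm : Measurable fun q : (G × G × G) × G => ‖f q.2‖ₑ * (‖g (q.2 - q.1.1)‖ₑ ^ 2 *
            (‖f (q.2 - q.1.2.1)‖ₑ ^ 2 * ‖g (q.2 - q.1.2.2)‖ₑ ^ 2)) := by fun_prop
        rw [lintegral_const_mul _ (Measurable.lintegral_prod_right' hm)]
        congr 1
        rw [lintegral_lintegral_swap (by exact hm.aemeasurable)]
        refine lintegral_congr fun u => ?_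
        have hs : ∀ {k : G → ℝ≥0∞}, Measurable k → Measurable fun x => k (u - x) :=
          fun hk => hk.comp (measurable_const_sub u)
        have ht : ∀ {k : G → ℝ≥0∞}, Measurable k → ∫⁻ x, k (u - x) ∂μ = ∫⁻ x, k x ∂μ := fun hk =>
          (Measure.measurePreserving_sub_left μ u).lintegral_comp hk
        have hp : ∫⁻ z : G × G × G, ‖g (u - z.1)‖ₑ ^ 2 * (‖f (u - z.2.1)‖ₑ ^ 2 *
            ‖g (u - z.2.2)‖ₑ ^ 2) ∂(μ.prod (μ.prod μ)) = (∫⁻ x, ‖g x‖ₑ ^ 2 ∂μ) *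
            ((∫⁻ x, ‖f x‖ₑ ^ 2 ∂μ) * ∫⁻ x, ‖g x‖ₑ ^ 2 ∂μ) := by
          rw [lintegral_prod_mul (f := fun x => ‖g (u - x)‖ₑ ^ 2)
            (g := fun y : G × G => ‖f (u - y.1)‖ₑ ^ 2 * ‖g (u - y.2)‖ₑ ^ 2)
            (hs n2).aemeasurable (by fun_prop),
            lintegral_prod_mul (f := fun x => ‖f (u - x)‖ₑ ^ 2) (g := fun x => ‖g (u - x)‖ₑ ^ 2)
            (hs m2).aemeasurable (hs n2).aemeasurable, ht n2, ht m2]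
        dsimp only
        rw [lintegral_const_mul _ (by fun_prop), hp]
    _ < ∞ := by
        rw [lintegral_mul_const _ hfm.enorm]
        exact mul_lt_top hf.2 (mul_lt_top hf.2 (mul_lt_top
          (hfin hg2).lt_top (mul_lt_top (hfin hf2).lt_top (hfin hg2).lt_top)))

/-- If the `L²` norms of the products `f(u) g(u - m)` are continuous at `m = 0`, so are the
products. -/
lemma tendsto_mul_translate (hfm : Measurable f) (hgm : Measurable g) (hg2 : MemLp g 2 μ)
    (hfg : ∫⁻ u, ‖f u‖ₑ ^ 2 * ‖g u‖ₑ ^ 2 ∂μ ≠ ∞)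
    (hs : Tendsto (fun m => ∫⁻ u, ‖f u‖ₑ ^ 2 * ‖g (u - m)‖ₑ ^ 2 ∂μ) (𝓝 0)
      (𝓝 (∫⁻ u, ‖f u‖ₑ ^ 2 * ‖g u‖ₑ ^ 2 ∂μ))) :
    Tendsto (fun m => ∫⁻ u, ‖f u * g (u - m) - f u * g u‖ₑ ^ 2 ∂μ) (𝓝 0) (𝓝 0) := by
  set S : ℕ → Set G := fun k => {x | (k : ℝ) < |f x|} with hS
  have hSm : ∀ k, MeasurableSet (S k) := fun k => measurableSet_lt measurable_const hfm.abs
  set c : ℕ → G → ℝ≥0∞ := fun k m => ∫⁻ u, ‖(S k).indicator f u‖ₑ ^ 2 * ‖g (u - m)‖ₑ ^ 2 ∂μ with hc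
  set b : ℕ → ℝ≥0∞ := fun k => ∫⁻ u, ‖(S k)ᶜ.indicator f u‖ₑ ^ 2 * ‖g u‖ₑ ^ 2 ∂μ with hb
  set a : G → ℝ≥0∞ := fun m => ∫⁻ u, ‖f u‖ₑ ^ 2 * ‖g (u - m)‖ₑ ^ 2 ∂μ with ha
  have ha0 : a 0 = ∫⁻ u, ‖f u‖ₑ ^ 2 * ‖g u‖ₑ ^ 2 ∂μ := by simp [ha]
  rw [← ha0] at hs hfg
  have hIm : ∀ k, Measurable ((S k).indicator f) := fun k => hfm.indicator (hSm k)
  have hIm' : ∀ k, Measurable ((S k)ᶜ.indicator f) := fun k => hfm.indicator (hSm k).compl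
  have hsplit : ∀ k x, ‖f x‖ₑ ^ 2 =
      ‖(S k).indicator f x‖ₑ ^ 2 + ‖(S k)ᶜ.indicator f x‖ₑ ^ 2 := fun k x => by
    by_cases hx : x ∈ S k <;> simp [hx]
  have hbd : ∀ k x, ‖(S k)ᶜ.indicator f x‖ₑ ≤ k := fun k x => by
    by_cases hx : x ∈ S k
    · simp [hx]
    · rw [indicator_of_mem (by simpa using hx), ← ofReal_norm, ← ENNReal.ofReal_natCast]
      exact ofReal_le_ofReal (not_lt.1 hx)
  have hgs : Tendsto (fun m => ∫⁻ u, ‖g (u - m) - g u‖ₑ ^ 2 ∂μ) (𝓝 0) (𝓝 0) := by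
    have := ENNReal.Tendsto.pow (n := 2) (tendsto_eLpNorm_translate (by norm_num) (by norm_num) hg2)
    simpa [eLpNorm_two_sq] using this
  have hgq : Tendsto (fun m => ∫⁻ u, ‖g (u - m) ^ 2 - g u ^ 2‖ₑ ∂μ) (𝓝 0) (𝓝 0) :=
    tendsto_lintegral_translate (g := fun u => g u ^ 2) hg2.integrable_sq
  have hab : ∀ k, a 0 = c k 0 + b k := fun k => by
    simp only [ha, hc, hb, sub_zero]
    rw [← lintegral_add_left (by fun_prop)]
    exact lintegral_congr fun u => by rw [hsplit k, add_mul]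
  have hbt : ∀ k, b k ≠ ∞ := fun k => ne_top_of_le_ne_top hfg (by rw [hab k]; exact le_add_self)
  have hcm : ∀ k m, c k m ≤
      a m + (k : ℝ≥0∞) ^ 2 * ∫⁻ u, ‖g (u - m) ^ 2 - g u ^ 2‖ₑ ∂μ - b k := by
    intro k m
    refine ENNReal.le_sub_of_add_le_right (hbt k) ?_
    rw [hc, hb, ha]
    dsimp only
    rw [← lintegral_add_left (by fun_prop), ← lintegral_const_mul _ (by fun_prop),
      ← lintegral_add_left (by fun_prop)]
    refine lintegral_mono fun u => ?_
    dsimp only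
    rw [hsplit k u, add_mul, add_assoc]
    refine add_le_add_right ?_ _
    have : ‖g u‖ₑ ^ 2 ≤ ‖g (u - m)‖ₑ ^ 2 + ‖g (u - m) ^ 2 - g u ^ 2‖ₑ := by
      rw [← enorm_pow, ← enorm_pow]
      calc _ = ‖g (u - m) ^ 2 - (g (u - m) ^ 2 - g u ^ 2)‖ₑ := by rw [sub_sub_cancel]
        _ ≤ _ := enorm_sub_le
    refine (mul_le_mul_right this _).trans ?_
    rw [mul_add]
    exact add_le_add_right (mul_le_mul_left (pow_le_pow_left' (hbd k u) 2) _) _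
  have hmain : ∀ (k : ℕ) m, ∫⁻ u, ‖f u * g (u - m) - f u * g u‖ₑ ^ 2 ∂μ ≤
      (k : ℝ≥0∞) ^ 2 * (∫⁻ u, ‖g (u - m) - g u‖ₑ ^ 2 ∂μ) + 2 * c k m + 2 * c k 0 := by
    intro k m
    rw [hc]
    dsimp only
    rw [← lintegral_const_mul _ (by fun_prop), ← lintegral_const_mul _ (by fun_prop),
      ← lintegral_const_mul _ (by fun_prop), ← lintegral_add_left (by fun_prop),
      ← lintegral_add_left (by fun_prop)]
    refine lintegral_mono fun u => ?_
    dsimp only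
    rw [← mul_sub, enorm_mul, mul_pow, hsplit k u, sub_zero, add_mul, add_comm, add_assoc]
    refine add_le_add (mul_le_mul_left (pow_le_pow_left' (hbd k u) 2) _) ?_
    have h1 : ‖g (u - m) - g u‖ₑ ^ 2 ≤ 2 * ‖g (u - m)‖ₑ ^ 2 + 2 * ‖g u‖ₑ ^ 2 :=
      (pow_le_pow_left' enorm_sub_le 2).trans (sq_add_le_two_mul _ _)
    refine (mul_le_mul_right h1 _).trans (le_of_eq ?_)
    ring
  have hlim : ∀ k : ℕ, Tendsto (fun m => (k : ℝ≥0∞) ^ 2 * (∫⁻ u, ‖g (u - m) - g u‖ₑ ^ 2 ∂μ) +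
      2 * (a m + (k : ℝ≥0∞) ^ 2 * ∫⁻ u, ‖g (u - m) ^ 2 - g u ^ 2‖ₑ ∂μ - b k) + 2 * c k 0) (𝓝 0)
      (𝓝 (4 * c k 0)) := by
    intro k
    have hk : ((k : ℝ≥0∞) ^ 2) ≠ ∞ := pow_ne_top (ENNReal.natCast_ne_top k)
    have t1 := ENNReal.Tendsto.const_mul (a := (k : ℝ≥0∞) ^ 2) hgs (Or.inr hk)
    have t2 := hs.add (ENNReal.Tendsto.const_mul (a := (k : ℝ≥0∞) ^ 2) hgq (Or.inr hk))
    have t3 := ENNReal.Tendsto.sub t2 (tendsto_const_nhds (x := b k)) (Or.inr (hbt k))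
    have t4 := (t1.add (ENNReal.Tendsto.const_mul (a := 2) t3 (Or.inr (by norm_num)))).add
      (tendsto_const_nhds (x := 2 * c k 0))
    convert t4 using 2
    rw [mul_zero, zero_add, add_zero, hab k, ENNReal.add_sub_cancel_right (hbt k)]
    ring
  have hc0 : Tendsto (fun k => 4 * c k 0) atTop (𝓝 0) := by
    have : Tendsto (fun k => c k 0) atTop (𝓝 (∫⁻ _, 0 ∂μ)) := by
      refine tendsto_lintegral_of_dominated_convergence (fun u => ‖f u‖ₑ ^ 2 * ‖g u‖ₑ ^ 2)
        (fun k => by fun_prop) (fun k => ae_of_all _ fun u => ?_) (by rwa [← ha0])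
        (ae_of_all _ fun u => ?_)
      · dsimp only
        rw [sub_zero]
        gcongr
        exact enorm_indicator_le_enorm_self _ _
      · obtain ⟨k₀, hk₀⟩ := exists_nat_ge |f u|
        refine tendsto_const_nhds.congr' ?_
        filter_upwards [eventually_ge_atTop k₀] with k hk
        have : u ∉ S k := not_lt.2 (hk₀.trans (by exact_mod_cast hk))
        rw [indicator_of_notMem this]
        simp
    have := ENNReal.Tendsto.const_mul (a := 4) this (Or.inr (by norm_num))
    simpa using this
  rw [ENNReal.tendsto_nhds_zero]
  intro ε hε
  obtain ⟨k, hk⟩ := ((tendsto_order.1 hc0).2 ε hε).exists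
  filter_upwards [(tendsto_order.1 (hlim k)).2 ε hk] with m hm
  refine (hmain k m).trans (le_trans ?_ hm.le)
  gcongr
  exact hcm k m

lemma continuousAt_conv4_of_translate (hfm : Measurable f) (hgm : Measurable g)
    (hg2 : MemLp g 2 μ) (hfg : ∫⁻ u, ‖f u‖ₑ ^ 2 * ‖g u‖ₑ ^ 2 ∂μ ≠ ∞)
    (hs : Tendsto (fun m => ∫⁻ u, ‖f u‖ₑ ^ 2 * ‖g (u - m)‖ₑ ^ 2 ∂μ) (𝓝 0)
      (𝓝 (∫⁻ u, ‖f u‖ₑ ^ 2 * ‖g u‖ₑ ^ 2 ∂μ))) : ContinuousAt (conv4 μ f g f g) 0 := by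
  set F : G → G → ℝ := fun m u => f u * g (u - m) with hF
  have hFm : ∀ m, Measurable (F m) := fun m => by fun_prop
  have e1 : ∀ m, eLpNorm (F m) 2 μ ^ 2 = ∫⁻ u, ‖f u‖ₑ ^ 2 * ‖g (u - m)‖ₑ ^ 2 ∂μ := fun m => by
    rw [eLpNorm_two_sq]; simp only [hF, enorm_mul, mul_pow]
  have hfin : ∀ᶠ m in 𝓝 (0 : G), MemLp (F m) 2 μ := by
    filter_upwards [(tendsto_order.1 hs).2 _ hfg.lt_top] with m hm
    refine ⟨(hFm m).aestronglyMeasurable, ?_⟩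
    rw [← e1] at hm
    by_contra hc
    rw [not_lt, top_le_iff] at hc
    simp [hc] at hm
  have hF0 : MemLp (F 0) 2 μ := hfin.self_of_nhds
  have hd : Tendsto (fun m => eLpNorm (F m - F 0) 2 μ) (𝓝 0) (𝓝 0) := by
    have := (ENNReal.continuous_rpow_const (y := 1 / 2)).tendsto 0 |>.comp
      (tendsto_mul_translate hfm hgm hg2 hfg hs)
    rw [ENNReal.zero_rpow_of_pos (by norm_num)] at this
    refine this.congr fun m => ?_
    have : ∫⁻ u, ‖f u * g (u - m) - f u * g u‖ₑ ^ 2 ∂μ = eLpNorm (F m - F 0) 2 μ ^ 2 := by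
      rw [eLpNorm_two_sq]; simp [hF]
    rw [Function.comp_apply, this, ← ENNReal.rpow_two, ← ENNReal.rpow_mul]
    norm_num
  have htr : Tendsto (fun m => eLpNorm (fun u => F 0 (u - m) - F 0 u) 2 μ) (𝓝 0) (𝓝 0) :=
    tendsto_eLpNorm_translate (by norm_num) (by norm_num) hF0
  have hconv : ∀ z : G × G × G, conv4 μ f g f g z = ∫ u, F z.1 u * F (z.2.2 - z.2.1) (u - z.2.1) ∂μ :=
    fun z => integral_congr_ae (ae_of_all _ fun u => by
      simp only [hF, sub_sub, add_sub_cancel]; ring)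
  have l1 : Tendsto (fun z : G × G × G => z.1) (𝓝 0) (𝓝 0) := continuous_fst.tendsto' _ _ rfl
  have l2 : Tendsto (fun z : G × G × G => z.2.1) (𝓝 0) (𝓝 0) :=
    (continuous_fst.comp continuous_snd).tendsto' _ _ rfl
  have l3 : Tendsto (fun z : G × G × G => z.2.2 - z.2.1) (𝓝 0) (𝓝 0) :=
    Continuous.tendsto' (by fun_prop) _ _ (by simp)
  have hUn : ∀ {k : G → ℝ} (_ : Measurable k) (w : G), eLpNorm (fun u => k (u - w)) 2 μ = eLpNorm k 2 μ :=
    fun hk w => eLpNorm_comp_measurePreserving hk.aestronglyMeasurable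
      (measurePreserving_sub_right μ w)
  rw [ContinuousAt, ← tendsto_sub_nhds_zero_iff, tendsto_zero_iff_enorm_tendsto_zero]
  set N := eLpNorm (F 0) 2 μ with hN
  have hNt : N ≠ ∞ := hF0.2.ne
  have hb : Tendsto (fun z : G × G × G => eLpNorm (F z.1 - F 0) 2 μ *
      (eLpNorm (F (z.2.2 - z.2.1) - F 0) 2 μ + N) + N * (eLpNorm (F (z.2.2 - z.2.1) - F 0) 2 μ +
        eLpNorm (fun u => F 0 (u - z.2.1) - F 0 u) 2 μ)) (𝓝 0) (𝓝 0) := by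
    have t := (ENNReal.Tendsto.mul (hd.comp l1) (Or.inr (by simpa using hNt))
      ((hd.comp l3).add_const N) (Or.inr ENNReal.zero_ne_top)).add (ENNReal.Tendsto.const_mul (a := N)
      ((hd.comp l3).add (htr.comp l2)) (Or.inr hNt))
    simpa [Function.comp_def] using t
  refine tendsto_of_tendsto_of_tendsto_of_le_of_le' tendsto_const_nhds hb
    (Eventually.of_forall fun _ => bot_le) ?_
  filter_upwards [l1.eventually hfin, l3.eventually hfin] with z h1 h3
  set V : G → ℝ := fun u => F (z.2.2 - z.2.1) (u - z.2.1) with hV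
  have hVm : Measurable V := (hFm _).comp (measurable_sub_const _)
  have hV2 : MemLp V 2 μ := h3.comp_measurePreserving (measurePreserving_sub_right μ z.2.1)
  have hz0 : conv4 μ f g f g 0 = ∫ u, F 0 u * F 0 u ∂μ := by simp [conv4, hF, mul_assoc]
  have hmulle : ∀ {p q : G → ℝ}, Measurable p → Measurable q →
      ∫⁻ u, ‖p u * q u‖ₑ ∂μ ≤ eLpNorm p 2 μ * eLpNorm q 2 μ := fun hp hq => by
    have := eLpNorm_smul_le_mul_eLpNorm (p := 2) (q := 2) (r := 1) (μ := μ)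
      hq.aestronglyMeasurable hp.aestronglyMeasurable
    rwa [eLpNorm_one_eq_lintegral_enorm] at this
  have hVn : eLpNorm V 2 μ ≤ eLpNorm (F (z.2.2 - z.2.1) - F 0) 2 μ + N := by
    rw [hV, hUn (hFm _)]
    calc _ = eLpNorm (F (z.2.2 - z.2.1) - F 0 + F 0) 2 μ := by rw [sub_add_cancel]
      _ ≤ _ := eLpNorm_add_le ((hFm _).sub (hFm _)).aestronglyMeasurable
        (hFm 0).aestronglyMeasurable (by norm_num)
  have hVd : eLpNorm (V - F 0) 2 μ ≤ eLpNorm (F (z.2.2 - z.2.1) - F 0) 2 μ +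
      eLpNorm (fun u => F 0 (u - z.2.1) - F 0 u) 2 μ := by
    rw [← hUn ((hFm _).sub (hFm _)) z.2.1]
    refine le_trans (le_of_eq ?_) (eLpNorm_add_le
      (((hFm (z.2.2 - z.2.1)).sub (hFm 0)).comp (measurable_sub_const z.2.1)).aestronglyMeasurable
      (((hFm 0).comp (measurable_sub_const z.2.1)).sub (hFm 0)).aestronglyMeasurable (by norm_num))
    congr 1
    funext u
    simp [hV]
  rw [hconv z, hz0, ← integral_sub (by exact h1.integrable_mul hV2)
    (by exact hF0.integrable_mul hF0)]
  calc _ ≤ ∫⁻ u, (‖(F z.1 - F 0) u * V u‖ₑ + ‖F 0 u * (V - F 0) u‖ₑ) ∂μ := by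
        refine (enorm_integral_le_lintegral_enorm _).trans (lintegral_mono fun u => ?_)
        refine le_trans (le_of_eq ?_) (enorm_add_le _ _)
        simp only [Pi.sub_apply, hV]; congr 1; ring
    _ = ∫⁻ u, ‖(F z.1 - F 0) u * V u‖ₑ ∂μ + ∫⁻ u, ‖F 0 u * (V - F 0) u‖ₑ ∂μ :=
        lintegral_add_left (((hFm _).sub (hFm _)).mul hVm).enorm _
    _ ≤ eLpNorm (F z.1 - F 0) 2 μ * eLpNorm V 2 μ + N * eLpNorm (V - F 0) 2 μ :=
        add_le_add (hmulle ((hFm _).sub (hFm _)) hVm) (hmulle (hFm _) (hVm.sub (hFm _)))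
    _ ≤ _ := by gcongr

/-- Convergence of the energies when the integrals `∫ f(u)² g(u - m)² du` are continuous at
`m = 0`. -/
theorem TaperedKernels.tendsto_energy_of_translate (h : TaperedKernels μ T H C c)
    (hfm : Measurable f) (hgm : Measurable g) (hf : Integrable f μ) (hg : Integrable g μ)
    (hf0 : ∀ x, 0 ≤ f x) (hf2 : MemLp f 2 μ) (hg2 : MemLp g 2 μ)
    (hfg : ∫⁻ u, ‖f u‖ₑ ^ 2 * ‖g u‖ₑ ^ 2 ∂μ ≠ ∞)
    (hs : Tendsto (fun m => ∫⁻ u, ‖f u‖ₑ ^ 2 * ‖g (u - m)‖ₑ ^ 2 ∂μ) (𝓝 0)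
      (𝓝 (∫⁻ u, ‖f u‖ₑ ^ 2 * ‖g u‖ₑ ^ 2 ∂μ))) :
    Integrable (fun u => f u ^ 2 * g u ^ 2) μ ∧
      Tendsto (fun n => energy μ T H n f g) atTop (𝓝 (c * ∫ u, f u ^ 2 * g u ^ 2 ∂μ)) :=
  h.tendsto_energy_of_conv4 hfm hgm hf hg hf0 (memLp_conv4 hfm hgm hf hf2 hg2)
    (continuousAt_conv4_of_translate hfm hgm hg2 hfg hs)

end Shift

/-! ### Integrability conditions -/

lemma memLp_of_integrable_of_le {X : Type*} [MeasurableSpace X] {μ : Measure X} {f : X → ℝ}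
    (hfm : Measurable f) (hf : Integrable f μ) {p r : ℝ≥0∞} (hp : MemLp f p μ) (h1 : 1 ≤ r) (hr : r ≤ p) : MemLp f r μ := by
  rcases eq_or_ne r ∞ with rfl | hrt
  · rwa [top_le_iff.1 hr] at hp
  set S : Set X := {x | 1 < ‖f x‖} with hS
  have hSm : MeasurableSet S := measurableSet_lt measurable_const hfm.norm
  have hfin : IsFiniteMeasure (μ.restrict S) :=
    ⟨by rw [Measure.restrict_apply_univ]; exact hf.measure_norm_gt_lt_top one_pos⟩
  have e1 : MemLp (S.indicator f) r μ := by
    rw [memLp_indicator_iff_restrict hSm]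
    exact (hp.restrict S).mono_exponent hr
  have e2 : MemLp (Sᶜ.indicator f) r μ := by
    refine ⟨(hfm.indicator hSm.compl).aestronglyMeasurable, ?_⟩
    have hr0 : r ≠ 0 := (zero_lt_one.trans_le h1).ne'
    rw [eLpNorm_lt_top_iff_lintegral_rpow_enorm_lt_top hr0 hrt]
    refine lt_of_le_of_lt (lintegral_mono fun x => ?_) hf.2
    by_cases hx : x ∈ S
    · have : 0 < r.toReal := ENNReal.toReal_pos hr0 hrt
      simp [hx, this]
    · rw [indicator_of_mem (by simpa using hx)]
      have h2 : ‖f x‖ₑ ≤ 1 := by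
        rw [← ofReal_norm, ← ENNReal.ofReal_one]
        exact ofReal_le_ofReal (not_lt.1 hx)
      have h3 : 1 ≤ r.toReal := by rw [← ENNReal.toReal_one]; exact ENNReal.toReal_mono hrt h1
      exact (ENNReal.rpow_le_rpow_of_exponent_ge h2 h3).trans (by rw [ENNReal.rpow_one])
  have := e1.add e2
  rwa [indicator_self_add_compl] at this

section SmallDom

variable {T : ℕ → ℝ} {H : ℕ → G → ℂ} {C : ℝ≥0} {c : ℝ} {f g : G → ℝ}

variable (μ) in
/-- The large values of `f` contribute arbitrarily little to the energy. -/
def SmallDom (f g : G → ℝ) : Prop :=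
  ∀ ε : ℝ≥0∞, 0 < ε → ∃ (A : Set G) (M : ℝ≥0) (P R : G → ℝ≥0∞), MeasurableSet A ∧
    (∀ x ∉ A, ‖f x‖ ≤ M) ∧ Measurable P ∧ Measurable R ∧
    (∀ x u, ‖A.indicator f x‖ₑ ^ 2 * ‖g u‖ₑ ^ 2 ≤ P x + R u) ∧ ∫⁻ x, P x ∂μ + ∫⁻ x, R x ∂μ ≤ ε

theorem TaperedKernels.tendsto_energy_of_smallDom (h : TaperedKernels μ T H C c)
    (hfm : Measurable f) (hgm : Measurable g) (hf : Integrable f μ) (hg : Integrable g μ)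
    (hg2 : MemLp g 2 μ) (h1 : SmallDom μ f g) (h2 : SmallDom μ g f) :
    Integrable (fun u => f u ^ 2 * g u ^ 2) μ ∧
      Tendsto (fun n => energy μ T H n f g) atTop (𝓝 (c * ∫ u, f u ^ 2 * g u ^ 2 ∂μ)) := by
  set K : ℝ≥0∞ := 16 * decayConst ^ 3 * 2 with hK
  have hKt : K ≠ ∞ := mul_ne_top (mul_ne_top (by norm_num)
    (pow_ne_top decayConst_ne_top)) (by norm_num)
  have key : ∀ {f g : G → ℝ}, Measurable f → Measurable g → SmallDom μ f g → ∀ ε : ℝ≥0∞, 0 < ε →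
      ∃ (A : Set G) (M : ℝ≥0), MeasurableSet A ∧ (∀ x ∉ A, ‖f x‖ ≤ M) ∧
        ∀ n, decayEnergy μ (T n) (A.indicator f) g ≤ ε := by
    intro f g hfm hgm hs ε hε
    have hε' : 0 < ε / K := ENNReal.div_pos hε.ne' hKt
    obtain ⟨A, M, P, R, hA, hM, hP, hR, hd, hI⟩ := hs _ hε'
    refine ⟨A, M, hA, hM, fun n => ?_⟩
    refine (decayEnergy_le_of_dom h.radial (h.T_pos n) (hfm.indicator hA) hgm hP hR hd).trans ?_
    rw [← mul_assoc, ← hK]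
    exact (mul_le_mul_right hI _).trans ENNReal.mul_div_le
  obtain ⟨A, M, hA, hM, hE⟩ := key hfm hgm h1 1 one_pos
  refine h.tendsto_energy_of_tight hfm hgm hf hg (E := 4 * 1 + 4 * (16 * decayConst ^ 3 *
    (2 * (M ^ 2 * ∫⁻ x, ‖g x‖ₑ ^ 2 ∂μ)))) ?_ (Eventually.of_forall fun n =>
      decayEnergy_le_of_split h.radial (h.T_pos n) hfm hgm hA hM (hE n)) fun ε hε => ?_
  · have hgt : ∫⁻ x, ‖g x‖ₑ ^ 2 ∂μ ≠ ∞ := by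
      rw [← eLpNorm_two_sq]; exact pow_ne_top hg2.2.ne
    have := decayConst_ne_top
    finiteness
  · obtain ⟨A, M, hA, hM, hE⟩ := key hfm hgm h1 ε hε
    obtain ⟨B, N, hB, hN, hE'⟩ := key hgm hfm h2 ε hε
    refine ⟨A, B, max M N, hA, hB, fun x hx => (hM x hx).trans (by simp),
      fun x hx => (hN x hx).trans (by simp), Eventually.of_forall fun n => ⟨hE n, ?_⟩⟩
    rw [decayEnergy_comm hfm (hgm.indicator hB)]
    exact hE' n

lemma tendsto_lintegral_gt (hfm : Measurable f) {φ : G → ℝ≥0∞} (hφm : Measurable φ)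
    (hφ : ∫⁻ x, φ x ∂μ ≠ ∞) :
    Tendsto (fun k : ℕ => ∫⁻ x, {x | (k : ℝ) < ‖f x‖}.indicator φ x ∂μ) atTop (𝓝 0) := by
  have : Tendsto (fun k : ℕ => ∫⁻ x, {x | (k : ℝ) < ‖f x‖}.indicator φ x ∂μ) atTop
      (𝓝 (∫⁻ _, 0 ∂μ)) := by
    refine tendsto_lintegral_of_dominated_convergence φ
      (fun k => hφm.indicator (measurableSet_lt measurable_const hfm.norm))
      (fun k => ae_of_all _ fun u => indicator_le_self _ _ _) hφ (ae_of_all _ fun u => ?_)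
    obtain ⟨k₀, hk₀⟩ := exists_nat_ge ‖f u‖
    refine tendsto_const_nhds.congr' ?_
    filter_upwards [eventually_ge_atTop k₀] with k hk
    have : u ∉ {x | (k : ℝ) < ‖f x‖} := not_lt.2 (hk₀.trans (by exact_mod_cast hk))
    rw [indicator_of_notMem this]
  simpa using this

lemma exists_bound_off_null (hfm : Measurable f) (hf : MemLp f ∞ μ) :
    ∃ (A : Set G) (M : ℝ≥0), MeasurableSet A ∧ μ A = 0 ∧ ∀ x ∉ A, ‖f x‖ ≤ M := by
  set M := (eLpNormEssSup f μ).toNNReal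
  have hM : (M : ℝ≥0∞) = eLpNormEssSup f μ :=
    ENNReal.coe_toNNReal (by simpa using hf.2.ne)
  refine ⟨{x | (M : ℝ) < ‖f x‖}, M, measurableSet_lt measurable_const hfm.norm, ?_,
    fun x hx => not_lt.1 hx⟩
  refine measure_mono_null (fun x hx => ?_) (meas_eLpNormEssSup_lt (f := f) (μ := μ))
  rw [mem_ofPred_eq, ← hM]
  have : M < ‖f x‖₊ := hx
  exact_mod_cast this

lemma smallDom_of_memLp_top (hfm : Measurable f) (hf : MemLp f ∞ μ) (g : G → ℝ) :
    SmallDom μ f g := by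
  intro ε _
  obtain ⟨A, M, hAm, hA0, hM⟩ := exists_bound_off_null hfm hf
  refine ⟨A, M, A.indicator fun _ => ∞, fun _ => 0, hAm, hM,
    measurable_const.indicator hAm, measurable_const, fun x u => ?_, ?_⟩
  · by_cases hx : x ∈ A <;> simp [hx]
  · rw [lintegral_indicator hAm]; simp [hA0]

lemma smallDom_of_memLp_two_top (hfm : Measurable f) (hgm : Measurable g) (hf : MemLp f 2 μ)
    (hg : MemLp g ∞ μ) : SmallDom μ f g := by
  intro ε hε
  obtain ⟨B, M, hB, hB0, hM⟩ := exists_bound_off_null hgm hg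
  have hfm2 : Measurable fun x => ‖f x‖ₑ ^ 2 := by fun_prop
  have hf2 : ∫⁻ x, ‖f x‖ₑ ^ 2 ∂μ ≠ ∞ := by rw [← eLpNorm_two_sq]; exact pow_ne_top hf.2.ne
  have ht2 := ENNReal.Tendsto.const_mul (a := (M : ℝ≥0∞) ^ 2)
    (tendsto_lintegral_gt (μ := μ) hfm hfm2 hf2) (Or.inr (pow_ne_top coe_ne_top))
  rw [mul_zero] at ht2
  obtain ⟨k, hk⟩ := ((tendsto_order.1 ht2).2 _ hε).exists
  have hAm : MeasurableSet {x | (k : ℝ) < ‖f x‖} := measurableSet_lt measurable_const hfm.norm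
  refine ⟨{x | (k : ℝ) < ‖f x‖}, k, fun x => (M : ℝ≥0∞) ^ 2 *
    {x | (k : ℝ) < ‖f x‖}.indicator (fun x => ‖f x‖ₑ ^ 2) x, B.indicator fun _ => ∞, hAm,
    fun x hx => not_lt.1 hx, (hfm2.indicator hAm).const_mul _, measurable_const.indicator hB,
    fun x u => ?_, ?_⟩
  · by_cases hu : u ∈ B
    · simp [hu]
    · have : ‖g u‖ₑ ≤ M := by
        rw [← ofReal_norm, ← ofReal_coe_nnreal]
        exact ofReal_le_ofReal (hM u hu)
      rw [indicator_of_notMem hu, add_zero, mul_comm]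
      refine mul_le_mul' (pow_le_pow_left' this 2) (le_of_eq ?_)
      by_cases hx : x ∈ {x | (k : ℝ) < ‖f x‖}
      · rw [indicator_of_mem hx, indicator_of_mem hx]
      · rw [indicator_of_notMem hx, indicator_of_notMem hx]; simp
  · rw [lintegral_const_mul _ (hfm2.indicator hAm), lintegral_indicator hB]
    simpa [hB0] using hk.le

lemma smallDom_of_holderConjugate (hfm : Measurable f) (hgm : Measurable g) {r s : ℝ}
    (hrs : r.HolderConjugate s) (hf : ∫⁻ x, (‖f x‖ₑ ^ 2) ^ r ∂μ ≠ ∞)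
    (hg : ∫⁻ x, (‖g x‖ₑ ^ 2) ^ s ∂μ ≠ ∞) : SmallDom μ f g := by
  intro ε hε
  have hr1 : 1 ≤ ofReal r := by simpa using hrs.lt.le
  have hs1 : 1 ≤ ofReal s := by simpa using hrs.symm.lt.le
  have hr0 := hrs.pos
  have hs0 := hrs.symm.pos
  have hε2 : 0 < ε / 2 := ENNReal.half_pos hε.ne'
  set K := ∫⁻ x, (‖g x‖ₑ ^ 2) ^ s ∂μ
  have ht : Tendsto (fun n : ℕ => ((n : ℝ≥0∞)⁻¹) ^ s * K) atTop (𝓝 0) := by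
    have h1 := (ENNReal.continuous_rpow_const (y := s)).tendsto 0 |>.comp
      ENNReal.tendsto_inv_nat_nhds_zero
    rw [ENNReal.zero_rpow_of_pos hs0] at h1
    simpa using ENNReal.Tendsto.mul_const h1 (Or.inr hg)
  obtain ⟨l, hl, hl0⟩ := (((tendsto_order.1 ht).2 _ hε2).and (eventually_gt_atTop 0)).exists
  have hl0' : (l : ℝ≥0∞) ≠ 0 := by exact_mod_cast hl0.ne'
  have hfm2 : Measurable fun x => (‖f x‖ₑ ^ 2) ^ r := by fun_prop
  have hgm2 : Measurable fun x => (‖g x‖ₑ ^ 2) ^ s := by fun_prop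
  have hlr : (l : ℝ≥0∞) ^ r ≠ ∞ := rpow_ne_top_of_nonneg hr0.le (ENNReal.natCast_ne_top l)
  have ht2 := ENNReal.Tendsto.const_mul (a := (l : ℝ≥0∞) ^ r)
    (tendsto_lintegral_gt (μ := μ) hfm hfm2 hf) (Or.inr hlr)
  rw [mul_zero] at ht2
  obtain ⟨k, hk⟩ := ((tendsto_order.1 ht2).2 _ hε2).exists
  have hAm : MeasurableSet {x | (k : ℝ) < ‖f x‖} := measurableSet_lt measurable_const hfm.norm
  refine ⟨{x | (k : ℝ) < ‖f x‖}, k, fun x => (l : ℝ≥0∞) ^ r *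
    {x | (k : ℝ) < ‖f x‖}.indicator (fun x => (‖f x‖ₑ ^ 2) ^ r) x,
    fun x => ((l : ℝ≥0∞)⁻¹) ^ s * (‖g x‖ₑ ^ 2) ^ s, hAm, fun x hx => not_lt.1 hx,
    (hfm2.indicator hAm).const_mul _, hgm2.const_mul _, fun x u => ?_, ?_⟩
  · by_cases hx : x ∈ {x | (k : ℝ) < ‖f x‖}
    · dsimp only
      rw [indicator_of_mem hx, indicator_of_mem hx]
      calc ‖f x‖ₑ ^ 2 * ‖g u‖ₑ ^ 2 = (l * ‖f x‖ₑ ^ 2) * ((l : ℝ≥0∞)⁻¹ * ‖g u‖ₑ ^ 2) := by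
            rw [mul_mul_mul_comm, ENNReal.mul_inv_cancel hl0' (ENNReal.natCast_ne_top l), one_mul]
        _ ≤ (l * ‖f x‖ₑ ^ 2) ^ r / ofReal r +
            ((l : ℝ≥0∞)⁻¹ * ‖g u‖ₑ ^ 2) ^ s / ofReal s := ENNReal.young_inequality _ _ hrs
        _ ≤ (l * ‖f x‖ₑ ^ 2) ^ r + ((l : ℝ≥0∞)⁻¹ * ‖g u‖ₑ ^ 2) ^ s :=
            add_le_add (div_le_of_le_mul (le_mul_of_one_le_right' hr1))
              (div_le_of_le_mul (le_mul_of_one_le_right' hs1))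
        _ = _ := by rw [mul_rpow_of_nonneg _ _ hr0.le, mul_rpow_of_nonneg _ _ hs0.le]
    · rw [indicator_of_notMem hx]; simp
  · rw [lintegral_const_mul _ (hfm2.indicator hAm), lintegral_const_mul _ hgm2]
    exact (add_le_add hk.le hl.le).trans (ENNReal.add_halves ε).le

/-- Convergence of the energies for `f ∈ L^p`, `g ∈ L^q`, `1/p + 1/q ≤ 1/2`. -/
theorem TaperedKernels.tendsto_energy_of_memLp (h : TaperedKernels μ T H C c)
    (hfm : Measurable f) (hgm : Measurable g) (hf : Integrable f μ) (hg : Integrable g μ)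
    {p q : ℝ≥0∞} (hpq : p⁻¹ + q⁻¹ ≤ 2⁻¹) (hfp : MemLp f p μ) (hgq : MemLp g q μ) :
    Integrable (fun u => f u ^ 2 * g u ^ 2) μ ∧
      Tendsto (fun n => energy μ T H n f g) atTop (𝓝 (c * ∫ u, f u ^ 2 * g u ^ 2 ∂μ)) := by
  have hp2 : 2 ≤ p := ENNReal.inv_le_inv.1 (le_self_add.trans hpq)
  have hq2 : 2 ≤ q := ENNReal.inv_le_inv.1 (le_add_self.trans hpq)
  have hf2 : MemLp f 2 μ := memLp_of_integrable_of_le hfm hf hfp (by norm_num) hp2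
  have hg2 : MemLp g 2 μ := memLp_of_integrable_of_le hgm hg hgq (by norm_num) hq2
  rcases eq_or_ne p ∞ with rfl | hp
  · exact h.tendsto_energy_of_smallDom hfm hgm hf hg hg2 (smallDom_of_memLp_top hfm hfp g)
      (smallDom_of_memLp_two_top hgm hfm hg2 hfp)
  rcases eq_or_ne q ∞ with rfl | hq
  · exact h.tendsto_energy_of_smallDom hfm hgm hf hg hg2 (smallDom_of_memLp_two_top hfm hgm hf2 hgq)
      (smallDom_of_memLp_top hgm hgq f)
  set s := q.toReal / 2 with hs
  have hp0 : 0 < p.toReal := ENNReal.toReal_pos (by rintro rfl; simp at hp2) hp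
  have hq0 : 0 < q.toReal := ENNReal.toReal_pos (by rintro rfl; simp at hq2) hq
  have hsum : p.toReal⁻¹ + q.toReal⁻¹ ≤ 2⁻¹ := by
    have := ENNReal.toReal_mono (by simp) hpq
    rwa [ENNReal.toReal_add (by simp; rintro rfl; simp at hp2) (by simp; rintro rfl; simp at hq2),
      ENNReal.toReal_inv, ENNReal.toReal_inv, ENNReal.toReal_inv, ENNReal.toReal_ofNat] at this
  have hq3 : 2 < q.toReal := by
    have : q.toReal⁻¹ < 2⁻¹ := by have := inv_pos.2 hp0; linarith
    exact (inv_lt_inv₀ hq0 two_pos).1 this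
  have hs1 : 1 < s := by rw [hs]; linarith
  have hrs := (Real.HolderConjugate.conjExponent hs1).symm
  set r := s.conjExponent with hr
  have hrp : 2 * r ≤ p.toReal := by
    have h1 : r⁻¹ + s⁻¹ = 1 := hrs.inv_add_inv_eq_one
    have h2 : s⁻¹ = 2 * q.toReal⁻¹ := by rw [hs, inv_div]; rfl
    have h3 : p.toReal⁻¹ ≤ (2 * r)⁻¹ := by rw [mul_inv]; linarith
    have := hrs.pos
    exact (inv_le_inv₀ hp0 (by positivity)).1 h3
  have hfr : MemLp f (ofReal (2 * r)) μ := by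
    refine memLp_of_integrable_of_le hfm hf hfp ?_ (ENNReal.ofReal_le_of_le_toReal hrp)
    rw [← ENNReal.ofReal_one]
    exact ofReal_le_ofReal (by linarith [hrs.lt])
  have hconv : ∀ {k : G → ℝ} {t : ℝ}, 0 < t → MemLp k (ofReal (2 * t)) μ →
      ∫⁻ x, (‖k x‖ₑ ^ 2) ^ t ∂μ ≠ ∞ := by
    intro k t ht hk
    have := (eLpNorm_lt_top_iff_lintegral_rpow_enorm_lt_top (by simpa using ht)
      ofReal_ne_top).1 hk.2
    rw [toReal_ofReal (by positivity)] at this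
    simp_rw [← ENNReal.rpow_two, ← ENNReal.rpow_mul]
    exact this.ne
  have hgs : MemLp g (ofReal (2 * s)) μ := by
    rwa [hs, mul_div_cancel₀ _ two_ne_zero, ENNReal.ofReal_toReal hq]
  exact h.tendsto_energy_of_smallDom hfm hgm hf hg hg2
    (smallDom_of_holderConjugate hfm hgm hrs (hconv hrs.pos hfr) (hconv hrs.symm.pos hgs))
    (smallDom_of_holderConjugate hgm hfm hrs.symm (hconv hrs.symm.pos hgs) (hconv hrs.pos hfr))

end SmallDom

/-! ### Power singularities -/

lemma lintegral_comp_abs_le {ψ : ℝ → ℝ≥0∞} (hψ : Measurable ψ) :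
    ∫⁻ t : ℝ, ψ |t| ≤ 2 * ∫⁻ t in Ioi 0, ψ t := by
  set φ : ℝ → ℝ≥0∞ := (Ioi 0).indicator ψ with hφ
  have hφm : Measurable φ := hψ.indicator measurableSet_Ioi
  calc ∫⁻ t : ℝ, ψ |t| ≤ ∫⁻ t, (φ t + φ (-t)) := by
        refine lintegral_mono_ae ?_
        have h0 : ∀ᵐ t : ℝ, t ≠ 0 := by simp [ae_iff]
        filter_upwards [h0] with t ht
        rcases ht.lt_or_gt with h | h
        · have : -t ∈ Ioi (0 : ℝ) := by simpa using h
          rw [hφ, indicator_of_mem this, abs_of_neg h]; exact le_add_self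
        · rw [hφ, indicator_of_mem (by exact h), abs_of_pos h]; exact le_self_add
    _ = _ := by
        rw [lintegral_add_left hφm, lintegral_neg_eq_self φ, ← two_mul, hφ,
          lintegral_indicator measurableSet_Ioi]

lemma lintegral_ofReal_rpow_Ioc {r a : ℝ} (hr : 0 < r) (ha : a < 1) :
    ∫⁻ t in Ioc 0 r, ofReal t ^ (-a) =
      ofReal (1 - a)⁻¹ * ofReal r ^ (1 - a) := by
  have hi : IntegrableOn (fun t : ℝ => t ^ (-a)) (Ioc 0 r) := by
    rw [← intervalIntegrable_iff_integrableOn_Ioc_of_le hr.le]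
    exact intervalIntegral.intervalIntegrable_rpow' (by linarith)
  calc _ = ∫⁻ t in Ioc 0 r, ofReal (t ^ (-a)) :=
        setLIntegral_congr_fun measurableSet_Ioc fun t ht => ofReal_rpow_of_pos ht.1
    _ = ofReal (∫ t in Ioc 0 r, t ^ (-a)) := by
        rw [ofReal_integral_eq_lintegral_ofReal hi]
        filter_upwards [ae_restrict_mem measurableSet_Ioc] with t ht
        exact Real.rpow_nonneg ht.1.le _
    _ = _ := by
        rw [← intervalIntegral.integral_of_le hr.le, integral_rpow (Or.inl (by linarith)),
          ofReal_rpow_of_pos hr, ← ofReal_mul (inv_nonneg.2 (by linarith))]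
        rw [show -a + 1 = 1 - a by ring, Real.zero_rpow (by linarith), sub_zero]
        congr 1; field_simp

lemma lintegral_ofReal_rpow_Ioi {r s : ℝ} (hr : 0 < r) (hs : 1 < s) :
    ∫⁻ t in Ioi r, ofReal t ^ (-s) =
      ofReal (s - 1)⁻¹ * ofReal r ^ (1 - s) := by
  calc _ = ∫⁻ t in Ioi r, ofReal (t ^ (-s)) :=
        setLIntegral_congr_fun measurableSet_Ioi fun t ht =>
          ofReal_rpow_of_pos (hr.trans ht)
    _ = ofReal (∫ t in Ioi r, t ^ (-s)) := by
        rw [ofReal_integral_eq_lintegral_ofReal (integrableOn_Ioi_rpow_of_lt (by linarith) hr)]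
        filter_upwards [ae_restrict_mem measurableSet_Ioi] with t ht
        exact Real.rpow_nonneg (hr.trans ht).le _
    _ = _ := by
        rw [integral_Ioi_rpow_of_lt (by linarith) hr,
          ofReal_rpow_of_pos hr, ← ofReal_mul (inv_nonneg.2 (by linarith))]
        congr 1
        rw [show -s + 1 = 1 - s by ring, show 1 - s = -(s - 1) by ring]
        have : s - 1 ≠ 0 := by linarith
        field_simp

section Power

lemma RadiallyDominated.lintegral_near_le (hμ : RadiallyDominated μ) {r a : ℝ} (hr : 0 < r)
    (ha : a < 1) :
    ∫⁻ x, {x : G | ‖x‖ ≤ r}.indicator (fun x => ‖x‖ₑ ^ (-a)) x ∂μ ≤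
      2 * ofReal (1 - a)⁻¹ * ofReal r ^ (1 - a) := by
  set ψ : ℝ → ℝ≥0∞ := (Iic r).indicator fun t => ofReal t ^ (-a) with hψ
  have hψm : Measurable ψ := Measurable.indicator (by fun_prop) measurableSet_Iic
  calc _ = ∫⁻ x, ψ ‖x‖ ∂μ := by
        refine lintegral_congr fun x => ?_
        by_cases hx : ‖x‖ ≤ r
        · rw [hψ, indicator_of_mem (by exact hx), indicator_of_mem (by exact hx), ofReal_norm]
        · rw [hψ, indicator_of_notMem (by exact hx), indicator_of_notMem (by exact hx)]
    _ ≤ 2 * ∫⁻ t in Ioi 0, ψ t := (hμ ψ hψm).trans (lintegral_comp_abs_le hψm)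
    _ = _ := by
        rw [hψ, lintegral_indicator measurableSet_Iic, Measure.restrict_restrict measurableSet_Iic,
          inter_comm, Ioi_inter_Iic, lintegral_ofReal_rpow_Ioc hr ha, mul_assoc]

lemma RadiallyDominated.lintegral_far_le (hμ : RadiallyDominated μ) {r s : ℝ} (hr : 0 < r)
    (hs : 1 < s) :
    ∫⁻ x, {x : G | r < ‖x‖}.indicator (fun x => ‖x‖ₑ ^ (-s)) x ∂μ ≤
      2 * ofReal (s - 1)⁻¹ * ofReal r ^ (1 - s) := by
  set ψ : ℝ → ℝ≥0∞ := (Ioi r).indicator fun t => ofReal t ^ (-s) with hψ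
  have hψm : Measurable ψ := Measurable.indicator (by fun_prop) measurableSet_Ioi
  calc _ = ∫⁻ x, ψ ‖x‖ ∂μ := by
        refine lintegral_congr fun x => ?_
        by_cases hx : r < ‖x‖
        · rw [hψ, indicator_of_mem (by exact hx), indicator_of_mem (by exact hx), ofReal_norm]
        · rw [hψ, indicator_of_notMem (by exact hx), indicator_of_notMem (by exact hx)]
    _ ≤ 2 * ∫⁻ t in Ioi 0, ψ t := (hμ ψ hψm).trans (lintegral_comp_abs_le hψm)
    _ = _ := by
        rw [hψ, lintegral_indicator measurableSet_Ioi, Measure.restrict_restrict measurableSet_Ioi,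
          inter_comm, Ioi_inter_Ioi, sup_eq_right.2 hr.le, lintegral_ofReal_rpow_Ioi hr hs,
          mul_assoc]

/-- The convolution of two power functions. -/
lemma RadiallyDominated.exists_lintegral_rpow_le (hμ : RadiallyDominated μ) {a b : ℝ} (ha0 : 0 ≤ a)
    (hb0 : 0 ≤ b) (ha : a < 1) (hb : b < 1) (hab : 1 < a + b) : ∃ K : ℝ≥0∞, K ≠ ∞ ∧ ∀ x : G, x ≠ 0 →
      ∫⁻ y, ‖y‖ₑ ^ (-a) * ‖x - y‖ₑ ^ (-b) ∂μ ≤ K * ‖x‖ₑ ^ (1 - a - b) := by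
  refine ⟨(2 * ofReal (1 - a)⁻¹ + 2 * ofReal (1 - b)⁻¹ +
    2 * (2 * ofReal (a + b - 1)⁻¹)) * ofReal 2⁻¹ ^ (1 - a - b), ?_, fun x hx => ?_⟩
  · have : ofReal 2⁻¹ ^ (1 - a - b) ≠ ∞ := by
      rw [ofReal_rpow_of_pos (by norm_num)]; exact ofReal_ne_top
    finiteness
  have hx0 : 0 < ‖x‖ := norm_pos_iff.2 hx
  set r := 2⁻¹ * ‖x‖ with hr
  have hr0 : 0 < r := by positivity
  set ρ := ofReal r with hρ
  have hρ0 : ρ ≠ 0 := by simpa [hρ] using hr0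
  have hρt : ρ ≠ ∞ := ofReal_ne_top
  set N : ℝ → G → ℝ≥0∞ := fun s => {x : G | ‖x‖ ≤ r}.indicator fun x => ‖x‖ₑ ^ (-s) with hN
  set F : G → ℝ≥0∞ := {x : G | r < ‖x‖}.indicator fun x => ‖x‖ₑ ^ (-(a + b)) with hF
  have hNm : ∀ s, Measurable (N s) := fun s =>
    Measurable.indicator (by fun_prop) (measurableSet_le measurable_norm measurable_const)
  have hFm : Measurable F :=
    Measurable.indicator (by fun_prop) (measurableSet_lt measurable_const measurable_norm)
  have hfar : ∀ {z : G} {s : ℝ}, 0 ≤ s → r ≤ ‖z‖ → ‖z‖ₑ ^ (-s) ≤ ρ ^ (-s) := by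
    intro z s hs hz
    rw [ENNReal.rpow_neg, ENNReal.rpow_neg, ENNReal.inv_le_inv]
    refine ENNReal.rpow_le_rpow ?_ hs
    rw [hρ, ← ofReal_norm]; exact ofReal_le_ofReal hz
  have hpt : ∀ y : G, ‖y‖ₑ ^ (-a) * ‖x - y‖ₑ ^ (-b) ≤
      N a y * ρ ^ (-b) + ρ ^ (-a) * N b (x - y) + (F y + F (x - y)) := by
    intro y
    have htri : ‖x‖ ≤ ‖y‖ + ‖x - y‖ := by
      calc ‖x‖ = ‖y + (x - y)‖ := by rw [add_sub_cancel]
        _ ≤ _ := norm_add_le _ _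
    rcases le_or_gt ‖y‖ r with h1 | h1
    · refine le_trans ?_ (le_self_add.trans le_self_add)
      rw [hN]; dsimp only
      rw [indicator_of_mem (by exact h1)]
      exact mul_le_mul_right (hfar hb0 (by linarith)) _
    rcases le_or_gt ‖x - y‖ r with h2 | h2
    · refine le_trans ?_ (le_add_self.trans le_self_add)
      rw [hN]; dsimp only
      rw [indicator_of_mem (by exact h2)]
      exact mul_le_mul_left (hfar ha0 h1.le) _
    · refine le_trans ?_ le_add_self
      rw [hF, indicator_of_mem (by exact h1), indicator_of_mem (by exact h2)]
      have hmin : ∀ {u v : G}, r < ‖u‖ → ‖u‖ ≤ ‖v‖ → ∀ {s t : ℝ}, 0 ≤ s →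
          ‖u‖ₑ ^ (-t) * ‖v‖ₑ ^ (-s) ≤ ‖u‖ₑ ^ (-(t + s)) := by
        intro u v hu huv s t hs
        have hu0 : ‖u‖ₑ ≠ 0 := by rw [enorm_ne_zero]; rintro rfl; rw [norm_zero] at hu; linarith
        rw [neg_add, ENNReal.rpow_add _ _ hu0 enorm_ne_top]
        refine mul_le_mul_right ?_ _
        rw [ENNReal.rpow_neg, ENNReal.rpow_neg, ENNReal.inv_le_inv]
        refine ENNReal.rpow_le_rpow ?_ hs
        rw [← ofReal_norm, ← ofReal_norm]; exact ofReal_le_ofReal huv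
      rcases le_total ‖y‖ ‖x - y‖ with h3 | h3
      · exact (hmin h1 h3 hb0).trans le_self_add
      · rw [mul_comm]
        refine (hmin h2 h3 ha0).trans ?_
        rw [add_comm b]
        exact le_add_self
  have hsub : ∀ {k : G → ℝ≥0∞}, Measurable k → ∫⁻ y, k (x - y) ∂μ = ∫⁻ y, k y ∂μ := fun hk =>
    (Measure.measurePreserving_sub_left μ x).lintegral_comp hk
  have hsm : ∀ {k : G → ℝ≥0∞}, Measurable k → Measurable fun y => k (x - y) := fun hk =>
    hk.comp (measurable_const_sub x)
  calc _ ≤ ∫⁻ y, (N a y * ρ ^ (-b) + ρ ^ (-a) * N b (x - y) + (F y + F (x - y))) ∂μ :=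
        lintegral_mono hpt
    _ = (∫⁻ y, N a y ∂μ) * ρ ^ (-b) + ρ ^ (-a) * ∫⁻ y, N b y ∂μ +
        (∫⁻ y, F y ∂μ + ∫⁻ y, F y ∂μ) := by
        rw [lintegral_add_left (by exact ((hNm a).mul_const _).add ((hsm (hNm b)).const_mul _)),
          lintegral_add_left (by exact (hNm a).mul_const _), lintegral_mul_const _ (hNm a),
          lintegral_const_mul _ (hsm (hNm b)), hsub (hNm b), lintegral_add_left hFm, hsub hFm]
    _ ≤ (2 * ofReal (1 - a)⁻¹ * ρ ^ (1 - a)) * ρ ^ (-b) +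
        ρ ^ (-a) * (2 * ofReal (1 - b)⁻¹ * ρ ^ (1 - b)) +
        (2 * ofReal (a + b - 1)⁻¹ * ρ ^ (1 - (a + b)) +
          2 * ofReal (a + b - 1)⁻¹ * ρ ^ (1 - (a + b))) := by
        have i1 := hμ.lintegral_near_le (G := G) hr0 ha
        have i2 := hμ.lintegral_near_le (G := G) hr0 hb
        have i3 := hμ.lintegral_far_le (G := G) hr0 hab
        exact add_le_add (add_le_add (mul_le_mul_left i1 _) (mul_le_mul_right i2 _))
          (add_le_add i3 i3)
    _ = (2 * ofReal (1 - a)⁻¹ + 2 * ofReal (1 - b)⁻¹ +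
        2 * (2 * ofReal (a + b - 1)⁻¹)) * ρ ^ (1 - a - b) := by
        have e1 : ρ ^ (1 - a) * ρ ^ (-b) = ρ ^ (1 - a - b) := by
          rw [← ENNReal.rpow_add _ _ hρ0 hρt, ← sub_eq_add_neg]
        have e2 : ρ ^ (-a) * ρ ^ (1 - b) = ρ ^ (1 - a - b) := by
          rw [← ENNReal.rpow_add _ _ hρ0 hρt]; congr 1; ring
        rw [show 1 - (a + b) = 1 - a - b by ring, mul_assoc, e1, mul_left_comm, e2]
        ring
    _ = _ := by
        rw [hρ, hr, ofReal_mul (by norm_num), ofReal_norm,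
          ENNReal.mul_rpow_of_ne_top ofReal_ne_top enorm_ne_top, mul_assoc]

end Power

section Power

variable {T : ℕ → ℝ} {H : ℕ → G → ℂ} {C : ℝ≥0} {c : ℝ} {f g : G → ℝ}

lemma decayTransform_comm (t : ℝ) (g : G → ℝ≥0∞) (x y : G) :
    decayTransform μ t g x y = decayTransform μ t g y x := by
  refine lintegral_congr fun u => ?_
  rw [decay_sub_comm u x, decay_sub_comm y u, mul_comm (decay t (x - u))]

lemma mul_enorm_mul_decay_le {t : ℝ} (w : G) : ofReal t * ‖w‖ₑ * decay t w ≤ 1 := by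
  rw [decay, ← div_eq_mul_inv]
  exact div_le_of_le_mul (by rw [one_mul]; exact le_add_self)

lemma enorm_rpow_mul_decay_rpow_le {t : ℝ} (ht : 0 < t) (w : G) {q s : ℝ} (hq : 0 ≤ q) :
    ‖w‖ₑ ^ q * decay t w ^ s ≤ (ofReal t)⁻¹ ^ q * decay t w ^ (s - q) := by
  have ht0 : ofReal t ≠ 0 := by simpa using ht
  have h1 : ‖w‖ₑ * decay t w ≤ (ofReal t)⁻¹ := by
    rw [← one_div, le_div_iff_mul_le (Or.inl ht0) (Or.inl ofReal_ne_top), mul_comm, ← mul_assoc]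
    exact mul_enorm_mul_decay_le w
  calc _ = (‖w‖ₑ * decay t w) ^ q * decay t w ^ (s - q) := by
        rw [mul_rpow_of_nonneg _ _ hq, mul_assoc,
          ← ENNReal.rpow_add _ _ (decay_ne_zero w) (decay_ne_top w), add_sub_cancel]
    _ ≤ _ := mul_le_mul_left (ENNReal.rpow_le_rpow h1 hq) _

lemma mul_decay_rpow_le {t : ℝ} (w : G) {s b : ℝ} (hb : 0 ≤ b) (hs : b ≤ s) :
    ofReal t ^ b * decay t w ^ s ≤ ‖w‖ₑ ^ (-b) := by
  refine (mul_le_mul_right (decay_rpow_le_rpow w hs) _).trans ?_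
  rw [← mul_rpow_of_nonneg _ _ hb, ENNReal.rpow_neg, ← ENNReal.inv_rpow]
  refine ENNReal.rpow_le_rpow ?_ hb
  rw [decay, ← div_eq_mul_inv]
  refine div_le_of_le_mul ?_
  rcases eq_or_ne ‖w‖ₑ 0 with h0 | h0
  · simp [h0]
  · rw [mul_add, mul_left_comm, ENNReal.inv_mul_cancel h0 enorm_ne_top, mul_one, mul_one]
    exact le_add_self (a := ofReal t)

/-- The majorant of the transform of a function with a zero of power type. -/
lemma decayTransform_le_of_rpow (hμ : RadiallyDominated μ) {t : ℝ} (ht : 0 < t)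
    {g : G → ℝ≥0∞} {M : ℝ≥0} {q : ℝ} (hq0 : 0 ≤ q) (hq : q ≤ 3 / 4)
    (hg : ∀ᵐ u ∂μ, g u ≤ M * ‖u‖ₑ ^ q) (x y : G) :
    decayTransform μ t g x y ≤ M * (4 * decayConst) * (ofReal t)⁻¹ *
      (‖x‖ₑ ^ q * decay t (y - x) ^ (3 / 4 : ℝ) +
        (ofReal t)⁻¹ ^ q * decay t (y - x) ^ (3 / 4 - q)) := by
  have i1 := lintegral_decay_conv_le hμ ht (a := 1) (b := 1) (θ := 3 / 4) (by norm_num)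
    (by norm_num) (by norm_num) (by norm_num) (by norm_num) x y
  have i2 := lintegral_decay_conv_le hμ ht (a := 1 - q) (b := 1) (θ := 3 / 4 - q) (by linarith)
    (by linarith) (by linarith) (by linarith) (by linarith) x y
  have hm : ∀ a b : ℝ, Measurable fun u => decay t (u - x) ^ a * decay t (y - u) ^ b := fun a b =>
    ((measurable_decay.comp (measurable_sub_const x)).pow_const a).mul
      ((measurable_decay.comp (measurable_const_sub y)).pow_const b)
  calc _ ≤ ∫⁻ u, (M * ‖x‖ₑ ^ q * (decay t (u - x) ^ (1 : ℝ) * decay t (y - u) ^ (1 : ℝ)) +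
        M * (ofReal t)⁻¹ ^ q * (decay t (u - x) ^ (1 - q) * decay t (y - u) ^ (1 : ℝ))) ∂μ := by
        refine lintegral_mono_ae ?_
        filter_upwards [hg] with u hu
        have h1 : ‖u‖ₑ ^ q ≤ ‖x‖ₑ ^ q + ‖u - x‖ₑ ^ q := by
          refine le_trans (ENNReal.rpow_le_rpow ?_ hq0)
            (ENNReal.rpow_add_le_add_rpow _ _ hq0 (by linarith))
          calc ‖u‖ₑ = ‖x + (u - x)‖ₑ := by rw [add_sub_cancel]
            _ ≤ _ := enorm_add_le _ _
        have h2 := enorm_rpow_mul_decay_rpow_le ht (u - x) (s := 1) hq0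
        rw [ENNReal.rpow_one] at h2
        rw [ENNReal.rpow_one, ENNReal.rpow_one]
        calc _ ≤ M * (‖x‖ₑ ^ q + ‖u - x‖ₑ ^ q) * (decay t (u - x) * decay t (y - u)) :=
              mul_le_mul_left (hu.trans (mul_le_mul_right h1 _)) _
          _ = M * ‖x‖ₑ ^ q * (decay t (u - x) * decay t (y - u)) +
              M * (‖u - x‖ₑ ^ q * decay t (u - x)) * decay t (y - u) := by ring
          _ ≤ M * ‖x‖ₑ ^ q * (decay t (u - x) * decay t (y - u)) +
              M * ((ofReal t)⁻¹ ^ q * decay t (u - x) ^ (1 - q)) * decay t (y - u) := by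
              gcongr
          _ = _ := by ring
    _ ≤ M * ‖x‖ₑ ^ q * (4 * decayConst * (ofReal t)⁻¹ * decay t (y - x) ^ (3 / 4 : ℝ)) +
        M * (ofReal t)⁻¹ ^ q *
          (4 * decayConst * (ofReal t)⁻¹ * decay t (y - x) ^ (3 / 4 - q)) := by
        rw [lintegral_add_left (by exact (hm _ _).const_mul _), lintegral_const_mul _ (hm _ _),
          lintegral_const_mul _ (hm _ _)]
        gcongr
    _ = _ := by ring

lemma decayTransform_sq_le_of_rpow (hμ : RadiallyDominated μ) {t : ℝ} (ht : 0 < t)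
    {g : G → ℝ≥0∞} {M : ℝ≥0} {q : ℝ} (hq0 : 0 ≤ q) (hq : q ≤ 3 / 4)
    (hg : ∀ᵐ u ∂μ, g u ≤ M * ‖u‖ₑ ^ q) (x y : G) :
    decayTransform μ t g x y ^ 2 ≤ 2 * (M * (4 * decayConst)) ^ 2 * (ofReal t)⁻¹ ^ 2 *
      (‖x‖ₑ ^ q * ‖y‖ₑ ^ q * decay t (y - x) ^ (3 / 2 : ℝ) +
        (ofReal t)⁻¹ ^ (2 * q) * decay t (y - x) ^ (3 / 2 - 2 * q)) := by
  wlog hxy : ‖x‖ₑ ≤ ‖y‖ₑ generalizing x y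
  · rw [decayTransform_comm, decay_sub_comm y x, mul_comm (‖x‖ₑ ^ q)]
    exact this y x (le_of_not_ge hxy)
  have hsq : ∀ (a : ℝ≥0∞) (s : ℝ), (a ^ s) ^ 2 = a ^ (2 * s) := fun a s => by
    rw [← ENNReal.rpow_two, ← ENNReal.rpow_mul, mul_comm]
  calc _ ≤ (M * (4 * decayConst) * (ofReal t)⁻¹ * (‖x‖ₑ ^ q * decay t (y - x) ^ (3 / 4 : ℝ) +
        (ofReal t)⁻¹ ^ q * decay t (y - x) ^ (3 / 4 - q))) ^ 2 :=
        pow_le_pow_left' (decayTransform_le_of_rpow hμ ht hq0 hq hg x y) 2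
    _ ≤ (M * (4 * decayConst) * (ofReal t)⁻¹) ^ 2 *
        (2 * (‖x‖ₑ ^ q * decay t (y - x) ^ (3 / 4 : ℝ)) ^ 2 +
          2 * ((ofReal t)⁻¹ ^ q * decay t (y - x) ^ (3 / 4 - q)) ^ 2) := by
        rw [mul_pow]
        exact mul_le_mul_right (sq_add_le_two_mul _ _) _
    _ = (M * (4 * decayConst) * (ofReal t)⁻¹) ^ 2 *
        (2 * (‖x‖ₑ ^ q * ‖x‖ₑ ^ q * decay t (y - x) ^ (3 / 2 : ℝ)) +
          2 * ((ofReal t)⁻¹ ^ (2 * q) * decay t (y - x) ^ (3 / 2 - 2 * q))) := by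
        rw [mul_pow (‖x‖ₑ ^ q), mul_pow ((ofReal t)⁻¹ ^ q), hsq (decay t (y - x)),
          hsq (decay t (y - x)), hsq (ofReal t)⁻¹, pow_two (‖x‖ₑ ^ q),
          show 2 * (3 / 4 : ℝ) = 3 / 2 by norm_num, show 2 * (3 / 4 - q) = 3 / 2 - 2 * q by ring]
    _ ≤ (M * (4 * decayConst) * (ofReal t)⁻¹) ^ 2 *
        (2 * (‖x‖ₑ ^ q * ‖y‖ₑ ^ q * decay t (y - x) ^ (3 / 2 : ℝ)) +
          2 * ((ofReal t)⁻¹ ^ (2 * q) * decay t (y - x) ^ (3 / 2 - 2 * q))) := by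
        gcongr
    _ = _ := by ring

lemma mul_le_sq_mul_div_add {a b u v : ℝ≥0∞} (hu : u ≠ 0) (hu' : u ≠ ∞) (hv : v ≠ 0) (hv' : v ≠ ∞) :
    a * b ≤ a ^ 2 * u * v⁻¹ + b ^ 2 * v * u⁻¹ := by
  have h1 : a * b * (u * v) ≤ a ^ 2 * u ^ 2 + b ^ 2 * v ^ 2 := by
    rw [← mul_pow, ← mul_pow, mul_mul_mul_comm]
    rcases le_total (a * u) (b * v) with h | h
    · exact (mul_le_mul_left h _).trans (by rw [← pow_two]; exact le_add_self)
    · exact (mul_le_mul_right h _).trans (by rw [← pow_two]; exact le_self_add)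
  have huv : u * v ≠ 0 := mul_ne_zero hu hv
  have huv' : u * v ≠ ∞ := mul_ne_top hu' hv'
  rw [← le_div_iff_mul_le (Or.inl huv) (Or.inl huv')] at h1
  refine h1.trans (le_of_eq ?_)
  rw [div_eq_mul_inv, ENNReal.mul_inv (Or.inl hu) (Or.inl hu'), add_mul]
  congr 1
  · calc _ = a ^ 2 * u * v⁻¹ * (u * u⁻¹) := by ring
      _ = _ := by rw [ENNReal.mul_inv_cancel hu hu', mul_one]
  · calc _ = b ^ 2 * v * u⁻¹ * (v * v⁻¹) := by ring
      _ = _ := by rw [ENNReal.mul_inv_cancel hv hv', mul_one]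

lemma RadiallyDominated.ae_ne_zero (hμ : RadiallyDominated μ) : ∀ᵐ x ∂μ, x ≠ 0 := by
  have := hμ (({0} : Set ℝ).indicator 1) (measurable_one.indicator (measurableSet_singleton 0))
  have h0 : ∫⁻ t : ℝ, ({0} : Set ℝ).indicator 1 |t| = 0 := by
    have : (fun t : ℝ => ({0} : Set ℝ).indicator (1 : ℝ → ℝ≥0∞) |t|) = ({0} : Set ℝ).indicator 1 := by
      funext t; simp [indicator]
    rw [this, lintegral_indicator_one (measurableSet_singleton 0)]; simp
  rw [h0] at this
  have h1 : (fun x : G => ({0} : Set ℝ).indicator (1 : ℝ → ℝ≥0∞) ‖x‖) = ({0} : Set G).indicator 1 := by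
    funext t; by_cases ht : t = 0 <;> simp [ht]
  rw [h1, lintegral_indicator_one (measurableSet_singleton 0), nonpos_iff_eq_zero] at this
  rw [ae_iff]
  simpa using this

/-- Bounds for the energy majorants of a function and a function with a zero of power type. -/
lemma RadiallyDominated.exists_decayEnergy_le (hμ : RadiallyDominated μ) {q : ℝ} (hq0 : 0 < q)
    (hq : q < 1 / 2) (hgm : Measurable g) {M : ℝ≥0} (hg : ∀ᵐ u ∂μ, ‖g u‖ ≤ M * ‖u‖ ^ q) :
    ∃ K : ℝ≥0∞, K ≠ ∞ ∧ ∀ (f : G → ℝ), Measurable f → ∀ t : ℝ, 0 < t →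
      decayEnergy μ t f g ≤ K * ∫⁻ x, ‖f x‖ₑ ^ 2 * ‖x‖ₑ ^ (2 * q) ∂μ := by
  obtain ⟨K₁, hK₁, hI⟩ := hμ.exists_lintegral_rpow_le (a := q + 1 / 2) (b := 1 - 2 * q)
    (by linarith) (by linarith) (by linarith) (by linarith) (by linarith)
  set L : ℝ≥0∞ := 2 * (M * (4 * decayConst)) ^ 2 with hL
  have hLt : L ≠ ∞ := by have := decayConst_ne_top; finiteness
  refine ⟨L * (2 * decayConst + 2 * K₁), by have := decayConst_ne_top; finiteness,
    fun f hfm t ht => ?_⟩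
  have hg' : ∀ᵐ u ∂μ, ‖g u‖ₑ ≤ M * ‖u‖ₑ ^ q := by
    filter_upwards [hg] with u hu
    rw [← ofReal_norm, ← ofReal_norm u, ENNReal.ofReal_rpow_of_nonneg (norm_nonneg _) hq0.le,
      ← ofReal_coe_nnreal, ← ofReal_mul (NNReal.coe_nonneg M)]
    exact ofReal_le_ofReal hu
  have ht0 : ofReal t ≠ 0 := by simpa using ht
  have htt : ofReal t ≠ ∞ := ofReal_ne_top
  set τ := ofReal t with hτ
  set F : G → ℝ≥0∞ := fun x => ‖f x‖ₑ ^ 2 * ‖x‖ₑ ^ (2 * q) with hF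
  have hFm : Measurable F := by fun_prop
  set W : G → ℝ≥0∞ := fun x => ‖x‖ₑ ^ (q + 1 / 2) with hW
  have hdm : Measurable fun p : G × G => decay t (p.2 - p.1) :=
    measurable_decay.comp (measurable_snd.sub measurable_fst)
  set A₁ : G × G → ℝ≥0∞ := fun p => F p.1 * (τ * decay t (p.2 - p.1) ^ (3 / 2 : ℝ)) with hA₁
  set B₁ : G × G → ℝ≥0∞ := fun p =>
    ‖f p.1‖ₑ ^ 2 * W p.1 * (‖p.2‖ₑ ^ (-(q + 1 / 2)) * ‖p.1 - p.2‖ₑ ^ (-(1 - 2 * q))) with hB₁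
  have hA₁m : Measurable A₁ := by fun_prop
  have hB₁m : Measurable B₁ := by fun_prop
  have hne : ∀ᵐ p ∂(μ.prod μ), p.1 ≠ 0 ∧ p.2 ≠ 0 :=
    (Measure.quasiMeasurePreserving_fst.ae hμ.ae_ne_zero).and
      (Measure.quasiMeasurePreserving_snd.ae hμ.ae_ne_zero)
  have hpt : ∀ᵐ p ∂(μ.prod μ), τ ^ 3 * (‖f p.1‖ₑ * ‖f p.2‖ₑ *
      (decayTransform μ t (fun x => ‖g x‖ₑ) p.1 p.2 * decayTransform μ t (fun x => ‖g x‖ₑ) p.1 p.2)) ≤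
      L * (A₁ p + A₁ p.swap + (B₁ p + B₁ p.swap)) := by
    filter_upwards [hne] with p hp
    obtain ⟨x, y⟩ := p
    obtain ⟨hx, hy⟩ := hp
    dsimp only at hx hy
    have hx0 : ‖x‖ₑ ≠ 0 := by simpa using hx
    have hy0 : ‖y‖ₑ ≠ 0 := by simpa using hy
    have h1 := decayTransform_sq_le_of_rpow hμ ht hq0.le (by linarith) hg' x y
    have hFx : ∀ z : G, (‖f z‖ₑ * ‖z‖ₑ ^ q) ^ 2 = F z := fun z => by
      rw [hF, mul_pow, ← ENNReal.rpow_two (‖z‖ₑ ^ q), ← ENNReal.rpow_mul, mul_comm q]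
    have h2 : ‖f x‖ₑ * ‖x‖ₑ ^ q * (‖f y‖ₑ * ‖y‖ₑ ^ q) ≤ F x + F y := by
      rw [← hFx, ← hFx]
      have := mul_le_sq_mul_div_add (a := ‖f x‖ₑ * ‖x‖ₑ ^ q) (b := ‖f y‖ₑ * ‖y‖ₑ ^ q)
        (u := 1) (v := 1) one_ne_zero (by simp) one_ne_zero (by simp)
      simpa using this
    have hWne : ∀ {z : G}, ‖z‖ₑ ≠ 0 → W z ≠ 0 ∧ W z ≠ ∞ ∧ (W z)⁻¹ = ‖z‖ₑ ^ (-(q + 1 / 2)) := by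
      intro z hz
      have a : W z ≠ 0 := by
        rw [hW]; exact (ENNReal.rpow_pos (pos_iff_ne_zero.2 hz) enorm_ne_top).ne'
      exact ⟨a, rpow_ne_top_of_nonneg (by linarith) enorm_ne_top, (ENNReal.rpow_neg _ _).symm⟩
    have h3 : ‖f x‖ₑ * ‖f y‖ₑ ≤ ‖f x‖ₑ ^ 2 * W x * ‖y‖ₑ ^ (-(q + 1 / 2)) +
        ‖f y‖ₑ ^ 2 * W y * ‖x‖ₑ ^ (-(q + 1 / 2)) := by
      obtain ⟨a1, a2, a3⟩ := hWne hx0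
      obtain ⟨b1, b2, b3⟩ := hWne hy0
      rw [← a3, ← b3]
      exact mul_le_sq_mul_div_add a1 a2 b1 b2
    have h4 : τ ^ (1 - 2 * q) * decay t (y - x) ^ (3 / 2 - 2 * q) ≤ ‖x - y‖ₑ ^ (-(1 - 2 * q)) := by
      rw [decay_sub_comm]
      exact mul_decay_rpow_le _ (by linarith) (by linarith)
    have hτ2 : τ ^ 3 * τ⁻¹ ^ 2 = τ := by
      rw [show τ ^ 3 = τ * τ ^ 2 by ring, mul_assoc, ← mul_pow, ENNReal.mul_inv_cancel ht0 htt]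
      simp
    have hτ3 : τ * τ⁻¹ ^ (2 * q) = τ ^ (1 - 2 * q) := by
      rw [ENNReal.inv_rpow, ← ENNReal.rpow_neg, sub_eq_add_neg, ENNReal.rpow_add _ _ ht0 htt,
        ENNReal.rpow_one]
    rw [← pow_two]
    calc _ ≤ τ ^ 3 * (‖f x‖ₑ * ‖f y‖ₑ * (L * τ⁻¹ ^ 2 *
          (‖x‖ₑ ^ q * ‖y‖ₑ ^ q * decay t (y - x) ^ (3 / 2 : ℝ) +
            τ⁻¹ ^ (2 * q) * decay t (y - x) ^ (3 / 2 - 2 * q)))) :=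
          mul_le_mul_right (mul_le_mul_right h1 _) _
      _ = L * (τ ^ 3 * τ⁻¹ ^ 2) * (‖f x‖ₑ * ‖x‖ₑ ^ q * (‖f y‖ₑ * ‖y‖ₑ ^ q) *
            decay t (y - x) ^ (3 / 2 : ℝ) + ‖f x‖ₑ * ‖f y‖ₑ * (
            τ⁻¹ ^ (2 * q) * decay t (y - x) ^ (3 / 2 - 2 * q))) := by ring
      _ = L * (‖f x‖ₑ * ‖x‖ₑ ^ q * (‖f y‖ₑ * ‖y‖ₑ ^ q) *
            (τ * decay t (y - x) ^ (3 / 2 : ℝ)) + ‖f x‖ₑ * ‖f y‖ₑ * (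
            (τ * τ⁻¹ ^ (2 * q)) * decay t (y - x) ^ (3 / 2 - 2 * q))) := by rw [hτ2]; ring
      _ ≤ L * ((F x + F y) * (τ * decay t (y - x) ^ (3 / 2 : ℝ)) +
            (‖f x‖ₑ ^ 2 * W x * ‖y‖ₑ ^ (-(q + 1 / 2)) +
              ‖f y‖ₑ ^ 2 * W y * ‖x‖ₑ ^ (-(q + 1 / 2))) * ‖x - y‖ₑ ^ (-(1 - 2 * q))) := by
          rw [hτ3]
          exact mul_le_mul_right (add_le_add (mul_le_mul_left h2 _) (mul_le_mul' h3 h4)) _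
      _ = _ := by
          simp only [hA₁, hB₁, Prod.swap]
          have hn : ‖y - x‖ₑ = ‖x - y‖ₑ := by rw [← enorm_neg, neg_sub]
          rw [hn, decay_sub_comm x y]
          ring
  have hswap : ∀ {k : G × G → ℝ≥0∞}, Measurable k →
      ∫⁻ p, k p.swap ∂(μ.prod μ) = ∫⁻ p, k p ∂(μ.prod μ) := fun hk => by
    have := (Measure.measurePreserving_swap (μ := μ) (ν := μ)).lintegral_comp hk
    exact this
  have hA : ∫⁻ p, A₁ p ∂(μ.prod μ) ≤ decayConst * ∫⁻ x, F x ∂μ := by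
    rw [lintegral_prod _ hA₁m.aemeasurable, mul_comm, ← lintegral_mul_const _ hFm]
    refine lintegral_mono fun x => ?_
    have hm : Measurable fun y => decay t (y - x) ^ (3 / 2 : ℝ) :=
      (measurable_decay.comp (measurable_sub_const x)).pow_const _
    simp only [hA₁]
    rw [lintegral_const_mul _ (hm.const_mul _), lintegral_const_mul _ hm,
      lintegral_sub_right_eq_self (fun y => decay t y ^ (3 / 2 : ℝ)) x]
    refine mul_le_mul_right ((mul_le_mul_right (lintegral_decay_le hμ ht (by norm_num)) _).trans
      (le_of_eq ?_)) _
    rw [← hτ, mul_left_comm, ENNReal.mul_inv_cancel ht0 htt, mul_one]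
  have hB : ∫⁻ p, B₁ p ∂(μ.prod μ) ≤ K₁ * ∫⁻ x, F x ∂μ := by
    rw [lintegral_prod _ hB₁m.aemeasurable, mul_comm, ← lintegral_mul_const _ hFm]
    refine lintegral_mono_ae ?_
    filter_upwards [hμ.ae_ne_zero] with x hx
    simp only [hB₁]
    rw [lintegral_const_mul _ (by fun_prop)]
    refine (mul_le_mul_right (hI x hx) _).trans (le_of_eq ?_)
    rw [hF, hW]
    dsimp only
    have hx0 : ‖x‖ₑ ≠ 0 := by simpa using hx
    have e : ‖x‖ₑ ^ (2 * q) = ‖x‖ₑ ^ (q + 1 / 2) * ‖x‖ₑ ^ (1 - (q + 1 / 2) - (1 - 2 * q)) := by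
      rw [← ENNReal.rpow_add _ _ hx0 enorm_ne_top]; congr 1; ring
    rw [e, mul_left_comm _ K₁, mul_comm K₁]
    simp only [mul_assoc]
  have hmA : Measurable fun p : G × G => A₁ p.swap := hA₁m.comp measurable_swap
  rw [decayEnergy, decayForm_eq_transform hfm.enorm hgm.enorm hfm.enorm hgm.enorm, ← hτ]
  have hmt := measurable_decayTransform (μ := μ) t hgm.enorm
  rw [← lintegral_const_mul _ (by fun_prop)]
  calc _ ≤ ∫⁻ p, L * (A₁ p + A₁ p.swap + (B₁ p + B₁ p.swap)) ∂(μ.prod μ) := lintegral_mono_ae hpt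
    _ = L * (∫⁻ p, A₁ p ∂(μ.prod μ) + ∫⁻ p, A₁ p ∂(μ.prod μ) +
        (∫⁻ p, B₁ p ∂(μ.prod μ) + ∫⁻ p, B₁ p ∂(μ.prod μ))) := by
        rw [lintegral_const_mul _ (by fun_prop), lintegral_add_left (by fun_prop),
          lintegral_add_left hA₁m, lintegral_add_left hB₁m, hswap hA₁m, hswap hB₁m]
    _ ≤ L * (decayConst * ∫⁻ x, F x ∂μ + decayConst * ∫⁻ x, F x ∂μ +
        (K₁ * ∫⁻ x, F x ∂μ + K₁ * ∫⁻ x, F x ∂μ)) := by gcongr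
    _ = _ := by ring

end Power

section Power

variable {T : ℕ → ℝ} {H : ℕ → G → ℂ} {C : ℝ≥0} {c : ℝ} {f g : G → ℝ}

variable (μ) in
/-- The energy majorants are bounded, and small up to bounded parts of the functions. -/
def EnergyTight (f g : G → ℝ) : Prop :=
  (∃ E : ℝ≥0∞, E ≠ ∞ ∧ ∀ t : ℝ, 0 < t → decayEnergy μ t f g ≤ E) ∧
  ∀ ε : ℝ≥0∞, 0 < ε → ∃ (A B : Set G) (M : ℝ≥0), MeasurableSet A ∧ MeasurableSet B ∧
      (∀ x ∉ A, ‖f x‖ ≤ M) ∧ (∀ x ∉ B, ‖g x‖ ≤ M) ∧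
      ∀ t : ℝ, 0 < t → decayEnergy μ t (A.indicator f) g ≤ ε ∧ decayEnergy μ t f (B.indicator g) ≤ ε

lemma EnergyTight.symm (hfm : Measurable f) (hgm : Measurable g) (h : EnergyTight μ f g) :
    EnergyTight μ g f := by
  obtain ⟨⟨E, hE, hb⟩, hs⟩ := h
  refine ⟨⟨E, hE, fun t ht => by rw [decayEnergy_comm hgm hfm]; exact hb t ht⟩, fun ε hε => ?_⟩
  obtain ⟨A, B, M, hA, hB, hf, hg, hd⟩ := hs ε hε
  refine ⟨B, A, M, hB, hA, hg, hf, fun t ht => ?_⟩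
  rw [decayEnergy_comm (hgm.indicator hB) hfm, decayEnergy_comm hgm (hfm.indicator hA)]
  exact (hd t ht).symm

lemma TaperedKernels.tendsto_energy_of_energyTight (h : TaperedKernels μ T H C c)
    (hfm : Measurable f) (hgm : Measurable g) (hf : Integrable f μ) (hg : Integrable g μ)
    (ht : EnergyTight μ f g) :
    Integrable (fun u => f u ^ 2 * g u ^ 2) μ ∧
      Tendsto (fun n => energy μ T H n f g) atTop (𝓝 (c * ∫ u, f u ^ 2 * g u ^ 2 ∂μ)) := by
  obtain ⟨⟨E, hE, hb⟩, hs⟩ := ht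
  refine h.tendsto_energy_of_tight hfm hgm hf hg hE
    (Eventually.of_forall fun n => hb _ (h.T_pos n)) fun ε hε => ?_
  obtain ⟨A, B, M, hA, hB, hf, hg, hd⟩ := hs ε hε
  exact ⟨A, B, M, hA, hB, hf, hg, Eventually.of_forall fun n => hd _ (h.T_pos n)⟩

lemma decayEnergy_eq_zero_of_ae (hfm : Measurable f) (hgm : Measurable g) (hg : g =ᵐ[μ] 0) (t : ℝ) :
    decayEnergy μ t f g = 0 := by
  have h0 : ∀ x y, decayTransform μ t (fun x => ‖g x‖ₑ) x y = 0 := fun x y => by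
    rw [decayTransform, lintegral_congr_ae (g := fun _ => 0), lintegral_zero]
    filter_upwards [hg] with u hu
    simp [hu]
  rw [decayEnergy, decayForm_eq_transform hfm.enorm hgm.enorm hfm.enorm hgm.enorm]
  simp [h0]

/-- A function with a singularity and a function with a zero at the origin. -/
theorem energyTight_of_power (hμ : RadiallyDominated μ) (hfm : Measurable f) (hgm : Measurable g)
    (hg : Integrable g μ) {q : ℝ} (hq0 : 0 < q) (hq : q < 1 / 2) {M : ℝ≥0}
    (hgM : ∀ᵐ u ∂μ, ‖g u‖ ≤ M) (hgq : ∀ᵐ u ∂μ, ‖g u‖ ≤ M * ‖u‖ ^ q)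
    (hoff : ∀ δ : ℝ, 0 < δ → ∃ N : ℝ≥0, ∀ᵐ x ∂μ, δ ≤ ‖x‖ → ‖f x‖ ≤ N) {a : ℝ} (ha : 0 < a)
    (hnear : ∫⁻ x, {x : G | ‖x‖ < a}.indicator (fun x => ‖f x‖ₑ ^ 2 * ‖x‖ₑ ^ (2 * q)) x ∂μ ≠ ∞) :
    EnergyTight μ f g := by
  obtain ⟨K, hK, hb⟩ := hμ.exists_decayEnergy_le hq0 hq hgm hgq
  set Φ : G → ℝ≥0∞ := fun x => ‖f x‖ₑ ^ 2 * ‖x‖ₑ ^ (2 * q) with hΦ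
  have hΦm : Measurable Φ := by fun_prop
  have hbm : ∀ δ : ℝ, MeasurableSet {x : G | ‖x‖ < δ} := fun δ =>
    measurableSet_lt measurable_norm measurable_const
  set B : Set G := {x | (M : ℝ) < ‖g x‖} with hB
  have hBm : MeasurableSet B := measurableSet_lt measurable_const hgm.norm
  have hB0 : B.indicator g =ᵐ[μ] 0 := by
    filter_upwards [hgM] with u hu
    have : u ∉ B := not_lt.2 hu
    rw [indicator_of_notMem this, Pi.zero_apply]
  have hBe : ∀ t, decayEnergy μ t f (B.indicator g) = 0 :=
    decayEnergy_eq_zero_of_ae hfm (hgm.indicator hBm) hB0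
  have hsmall : ∀ ε : ℝ≥0∞, 0 < ε → ∃ (A : Set G) (N : ℝ≥0), MeasurableSet A ∧
      (∀ x ∉ A, ‖f x‖ ≤ N) ∧ ∀ t : ℝ, 0 < t → decayEnergy μ t (A.indicator f) g ≤ ε := by
    intro ε hε
    have hlim : Tendsto (fun k : ℕ => K * ∫⁻ x, {x : G | ‖x‖ < 1 / ((k : ℝ) + 1)}.indicator
        ({x : G | ‖x‖ < a}.indicator Φ) x ∂μ) atTop (𝓝 0) := by
      have : Tendsto (fun k : ℕ => ∫⁻ x, {x : G | ‖x‖ < 1 / ((k : ℝ) + 1)}.indicator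
          ({x : G | ‖x‖ < a}.indicator Φ) x ∂μ) atTop (𝓝 (∫⁻ _, 0 ∂μ)) := by
        refine tendsto_lintegral_of_dominated_convergence ({x : G | ‖x‖ < a}.indicator Φ)
          (fun k => (hΦm.indicator (hbm _)).indicator (hbm _))
          (fun k => ae_of_all _ fun u => indicator_le_self _ _ _) hnear ?_
        filter_upwards [hμ.ae_ne_zero] with x hx
        refine tendsto_const_nhds.congr' ?_
        filter_upwards [(tendsto_order.1 (tendsto_one_div_add_atTop_nhds_zero_nat (𝕜 := ℝ))).2 _
          (norm_pos_iff.2 hx)] with k hk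
        have : x ∉ {x : G | ‖x‖ < 1 / ((k : ℝ) + 1)} := not_lt.2 hk.le
        rw [indicator_of_notMem this]
      simpa using ENNReal.Tendsto.const_mul (a := K) this (Or.inr hK)
    obtain ⟨k, hk, hka⟩ := (((tendsto_order.1 hlim).2 ε hε).and
      ((tendsto_order.1 (tendsto_one_div_add_atTop_nhds_zero_nat (𝕜 := ℝ))).2 a ha)).exists
    set δ : ℝ := 1 / ((k : ℝ) + 1)
    obtain ⟨N, hN⟩ := hoff δ (by positivity)
    have hNm : MeasurableSet {x : G | (N : ℝ) < ‖f x‖} := measurableSet_lt measurable_const hfm.norm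
    refine ⟨{x | ‖x‖ < δ} ∪ {x | (N : ℝ) < ‖f x‖}, N, (hbm δ).union hNm, fun x hx => ?_,
      fun t ht => ?_⟩
    · by_contra hc
      exact hx (Or.inr (not_le.1 hc))
    · refine (hb _ (hfm.indicator ((hbm δ).union hNm)) t ht).trans (le_trans ?_ hk.le)
      refine mul_le_mul_right (lintegral_mono_ae ?_) _
      filter_upwards [hN] with x hx
      by_cases hxδ : ‖x‖ < δ
      · rw [indicator_of_mem (show x ∈ {x : G | ‖x‖ < δ} from hxδ),
          indicator_of_mem (show x ∈ {x : G | ‖x‖ < a} from hxδ.trans hka)]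
        exact mul_le_mul_left (pow_le_pow_left' (enorm_indicator_le_enorm_self _ _) 2) _
      · rw [indicator_of_notMem (s := {x | ‖x‖ < δ} ∪ {x | (N : ℝ) < ‖f x‖})]
        · simp
        · rintro (h1 | h1)
          · exact hxδ h1
          · exact absurd (hx (not_lt.1 hxδ)) (not_le.2 h1)
  refine ⟨?_, fun ε hε => ?_⟩
  · obtain ⟨A, N, hA, hN, hE⟩ := hsmall 1 one_pos
    have hg2 : ∫⁻ x, ‖g x‖ₑ ^ 2 ∂μ ≠ ∞ := by
      have hm : MemLp g ∞ μ := memLp_top_of_bound hgm.aestronglyMeasurable M hgM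
      have := memLp_of_integrable_of_le hgm hg hm (r := 2) (by norm_num) le_top
      rw [← eLpNorm_two_sq]; exact pow_ne_top this.2.ne
    have := decayConst_ne_top
    exact ⟨_, by finiteness, fun t ht => decayEnergy_le_of_split hμ ht hfm hgm hA hN (hE t ht)⟩
  · obtain ⟨A, N, hA, hN, hE⟩ := hsmall ε hε
    refine ⟨A, B, max N M, hA, hBm, fun x hx => (hN x hx).trans (by simp),
      fun x hx => (not_lt.1 hx).trans (by simp), fun t ht => ⟨hE t ht, ?_⟩⟩
    rw [hBe]; exact zero_le

end Power

/-! ### Singularities of power type on the frequency domain -/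

lemma radiallyDominated_real : RadiallyDominated (volume : Measure ℝ) := fun _ _ => le_rfl

/-- `v` has a zero of power type at the origin that compensates a singularity of `u`. -/
def CondPower (Λ : Set ℝ) (u v : ℝ → ℝ) : Prop :=
  ∃ (q : ℝ) (M : ℝ≥0) (a : ℝ), 0 < q ∧ q < 1 / 2 ∧ 0 < a ∧
    (∀ x ∈ Λ, x ≠ 0 → ‖v x‖ ≤ M ∧ ‖v x‖ ≤ M * |x| ^ q) ∧
    (∀ δ : ℝ, 0 < δ → ∃ N : ℝ≥0, ∀ x ∈ Λ, δ ≤ |x| → ‖u x‖ ≤ N) ∧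
    ∫⁻ x in Λ, {x : ℝ | |x| < a}.indicator (fun x => ‖u x‖ₑ ^ 2 * ‖x‖ₑ ^ (2 * q)) x ≠ ∞

section Singular

variable {Λ : Set ℝ} {u v L L' : ℝ → ℝ} {r α β : ℝ} {M : ℝ≥0}

lemma exists_bound_off_zero (h : BoundedOffZero Λ u) {δ : ℝ} (hδ : 0 < δ) :
    ∃ N : ℝ≥0, ∀ x ∈ Λ, δ ≤ |x| → ‖u x‖ ≤ N := by
  obtain ⟨N, hN⟩ := h δ hδ
  exact ⟨N.toNNReal, fun x hx h1 => (hN x hx h1).trans (Real.le_coe_toNNReal N)⟩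

lemma memLp_of_bounded_off_zero (hΛ : MeasurableSet Λ) (hu : IntegrableOn u Λ)
    (hoff : BoundedOffZero Λ u) (hr : 0 < r) {s : ℝ} (hs : 1 ≤ s)
    (hnear : ∫⁻ x in Λ, {x : ℝ | |x| ≤ r}.indicator (fun x => ‖u x‖ₑ ^ s) x ≠ ∞) :
    MemLp u (ofReal s) (volume.restrict Λ) := by
  obtain ⟨N, hN⟩ := exists_bound_off_zero hoff hr
  have hS : MeasurableSet {x : ℝ | |x| ≤ r} := measurableSet_le measurable_norm measurable_const
  have hs0 : ofReal s ≠ 0 := by simpa using by linarith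
  have h1 : MemLp ({x : ℝ | |x| ≤ r}.indicator u) (ofReal s) (volume.restrict Λ) := by
    refine ⟨hu.1.indicator hS, ?_⟩
    rw [eLpNorm_lt_top_iff_lintegral_rpow_enorm_lt_top hs0 ofReal_ne_top,
      toReal_ofReal (by linarith)]
    refine lt_of_le_of_lt (lintegral_mono fun x => ?_) hnear.lt_top
    by_cases hx : |x| ≤ r
    · rw [indicator_of_mem (by exact hx), indicator_of_mem (by exact hx)]
    · rw [indicator_of_notMem (by exact hx), indicator_of_notMem (by exact hx)]
      simp [show 0 < s by linarith]
  set w := {x : ℝ | |x| ≤ r}ᶜ.indicator u with hw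
  have hwi : Integrable w (volume.restrict Λ) := Integrable.indicator hu hS.compl
  have hwb : ∀ᵐ x ∂(volume.restrict Λ), ‖w x‖ ≤ N := by
    filter_upwards [ae_restrict_mem hΛ] with x hx
    by_cases h : |x| ≤ r
    · rw [hw, indicator_of_notMem (by simpa using h)]; simp
    · rw [hw, indicator_of_mem (by simpa using h)]
      exact hN x hx (not_le.1 h).le
  set w' := hwi.1.aemeasurable.mk w
  have hw' : w =ᵐ[volume.restrict Λ] w' := hwi.1.aemeasurable.ae_eq_mk
  have hwm : Measurable w' := hwi.1.aemeasurable.measurable_mk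
  have h2 : MemLp w' (ofReal s) (volume.restrict Λ) := by
    refine memLp_of_integrable_of_le hwm (hwi.congr hw')
      (memLp_top_of_bound hwm.aestronglyMeasurable N ?_) (by simpa using hs) le_top
    filter_upwards [hwb, hw'] with x h3 h4
    rwa [← h4]
  have := h1.add (h2.ae_eq hw'.symm)
  rwa [hw, indicator_self_add_compl] at this

lemma enorm_le_of_singular (hu : ∀ x ∈ Λ, x ≠ 0 → |x| ≤ r → |u x| ≤ |x| ^ (-α) * |L x|) {x : ℝ}
    (hx : x ∈ Λ) (hx0 : x ≠ 0) (hxr : |x| ≤ r) : ‖u x‖ₑ ≤ ‖x‖ₑ ^ (-α) * ‖L x‖ₑ := by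
  have h0 : 0 < |x| := abs_pos.2 hx0
  rw [← ofReal_norm, ← ofReal_norm, ← ofReal_norm, Real.norm_eq_abs, Real.norm_eq_abs,
    Real.norm_eq_abs, ofReal_rpow_of_pos h0, ← ofReal_mul (by positivity)]
  exact ofReal_le_ofReal (hu x hx hx0 hxr)

lemma ae_ne_zero_real (Λ : Set ℝ) : ∀ᵐ x ∂(volume.restrict Λ), x ≠ (0 : ℝ) :=
  ae_restrict_of_ae (by simp [ae_iff])

lemma lintegral_rpow_near_ne_top (hr : 0 < r) {a : ℝ} (ha : a < 1) (K : ℝ≥0) :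
    ∫⁻ x in Λ, {x : ℝ | |x| ≤ r}.indicator (fun x => K * ‖x‖ₑ ^ (-a)) x ≠ ∞ := by
  have h1 := radiallyDominated_real.lintegral_near_le hr ha
  have hS : MeasurableSet {x : ℝ | |x| ≤ r} := measurableSet_le measurable_norm measurable_const
  refine ne_top_of_le_ne_top (b := K * (2 * ofReal (1 - a)⁻¹ * ofReal r ^ (1 - a))) ?_ ?_
  · have : ofReal r ^ (1 - a) ≠ ∞ :=
      rpow_ne_top_of_nonneg (by linarith) ofReal_ne_top
    finiteness
  · refine (setLIntegral_le_lintegral _ _).trans (le_trans (le_of_eq ?_) (mul_le_mul_right h1 _))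
    rw [← lintegral_const_mul _ (Measurable.indicator (by fun_prop) (by exact hS))]
    refine lintegral_congr fun x => ?_
    by_cases hx : |x| ≤ r
    · rw [indicator_of_mem (by exact hx), indicator_of_mem (by exact hx)]
    · rw [indicator_of_notMem (by exact hx), indicator_of_notMem (by exact hx), mul_zero]

/-- Functions with singularities of power type are in `L^p`. -/
lemma memLp_of_singular (hΛ : MeasurableSet Λ) (hui : IntegrableOn u Λ)
    (hoff : BoundedOffZero Λ u) (hr : 0 < r)
    (hu : ∀ x ∈ Λ, x ≠ 0 → |x| ≤ r → |u x| ≤ |x| ^ (-α) * |L x|)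
    (hL : ∀ x, |x| ≤ r → |L x| ≤ M) {γ : ℝ} (hαγ : α < γ) (hγ : 0 < γ) (hγ1 : γ ≤ 1) :
    MemLp u (ofReal γ)⁻¹ (volume.restrict Λ) := by
  rw [← ofReal_inv_of_pos hγ]
  refine memLp_of_bounded_off_zero hΛ hui hoff hr ((one_le_inv₀ hγ).2 hγ1) ?_
  refine ne_top_of_le_ne_top (lintegral_rpow_near_ne_top (Λ := Λ) hr (a := α * γ⁻¹)
    (by rw [← div_eq_mul_inv, div_lt_one hγ]; exact hαγ) (M ^ γ⁻¹)) (lintegral_mono_ae ?_)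
  filter_upwards [ae_restrict_mem hΛ, ae_ne_zero_real Λ] with x hx hx0
  by_cases hxr : |x| ≤ r
  · rw [indicator_of_mem (by exact hxr), indicator_of_mem (by exact hxr)]
    have hLx : ‖L x‖ₑ ≤ M := by
      rw [← ofReal_norm, ← ofReal_coe_nnreal]; exact ofReal_le_ofReal (hL x hxr)
    have hi : 0 ≤ γ⁻¹ := by positivity
    calc _ ≤ (‖x‖ₑ ^ (-α) * M) ^ γ⁻¹ := ENNReal.rpow_le_rpow
          ((enorm_le_of_singular hu hx hx0 hxr).trans (mul_le_mul_right hLx _)) hi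
      _ = _ := by
          rw [mul_rpow_of_nonneg _ _ hi, ← ENNReal.rpow_mul, mul_comm, neg_mul,
            ENNReal.coe_rpow_of_nonneg _ hi]
  · rw [indicator_of_notMem (by exact hxr), indicator_of_notMem (by exact hxr)]

/-- The critical exponent. -/
lemma memLp_of_singular_critical (hΛ : MeasurableSet Λ) (hui : IntegrableOn u Λ)
    (hoff : BoundedOffZero Λ u) (hr : 0 < r)
    (hu : ∀ x ∈ Λ, x ≠ 0 → |x| ≤ r → |u x| ≤ |x| ^ (-α) * |L x|)
    (hL : ∀ x, |x| ≤ r → |L x| ≤ M) (hα : 0 ≤ α) (hα1 : α ≤ 1 / 2)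
    (hw : MemLp (fun x => |x| ^ (-(1 / 2 : ℝ)) * L x) 2 (volume.restrict (Icc (-r) r))) :
    MemLp u (ofReal α)⁻¹ (volume.restrict Λ) := by
  rcases hα.eq_or_lt with rfl | hα0
  · rw [ENNReal.ofReal_zero, ENNReal.inv_zero]
    obtain ⟨N, hN⟩ := exists_bound_off_zero hoff hr
    refine memLp_top_of_bound hui.1 (max N M) ?_
    filter_upwards [ae_restrict_mem hΛ, ae_ne_zero_real Λ] with x hx hx0
    rcases le_or_gt |x| r with h | h
    · refine le_trans ?_ (le_max_right _ _)
      have := hu x hx hx0 h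
      rw [neg_zero, Real.rpow_zero, one_mul] at this
      exact this.trans (hL x h)
    · exact (hN x hx h.le).trans (le_max_left _ _)
  rw [← ofReal_inv_of_pos hα0]
  have hi : 2 ≤ α⁻¹ := by
    rw [show (2 : ℝ) = (1 / 2)⁻¹ by norm_num]
    exact (inv_le_inv₀ (by norm_num) hα0).2 hα1
  refine memLp_of_bounded_off_zero hΛ hui hoff hr (by linarith) ?_
  have hw2 : ∫⁻ x in Icc (-r) r, ‖|x| ^ (-(1 / 2 : ℝ)) * L x‖ₑ ^ 2 ≠ ∞ := by
    rw [← eLpNorm_two_sq]; exact pow_ne_top hw.2.ne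
  refine ne_top_of_le_ne_top (b := (M : ℝ≥0∞) ^ (α⁻¹ - 2) *
    ∫⁻ x in Icc (-r) r, ‖|x| ^ (-(1 / 2 : ℝ)) * L x‖ₑ ^ 2) (mul_ne_top
    (rpow_ne_top_of_nonneg (by linarith) coe_ne_top) hw2) ?_
  rw [← lintegral_const_mul'' _ (hw.1.enorm.pow_const 2), ← lintegral_indicator measurableSet_Icc]
  refine le_trans (lintegral_mono_ae ?_) (setLIntegral_le_lintegral Λ _)
  filter_upwards [ae_restrict_mem hΛ, ae_ne_zero_real Λ] with x hx hx0
  by_cases hxr : |x| ≤ r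
  · rw [indicator_of_mem (by exact hxr), indicator_of_mem (show x ∈ Icc (-r) r from abs_le.1 hxr)]
    have hLx : ‖L x‖ₑ ≤ M := by
      rw [← ofReal_norm, ← ofReal_coe_nnreal]; exact ofReal_le_ofReal (hL x hxr)
    have hx0' : 0 < |x| := abs_pos.2 hx0
    have e1 : ‖|x| ^ (-(1 / 2 : ℝ))‖ₑ = ‖x‖ₑ ^ (-(1 / 2 : ℝ)) := by
      rw [← ofReal_norm x, Real.norm_eq_abs, ofReal_rpow_of_pos hx0',
        Real.enorm_of_nonneg (by positivity)]
    have hx1 : ‖x‖ₑ ≠ 0 := by simpa using hx0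
    calc _ ≤ (‖x‖ₑ ^ (-α) * ‖L x‖ₑ) ^ α⁻¹ := ENNReal.rpow_le_rpow
          (enorm_le_of_singular hu hx hx0 hxr) (by positivity)
      _ = ‖x‖ₑ ^ (-(1 : ℝ)) * (‖L x‖ₑ ^ (α⁻¹ - 2) * ‖L x‖ₑ ^ 2) := by
          rw [mul_rpow_of_nonneg _ _ (by positivity), ← ENNReal.rpow_mul, neg_mul,
            mul_inv_cancel₀ hα0.ne', ← ENNReal.rpow_two,
            ← ENNReal.rpow_add_of_nonneg _ _ (by linarith) (by norm_num), sub_add_cancel]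
      _ ≤ ‖x‖ₑ ^ (-(1 : ℝ)) * ((M : ℝ≥0∞) ^ (α⁻¹ - 2) * ‖L x‖ₑ ^ 2) := by gcongr
      _ = _ := by
          rw [enorm_mul, e1, mul_pow, ← ENNReal.rpow_two (‖x‖ₑ ^ _), ← ENNReal.rpow_mul]
          norm_num
          ring
  · rw [indicator_of_notMem (by exact hxr)]; exact zero_le

/-- A singularity compensated by a zero. -/
lemma condPower_of_singular (hΛ : MeasurableSet Λ)
    (hoff : BoundedOffZero Λ u) (hoff' : BoundedOffZero Λ v) (hr : 0 < r) (hr1 : r ≤ 1)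
    (hu : ∀ x ∈ Λ, x ≠ 0 → |x| ≤ r → |u x| ≤ |x| ^ (-α) * |L x|)
    (hv : ∀ x ∈ Λ, x ≠ 0 → |x| ≤ r → |v x| ≤ |x| ^ (-β) * |L' x|)
    (hL : ∀ x, |x| ≤ r → |L x| ≤ M) (hL' : ∀ x, |x| ≤ r → |L' x| ≤ M) (hα : α < 1) (hβ : β < 0)
    (hαβ : α + β ≤ 1 / 2)
    (hw : MemLp (fun x => |x| ^ (-(α + β)) * L x) 2 (volume.restrict (Icc (-r) r))) :
    CondPower Λ u v := by
  obtain ⟨N, hN⟩ := exists_bound_off_zero hoff' hr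
  have hvq : ∀ q : ℝ, 0 < q → q ≤ -β → ∃ K : ℝ≥0,
      ∀ x ∈ Λ, x ≠ 0 → ‖v x‖ ≤ K ∧ ‖v x‖ ≤ K * |x| ^ q := by
    intro q hq0 hqβ
    refine ⟨max (max N M) (N * (r.toNNReal ^ q)⁻¹), fun x hx hx0 => ?_⟩
    have hx0' : 0 < |x| := abs_pos.2 hx0
    push_cast
    rw [Real.coe_toNNReal r hr.le]
    rcases le_or_gt |x| r with h | h
    · have h1 : ‖v x‖ ≤ M * |x| ^ q := by
        refine (hv x hx hx0 h).trans ?_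
        rw [mul_comm]
        refine mul_le_mul (hL' x h) ?_ (by positivity) M.2
        exact Real.rpow_le_rpow_of_exponent_ge hx0' (h.trans hr1) hqβ
      have h2 : |x| ^ q ≤ 1 := Real.rpow_le_one hx0'.le (h.trans hr1) hq0.le
      have h3 : (M : ℝ) ≤ max (max (N : ℝ) M) (N * (r ^ q)⁻¹) :=
        (le_max_right _ _).trans (le_max_left _ _)
      exact ⟨(h1.trans (mul_le_of_le_one_right M.2 h2)).trans h3,
        h1.trans (mul_le_mul_of_nonneg_right h3 (by positivity))⟩
    · have h1 := hN x hx h.le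
      refine ⟨h1.trans ((le_max_left _ _).trans (le_max_left _ _)), ?_⟩
      refine le_trans ?_ (mul_le_mul_of_nonneg_right (le_max_right _ _) (by positivity))
      have h2 : r ^ q ≤ |x| ^ q := Real.rpow_le_rpow hr.le h.le hq0.le
      have h3 : 0 < r ^ q := by positivity
      have h4 : 1 ≤ (r ^ q)⁻¹ * |x| ^ q := by rw [inv_mul_eq_div, one_le_div h3]; exact h2
      rw [mul_assoc]
      exact h1.trans (le_mul_of_one_le_right N.2 h4)
  have hmono : ∀ {Φ : ℝ → ℝ≥0∞}, {x : ℝ | |x| < r}.indicator Φ ≤ {x : ℝ | |x| ≤ r}.indicator Φ :=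
    indicator_le_indicator_of_subset (fun x (hx : |x| < r) => hx.le) (fun _ => zero_le)
  rcases hαβ.eq_or_lt with heq | hlt
  · obtain ⟨K, hK⟩ := hvq (-β) (by linarith) le_rfl
    refine ⟨-β, K, r, by linarith, by linarith, hr, hK, fun δ hδ => exists_bound_off_zero hoff hδ, ?_⟩
    have hw2 : ∫⁻ x in Icc (-r) r, ‖|x| ^ (-(α + β)) * L x‖ₑ ^ 2 ≠ ∞ := by
      rw [← eLpNorm_two_sq]; exact pow_ne_top hw.2.ne
    refine ne_top_of_le_ne_top hw2 ((lintegral_mono hmono).trans ?_)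
    rw [← lintegral_indicator measurableSet_Icc]
    refine le_trans (lintegral_mono_ae ?_) (setLIntegral_le_lintegral Λ _)
    filter_upwards [ae_restrict_mem hΛ, ae_ne_zero_real Λ] with x hx hx0
    by_cases hxr : |x| ≤ r
    · rw [indicator_of_mem (by exact hxr), indicator_of_mem (show x ∈ Icc (-r) r from abs_le.1 hxr)]
      have hx0' : 0 < |x| := abs_pos.2 hx0
      have e1 : ‖|x| ^ (-(α + β))‖ₑ = ‖x‖ₑ ^ (-(α + β)) := by
        rw [← ofReal_norm x, Real.norm_eq_abs, ofReal_rpow_of_pos hx0',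
          Real.enorm_of_nonneg (by positivity)]
      have hx1 : ‖x‖ₑ ≠ 0 := by simpa using hx0
      calc _ ≤ (‖x‖ₑ ^ (-α) * ‖L x‖ₑ) ^ 2 * ‖x‖ₑ ^ (2 * -β) :=
            mul_le_mul_left (pow_le_pow_left' (enorm_le_of_singular hu hx hx0 hxr) 2) _
        _ = (‖x‖ₑ ^ (-α)) ^ 2 * ‖x‖ₑ ^ (2 * -β) * ‖L x‖ₑ ^ 2 := by ring
        _ = _ := by
            rw [enorm_mul, e1, mul_pow, ← ENNReal.rpow_two, ← ENNReal.rpow_mul,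
              ← ENNReal.rpow_add _ _ hx1 enorm_ne_top, ← ENNReal.rpow_two (‖x‖ₑ ^ (-(α + β))),
              ← ENNReal.rpow_mul]
            congr 2; ring
    · rw [indicator_of_notMem (by exact hxr)]; exact zero_le
  · obtain ⟨q, hq1, hq2⟩ : ∃ q, max (α - 1 / 2) 0 < q ∧ q < min (-β) (1 / 2) :=
      exists_between (max_lt (lt_min (by linarith) (by linarith)) (lt_min (by linarith) (by norm_num)))
    rw [max_lt_iff] at hq1
    rw [lt_min_iff] at hq2
    obtain ⟨K, hK⟩ := hvq q hq1.2 hq2.1.le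
    refine ⟨q, K, r, hq1.2, hq2.2, hr, hK, fun δ hδ => exists_bound_off_zero hoff hδ, ?_⟩
    refine ne_top_of_le_ne_top (lintegral_rpow_near_ne_top (Λ := Λ) hr (a := 2 * (α - q))
      (by linarith) (M ^ 2)) ((lintegral_mono hmono).trans (lintegral_mono_ae ?_))
    filter_upwards [ae_restrict_mem hΛ, ae_ne_zero_real Λ] with x hx hx0
    by_cases hxr : |x| ≤ r
    · rw [indicator_of_mem (by exact hxr), indicator_of_mem (by exact hxr)]
      have hLx : ‖L x‖ₑ ≤ M := by
        rw [← ofReal_norm, ← ofReal_coe_nnreal]; exact ofReal_le_ofReal (hL x hxr)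
      have hx1 : ‖x‖ₑ ≠ 0 := by simpa using hx0
      calc _ ≤ (‖x‖ₑ ^ (-α) * M) ^ 2 * ‖x‖ₑ ^ (2 * q) :=
            mul_le_mul_left (pow_le_pow_left' ((enorm_le_of_singular hu hx hx0 hxr).trans
              (mul_le_mul_right hLx _)) 2) _
        _ = M ^ 2 * ((‖x‖ₑ ^ (-α)) ^ 2 * ‖x‖ₑ ^ (2 * q)) := by ring
        _ = _ := by
            rw [← ENNReal.rpow_two (‖x‖ₑ ^ _), ← ENNReal.rpow_mul,
              ← ENNReal.rpow_add _ _ hx1 enorm_ne_top]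
            push_cast
            congr 2; ring
    · rw [indicator_of_notMem (by exact hxr)]; exact zero_le

/-- Reduction of the condition on power singularities. -/
theorem CondSingular.cases (hΛ : MeasurableSet Λ) (hui : IntegrableOn u Λ) (hvi : IntegrableOn v Λ)
    (hu0 : ∀ x ∈ Λ, 0 ≤ u x) (h : CondSingular Λ u v) :
    CondLp Λ u v ∨ CondPower Λ u v ∨ CondPower Λ v u := by
  obtain ⟨hoff, hoff', a, α, β, L, L', ha, hα, hβ, hαβ, hL, hL', hw, hw', hu, hv⟩ := h
  obtain ⟨b, hb, ⟨M, hM⟩, -⟩ := hL.local_cond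
  obtain ⟨b', hb', ⟨M', hM'⟩, -⟩ := hL'.local_cond
  set r := min (min a 1) (min b b') with hr
  have hr0 : 0 < r := lt_min (lt_min ha one_pos) (lt_min hb hb')
  have hra : r ≤ a := (min_le_left _ _).trans (min_le_left _ _)
  have hr1 : r ≤ 1 := (min_le_left _ _).trans (min_le_right _ _)
  have hrb : r ≤ b := (min_le_right _ _).trans (min_le_left _ _)
  have hrb' : r ≤ b' := (min_le_right _ _).trans (min_le_right _ _)
  set K : ℝ≥0 := max M.toNNReal M'.toNNReal with hK
  have hLK : ∀ x, |x| ≤ r → |L x| ≤ K := fun x hx =>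
    (hM x (abs_le.1 (hx.trans hrb))).trans ((Real.le_coe_toNNReal M).trans (by simp [hK]))
  have hLK' : ∀ x, |x| ≤ r → |L' x| ≤ K := fun x hx =>
    (hM' x (abs_le.1 (hx.trans hrb'))).trans ((Real.le_coe_toNNReal M').trans (by simp [hK]))
  have hu1 : ∀ x ∈ Λ, x ≠ 0 → |x| ≤ r → |u x| ≤ |x| ^ (-α) * |L x| := fun x hx hx0 hxr => by
    rw [abs_of_nonneg (hu0 x hx)]
    exact (hu x (abs_le.1 (hxr.trans hra)) hx0).trans
      (mul_le_mul_of_nonneg_left (le_abs_self _) (by positivity))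
  have hv1 : ∀ x ∈ Λ, x ≠ 0 → |x| ≤ r → |v x| ≤ |x| ^ (-β) * |L' x| := fun x hx hx0 hxr =>
    (hv x (abs_le.1 (hxr.trans hra)) hx0).trans
      (mul_le_mul_of_nonneg_left (le_abs_self _) (by positivity))
  have hsub : Icc (-r) r ⊆ Icc (-a) a := Icc_subset_Icc (by linarith) hra
  have hwr := hw.mono_measure (Measure.restrict_mono hsub le_rfl)
  have hwr' := hw'.mono_measure (Measure.restrict_mono hsub le_rfl)
  rcases lt_or_ge β 0 with hβ0 | hβ0
  · exact Or.inr (Or.inl (condPower_of_singular hΛ hoff hoff' hr0 hr1 hu1 hv1 hLK hLK' hα hβ0 hαβ hwr))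
  rcases lt_or_ge α 0 with hα0 | hα0
  · refine Or.inr (Or.inr (condPower_of_singular hΛ hoff' hoff hr0 hr1 hv1 hu1 hLK' hLK hβ hα0
      (by linarith) ?_))
    rwa [add_comm β]
  left
  have hhalf : ∀ {x y : ℝ}, 0 ≤ x → 0 ≤ y → x + y = 1 / 2 →
      (ofReal x)⁻¹⁻¹ + (ofReal y)⁻¹⁻¹ ≤ 2⁻¹ := fun hx hy hxy => by
    rw [inv_inv, inv_inv, ← ENNReal.ofReal_add hx hy, hxy, one_div,
      ofReal_inv_of_pos two_pos, ENNReal.ofReal_ofNat]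
  have hone : ∀ {x : ℝ}, x ≤ 1 → 1 ≤ (ofReal x)⁻¹ := fun hx => by
    rw [ENNReal.one_le_inv]; simpa using hx
  rcases hαβ.eq_or_lt with heq | hlt
  · rw [heq] at hwr hwr'
    exact ⟨_, _, hone (by linarith), hone (by linarith), hhalf hα0 hβ0 heq,
      memLp_of_singular_critical hΛ hui hoff hr0 hu1 hLK hα0 (by linarith) hwr,
      memLp_of_singular_critical hΛ hvi hoff' hr0 hv1 hLK' hβ0 (by linarith) hwr'⟩
  · set d := (1 / 2 - α - β) / 2 with hd
    have hd0 : 0 < d := by rw [hd]; linarith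
    exact ⟨_, _, hone (x := α + d) (by linarith), hone (x := β + d) (by linarith),
      hhalf (by linarith) (by linarith) (by rw [hd]; ring),
      memLp_of_singular hΛ hui hoff hr0 hu1 hLK (by linarith) (by linarith) (by linarith),
      memLp_of_singular hΛ hvi hoff' hr0 hv1 hLK' (by linarith) (by linarith) (by linarith)⟩

end Singular

/-! ### Time and frequency -/

section TimeFrequency

variable {S : Type*} [MeasurableSpace S] [AddCommGroup S] {τ : Measure S} [IsFiniteMeasure τ]
  {e : S → G → ℂ}

/-- A pairing of time and frequency. -/
structure IsPairing (e : S → G → ℂ) : Prop where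
  meas : Measurable fun p : S × G => e p.1 p.2
  norm_eq : ∀ t x, ‖e t x‖ = 1
  map_add : ∀ t x y, e t (x + y) = e t x * e t y
  map_neg : ∀ t x, e t (-x) = conj (e t x)
  map_sub : ∀ t s x, e (t - s) x = e t x * conj (e s x)

/-- The Fourier transform of the weight `w` on the time domain. -/
def taperFT (τ : Measure S) (e : S → G → ℂ) (w : S → ℝ) (x : G) : ℂ :=
  ∫ t, (w t : ℂ) * e t x ∂τ

variable {w : S → ℝ} {K : ℝ}

lemma measurable_taperFT (he : IsPairing e) (hw : Measurable w) : Measurable (taperFT τ e w) := by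
  have : Measurable fun p : G × S => (w p.2 : ℂ) * e p.2 p.1 :=
    (Complex.measurable_ofReal.comp (hw.comp measurable_snd)).mul (he.meas.comp measurable_swap)
  exact this.stronglyMeasurable.integral_prod_right'.measurable

lemma norm_taperFT_le (he : IsPairing e) (hK : ∀ t, |w t| ≤ K) (x : G) :
    ‖taperFT τ e w x‖ ≤ K * τ.real univ :=
  norm_integral_le_of_norm_le_const (ae_of_all _ fun t => by
    rw [norm_mul, he.norm_eq, mul_one, Complex.norm_real]; exact hK t)

lemma conj_taperFT (he : IsPairing e) (x : G) : conj (taperFT τ e w x) = taperFT τ e w (-x) := by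
  rw [taperFT, ← integral_conj]
  exact integral_congr_ae (ae_of_all _ fun t => by simp [he.map_neg])

/-- The trace of the square of a Hermitian kernel. -/
lemma mtrace_mcomp_self {β : Type*} [MeasurableSpace β] {ν : Measure β} [IsFiniteMeasure ν]
    {k : β → β → ℂ} {b : ℝ} (hk : BddKernel k b) (hc : ∀ x y, conj (k x y) = k y x) :
    mtrace ν (mcomp ν k k) = ((hsq ν k).toReal : ℂ) := by
  have hm : Measurable fun p : β × β => ‖k p.1 p.2‖ ^ 2 := hk.meas.norm.pow_const 2
  have hi : Integrable (fun p : β × β => ‖k p.1 p.2‖ ^ 2) (ν.prod ν) :=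
    Integrable.of_bound hm.aestronglyMeasurable (b ^ 2) (ae_of_all _ fun p => by
      rw [norm_pow, norm_norm]; exact pow_le_pow_left₀ (norm_nonneg _) (hk.bound _ _) 2)
  have e1 : (hsq ν k).toReal = ∫ p, ‖k p.1 p.2‖ ^ 2 ∂(ν.prod ν) := by
    rw [integral_eq_lintegral_of_nonneg_ae (ae_of_all _ fun p => by positivity)
      hm.aestronglyMeasurable, hsq]
    simp_rw [ENNReal.ofReal_pow (norm_nonneg _), ofReal_norm]
  rw [e1, integral_prod _ hi, ← integral_complex_ofReal]
  refine integral_congr_ae (ae_of_all _ fun x => ?_)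
  simp only [mcomp]
  rw [← integral_complex_ofReal]
  refine integral_congr_ae (ae_of_all _ fun y => ?_)
  simp only [← hc x y, Complex.mul_conj, Complex.normSq_eq_norm_sq]

lemma ofReal_mcomp (k l : S → S → ℝ) : (fun t s => ((mcomp τ k l t s : ℝ) : ℂ)) =
    mcomp τ (fun t s => (k t s : ℂ)) fun t s => (l t s : ℂ) := by
  funext t s
  simp only [mcomp]
  rw [← integral_complex_ofReal]
  simp

lemma ofReal_mtrace2 (k l : S → S → ℝ) : ((mtrace2 τ k l : ℝ) : ℂ) =
    mtrace2 τ (fun t s => (k t s : ℂ)) fun t s => (l t s : ℂ) := by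
  rw [mtrace2, mtrace2, ← ofReal_mcomp, ← ofReal_mcomp, mtrace, mtrace, ← integral_complex_ofReal]

lemma ofReal_mtrace4 (k l : S → S → ℝ) : ((mtrace4 τ k l : ℝ) : ℂ) =
    mtrace4 τ (fun t s => (k t s : ℂ)) fun t s => (l t s : ℂ) := by
  rw [mtrace4, mtrace4, ← ofReal_mcomp, ← ofReal_mcomp, ← ofReal_mcomp, mtrace, mtrace,
    ← integral_complex_ofReal]

variable {f g : G → ℝ} {γ ρ : S → ℝ}

lemma measurable_of_fourier (he : IsPairing e) (hgm : Measurable g)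
    (hγ : ∀ t, ∫ x, (g x : ℂ) * e t x ∂μ = γ t) : Measurable γ := by
  have h1 : Measurable fun p : S × G => (g p.2 : ℂ) * e p.1 p.2 :=
    (Complex.measurable_ofReal.comp (hgm.comp measurable_snd)).mul he.meas
  have h2 : Measurable fun t => ∫ x, (g x : ℂ) * e t x ∂μ :=
    h1.stronglyMeasurable.integral_prod_right'.measurable
  simp_rw [hγ] at h2
  exact Complex.measurable_re.comp h2

lemma abs_le_of_fourier (he : IsPairing e) (hγ : ∀ t, ∫ x, (g x : ℂ) * e t x ∂μ = γ t) (t : S) :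
    |γ t| ≤ ∫ x, |g x| ∂μ := by
  have : ‖((γ t : ℝ) : ℂ)‖ ≤ ∫ x, |g x| ∂μ := by
    rw [← hγ]
    refine (norm_integral_le_integral_norm _).trans (le_of_eq (integral_congr_ae
      (ae_of_all _ fun x => ?_)))
    simp [he.norm_eq]
  simpa using this

/-- The kernel of the quadratic form in the time domain and its transform. -/
lemma transform_taperFT [MeasurableSub₂ S] (he : IsPairing e) (hw : Measurable w)
    (hK : ∀ t, |w t| ≤ K)
    (hg : Integrable g μ) (hγ : ∀ t, ∫ x, (g x : ℂ) * e t x ∂μ = γ t) :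
    transform μ (taperFT τ e w) g = mcomp τ (fun x t => conj (e t x))
      (mcomp τ (fun t s => ((γ (t - s) * w t * w s : ℝ) : ℂ)) e) := by
  funext x y
  have hwc : Measurable fun t => (w t : ℂ) := Complex.measurable_ofReal.comp hw
  set F : G → S × S → ℂ := fun u p => (g u : ℂ) *
    (((w p.1 : ℂ) * e p.1 (u - x)) * ((w p.2 : ℂ) * e p.2 (y - u))) with hF
  have hFi : Integrable (Function.uncurry F) (μ.prod (τ.prod τ)) := by
    have h1 : Integrable (fun q : G × S × S => (g q.1 : ℂ) * (1 : ℂ)) (μ.prod (τ.prod τ)) :=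
      Integrable.mul_prod (f := fun u => (g u : ℂ)) (g := fun _ : S × S => (1 : ℂ)) hg.ofReal
        (integrable_const _)
    simp only [mul_one] at h1
    have hm : Measurable fun q : G × S × S =>
        ((w q.2.1 : ℂ) * e q.2.1 (q.1 - x)) * ((w q.2.2 : ℂ) * e q.2.2 (y - q.1)) := by
      have a1 := he.meas.comp (by fun_prop : Measurable fun q : G × S × S => (q.2.1, q.1 - x))
      have a2 := he.meas.comp (by fun_prop : Measurable fun q : G × S × S => (q.2.2, y - q.1))
      exact ((hwc.comp (by fun_prop)).mul a1).mul ((hwc.comp (by fun_prop)).mul a2)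
    refine h1.mul_bdd (c := K * K) hm.aestronglyMeasurable (ae_of_all _ fun q => ?_)
    rw [norm_mul, norm_mul, norm_mul, he.norm_eq, he.norm_eq, mul_one, mul_one, Complex.norm_real,
      Complex.norm_real]
    exact mul_le_mul (hK _) (hK _) (norm_nonneg _) ((abs_nonneg _).trans (hK q.2.1))
  have hpt : ∀ p : S × S, ∫ u, F u p ∂μ =
      conj (e p.1 x) * (((γ (p.1 - p.2) * w p.1 * w p.2 : ℝ) : ℂ) * e p.2 y) := by
    intro p
    have : ∀ u, F u p = conj (e p.1 x) * ((w p.1 : ℂ) * (w p.2) * e p.2 y) *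
        ((g u : ℂ) * e (p.1 - p.2) u) := fun u => by
      simp only [hF, sub_eq_add_neg u x, sub_eq_add_neg y u, he.map_add, he.map_neg, he.map_sub]
      ring
    simp_rw [this]
    rw [integral_const_mul, hγ]
    push_cast; ring
  calc transform μ (taperFT τ e w) g x y = ∫ u, ∫ p, F u p ∂(τ.prod τ) ∂μ := by
        refine integral_congr_ae (ae_of_all _ fun u => ?_)
        simp only [hF]
        rw [integral_const_mul, integral_prod_mul (fun t => (w t : ℂ) * e t (u - x))
          (fun s => (w s : ℂ) * e s (y - u))]
        rfl
    _ = ∫ p, ∫ u, F u p ∂μ ∂(τ.prod τ) := integral_integral_swap hFi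
    _ = ∫ p : S × S, conj (e p.1 x) * (((γ (p.1 - p.2) * w p.1 * w p.2 : ℝ) : ℂ) * e p.2 y)
          ∂(τ.prod τ) := integral_congr_ae (ae_of_all _ hpt)
    _ = _ := by
        have hi : Integrable (fun p : S × S => ∫ u, F u p ∂μ) (τ.prod τ) := hFi.integral_prod_right
        rw [integral_prod _ (hi.congr (ae_of_all _ hpt))]
        simp only [mcomp, integral_const_mul]

/-- Traces in the time domain as integrals in the frequency domain. -/
theorem mtrace_eq_hsq [MeasurableSub₂ S] (he : IsPairing e) (hw : Measurable w)
    (hK : ∀ t, |w t| ≤ K) (hfm : Measurable f) (hgm : Measurable g)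
    (hf : Integrable f μ) (hg : Integrable g μ) (hf0 : ∀ x, 0 ≤ f x)
    (hγ : ∀ t, ∫ x, (g x : ℂ) * e t x ∂μ = γ t) (hρ : ∀ t, ∫ x, (f x : ℂ) * e t x ∂μ = ρ t) :
    mtrace2 τ (fun t s => γ (t - s) * w t * w s) (fun t s => ρ (t - s)) =
      ∫ p, f p.1 * f p.2 * ‖transform μ (taperFT τ e w) g p.1 p.2‖ ^ 2 ∂(μ.prod μ) ∧
    mtrace4 τ (fun t s => γ (t - s) * w t * w s) (fun t s => ρ (t - s)) =
      (hsq (densityMeasure μ f) (mcomp (densityMeasure μ f) (transform μ (taperFT τ e w) g)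
        (transform μ (taperFT τ e w) g))).toReal := by
  have := isFiniteMeasure_densityMeasure hf
  set ν := densityMeasure μ f with hν
  set D := transform μ (taperFT τ e w) g with hD
  rcases isEmpty_or_nonempty S with hS | ⟨⟨t₀⟩⟩
  · have : τ = 0 := Measure.eq_zero_of_isEmpty τ
    have hD0 : D = fun _ _ => 0 := by funext x y; simp [hD, transform, taperFT, this]
    simp [mtrace2, mtrace4, mtrace, this, hD0, hsq, mcomp]
  have hK0 : 0 ≤ K := (abs_nonneg _).trans (hK t₀)
  have hγm := measurable_of_fourier he hgm hγ
  have hB : BddKernel (fun t s => ((γ (t - s) * w t * w s : ℝ) : ℂ)) ((∫ x, |g x| ∂μ) * K * K) := by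
    refine ⟨Complex.measurable_ofReal.comp (by fun_prop), fun t s => ?_⟩
    rw [Complex.norm_real, norm_mul, norm_mul]
    exact mul_le_mul (mul_le_mul (abs_le_of_fourier he hγ _) (hK _) (abs_nonneg _)
      (integral_nonneg fun _ => abs_nonneg _)) (hK _) (abs_nonneg _)
      (mul_nonneg (integral_nonneg fun _ => abs_nonneg _) hK0)
  have hE : BddKernel e 1 := ⟨he.meas, fun t x => (he.norm_eq t x).le⟩
  have hE' : BddKernel (fun (x : G) (t : S) => conj (e t x)) 1 :=
    ⟨(Complex.continuous_conj.measurable.comp he.meas).comp measurable_swap, fun x t => by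
      rw [RCLike.norm_conj]; exact (he.norm_eq t x).le⟩
  have hDe := transform_taperFT (τ := τ) he hw hK hg hγ
  obtain ⟨t2, t4⟩ := mtrace_factor (ν := ν) hB hE hE'
    (mul_nonneg (mul_nonneg (integral_nonneg fun _ => abs_nonneg _) hK0) hK0) zero_le_one zero_le_one
    hDe
  have hR : mcomp ν e (fun (x : G) (t : S) => conj (e t x)) = fun t s => ((ρ (t - s) : ℝ) : ℂ) := by
    funext t s
    rw [mcomp, hν, densityMeasure, integral_withDensity_eq_integral_toReal_smul
      hfm.ennreal_ofReal (ae_of_all _ fun _ => ofReal_lt_top), ← hρ]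
    refine integral_congr_ae (ae_of_all _ fun x => ?_)
    simp only [toReal_ofReal (hf0 x), he.map_sub, Complex.real_smul]
  rw [hR, ← hD] at t2 t4
  have hDb : BddKernel D ((∫ u, |g u| ∂μ) * ((K * τ.real univ) * (K * τ.real univ))) :=
    ⟨measurable_transform (measurable_taperFT he hw) hgm,
      norm_transform_le (norm_taperFT_le he hK) hg⟩
  have hDc : ∀ x y, conj (D x y) = D y x := conj_transform (conj_taperFT he) g
  have hNc : ∀ x y, conj (mcomp ν D D x y) = mcomp ν D D y x := fun x y => by
    simp only [mcomp]
    rw [← integral_conj]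
    refine integral_congr_ae (ae_of_all _ fun z => ?_)
    simp only [map_mul, hDc]; ring
  rw [mtrace_mcomp_self hDb hDc] at t2
  rw [mtrace_mcomp_self (hDb.comp hDb (by positivity)) hNc] at t4
  rw [← ofReal_mtrace2, Complex.ofReal_inj] at t2
  rw [← ofReal_mtrace4, Complex.ofReal_inj] at t4
  refine ⟨?_, t4⟩
  rw [t2, hsq_densityMeasure hfm hf hf0 hDb, toReal_ofReal]
  exact integral_nonneg fun p => mul_nonneg (mul_nonneg (hf0 _) (hf0 _)) (by positivity)

end TimeFrequency

/-! ### Convergence in distribution -/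

/-- Convergence of normalized random variables from Gaussian approximations of their
characteristic functions. -/
theorem tendstoInDistribution_of_charFun {Ω : Type*} [MeasurableSpace Ω] {P : Measure Ω}
    [IsProbabilityMeasure P] {Q : ℕ → Ω → ℝ} {T m₂ m₄ : ℕ → ℝ} {v : ℝ} (hv : 0 ≤ v)
    (hT : ∀ n, 0 < T n) (h : ∀ n, HasQuadLaw P (Q n) (m₂ n) (m₄ n))
    (h2 : Tendsto (fun n => (T n)⁻¹ * m₂ n) atTop (𝓝 (v / 2)))
    (h4 : Tendsto (fun n => (T n)⁻¹ ^ 2 * m₄ n) atTop (𝓝 0)) :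
    TendstoInDistribution (fun n => normalized P (T n) (Q n)) atTop (id : ℝ → ℝ) (fun _ => P)
      (gaussianReal 0 v.toNNReal) where
  forall_aemeasurable n := ((h n).1.1.aemeasurable.sub_const _).const_mul _
  tendsto := by
    refine ProbabilityMeasure.tendsto_iff_tendsto_charFun.2 fun θ => ?_
    have hm : ∀ n, AEMeasurable (normalized P (T n) (Q n)) P := fun n =>
      ((h n).1.1.aemeasurable.sub_const _).const_mul _
    have hc : ∀ n, charFun (P.map (normalized P (T n) (Q n))) θ =
        ∫ ω, Complex.exp (((θ * (√(T n))⁻¹) * (Q n ω - ∫ ω', Q n ω' ∂P) : ℝ) * Complex.I) ∂P := by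
      intro n
      rw [charFun_apply_real, integral_map (hm n) (by fun_prop)]
      refine integral_congr_ae (ae_of_all _ fun ω => ?_)
      simp only [normalized]
      congr 2
      push_cast; ring
    simp only [ProbabilityMeasure.coe_mk, Measure.map_id, hc, charFun_gaussianReal]
    have e0 : ∀ n, (θ * (√(T n))⁻¹) ^ 2 * m₂ n = θ ^ 2 * ((T n)⁻¹ * m₂ n) := fun n => by
      rw [mul_pow, inv_pow, Real.sq_sqrt (hT n).le, mul_assoc]
    have e1 : ∀ n, chiSqConst * |θ * (√(T n))⁻¹| ^ 3 * √(m₂ n * m₄ n) =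
        chiSqConst * |θ| ^ 3 * √(((T n)⁻¹ * m₂ n) * ((T n)⁻¹ ^ 2 * m₄ n)) := fun n => by
      have a : (0 : ℝ) ≤ (T n)⁻¹ := inv_nonneg.2 (hT n).le
      rw [show ((T n)⁻¹ * m₂ n) * ((T n)⁻¹ ^ 2 * m₄ n) = (T n)⁻¹ ^ 3 * (m₂ n * m₄ n) by ring,
        Real.sqrt_mul (pow_nonneg a 3), abs_mul, mul_pow, ← Real.sqrt_inv,
        abs_of_nonneg (Real.sqrt_nonneg _)]
      have : √((T n)⁻¹ ^ 3) = √(T n)⁻¹ ^ 3 := by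
        rw [Real.sqrt_eq_iff_mul_self_eq (pow_nonneg a 3) (by positivity)]
        rw [← mul_pow, Real.mul_self_sqrt a]
      rw [this]; ring
    have b1 : Tendsto (fun n => chiSqConst * |θ| ^ 3 * √(((T n)⁻¹ * m₂ n) * ((T n)⁻¹ ^ 2 * m₄ n))) atTop
        (𝓝 0) := by
      have := ((h2.mul h4).sqrt).const_mul (chiSqConst * |θ| ^ 3)
      simpa using this
    have b2 := squeeze_zero_norm (fun n => by
      have := (h n).2.2 (θ * (√(T n))⁻¹)
      rwa [e1, e0] at this) b1
    have b3 : Tendsto (fun n => Complex.exp (-(θ ^ 2 * ((T n)⁻¹ * m₂ n) : ℝ))) atTop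
        (𝓝 (Complex.exp (-(θ ^ 2 * (v / 2) : ℝ)))) :=
      (Complex.continuous_exp.tendsto _).comp
        ((Complex.continuous_ofReal.tendsto _).comp (h2.const_mul (θ ^ 2))).neg
    have b4 := b2.add b3
    simp only [sub_add_cancel, zero_add] at b4
    convert b4 using 2
    rw [Real.coe_toNNReal v hv]
    push_cast; ring_nf

/-! ### Charts of the frequency group -/

section Chart

/-- An isometric measurable section `s` of a covering `q : ℝ → G` with image in `Λ`. -/
structure FreqChart (Λ : Set ℝ) (μ : Measure G) (q : ℝ →+ G) (s : G → ℝ) : Prop where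
  measurableSet : MeasurableSet Λ
  emb : MeasurableEmbedding s
  map_eq : μ.map s = volume.restrict Λ
  mem : ∀ x, s x ∈ Λ
  abs_eq : ∀ x, |s x| = ‖x‖
  right_inv : ∀ x, q (s x) = x
  nhds : map q (𝓝 0) = 𝓝 0

variable {Λ : Set ℝ} {q : ℝ →+ G} {s : G → ℝ}

lemma FreqChart.mp (hc : FreqChart Λ μ q s) : MeasurePreserving s μ (volume.restrict Λ) :=
  ⟨hc.emb.measurable, hc.map_eq⟩

lemma FreqChart.radial (hc : FreqChart Λ μ q s) : RadiallyDominated μ := fun ψ _ => by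
  simp_rw [← hc.abs_eq]
  rw [hc.mp.lintegral_comp_emb hc.emb fun t => ψ |t|]
  exact setLIntegral_le_lintegral _ _

lemma FreqChart.ae (hc : FreqChart Λ μ q s) {p : ℝ → Prop} (h : ∀ x ∈ Λ, x ≠ 0 → p x) :
    ∀ᵐ u ∂μ, p (s u) := by
  refine hc.mp.quasiMeasurePreserving.ae (p := p) ?_
  have h1 : ∀ᵐ x ∂(volume.restrict Λ : Measure ℝ), x ≠ 0 := ae_restrict_of_ae (Measure.ae_ne volume 0)
  filter_upwards [h1, ae_restrict_mem hc.measurableSet] with x h1 h2 using h x h2 h1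

lemma FreqChart.memLp (hc : FreqChart Λ μ q s) {f : ℝ → ℝ} {F : G → ℝ} {p : ℝ≥0∞}
    (hF : F =ᵐ[μ] f ∘ s) (h : MemLp f p (volume.restrict Λ)) : MemLp F p μ :=
  (memLp_congr_ae hF).2 (h.comp_measurePreserving hc.mp)

lemma FreqChart.integrable (hc : FreqChart Λ μ q s) {f : ℝ → ℝ} {F : G → ℝ}
    (hF : F =ᵐ[μ] f ∘ s) (h : IntegrableOn f Λ) : Integrable F μ :=
  memLp_one_iff_integrable.1 (hc.memLp hF (memLp_one_iff_integrable.2 h))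

lemma FreqChart.exists_version (hc : FreqChart Λ μ q s) {f : ℝ → ℝ} (hf : IntegrableOn f Λ) :
    ∃ F : G → ℝ, Measurable F ∧ F =ᵐ[μ] f ∘ s ∧ ((∀ x ∈ Λ, 0 ≤ f x) → ∀ x, 0 ≤ F x) := by
  have h1 : AEMeasurable (f ∘ s) μ :=
    hf.aemeasurable.comp_quasiMeasurePreserving hc.mp.quasiMeasurePreserving
  by_cases h0 : ∀ x ∈ Λ, 0 ≤ f x
  · refine ⟨fun x => max (h1.mk _ x) 0, h1.measurable_mk.max measurable_const, ?_,
      fun _ x => le_max_right _ _⟩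
    filter_upwards [h1.ae_eq_mk] with x hx
    rw [← hx, Function.comp_apply, max_eq_left (h0 _ (hc.mem x))]
  · exact ⟨_, h1.measurable_mk, h1.ae_eq_mk.symm, fun h => absurd h h0⟩

lemma ae_eq_comp_sub {F F' : G → ℝ} (h : F =ᵐ[μ] F') (z : G) :
    (fun u => F (u - z)) =ᵐ[μ] fun u => F' (u - z) :=
  (measurePreserving_sub_right μ z).quasiMeasurePreserving.ae_eq_comp h

variable {f g : ℝ → ℝ} {F Γ : G → ℝ}

lemma FreqChart.conv4_eq (hc : FreqChart Λ μ q s) (hfp : ∀ x, f (s (q x)) = f x)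
    (hgp : ∀ x, g (s (q x)) = g x) (hF : F =ᵐ[μ] f ∘ s) (hΓ : Γ =ᵐ[μ] g ∘ s) (x : ℝ × ℝ × ℝ) :
    conv4 μ F Γ F Γ (q x.1, q x.2.1, q x.2.2) = convFun Λ f g x := by
  rw [convFun, ← hc.mp.integral_comp hc.emb, conv4]
  refine integral_congr_ae ?_
  filter_upwards [hF, ae_eq_comp_sub hΓ (q x.1), ae_eq_comp_sub hF (q x.2.1),
    ae_eq_comp_sub hΓ (q x.2.2)] with u h1 h2 h3 h4
  have e : ∀ y, s (u - q y) = s (q (s u - y)) := fun y => by rw [map_sub, hc.right_inv]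
  simp only [h1, h2, h3, h4, Function.comp_apply, e, hfp, hgp]

lemma FreqChart.lintegral_translate (hc : FreqChart Λ μ q s)
    (hgp : ∀ x, g (s (q x)) = g x) (hF : F =ᵐ[μ] f ∘ s) (hΓ : Γ =ᵐ[μ] g ∘ s) (m : ℝ) :
    ∫⁻ u, ‖F u‖ₑ ^ 2 * ‖Γ (u - q m)‖ₑ ^ 2 ∂μ =
      ∫⁻ x in Λ, ofReal (f x ^ 2 * g (x - m) ^ 2) := by
  rw [← hc.mp.lintegral_comp_emb hc.emb]
  refine lintegral_congr_ae ?_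
  filter_upwards [hF, ae_eq_comp_sub hΓ (q m)] with u h1 h2
  rw [h1, h2, ofReal_mul (sq_nonneg _)]
  have e : s (u - q m) = s (q (s u - m)) := by rw [map_sub, hc.right_inv]
  simp only [Function.comp_apply, e, hgp, Real.enorm_eq_ofReal_abs,
    ← ENNReal.ofReal_pow (abs_nonneg _), sq_abs]

lemma FreqChart.energyTight (hc : FreqChart Λ μ q s) (hF : Measurable F) (hΓ : Measurable Γ)
    (hFf : F =ᵐ[μ] f ∘ s) (hΓg : Γ =ᵐ[μ] g ∘ s) (hΓi : Integrable Γ μ)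
    (h : CondPower Λ f g) : EnergyTight μ F Γ := by
  obtain ⟨r, M, a, hr0, hr, ha, hb, hoff, hnear⟩ := h
  refine energyTight_of_power hc.radial hF hΓ hΓi hr0 hr (M := M) ?_ ?_ (fun δ hδ => ?_) ha ?_
  · filter_upwards [hΓg, hc.ae fun x hx h0 => (hb x hx h0).1] with u h1 h2
    rwa [h1]
  · filter_upwards [hΓg, hc.ae fun x hx h0 => (hb x hx h0).2] with u h1 h2
    rwa [h1, ← hc.abs_eq]
  · obtain ⟨N, hN⟩ := hoff δ hδ
    refine ⟨N, ?_⟩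
    filter_upwards [hFf] with u h1 h2
    rw [h1]; exact hN _ (hc.mem u) (by rwa [hc.abs_eq])
  · rw [← hc.mp.lintegral_comp_emb hc.emb] at hnear
    convert hnear using 1
    refine lintegral_congr_ae ?_
    filter_upwards [hFf] with u h1
    have e : ‖s u‖ₑ = ‖u‖ₑ := by rw [Real.enorm_eq_ofReal_abs, hc.abs_eq, ofReal_norm]
    by_cases hu : ‖u‖ < a
    · rw [indicator_of_mem (by exact hu),
        indicator_of_mem (show s u ∈ {x : ℝ | |x| < a} from (hc.abs_eq u).trans_lt hu), h1, e]; rfl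
    · rw [indicator_of_notMem (by exact hu),
        indicator_of_notMem (show s u ∉ {x : ℝ | |x| < a} from fun h => hu (hc.abs_eq u ▸ h))]

lemma FreqChart.integral_sq (hc : FreqChart Λ μ q s) (hFf : F =ᵐ[μ] f ∘ s) (hΓg : Γ =ᵐ[μ] g ∘ s) :
    ∫ u, F u ^ 2 * Γ u ^ 2 ∂μ = ∫ x in Λ, f x ^ 2 * g x ^ 2 := by
  rw [← hc.mp.integral_comp hc.emb]
  refine integral_congr_ae ?_
  filter_upwards [hFf, hΓg] with u h1 h2
  rw [h1, h2]; rfl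

lemma FreqChart.integrable_sq_iff (hc : FreqChart Λ μ q s) (hFf : F =ᵐ[μ] f ∘ s)
    (hΓg : Γ =ᵐ[μ] g ∘ s) : Integrable (fun u => F u ^ 2 * Γ u ^ 2) μ ↔
      IntegrableOn (fun x => f x ^ 2 * g x ^ 2) Λ := by
  rw [IntegrableOn, ← hc.mp.integrable_comp_emb hc.emb]
  refine integrable_congr ?_
  filter_upwards [hFf, hΓg] with u h1 h2
  rw [h1, h2]; rfl

/-- Convergence of the energies under the analytic conditions on `f` and `g`. -/
theorem FreqChart.tendsto_energy (hc : FreqChart Λ μ q s) {T : ℕ → ℝ} {H : ℕ → G → ℂ} {C : ℝ≥0}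
    {c : ℝ} (h : TaperedKernels μ T H C c) (hf : IntegrableOn f Λ) (hg : IntegrableOn g Λ)
    (hf0 : ∀ x ∈ Λ, 0 ≤ f x) (hfp : ∀ x, f (s (q x)) = f x) (hgp : ∀ x, g (s (q x)) = g x)
    (hF : Measurable F) (hΓ : Measurable Γ) (hF0 : ∀ x, 0 ≤ F x)
    (hFf : F =ᵐ[μ] f ∘ s) (hΓg : Γ =ᵐ[μ] g ∘ s)
    (hcond : CondLp Λ f g ∨ CondConv Λ f g ∨ CondShift Λ f g ∨ CondSingular Λ f g) :
    Integrable (fun u => F u ^ 2 * Γ u ^ 2) μ ∧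
      Tendsto (fun n => energy μ T H n F Γ) atTop (𝓝 (c * ∫ u, F u ^ 2 * Γ u ^ 2 ∂μ)) := by
  have hFi := hc.integrable hFf hf
  have hΓi := hc.integrable hΓg hg
  have hLp : CondLp Λ f g → Integrable (fun u => F u ^ 2 * Γ u ^ 2) μ ∧
      Tendsto (fun n => energy μ T H n F Γ) atTop (𝓝 (c * ∫ u, F u ^ 2 * Γ u ^ 2 ∂μ)) := by
    rintro ⟨p, r, -, -, hpr, hfp, hgr⟩
    exact h.tendsto_energy_of_memLp hF hΓ hFi hΓi hpr (hc.memLp hFf hfp) (hc.memLp hΓg hgr)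
  rcases hcond with hcond | ⟨h1, h2⟩ | ⟨h1, h2, h3, h4⟩ | hcond
  · exact hLp hcond
  · refine h.tendsto_energy_of_conv4 hF hΓ hFi hΓi hF0 ?_ ?_
    · rw [Measure.volume_eq_prod, ← Measure.prod_restrict, Measure.volume_eq_prod,
        ← Measure.prod_restrict] at h1
      convert h1.comp_measurePreserving (hc.mp.prod (hc.mp.prod hc.mp)) using 1
      funext z
      simp only [Function.comp_apply, ← hc.conv4_eq hfp hgp hFf hΓg, Prod.map_fst, Prod.map_snd,
        hc.right_inv]
    · have e : 𝓝 (0 : G × G × G) = map (fun x : ℝ × ℝ × ℝ => (q x.1, q x.2.1, q x.2.2))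
          (𝓝 (0, 0, 0)) := by
        rw [show (0 : G × G × G) = (0, 0, 0) from rfl]
        simp only [nhds_prod_eq, ← hc.nhds, prod_map_map_eq]
      have e0 := hc.conv4_eq hfp hgp hFf hΓg (0, 0, 0)
      simp only [map_zero] at e0
      rw [ContinuousAt, e, tendsto_map'_iff, show (0 : G × G × G) = (0, 0, 0) from rfl, e0]
      exact Tendsto.congr (f₁ := convFun Λ f g) (fun x => (hc.conv4_eq hfp hgp hFf hΓg x).symm) h2
  · have e0 := hc.lintegral_translate hgp hFf hΓg 0
    simp only [map_zero, sub_zero] at e0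
    refine h.tendsto_energy_of_translate hF hΓ hFi hΓi hF0 (hc.memLp hFf h1) (hc.memLp hΓg h2) ?_ ?_
    · have := (hc.memLp (F := fun u => F u * Γ u) (by
        filter_upwards [hFf, hΓg] with u h1 h2
        rw [h1, h2]; rfl) h3).2
      rw [eLpNorm_lt_top_iff_lintegral_rpow_enorm_lt_top two_ne_zero ENNReal.ofNat_ne_top] at this
      convert this.ne using 3 with u
      rw [enorm_mul, ENNReal.toReal_ofNat, ENNReal.rpow_ofNat, mul_pow]
    · rw [← hc.nhds, tendsto_map'_iff, e0]
      have : Tendsto (fun m : ℝ => ∫⁻ x in Λ, ofReal (f x ^ 2 * g (x - m) ^ 2)) (𝓝 0)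
          (𝓝 (∫⁻ x in Λ, ofReal (f x ^ 2 * g x ^ 2))) := by
        rw [← pure_sup_nhdsNE, tendsto_sup]
        refine ⟨?_, h4⟩
        rw [tendsto_pure_left]
        intro u hu
        simpa using mem_of_mem_nhds hu
      exact this.congr fun m => (hc.lintegral_translate hgp hFf hΓg m).symm
  · rcases hcond.cases hc.measurableSet hf hg hf0 with hcond | hcond | hcond
    · exact hLp hcond
    · exact h.tendsto_energy_of_energyTight hF hΓ hFi hΓi (hc.energyTight hF hΓ hFf hΓg hΓi hcond)
    · exact h.tendsto_energy_of_energyTight hF hΓ hFi hΓi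
        ((hc.energyTight hΓ hF hΓg hFf hFi hcond).symm hΓ hF)

end Chart

/-! ### Asymptotic normality along sequences -/

lemma variance_normalized {Ω : Type*} [MeasurableSpace Ω] {P : Measure Ω}
    [IsProbabilityMeasure P] {Q : Ω → ℝ} {T : ℝ} (hT : 0 < T) (hQ : AEStronglyMeasurable Q P) :
    Var[normalized P T Q; P] = T⁻¹ * Var[Q; P] := by
  have : normalized P T Q = fun ω => (√T)⁻¹ * (Q ω - ∫ ω', Q ω' ∂P) := rfl
  rw [this, variance_const_mul, variance_sub_const hQ, inv_pow, Real.sq_sqrt hT.le]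

/-- The kernel of a tapered quadratic functional. -/
def formKernel {S : Type*} [AddCommGroup S] (Λ : Set ℝ) (g : ℝ → ℝ) (i w : S → ℝ)
    (t s : S) : ℝ :=
  fourierR Λ g (i (t - s)) * w t * w s

/-- `Q` behaves like a tapered quadratic functional of a Gaussian process. -/
def IsGaussianForm {S : Type*} [MeasurableSpace S] [AddCommGroup S] {Ω : Type*} [MeasurableSpace Ω]
    (P : Measure Ω) (τ : Measure S) (Λ : Set ℝ) (f g : ℝ → ℝ) (i w : S → ℝ) (Q : Ω → ℝ) : Prop :=
  HasQuadLaw P Q (mtrace2 τ (formKernel Λ g i w) fun t s => fourierR Λ f (i (t - s)))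
    (mtrace4 τ (formKernel Λ g i w) fun t s => fourierR Λ f (i (t - s)))

section Assembly

variable {Λ : Set ℝ} {q : ℝ →+ G} {s : G → ℝ} {f g : ℝ → ℝ}
  {S : Type*} [MeasurableSpace S] [AddCommGroup S] [MeasurableSub₂ S] {e : S → G → ℂ}
  {i : S → ℝ}

lemma FreqChart.integral_fourier (hc : FreqChart Λ μ q s)
    (hei : ∀ t x, e t x = Complex.exp (Complex.I * (s x : ℂ) * (i t : ℂ))) {F : G → ℝ}
    (hF : F =ᵐ[μ] f ∘ s) (t : S) : ∫ x, (F x : ℂ) * e t x ∂μ = fourierC Λ f (i t) := by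
  rw [fourierC, ← hc.mp.integral_comp hc.emb]
  refine integral_congr_ae ?_
  filter_upwards [hF] with u h1
  rw [h1, hei, mul_comm]; rfl

/-- The central limit theorem along a sequence. -/
theorem FreqChart.tendstoInDistribution (hc : FreqChart Λ μ q s) (he : IsPairing e)
    (hei : ∀ t x, e t x = Complex.exp (Complex.I * (s x : ℂ) * (i t : ℂ)))
    {τ : ℕ → Measure S} [∀ n, IsFiniteMeasure (τ n)] {w : ℕ → S → ℝ} {h : ℝ → ℝ} {K : ℝ} {T : ℕ → ℝ}
    {C : ℝ≥0} (hw : ∀ n, Measurable (w n)) (hK : ∀ n t, |w n t| ≤ K)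
    (hH : TaperedKernels μ T (fun n => taperFT (τ n) e (w n)) C (8 * Real.pi ^ 3 * taperMoment h 4))
    (hf : IntegrableOn f Λ) (hg : IntegrableOn g Λ)
    (hf0 : ∀ x ∈ Λ, 0 ≤ f x) (hfp : ∀ x, f (s (q x)) = f x) (hgp : ∀ x, g (s (q x)) = g x)
    (hρ : ∀ t, fourierC Λ f (i t) = (fourierR Λ f (i t) : ℂ))
    (hγ : ∀ t, fourierC Λ g (i t) = (fourierR Λ g (i t) : ℂ))
    {Ω : Type*} [MeasurableSpace Ω] {P : Measure Ω} [IsProbabilityMeasure P] {Q : ℕ → Ω → ℝ}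
    (hQ : ∀ n, IsGaussianForm P (τ n) Λ f g i (w n) (Q n))
    (hcond : (CondLp Λ f g ∨ CondConv Λ f g ∨ CondShift Λ f g ∨ CondSingular Λ f g) ∨
      CondVariance Λ h f g fun n => Var[normalized P (T n) (Q n); P]) :
    IntegrableOn (fun x => f x ^ 2 * g x ^ 2) Λ ∧
    TendstoInDistribution (fun n => normalized P (T n) (Q n)) atTop (id : ℝ → ℝ) (fun _ => P)
      (gaussianReal 0 (asympVar Λ h f g).toNNReal) := by
  obtain ⟨F, hF, hFf, hF0⟩ := hc.exists_version hf
  obtain ⟨Γ, hΓ, hΓg, -⟩ := hc.exists_version hg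
  have hF0 := hF0 hf0
  have hFi := hc.integrable hFf hf
  have hΓi := hc.integrable hΓg hg
  have hm := fun n => mtrace_eq_hsq (τ := τ n) he (hw n) (hK n) hF hΓ hFi hΓi hF0
    (γ := fun t => fourierR Λ g (i t)) (ρ := fun t => fourierR Λ f (i t))
    (fun t => by rw [hc.integral_fourier hei hΓg, hγ])
    (fun t => by rw [hc.integral_fourier hei hFf, hρ])
  have hT := hH.T_pos
  have hE2 : ∀ n, (T n)⁻¹ * mtrace2 (τ n) (formKernel Λ g i (w n))
      (fun t s => fourierR Λ f (i (t - s))) = energy μ T (fun n => taperFT (τ n) e (w n)) n F Γ := fun n => by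
    rw [energy, ← (hm n).1]; rfl
  have hv : asympVar Λ h f g =
      2 * (8 * Real.pi ^ 3 * taperMoment h 4 * ∫ u, F u ^ 2 * Γ u ^ 2 ∂μ) := by
    rw [asympVar, hc.integral_sq hFf hΓg]; ring
  have hv0 : 0 ≤ asympVar Λ h f g := by
    rw [hv]
    exact mul_nonneg zero_le_two (mul_nonneg hH.pos.le (integral_nonneg fun u => by positivity))
  obtain ⟨hI, hE⟩ : Integrable (fun u => F u ^ 2 * Γ u ^ 2) μ ∧
      Tendsto (fun n => energy μ T (fun n => taperFT (τ n) e (w n)) n F Γ) atTop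
        (𝓝 (8 * Real.pi ^ 3 * taperMoment h 4 * ∫ u, F u ^ 2 * Γ u ^ 2 ∂μ)) := by
    rcases hcond with hcond | ⟨-, h2, h3⟩
    · exact hc.tendsto_energy hH hf hg hf0 hfp hgp hF hΓ hF0 hFf hΓg hcond
    · refine ⟨(hc.integrable_sq_iff hFf hΓg).2 ?_, ?_⟩
      · have := h2.integrable_sq
        simp only [mul_pow] at this
        exact this
      · have := h3.const_mul (1 / 2)
        rw [hv, ← mul_assoc (1 / 2 : ℝ), show (1 / 2 : ℝ) * 2 = 1 by norm_num, one_mul] at this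
        refine this.congr fun n => ?_
        rw [variance_normalized (hT n) (hQ n).1.1, (hQ n).2.1, ← hE2]; ring
  refine ⟨(hc.integrable_sq_iff hFf hΓg).1 hI, tendstoInDistribution_of_charFun hv0 hT hQ ?_ ?_⟩
  · simp_rw [hE2, hv, mul_div_cancel_left₀ _ (two_ne_zero (α := ℝ))]
    exact hE
  · have := hH.tendsto_hsq hF hΓ hFi hΓi hF0 hI hE
    have := (ENNReal.tendsto_toReal ENNReal.zero_ne_top).comp this
    simp only [Function.comp_def, ENNReal.toReal_zero] at this
    refine this.congr fun n => ?_
    have h4 := (hm n).2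
    rw [ENNReal.toReal_mul, ENNReal.toReal_pow, ENNReal.toReal_inv,
      toReal_ofReal (hT n).le, mul_comm, ← h4]; rfl

/-- The Fourier transform of an even function is real. -/
lemma fourierC_eq_ofReal (hΛ : ∀ x, -x ∈ Λ ↔ x ∈ Λ) (hΛm : MeasurableSet Λ)
    (hg : ∀ x, g (-x) = g x) (t : ℝ) : fourierC Λ g t = (fourierR Λ g t : ℂ) := by
  refine (Complex.conj_eq_iff_re.1 ?_).symm
  rw [fourierC, ← integral_conj, ← integral_indicator hΛm, ← integral_indicator hΛm,
    ← integral_neg_eq_self]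
  refine integral_congr_ae (ae_of_all _ fun x => ?_)
  dsimp only
  by_cases hx : x ∈ Λ
  · rw [indicator_of_mem ((hΛ x).2 hx), indicator_of_mem hx, hg, map_mul, ← Complex.exp_conj]
    simp
  · rw [indicator_of_notMem (mt (hΛ x).1 hx), indicator_of_notMem hx]

end Assembly

/-! ### Tapers -/

section Taper

variable {h : ℝ → ℝ}

lemma IsTaper.exists_bound (hh : IsTaper h) : ∃ M, 0 ≤ M ∧ ∀ t, |h t| ≤ M := by
  obtain ⟨M, hM⟩ := isCompact_Icc.exists_bound_of_continuousOn hh.continuousOn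
  have hM0 : 0 ≤ M := (norm_nonneg _).trans (hM 0 (by simp))
  refine ⟨M, hM0, fun t => ?_⟩
  by_cases ht : t ∈ Icc (0 : ℝ) 1
  · exact hM t ht
  · rwa [hh.support t ht, abs_zero]

lemma IsTaper.eq_indicator (hh : IsTaper h) : (Icc (0 : ℝ) 1).indicator h = h :=
  indicator_eq_self.2 fun t ht => by_contra fun h' => ht (hh.support t h')

lemma IsTaper.measurable (hh : IsTaper h) : Measurable h := by
  rw [← hh.eq_indicator, ← piecewise_eq_indicator]
  exact hh.continuousOn.measurable_piecewise continuousOn_const measurableSet_Icc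

lemma IsTaper.continuousAt (hh : IsTaper h) {t : ℝ} (h0 : t ≠ 0) (h1 : t ≠ 1) :
    ContinuousAt h t := by
  by_cases ht : t ∈ Icc (0 : ℝ) 1
  · exact hh.continuousOn.continuousAt
      (Icc_mem_nhds (lt_of_le_of_ne ht.1 h0.symm) (lt_of_le_of_ne ht.2 h1))
  · have : h =ᶠ[𝓝 t] fun _ => 0 := by
      filter_upwards [isClosed_Icc.isOpen_compl.mem_nhds ht] with u hu using hh.support u hu
    exact continuousAt_const.congr this.symm

lemma IsTaper.pow (hh : IsTaper h) (k : ℕ) (hk : 1 ≤ k) : IsTaper fun t => h t ^ k where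
  continuousOn := hh.continuousOn.pow k
  nonneg t := pow_nonneg (hh.nonneg t) k
  boundedVariation := by
    induction k, hk using Nat.le_induction with
    | base => simpa using hh.boundedVariation
    | succ n _ ih =>
      simp_rw [pow_succ]
      exact ih.fun_mul hh.boundedVariation
  support t ht := by rw [hh.support t ht, zero_pow (by lia)]
  moment_ne_zero j hj := by
    simp only [taperMoment, ← pow_mul]
    exact hh.moment_ne_zero (k * j) (Nat.mul_pos hk hj)

lemma IsTaper.moment_pos (hh : IsTaper h) {k : ℕ} (hk : 1 ≤ k) : 0 < taperMoment h k :=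
  lt_of_le_of_ne (integral_nonneg fun t => pow_nonneg (hh.nonneg t) k)
    (hh.moment_ne_zero k hk).symm

lemma summation_by_parts (a : ℕ → ℝ) (z : ℂ) (N : ℕ) :
    (z - 1) * ∑ j ∈ Finset.range (N + 1), (a j : ℂ) * z ^ j =
      a N * z ^ (N + 1) - a 0 - ∑ j ∈ Finset.range N, ((a (j + 1) - a j : ℝ) : ℂ) * z ^ (j + 1) := by
  induction N with
  | zero => simp; ring
  | succ n ih =>
    rw [Finset.sum_range_succ, mul_add, ih, Finset.sum_range_succ _ n]
    push_cast; ring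

/-- Exponential sums with coefficients of bounded variation. -/
lemma IsTaper.exists_norm_sum_le (hh : IsTaper h) : ∃ A, 0 ≤ A ∧ (∀ t, |h t| ≤ A) ∧
    ∀ (N : ℕ) (u : ℕ → ℝ) (z : ℂ), MonotoneOn u (Iic N) → (∀ j ≤ N, u j ∈ Icc (0 : ℝ) 1) → ‖z‖ = 1 →
      ‖(z - 1) * ∑ j ∈ Finset.range (N + 1), (h (u j) : ℂ) * z ^ j‖ ≤ A := by
  obtain ⟨M, hM0, hM⟩ := hh.exists_bound
  set V := (eVariationOn h (Icc 0 1)).toReal with hV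
  have hV0 : 0 ≤ V := ENNReal.toReal_nonneg
  refine ⟨2 * M + V, by positivity, fun t => (hM t).trans (by linarith), fun N u z hu hI hz => ?_⟩
  have h1 : ∑ j ∈ Finset.range N, |h (u (j + 1)) - h (u j)| ≤ V := by
    have := eVariationOn.sum_le_of_monotoneOn_Iic (f := h) hu hI
    have h2 := ENNReal.toReal_mono hh.boundedVariation this
    rw [ENNReal.toReal_sum fun j _ => edist_ne_top _ _] at h2
    simp only [edist_dist, Real.dist_eq, toReal_ofReal (abs_nonneg _)] at h2
    exact h2
  rw [summation_by_parts fun j => h (u j)]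
  have h3 : ‖∑ j ∈ Finset.range N, ((h (u (j + 1)) - h (u j) : ℝ) : ℂ) * z ^ (j + 1)‖ ≤ V := by
    refine (norm_sum_le _ _).trans (le_trans (le_of_eq ?_) h1)
    refine Finset.sum_congr rfl fun j _ => ?_
    rw [norm_mul, norm_pow, hz, one_pow, mul_one, Complex.norm_real, Real.norm_eq_abs]
  have h4 : ‖(h (u N) : ℂ) * z ^ (N + 1)‖ ≤ M := by
    rw [norm_mul, norm_pow, hz, one_pow, mul_one, Complex.norm_real]; exact hM _
  have h5 : ‖(h (u 0) : ℂ)‖ ≤ M := by rw [Complex.norm_real]; exact hM _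
  calc _ ≤ _ := norm_sub_le _ _
    _ ≤ _ := add_le_add_left (norm_sub_le _ _) _
    _ ≤ _ := by linarith

/-- Riemann sums with a weight. -/
lemma tendsto_weighted_riemann {F : ℝ → ℝ} (hF : ContinuousOn F (Icc 0 1)) {k : ℝ → ℂ}
    (hk : Continuous k) (hk1 : ∀ u, ‖k u‖ ≤ 1) :
    Tendsto (fun n : ℕ => ∑ j ∈ Finset.range (n + 1), (F ((j + 1) / (n + 1)) : ℂ) *
      ∫ u in ((j : ℕ) / (n + 1) : ℝ)..((j + 1 : ℕ) / (n + 1) : ℝ), k u) atTop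
      (𝓝 (∫ u in (0 : ℝ)..1, (F u : ℂ) * k u)) := by
  rw [Metric.tendsto_atTop]
  intro ε hε
  obtain ⟨δ, hδ, hd⟩ := Metric.uniformContinuousOn_iff.1
    (isCompact_Icc.uniformContinuousOn_of_continuous hF) (ε / 2) (half_pos hε)
  obtain ⟨N, hN⟩ := exists_nat_one_div_lt hδ
  refine ⟨N, fun n hn => ?_⟩
  have hn0 : (0 : ℝ) < n + 1 := by positivity
  have hnδ : 1 / ((n : ℝ) + 1) < δ := lt_of_le_of_lt (by gcongr) hN
  have hsub : ∀ j < n + 1, uIcc ((j : ℕ) / (n + 1) : ℝ) ((j + 1 : ℕ) / (n + 1)) ⊆ Icc 0 1 := by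
    intro j hj
    have : ((j + 1 : ℕ) : ℝ) ≤ n + 1 := by exact_mod_cast hj
    rw [uIcc_of_le (by gcongr; simp)]
    exact Icc_subset_Icc (by positivity) ((div_le_one hn0).2 this)
  have hFc : ContinuousOn (fun u => (F u : ℂ) * k u) (Icc 0 1) :=
    (Complex.continuous_ofReal.comp_continuousOn hF).mul hk.continuousOn
  have h1 := intervalIntegral.sum_integral_adjacent_intervals (μ := volume)
    (f := fun u => (F u : ℂ) * k u) (a := fun j : ℕ => (j / (n + 1) : ℝ)) (n := n + 1)
    fun j hj => (hFc.mono (hsub j hj)).intervalIntegrable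
  simp only [Nat.cast_zero, zero_div, Nat.cast_add_one n, div_self hn0.ne'] at h1
  rw [← h1, dist_eq_norm, ← Finset.sum_sub_distrib]
  have h2 : ∀ j ∈ Finset.range (n + 1), ‖(F ((j + 1) / (n + 1)) : ℂ) *
      (∫ u in ((j : ℕ) / (n + 1) : ℝ)..((j + 1 : ℕ) / (n + 1) : ℝ), k u) -
      ∫ u in ((j : ℕ) / (n + 1) : ℝ)..((j + 1 : ℕ) / (n + 1) : ℝ), (F u : ℂ) * k u‖ ≤
      ε / 2 * (1 / (n + 1)) := by
    intro j hj
    rw [Finset.mem_range] at hj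
    rw [← intervalIntegral.integral_const_mul, ← intervalIntegral.integral_sub
      (hk.const_mul _ |>.intervalIntegrable _ _) (hFc.mono (hsub j hj)).intervalIntegrable]
    have hlen : |((j + 1 : ℕ) / (n + 1) : ℝ) - j / (n + 1)| = 1 / (n + 1) := by
      rw [← sub_div, abs_of_nonneg (by push_cast; simp; positivity)]; push_cast; simp
    rw [← hlen]
    refine intervalIntegral.norm_integral_le_of_norm_le_const fun u hu => ?_
    have hu := uIoc_subset_uIcc hu
    rw [← sub_mul, norm_mul, ← Complex.ofReal_sub, Complex.norm_real, ← mul_one (ε / 2)]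
    refine mul_le_mul (le_of_lt ?_) (hk1 u) (norm_nonneg _) (half_pos hε).le
    have hr : ((j : ℝ) + 1) / (n + 1) ∈ uIcc ((j : ℕ) / (n + 1) : ℝ) ((j + 1 : ℕ) / (n + 1)) := by
      convert right_mem_uIcc using 2; push_cast; rfl
    refine hd _ (hsub j hj hr) u (hsub j hj hu) (lt_of_le_of_lt ?_ hnδ)
    rw [Real.dist_eq, ← hlen]
    rw [uIcc_of_le (by gcongr; simp)] at hr hu
    exact abs_sub_le_of_le_of_le hr.1 hr.2 hu.1 hu.2 |>.trans (le_abs_self _)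
  refine ((norm_sum_le _ _).trans (Finset.sum_le_sum h2)).trans_lt ?_
  rw [Finset.sum_const, Finset.card_range, nsmul_eq_mul]
  push_cast
  rw [mul_comm (ε / 2), ← mul_assoc, mul_one_div_cancel hn0.ne', one_mul]
  exact half_lt_self hε

lemma IsTaper.tendsto_riemann (hh : IsTaper h) {m : ℕ} :
    Tendsto (fun n : ℕ => ∑ j ∈ Finset.range (n + 1), h ((j + 1) / (n + 1)) ^ m * (n + 1 : ℝ)⁻¹)
      atTop (𝓝 (taperMoment h m)) := by
  have h1 := tendsto_weighted_riemann (hh.continuousOn.pow m) (k := fun _ => 1) continuous_const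
    (by simp)
  have h2 := (Complex.continuous_re.tendsto _).comp h1
  convert h2 using 1
  · funext n
    simp only [Function.comp_apply, Complex.re_sum]
    refine Finset.sum_congr rfl fun j _ => ?_
    rw [intervalIntegral.integral_const, ← sub_div, Complex.re_ofReal_mul, Nat.cast_add_one,
      add_sub_cancel_left, one_div, Complex.real_smul, mul_one, Complex.ofReal_re]
    rfl
  · rw [taperMoment, integral_Icc_eq_integral_Ioc, ← intervalIntegral.integral_of_le zero_le_one]
    simp only [mul_one]
    rw [intervalIntegral.integral_ofReal, Complex.ofReal_re]
    rfl

end Taper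

section Edge

variable {S : Type*} [MeasurableSpace S] [AddCommGroup S] {τ : Measure S} [IsFiniteMeasure τ]
  {e : S → G → ℂ} {w : S → ℝ} {c : ℝ} {x : G}

lemma enorm_le_decay {z : ℂ} {T A B : ℝ} (hT : 0 < T) (hA : 0 ≤ A) (hB : 0 ≤ B)
    (h1 : ‖z‖ ≤ A * T) (h2 : ‖x‖ * ‖z‖ ≤ B) :
    ‖z‖ₑ ≤ (A + B).toNNReal * ofReal T * decay T x := by
  rw [decay, ← div_eq_mul_inv, le_div_iff_mul_le (by simp) (by left; finiteness)]
  rw [← ofReal_norm x, ← ofReal_norm z, ← ofReal_mul hT.le, ← ENNReal.ofReal_one,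
    ← ENNReal.ofReal_add zero_le_one (by positivity), ← ofReal_mul (norm_nonneg _)]
  change _ ≤ ofReal (A + B) * _
  rw [← ofReal_mul (by positivity)]
  refine ofReal_le_ofReal ?_
  nlinarith [mul_le_mul_of_nonneg_left h2 hT.le]

lemma integrable_edge_of_le {H : G → ℂ} {T : ℝ} {C : ℝ≥0} (hT : 0 < T) (hμ : RadiallyDominated μ)
    (hm : Measurable H) (h : ∀ x, ‖H x‖ₑ ≤ C * ofReal T * decay T x) :
    Integrable (edge H) (μ.prod (μ.prod μ)) := by
  refine ⟨(measurable_edge hm).aestronglyMeasurable, ?_⟩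
  refine (lintegral_mono (g := fun z => C ^ 4 * (ofReal T * weight T z)) fun z => ?_).trans_lt
    ?_
  · simp only [edge, enorm_mul, weight]
    calc _ ≤ _ := mul_le_mul' (mul_le_mul' (mul_le_mul' (h _) (h _)) (h _)) (h _)
      _ = _ := by ring
  · rw [lintegral_const_mul _ ((measurable_weight _).const_mul _),
      lintegral_const_mul _ (measurable_weight _)]
    have h1 := lintegral_weight_le hμ hT
    have h2 : 16 * decayConst ^ 3 ≠ ∞ := by have := decayConst_ne_top; finiteness
    exact mul_lt_top (ENNReal.pow_lt_top ENNReal.coe_lt_top) (mul_lt_top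
      ofReal_lt_top (h1.trans_lt h2.lt_top))

/-- The cyclic integral of a Fourier transform. -/
lemma integral_edge_taperFT (he : IsPairing e)
    (hi : Integrable (edge (taperFT τ e w)) (μ.prod (μ.prod μ)))
    (hc : ∀ k : ℕ, 1 ≤ k → ∀ x, ∫ y, taperFT τ e w (x - y) * taperFT τ e (fun t => w t ^ k) y ∂μ =
      2 * Real.pi * taperFT τ e (fun t => w t ^ (k + 1)) x) :
    ∫ z, edge (taperFT τ e w) z ∂(μ.prod (μ.prod μ)) = 8 * Real.pi ^ 3 * ((∫ t, w t ^ 4 ∂τ : ℝ) : ℂ) := by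
  have h1 := hc 1 le_rfl
  simp only [pow_one, Nat.reduceAdd] at h1
  rw [integral_prod _ hi]
  have e1 : ∀ᵐ x ∂μ, ∫ p, edge (taperFT τ e w) (x, p) ∂(μ.prod μ) =
      taperFT τ e w (0 - x) * (4 * Real.pi ^ 2 * taperFT τ e (fun t => w t ^ 3) x) := by
    filter_upwards [hi.prod_right_ae] with x hx
    rw [integral_prod _ hx]
    have e2 : ∀ y, ∫ v, edge (taperFT τ e w) (x, y, v) ∂μ = taperFT τ e w (0 - x) * (2 * Real.pi) *
        (taperFT τ e w (x - y) * taperFT τ e (fun t => w t ^ 2) y) := fun y => by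
      have : ∀ v, edge (taperFT τ e w) (x, y, v) = taperFT τ e w (0 - x) * taperFT τ e w (x - y) *
          (taperFT τ e w (y - v) * taperFT τ e w v) := fun v => by
        simp only [edge, zero_sub]; ring
      simp_rw [this]
      rw [integral_const_mul, h1]; ring
    simp_rw [e2]
    rw [integral_const_mul, hc 2 one_le_two]; ring
  rw [integral_congr_ae e1]
  have e3 : ∀ x, taperFT τ e w (0 - x) * (4 * Real.pi ^ 2 * taperFT τ e (fun t => w t ^ 3) x) =
      4 * Real.pi ^ 2 * (taperFT τ e w (0 - x) * taperFT τ e (fun t => w t ^ 3) x) := fun x => by ring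
  simp_rw [e3]
  rw [integral_const_mul, hc 3 (by norm_num)]
  have e4 : taperFT τ e (fun t => w t ^ 4) 0 = ((∫ t, w t ^ 4 ∂τ : ℝ) : ℂ) := by
    rw [taperFT, ← integral_complex_ofReal]
    refine integral_congr_ae (ae_of_all _ fun t => ?_)
    have : e t 0 = 1 := by
      have h1 := he.map_add t 0 0
      rw [add_zero] at h1
      have h2 : e t 0 ≠ 0 := norm_ne_zero_iff.1 (by rw [he.norm_eq]; exact one_ne_zero)
      exact (mul_eq_left₀ h2).1 h1.symm
    simp [this]
  rw [show 3 + 1 = 4 from rfl, e4]; ring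

end Edge

end Group

/-! ### Discrete time: the frequency domain -/

section Discrete

instance fact_two_pi_pos : Fact (0 < 2 * Real.pi) := ⟨Real.two_pi_pos⟩

/-- The circle of frequencies. -/
abbrev Circ : Type := AddCircle (2 * Real.pi)

/-- The projection onto the circle. -/
def circMk : ℝ →+ Circ := QuotientAddGroup.mk' _

/-- The representative of a frequency in `(-π, π]`. -/
def circRep (x : Circ) : ℝ := AddCircle.measurableEquivIoc (2 * Real.pi) (-Real.pi) x

lemma circMk_circRep (x : Circ) : circMk (circRep x) = x := AddCircle.coe_equivIoc ..

lemma circRep_mem (x : Circ) : circRep x ∈ Ioc (-Real.pi) Real.pi := by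
  have := (AddCircle.measurableEquivIoc (2 * Real.pi) (-Real.pi) x).2
  exact ⟨this.1, this.2.trans_eq (by ring)⟩

lemma freqChart_circ : FreqChart freqD (volume : Measure Circ) circMk circRep where
  measurableSet := measurableSet_Icc
  emb := (MeasurableEmbedding.subtype_coe measurableSet_Ioc).comp
    (AddCircle.measurableEquivIoc (2 * Real.pi) (-Real.pi)).measurableEmbedding
  map_eq := by
    have h1 := AddCircle.measurePreserving_equivIoc (2 * Real.pi) (a := -Real.pi)
    have h2 : (volume : Measure Circ).map circRep =
        ((volume : Measure Circ).map (AddCircle.equivIoc (2 * Real.pi) (-Real.pi))).map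
          Subtype.val := by
      rw [Measure.map_map measurable_subtype_coe h1.measurable]; rfl
    rw [h2, h1.map_eq, map_comap_subtype_coe measurableSet_Ioc,
      show -Real.pi + 2 * Real.pi = Real.pi by ring]
    exact Measure.restrict_congr_set Ioc_ae_eq_Icc
  mem x := Ioc_subset_Icc_self (circRep_mem x)
  abs_eq x := by
    have h1 := circRep_mem x
    conv_rhs => rw [← circMk_circRep x]
    refine ((AddCircle.norm_coe_eq_abs_iff (2 * Real.pi) Real.two_pi_pos.ne').2 ?_).symm
    rw [abs_of_pos Real.two_pi_pos, mul_div_cancel_left₀ _ two_ne_zero]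
    exact abs_le.2 ⟨h1.1.le, h1.2⟩
  right_inv := circMk_circRep
  nhds := by
    have h1 : IsOpenMap (circMk : ℝ → Circ) := QuotientAddGroup.isOpenMap_coe
    have h2 : Continuous (circMk : ℝ → Circ) := continuous_quot_mk
    have := h1.map_nhds_eq (x := 0) h2.continuousAt
    rwa [map_zero] at this

lemma circRep_periodic {f : ℝ → ℝ} (hf : Function.Periodic f (2 * Real.pi)) (x : ℝ) :
    f (circRep (circMk x)) = f x := by
  have h1 : (circMk (circRep (circMk x)) : Circ) = circMk x := circMk_circRep _
  obtain ⟨n, hn⟩ := AddSubgroup.mem_zmultiples_iff.1 (QuotientAddGroup.eq_iff_sub_mem.1 h1)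
  have : circRep (circMk x) = x + n • (2 * Real.pi) := by rw [hn]; ring
  rw [this]
  exact hf.zsmul n x

/-- The characters of the circle. -/
def circPair (t : ℤ) (x : Circ) : ℂ := fourier t x

lemma circPair_eq (t : ℤ) (x : Circ) :
    circPair t x = Complex.exp (Complex.I * (circRep x : ℂ) * ((t : ℝ) : ℂ)) := by
  conv_lhs => rw [← circMk_circRep x]
  have := fourier_coe_apply (T := 2 * Real.pi) (n := t) (x := circRep x)
  refine this.trans ?_
  congr 1
  have : (Real.pi : ℂ) ≠ 0 := by exact_mod_cast Real.pi_ne_zero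
  push_cast
  field_simp

lemma isPairing_circ : IsPairing circPair where
  meas := measurable_from_prod_countable_right fun t => (fourier t).continuous.measurable
  norm_eq t x := Circle.norm_coe _
  map_add t x y := by simp [circPair, fourier_apply, smul_add, AddCircle.toCircle_add]
  map_neg t x := by
    rw [circPair, circPair, ← fourier_neg, fourier_apply, fourier_apply, smul_neg, neg_smul]
  map_sub t s x := by
    rw [circPair, circPair, circPair, ← fourier_neg, ← fourier_add, sub_eq_add_neg]

lemma integral_circPair (t : ℤ) : ∫ x, circPair t x = if t = 0 then 2 * (Real.pi : ℂ) else 0 := by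
  split_ifs with h
  · simp [h, circPair, Measure.real, AddCircle.measure_univ, Real.pi_pos.le]
  · have h1 := integral_add_right_eq_self (μ := (volume : Measure Circ)) (circPair t)
      ((2 * Real.pi / 2 / t : ℝ) : Circ)
    have h2 : ∀ x : Circ, circPair t (x + ((2 * Real.pi / 2 / t : ℝ) : Circ)) = -circPair t x :=
      fun x => fourier_add_half_inv_index h Real.two_pi_pos x
    simp_rw [h2, integral_neg] at h1
    exact self_eq_neg.1 h1.symm

/-- The times `1, …, T`. -/
def timeD (T : ℕ) : Measure ℤ := Measure.count.restrict (Finset.Icc (1 : ℤ) T)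

instance (T : ℕ) : IsFiniteMeasure (timeD T) :=
  ⟨by rw [timeD, Measure.restrict_apply_univ]; simp [Measure.count_apply]⟩

lemma integral_timeD {E : Type*} [NormedAddCommGroup E] [NormedSpace ℝ E] [CompleteSpace E]
    (T : ℕ) (F : ℤ → E) : ∫ t, F t ∂timeD T = ∑ t ∈ Finset.Icc 1 T, F t := by
  have h0 : IntegrableOn F (Finset.Icc (1 : ℤ) T) (timeD T) := IntegrableOn.finset
  rw [IntegrableOn, timeD, Measure.restrict_restrict (Finset.measurableSet _), inter_self] at h0
  rw [timeD, setIntegral_finset _ h0]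
  have h1 : Finset.Icc (1 : ℤ) T = (Finset.Icc 1 T).map Nat.castEmbedding := by
    ext t
    simp only [Finset.mem_Icc, Finset.mem_map, Nat.castEmbedding_apply]
    exact ⟨fun h => ⟨t.toNat, by lia, by lia⟩, fun ⟨a, h, h'⟩ => by lia⟩
  rw [h1, Finset.sum_map]
  simp [Measure.real]

lemma integral_taperFT_conv_timeD (T : ℕ) (a b : ℤ → ℝ) (x : Circ) :
    ∫ y, taperFT (timeD T) circPair a (x - y) * taperFT (timeD T) circPair b y =
      2 * Real.pi * taperFT (timeD T) circPair (fun t => a t * b t) x := by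
  simp only [taperFT, integral_timeD]
  have e1 : ∀ (t s : ℕ) (y : Circ), ((a t : ℂ) * circPair t (x - y)) * ((b s : ℂ) * circPair s y) =
      (a t : ℂ) * circPair t x * b s * circPair ((s : ℤ) - t) y := fun t s y => by
    rw [sub_eq_add_neg, isPairing_circ.map_add, isPairing_circ.map_neg, isPairing_circ.map_sub]
    ring
  have hi : ∀ (c : ℂ) (t : ℤ), Integrable (fun y => c * circPair t y) (volume : Measure Circ) :=
    fun c t => ((fourier t).continuous.integrable_of_hasCompactSupport
      (HasCompactSupport.of_compactSpace _)).const_mul c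
  simp_rw [Finset.sum_mul_sum, e1]
  rw [integral_finsetSum _ fun t _ => integrable_finsetSum _ fun s _ => hi _ _, Finset.mul_sum]
  refine Finset.sum_congr rfl fun t ht => ?_
  rw [integral_finsetSum _ fun s _ => hi _ _]
  simp_rw [integral_const_mul, integral_circPair, sub_eq_zero, Nat.cast_inj]
  rw [Finset.sum_eq_single_of_mem t ht fun s _ hs => by rw [if_neg hs, mul_zero], if_pos rfl]
  push_cast; ring

/-- The taper in discrete time. -/
def taperD (h : ℝ → ℝ) (T : ℕ) (t : ℤ) : ℝ := h (t / T)

variable {h : ℝ → ℝ}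

lemma norm_circPair_sub_one_ge (x : Circ) : 2 / Real.pi * ‖x‖ ≤ ‖circPair 1 x - 1‖ := by
  have h1 := circRep_mem x
  have h2 : |circRep x| ≤ Real.pi := abs_le.2 ⟨h1.1.le, h1.2⟩
  rw [circPair_eq, Int.cast_one, Complex.ofReal_one, mul_one,
    Complex.norm_exp_I_mul_ofReal_sub_one, ← freqChart_circ.abs_eq, norm_mul, Real.norm_eq_abs,
    Real.norm_eq_abs, abs_two]
  have := Real.mul_abs_le_abs_sin (x := circRep x / 2) (by rw [abs_div, abs_two]; linarith)
  rw [abs_div, abs_two] at this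
  linarith

lemma IsTaper.exists_norm_taperFT_timeD (hh : IsTaper h) : ∃ C : ℝ≥0, ∀ n x,
    ‖taperFT (timeD (n + 1)) circPair (taperD h (n + 1)) x‖ₑ ≤
      C * ofReal (n + 1) * decay (n + 1) x := by
  obtain ⟨A, hA0, hA, hS⟩ := hh.exists_norm_sum_le
  refine ⟨_, fun n x => enorm_le_decay (A := A) (B := A * (Real.pi / 2)) (by positivity) hA0
    (by positivity) ?_ ?_⟩
  · refine (norm_taperFT_le isPairing_circ (fun t => hA _) x).trans (le_of_eq ?_)
    congr 1
    have := integral_timeD (n + 1) fun _ => (1 : ℝ)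
    simpa [Measure.real] using this
  · set z := circPair 1 x with hz
    have hz1 : ‖z‖ = 1 := isPairing_circ.norm_eq 1 x
    have e1 : taperFT (timeD (n + 1)) circPair (taperD h (n + 1)) x =
        z * ∑ j ∈ Finset.range (n + 1), (h ((j + 1 : ℝ) / (n + 1)) : ℂ) * z ^ j := by
      have hp : ∀ j : ℕ, circPair j x = z ^ j := fun j => by
        rw [hz, circPair_eq, circPair_eq, ← Complex.exp_nat_mul]
        congr 1; push_cast; ring
      rw [taperFT, integral_timeD, Finset.mul_sum, ← Finset.Ico_add_one_right_eq_Icc,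
        Finset.sum_Ico_eq_sum_range]
      refine Finset.sum_congr (by simp) fun j _ => ?_
      rw [hp, taperD, pow_add, pow_one]
      push_cast
      rw [add_comm (1 : ℝ)]; ring
    have h1 := hS n (fun j => (j + 1 : ℝ) / (n + 1)) z (fun i _ j _ hij => by
      have : (i : ℝ) ≤ j := by exact_mod_cast hij
      dsimp only; gcongr) (fun j hj => by
      have : (j : ℝ) ≤ n := by exact_mod_cast hj
      exact ⟨by positivity, (div_le_one (by positivity)).2 (by linarith)⟩) hz1
    rw [e1, norm_mul, hz1, one_mul]
    rw [norm_mul] at h1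
    have h2 := (mul_le_mul_of_nonneg_right (norm_circPair_sub_one_ge x) (norm_nonneg _)).trans h1
    have hpi := Real.pi_pos
    calc _ = Real.pi / 2 * (2 / Real.pi * ‖x‖ * ‖∑ j ∈ Finset.range (n + 1),
          (h ((j + 1 : ℝ) / (n + 1)) : ℂ) * z ^ j‖) := by field_simp
      _ ≤ Real.pi / 2 * A := by gcongr
      _ = _ := mul_comm _ _

lemma IsTaper.exists_taperedKernels_circ (hh : IsTaper h) : ∃ C : ℝ≥0,
    TaperedKernels (volume : Measure Circ) (fun n => (n : ℝ) + 1)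
      (fun n => taperFT (timeD (n + 1)) circPair (taperD h (n + 1))) C
      (8 * Real.pi ^ 3 * taperMoment h 4) := by
  obtain ⟨C, hC⟩ := hh.exists_norm_taperFT_timeD
  have hm : ∀ n, Measurable (taperFT (timeD (n + 1)) circPair (taperD h (n + 1))) := fun n =>
    measurable_taperFT isPairing_circ (measurable_of_countable _)
  have hpos := hh.moment_pos (k := 4) (by norm_num)
  refine ⟨C, fun n => by simp, tendsto_natCast_atTop_atTop.atTop_add tendsto_const_nhds, hm,
    fun n x => conj_taperFT isPairing_circ x, hC, freqChart_circ.radial, by positivity, ?_⟩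
  have e1 : ∀ n : ℕ, (((n : ℝ) + 1 : ℝ) : ℂ)⁻¹ * ∫ z, edge (taperFT (timeD (n + 1)) circPair
      (taperD h (n + 1))) z ∂((volume : Measure Circ).prod (volume.prod volume)) =
      ((8 * Real.pi ^ 3 * ∑ j ∈ Finset.range (n + 1), h ((j + 1) / (n + 1)) ^ 4 * (n + 1 : ℝ)⁻¹ : ℝ) : ℂ) := by
    intro n
    rw [integral_edge_taperFT isPairing_circ (integrable_edge_of_le (by positivity)
      freqChart_circ.radial (hm n) (hC n)), integral_timeD, ← Finset.Ico_add_one_right_eq_Icc,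
      Finset.sum_Ico_eq_sum_range, ← Finset.sum_mul]
    · push_cast
      simp only [taperD]
      push_cast
      simp_rw [add_comm (1 : ℝ)]
      ring
    · intro k _ x
      rw [integral_taperFT_conv_timeD]
      simp_rw [pow_succ']
  simp_rw [e1]
  refine (Complex.continuous_ofReal.tendsto _).comp (Tendsto.const_mul _ ?_)
  exact hh.tendsto_riemann

end Discrete

/-! ### Quadratic functionals of stationary processes -/

section Stationary

variable {Λ : Set ℝ} {f g : ℝ → ℝ}

lemma continuous_fourierR (hg : IntegrableOn g Λ) : Continuous (fourierR Λ g) := by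
  refine Complex.continuous_re.comp (continuous_of_dominated (bound := fun x => |g x|)
    (fun t => ?_) (fun t => ae_of_all _ fun x => ?_) hg.abs (ae_of_all _ fun x => by fun_prop))
  · exact (Continuous.aestronglyMeasurable (by fun_prop)).mul
      (Complex.continuous_ofReal.comp_aestronglyMeasurable hg.1)
  · rw [norm_mul, mul_assoc, ← Complex.ofReal_mul, Complex.norm_exp_I_mul_ofReal, one_mul,
      Complex.norm_real, Real.norm_eq_abs]

lemma abs_fourierR_le (t : ℝ) : |fourierR Λ g t| ≤ ∫ x in Λ, |g x| := by
  refine (Complex.abs_re_le_norm _).trans ((norm_integral_le_integral_norm _).trans (le_of_eq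
    (integral_congr_ae (ae_of_all _ fun x => ?_))))
  dsimp only
  rw [norm_mul, mul_assoc, ← Complex.ofReal_mul, Complex.norm_exp_I_mul_ofReal, one_mul,
    Complex.norm_real, Real.norm_eq_abs]

lemma fourierR_neg (t : ℝ) : fourierR Λ g (-t) = fourierR Λ g t := by
  rw [fourierR, ← Complex.conj_re, fourierC, ← integral_conj, fourierR, fourierC]
  congr 2
  funext x
  simp [← Complex.exp_conj]

variable {S : Type*} [MeasurableSpace S] [MeasurableSingletonClass S]
  [AddCommGroup S] [MeasurableSub₂ S] {τ : Measure S}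
  [IsFiniteMeasure τ] {i : S → ℝ} {w : S → ℝ} {K : ℝ} {Ω : Type*} [MeasurableSpace Ω]
  {P : Measure Ω} [IsProbabilityMeasure P] {X : S → Ω → ℝ}

lemma IsGaussianStationary.fourierC_eq (hX : IsGaussianStationary i Λ X P f) (t : S) :
    fourierC Λ f (i t) = (fourierR Λ f (i t) : ℂ) := by
  rw [fourierR, ← hX.covariance 0 t, Complex.ofReal_re]

lemma HasQuadLaw.congr {Q Q' : Ω → ℝ} {m₂ m₄ : ℝ} (h : HasQuadLaw P Q m₂ m₄) (hQ : Q =ᵐ[P] Q') :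
    HasQuadLaw P Q' m₂ m₄ := by
  refine ⟨(memLp_congr_ae hQ).1 h.1, by rw [← variance_congr hQ]; exact h.2.1, fun θ => ?_⟩
  have : ∫ ω, Complex.exp ((θ * (Q' ω - ∫ ω', Q' ω' ∂P) : ℝ) * Complex.I) ∂P =
      ∫ ω, Complex.exp ((θ * (Q ω - ∫ ω', Q ω' ∂P) : ℝ) * Complex.I) ∂P := by
    rw [integral_congr_ae hQ]
    refine integral_congr_ae ?_
    filter_upwards [hQ] with ω hω
    rw [hω]
  rw [this]
  exact h.2.2 θ

theorem IsGaussianStationary.isGaussianForm (hX : IsGaussianStationary i Λ X P f)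
    (hi : ∀ t s, i (t - s) = i t - i s) (him : Measurable i)
    (hXm : Measurable fun p : S × Ω => X p.1 p.2) (hg : IntegrableOn g Λ) (hw : Measurable w)
    (hK : ∀ t, |w t| ≤ K) {r : ℕ → S → S} {I : ℕ → Finset S} {A : Set S}
    (hr : ∀ n, Measurable (r n)) (hI : ∀ n t, r n t ∈ I n) (hA : ∀ᵐ t ∂τ, t ∈ A)
    (hri : ∀ t ∈ A, Tendsto (fun n => i (r n t)) atTop (𝓝 (i t)))
    (hrw : ∀ t ∈ A, Tendsto (fun n => w (r n t)) atTop (𝓝 (w t))) {Q : Ω → ℝ}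
    (hQ : Q = fun ω => ∫ p, formKernel Λ g i w p.1 p.2 * X p.1 ω * X p.2 ω ∂(τ.prod τ)) :
    IsGaussianForm P τ Λ f g i w Q := by
  have hK0 : 0 ≤ K := (abs_nonneg _).trans (hK 0)
  have hγ := continuous_fourierR hg
  have hρ := continuous_fourierR hX.density_integrable
  have h0 : ∀ ψ : ℝ → ℝ, 0 ≤ ∫ x in Λ, |ψ x| := fun ψ => integral_nonneg fun _ => abs_nonneg _
  refine quadForm_process hX.gaussian hX.centered hXm (fun t s => ?_) (fun t s => ?_)
    (b := (∫ x in Λ, |g x|) * K * K) (c := ∫ x in Λ, |f x|) ⟨?_, fun t s => ?_⟩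
    ⟨hρ.measurable.comp (by fun_prop), fun t s => abs_fourierR_le _⟩
    (mul_nonneg (mul_nonneg (h0 g) hK0) hK0) (h0 f) hr hI hA
    (fun t ht s hs => ?_) (fun t ht s hs => ?_) (fun t ht => ?_) hQ
  · have := hX.covariance s (t - s)
    rw [add_sub_cancel] at this
    rw [fourierR, ← this, Complex.ofReal_re]
  · rw [formKernel, formKernel, hi, hi, ← neg_sub, fourierR_neg]; ring
  · exact ((hγ.measurable.comp (by fun_prop)).mul (by fun_prop)).mul (by fun_prop)
  · rw [formKernel, norm_mul, norm_mul]
    exact mul_le_mul (mul_le_mul (abs_fourierR_le _) (hK _) (abs_nonneg _) (h0 g)) (hK _)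
      (abs_nonneg _) (mul_nonneg (h0 g) hK0)
  · simp only [formKernel, hi]
    exact (((hγ.tendsto _).comp ((hri t ht).sub (hri s hs))).mul (hrw t ht)).mul (hrw s hs)
  · simp only [hi]
    exact (hρ.tendsto _).comp ((hri t ht).sub (hri s hs))
  · simp only [hi]
    exact (hρ.tendsto _).comp ((hri t ht).sub_const _)

/-- The trace as the trace of a product of tapered Toeplitz operators. -/
lemma mtrace2_formKernel (hi : ∀ t s, i (t - s) = i t - i s) :
    mtrace2 τ (formKernel Λ g i w) (fun t s => fourierR Λ f (i (t - s))) =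
      ∫ t, ∫ s, (∫ u, fourierR Λ f (i t - i u) * w u * (fourierR Λ g (i u - i s) * w s) ∂τ) *
        (∫ u, fourierR Λ f (i s - i u) * w u * (fourierR Λ g (i u - i t) * w t) ∂τ) ∂τ ∂τ := by
  have : ∀ t s, mcomp τ (formKernel Λ g i w) (fun t s => fourierR Λ f (i (t - s))) t s =
      ∫ u, fourierR Λ f (i s - i u) * w u * (fourierR Λ g (i u - i t) * w t) ∂τ := fun t s => by
    refine integral_congr_ae (ae_of_all _ fun u => ?_)
    simp only [formKernel, hi]
    rw [← neg_sub (i u), fourierR_neg, ← neg_sub (i s), fourierR_neg]; ring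
  simp only [mtrace2, mtrace]
  refine integral_congr_ae (ae_of_all _ fun t => ?_)
  simp only
  rw [mcomp]
  exact integral_congr_ae (ae_of_all _ fun s => by simp only [this]; ring)

end Stationary

/-! ### Discrete time: the quadratic functional -/

section Discrete

variable {f g h : ℝ → ℝ} {Ω : Type*} [MeasurableSpace Ω] {P : Measure Ω} [IsProbabilityMeasure P]
  {X : ℤ → Ω → ℝ}

lemma integral_timeD_prod (T : ℕ) (F : ℤ × ℤ → ℝ) : ∫ p, F p ∂(timeD T).prod (timeD T) =
    ∑ t ∈ Finset.Icc 1 T, ∑ s ∈ Finset.Icc 1 T, F (t, s) := by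
  have h0 : IntegrableOn F ((Finset.Icc (1 : ℤ) T : Set ℤ) ×ˢ (Finset.Icc (1 : ℤ) T : Set ℤ))
      ((timeD T).prod (timeD T)) :=
    IntegrableOn.of_finite ((Finset.finite_toSet _).prod (Finset.finite_toSet _))
  rw [IntegrableOn, ← Measure.prod_restrict, timeD, Measure.restrict_restrict
    (Finset.measurableSet _), inter_self, ← timeD] at h0
  rw [integral_prod _ h0, integral_timeD]
  simp_rw [integral_timeD]

lemma isGaussianForm_quadD (hh : IsTaper h)
    (hX : IsGaussianStationary (fun n : ℤ => (n : ℝ)) freqD X P f) (hg : IntegrableOn g freqD)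
    (T : ℕ) : IsGaussianForm P (timeD T) freqD f g (fun n : ℤ => (n : ℝ)) (taperD h T)
      (quadD h g X T) := by
  obtain ⟨M, -, hM⟩ := hh.exists_bound
  set Y : ℤ → Ω → ℝ := fun t => (hX.gaussian.aemeasurable t).mk with hY
  have hXY : ∀ t, X t =ᵐ[P] Y t := fun t => (hX.gaussian.aemeasurable t).ae_eq_mk
  have hYs : IsGaussianStationary (fun n : ℤ => (n : ℝ)) freqD Y P f := by
    refine ⟨hX.gaussian.congr hXY, fun t => ?_, hX.density_nonneg, hX.density_integrable,
      fun t u => ?_⟩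
    · rw [← hX.centered t]; exact integral_congr_ae (hXY t).symm
    · rw [← hX.covariance t u]
      congr 1
      refine integral_congr_ae ?_
      filter_upwards [hXY t, hXY (t + u)] with ω h1 h2
      rw [h1, h2]
  have hf := hYs.isGaussianForm (τ := timeD T) (w := taperD h T) (K := M)
    (r := fun _ t => if t ∈ Finset.Icc (1 : ℤ) T then t else 1) (I := fun _ => insert 1 (Finset.Icc (1 : ℤ) T))
    (A := Finset.Icc (1 : ℤ) T) (Q := quadD h g Y T) (by simp) (measurable_of_countable _)
    (measurable_from_prod_countable_right fun t => (hX.gaussian.aemeasurable t).measurable_mk) hg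
    (measurable_of_countable _) (fun t => hM _) (fun _ => measurable_of_countable _)
    (fun _ t => by split_ifs with h1 <;> simp [h1]) (ae_restrict_mem (Finset.measurableSet _))
    (fun t ht => by rw [Finset.mem_coe] at ht; simp only [if_pos ht]; exact tendsto_const_nhds)
    (fun t ht => by rw [Finset.mem_coe] at ht; simp only [if_pos ht]; exact tendsto_const_nhds) (by
      funext ω
      rw [integral_timeD_prod]
      simp only [quadD, formKernel, taperD, Int.cast_sub, Int.cast_natCast])
  refine HasQuadLaw.congr hf ?_
  filter_upwards [ae_all_iff.2 hXY] with ω hω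
  simp only [quadD, hω]

lemma traceD_eq (T : ℕ) : traceD h f g T = mtrace2 (timeD T)
    (formKernel freqD g (fun n : ℤ => (n : ℝ)) (taperD h T))
    (fun t s => fourierR freqD f (((t - s : ℤ) : ℤ) : ℝ)) := by
  rw [mtrace2_formKernel (i := fun n : ℤ => (n : ℝ)) (fun t s => by simp)]
  simp_rw [integral_timeD]
  rw [traceD, pow_two, Matrix.trace]
  simp only [Matrix.diag_apply, Matrix.mul_apply, toeplitzMatrix, Matrix.of_apply, taperD,
    Int.cast_natCast]
  rw [← Finset.sum_coe_sort (Finset.Icc 1 T)]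
  refine Finset.sum_congr rfl fun t _ => ?_
  rw [← Finset.sum_coe_sort (Finset.Icc 1 T)]
  refine Finset.sum_congr rfl fun s _ => ?_
  congr 1 <;> rw [← Finset.sum_coe_sort (Finset.Icc 1 T)]

lemma variance_normQuadD (hh : IsTaper h)
    (hX : IsGaussianStationary (fun n : ℤ => (n : ℝ)) freqD X P f) (hg : IntegrableOn g freqD)
    {T : ℕ} (hT : 0 < T) : Var[normQuadD P h g X T; P] = 2 / (T : ℝ) * traceD h f g T := by
  obtain ⟨h1, h2, -⟩ := isGaussianForm_quadD hh hX hg T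
  rw [normQuadD, variance_normalized (by exact_mod_cast hT) h1.1, h2, traceD_eq]; ring

theorem isAsympNormal_discrete (hh : IsTaper h)
    (hX : IsGaussianStationary (fun n : ℤ => (n : ℝ)) freqD X P f) (hg : IsGenerating freqD g)
    (hfp : Function.Periodic f (2 * Real.pi)) (hgp : Function.Periodic g (2 * Real.pi))
    (hcond : (CondLp freqD f g ∨ CondConv freqD f g ∨ CondShift freqD f g ∨ CondSingular freqD f g) ∨
      CondVariance freqD h f g fun T => Var[normQuadD P h g X T; P]) :
    IsAsympNormal P freqD h f g (normQuadD P h g X) := by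
  obtain ⟨C, hH⟩ := hh.exists_taperedKernels_circ
  obtain ⟨M, -, hM⟩ := hh.exists_bound
  have hF := fun n => isGaussianForm_quadD hh hX hg.integrable (n + 1)
  have hT : ∀ n : ℕ, (n : ℝ) + 1 = (n + 1 : ℕ) := fun n => by push_cast; rfl
  have := freqChart_circ.tendstoInDistribution isPairing_circ (i := fun n : ℤ => (n : ℝ))
    circPair_eq (τ := fun n => timeD (n + 1)) (fun n => measurable_of_countable _)
    (fun n t => hM _) hH hX.density_integrable hg.integrable hX.density_nonneg
    (circRep_periodic hfp) (circRep_periodic hgp) hX.fourierC_eq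
    (fun t => fourierC_eq_ofReal (fun x => by simp [neg_le, and_comm]) measurableSet_Icc
      hg.even _) hF (hcond.imp_right fun h => ⟨h.1, h.2.1, by
      simp_rw [hT]; exact h.2.2.comp (tendsto_add_atTop_nat 1)⟩)
  refine ⟨this.1, fun T => ?_, this.2.aemeasurable_limit, ?_⟩
  · exact ((isGaussianForm_quadD hh hX hg.integrable T).1.1.aemeasurable.sub_const _).const_mul _
  · have h2 := this.2.tendsto
    simp_rw [hT] at h2
    exact (tendsto_add_atTop_iff_nat 1).1 h2

end Discrete

/-! ### Continuous time: the frequency domain -/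

section Continuous

open scoped FourierTransform Convolution

lemma freqChart_real : FreqChart freqC (volume : Measure ℝ) (AddMonoidHom.id ℝ) id where
  measurableSet := MeasurableSet.univ
  emb := MeasurableEmbedding.id
  map_eq := by rw [Measure.map_id, freqC, Measure.restrict_univ]
  mem := mem_univ
  abs_eq _ := rfl
  right_inv _ := rfl
  nhds := map_id

/-- The characters of the real line. -/
def realPair (t x : ℝ) : ℂ := Complex.exp (Complex.I * (x : ℂ) * (t : ℂ))

lemma isPairing_real : IsPairing realPair where
  meas := by unfold realPair; fun_prop
  norm_eq t x := by rw [realPair, mul_assoc, ← Complex.ofReal_mul, Complex.norm_exp_I_mul_ofReal]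
  map_add t x y := by rw [realPair, realPair, realPair, ← Complex.exp_add]; push_cast; ring_nf
  map_neg t x := by simp [realPair, ← Complex.exp_conj]
  map_sub t s x := by
    simp only [realPair, ← Complex.exp_conj, ← Complex.exp_add, map_mul, Complex.conj_I,
      Complex.conj_ofReal]
    push_cast; ring_nf

/-- Lebesgue measure on `[0, T]`. -/
def timeC (T : ℝ) : Measure ℝ := volume.restrict (Icc 0 T)

instance (T : ℝ) : IsFiniteMeasure (timeC T) := by unfold timeC; infer_instance

/-- The taper in continuous time. -/
def taperC (h : ℝ → ℝ) (T t : ℝ) : ℝ := h (t / T)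

variable {h : ℝ → ℝ} {T : ℝ}

lemma integral_timeC {E : Type*} [NormedAddCommGroup E] [NormedSpace ℝ E] (hT : 0 < T)
    (F : ℝ → E) : ∫ t, F (t / T) ∂timeC T = T • ∫ u in (0 : ℝ)..1, F u := by
  rw [timeC, integral_Icc_eq_integral_Ioc, ← intervalIntegral.integral_of_le hT.le,
    intervalIntegral.integral_comp_div _ hT.ne', zero_div, div_self hT.ne']

lemma IsTaper.exists_norm_integral_le (hh : IsTaper h) : ∃ A, 0 ≤ A ∧ (∀ t, |h t| ≤ A) ∧
    ∀ y : ℝ, |y| * ‖∫ u in (0 : ℝ)..1, (h u : ℂ) * Complex.exp (Complex.I * y * u)‖ ≤ A := by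
  obtain ⟨A, hA0, hA, hS⟩ := hh.exists_norm_sum_le
  refine ⟨A, hA0, hA, fun y => ?_⟩
  rcases eq_or_ne y 0 with rfl | hy
  · simpa using hA0
  have h1 := ((tendsto_weighted_riemann hh.continuousOn (k := fun u => Complex.exp (Complex.I * y * u))
    (by fun_prop) fun u => (isPairing_real.norm_eq u y).le).norm).const_mul |y|
  refine le_of_tendsto h1 (Eventually.of_forall fun n => ?_)
  set z := Complex.exp (Complex.I * y / (n + 1)) with hz
  have hn : (n : ℂ) + 1 ≠ 0 := by exact_mod_cast n.succ_ne_zero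
  have hz1 : ‖z‖ = 1 := by
    rw [hz, show Complex.I * y / ((n : ℂ) + 1) = Complex.I * ((y / (n + 1) : ℝ) : ℂ) by
      push_cast; ring, Complex.norm_exp_I_mul_ofReal]
  have hIy : Complex.I * (y : ℂ) ≠ 0 := mul_ne_zero Complex.I_ne_zero (by exact_mod_cast hy)
  have hp : ∀ j : ℕ, Complex.exp (Complex.I * y * (((j : ℕ) / (n + 1) : ℝ) : ℂ)) = z ^ j := fun j => by
    rw [hz, ← Complex.exp_nat_mul]; congr 1; push_cast; ring
  have h2 := hS n (fun j => (j + 1 : ℝ) / (n + 1)) z (fun i _ j _ hij => by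
    have : (i : ℝ) ≤ j := by exact_mod_cast hij
    dsimp only; gcongr) (fun j hj => by
    have : (j : ℝ) ≤ n := by exact_mod_cast hj
    exact ⟨by positivity, (div_le_one (by positivity)).2 (by linarith)⟩) hz1
  refine le_trans (le_of_eq ?_) h2
  have hyn : |y| = ‖Complex.I * (y : ℂ)‖ := by
    rw [norm_mul, Complex.norm_I, one_mul, Complex.norm_real, Real.norm_eq_abs]
  rw [hyn, ← norm_mul, Finset.mul_sum, Finset.mul_sum]
  congr 1
  refine Finset.sum_congr rfl fun j _ => ?_
  rw [integral_exp_mul_complex hIy, hp, hp, pow_succ, mul_left_comm, mul_div_cancel₀ _ hIy]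
  ring

lemma taperFT_timeC (hT : 0 < T) (x : ℝ) : taperFT (timeC T) realPair (taperC h T) x =
    T * ∫ u in (0 : ℝ)..1, (h u : ℂ) * Complex.exp (Complex.I * (x * T : ℝ) * u) := by
  have := integral_timeC hT fun u => (h u : ℂ) * Complex.exp (Complex.I * (x * T : ℝ) * u)
  rw [Complex.real_smul] at this
  rw [← this]
  refine integral_congr_ae (ae_of_all _ fun t => ?_)
  have hTc : (T : ℂ) ≠ 0 := by exact_mod_cast hT.ne'
  simp only [taperC, realPair]
  congr 2
  push_cast; field_simp

lemma IsTaper.exists_norm_taperFT_timeC (hh : IsTaper h) : ∃ C : ℝ≥0, ∀ T : ℝ, 0 < T → ∀ x,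
    ‖taperFT (timeC T) realPair (taperC h T) x‖ₑ ≤ C * ofReal T * decay T x := by
  obtain ⟨A, hA0, hA, hI⟩ := hh.exists_norm_integral_le
  refine ⟨_, fun T hT x => enorm_le_decay hT hA0 hA0 ?_ ?_⟩
  · refine (norm_taperFT_le isPairing_real (fun t => hA _) x).trans (le_of_eq ?_)
    simp [timeC, hT.le]
  · have := hI (x * T)
    rw [abs_mul, abs_of_pos hT] at this
    rw [taperFT_timeC hT, norm_mul, Complex.norm_real, Real.norm_eq_abs, Real.norm_eq_abs,
      abs_of_pos hT, ← mul_assoc]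
    exact this

lemma memLp_two_of_le_decay {H : ℝ → ℂ} {C : ℝ≥0} (hT : 0 < T) (hm : Measurable H)
    (h : ∀ x, ‖H x‖ₑ ≤ C * ofReal T * decay T x) : MemLp H 2 volume := by
  refine ⟨hm.aestronglyMeasurable, ?_⟩
  rw [eLpNorm_lt_top_iff_lintegral_rpow_enorm_lt_top two_ne_zero ENNReal.ofNat_ne_top,
    ENNReal.toReal_ofNat]
  have h1 := lintegral_decay_le radiallyDominated_real hT (s := 2) (by norm_num)
  calc _ ≤ ∫⁻ x, (C * ofReal T) ^ (2 : ℝ) * decay T x ^ (2 : ℝ) := lintegral_mono fun x => by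
        rw [← mul_rpow_of_nonneg _ _ zero_le_two]
        exact ENNReal.rpow_le_rpow (h x) zero_le_two
    _ = (C * ofReal T) ^ (2 : ℝ) * ∫⁻ x, decay T x ^ (2 : ℝ) :=
        lintegral_const_mul _ (measurable_decay.pow_const _)
    _ < ∞ := mul_lt_top (by finiteness) (h1.trans_lt (mul_lt_top
        decayConst_ne_top.lt_top (by simpa using hT)))

lemma integral_taperFT_conv_timeC {a b : ℝ → ℝ} {M : ℝ} (ha : Measurable a) (hb : Measurable b)
    (hM : ∀ t, |a t| ≤ M) (hM' : ∀ t, |b t| ≤ M) (ha0 : ∀ t ∉ Icc 0 T, a t = 0)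
    (hb0 : ∀ t ∉ Icc 0 T, b t = 0) (hbc : ∀ᵐ t, ContinuousAt b t) (x : ℝ)
    (hi : Integrable fun y => taperFT (timeC T) realPair a (x - y) * taperFT (timeC T) realPair b y) :
    ∫ y, taperFT (timeC T) realPair a (x - y) * taperFT (timeC T) realPair b y =
      2 * Real.pi * taperFT (timeC T) realPair (fun t => a t * b t) x := by
  have hint : ∀ {c : ℝ → ℝ}, Measurable c → (∀ t, |c t| ≤ M) → (∀ t ∉ Icc 0 T, c t = 0) →
      Integrable c := fun {c} hc hcM hc0 => by
    have : IntegrableOn c (Icc 0 T) := Integrable.of_bound hc.aestronglyMeasurable M (ae_of_all _ hcM)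
    rwa [← integrable_indicator_iff measurableSet_Icc, indicator_eq_self.2 fun t ht =>
      by_contra fun h' => ht (hc0 t h')] at this
  have hall : ∀ {c : ℝ → ℝ}, (∀ t ∉ Icc 0 T, c t = 0) → ∀ y,
      taperFT (timeC T) realPair c y = ∫ t, (c t : ℂ) * realPair t y := fun {c} hc0 y => by
    rw [taperFT, timeC]
    exact setIntegral_eq_integral_of_forall_compl_eq_zero fun t ht => by simp [hc0 t ht]
  set F₁ : ℝ → ℂ := fun t => (a t : ℂ) * realPair t x with hF₁
  set F₂ : ℝ → ℂ := fun t => (b (-t) : ℂ) with hF₂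
  have i1 : Integrable F₁ := (hint ha hM ha0).ofReal.mul_bdd (c := 1)
    (isPairing_real.meas.comp measurable_prodMk_right).aestronglyMeasurable
    (ae_of_all _ fun t => (isPairing_real.norm_eq t x).le)
  have i2 : Integrable F₂ := Integrable.comp_neg (f := fun t => (b t : ℂ)) (hint hb hM' hb0).ofReal
  have hk : Integrable (F₁ ⋆[ContinuousLinearMap.mul ℂ ℂ] F₂) := i1.integrable_convolution _ i2
  have hF : ∀ ξ : ℝ, 𝓕 (F₁ ⋆[ContinuousLinearMap.mul ℂ ℂ] F₂) ξ =
      taperFT (timeC T) realPair a (x - 2 * Real.pi * ξ) *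
        taperFT (timeC T) realPair b (2 * Real.pi * ξ) := fun ξ => by
    rw [Real.fourier_mul_convolution_eq i1 i2, hall ha0, hall hb0, Real.fourier_real_eq_integral_exp_smul,
      Real.fourier_real_eq_integral_exp_smul, ← integral_neg_eq_self fun t => (b t : ℂ) * realPair t _]
    congr 1 <;> refine integral_congr_ae (ae_of_all _ fun t => ?_)
    · simp only [hF₁, realPair, smul_eq_mul]
      rw [mul_left_comm, ← Complex.exp_add]
      congr 2; push_cast; ring
    · simp only [hF₂, realPair, smul_eq_mul, mul_comm (Complex.exp _)]
      congr 2; push_cast; ring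
  have hpi := Real.two_pi_pos
  have hFi : Integrable (𝓕 (F₁ ⋆[ContinuousLinearMap.mul ℂ ℂ] F₂)) := by
    have := hi.comp_mul_left' hpi.ne'
    exact this.congr (ae_of_all _ fun ξ => (hF ξ).symm)
  have hc : ContinuousAt (F₁ ⋆[ContinuousLinearMap.mul ℂ ℂ] F₂) 0 := by
    refine tendsto_integral_filter_of_dominated_convergence (fun t => M * ‖F₁ t‖)
      (Eventually.of_forall fun u => ?_) (Eventually.of_forall fun u => ae_of_all _ fun t => ?_)
      (i1.norm.const_mul M) ?_
    · exact i1.aestronglyMeasurable.mul (Complex.measurable_ofReal.comp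
        (hb.comp (by fun_prop))).aestronglyMeasurable
    · rw [ContinuousLinearMap.mul_apply', norm_mul, mul_comm]
      exact mul_le_mul_of_nonneg_right (by rw [Complex.norm_real]; exact hM' _) (norm_nonneg _)
    · filter_upwards [hbc] with t ht
      refine Tendsto.const_mul _ ((Complex.continuous_ofReal.tendsto _).comp ?_)
      simp only [zero_sub, neg_neg]
      exact ht.tendsto.comp (Continuous.tendsto' (by fun_prop) _ _ (by simp))
  have h0 := hk.fourierInv_fourier_eq hFi hc
  rw [Real.fourierInv_eq'] at h0
  simp only [inner_zero_right, mul_zero, Complex.ofReal_zero, zero_mul, Complex.exp_zero, one_smul,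
    hF] at h0
  rw [Measure.integral_comp_mul_left fun y => taperFT (timeC T) realPair a (x - y) *
    taperFT (timeC T) realPair b y, abs_of_pos (inv_pos.2 hpi), Complex.real_smul] at h0
  have h1 : (F₁ ⋆[ContinuousLinearMap.mul ℂ ℂ] F₂) 0 =
      taperFT (timeC T) realPair (fun t => a t * b t) x := by
    rw [hall fun t ht => by rw [ha0 t ht, zero_mul]]
    refine integral_congr_ae (ae_of_all _ fun t => ?_)
    simp [hF₁, hF₂]; ring
  have hpc : (Real.pi : ℂ) ≠ 0 := by exact_mod_cast Real.pi_ne_zero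
  rw [← h1, ← h0]
  push_cast; field_simp

lemma IsTaper.taperC_eq_zero (hh : IsTaper h) (hT : 0 < T) {t : ℝ} (ht : t ∉ Icc 0 T) :
    taperC h T t = 0 :=
  hh.support _ fun h1 => ht ⟨by simpa using (le_div_iff₀ hT).1 h1.1, (div_le_one hT).1 h1.2⟩

lemma IsTaper.continuousAt_taperC (hh : IsTaper h) (hT : T ≠ 0) {t : ℝ} (h0 : t ≠ 0) (h1 : t ≠ T) :
    ContinuousAt (taperC h T) t :=
  ContinuousAt.comp (f := fun t => t / T) (hh.continuousAt (div_ne_zero h0 hT)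
    fun h => h1 ((div_eq_one_iff_eq hT).1 h)) (by fun_prop)

lemma IsTaper.exists_taperedKernels_real (hh : IsTaper h) : ∃ C : ℝ≥0,
    ∀ T : ℕ → ℝ, (∀ n, 1 ≤ T n) → Tendsto T atTop atTop →
    TaperedKernels (volume : Measure ℝ) T
      (fun n => taperFT (timeC (T n)) realPair (taperC h (T n))) C
      (8 * Real.pi ^ 3 * taperMoment h 4) := by
  obtain ⟨C, hC⟩ := hh.exists_norm_taperFT_timeC
  refine ⟨C, fun T h1 hT => ?_⟩
  have hT0 : ∀ n, 0 < T n := fun n => one_pos.trans_le (h1 n)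
  have hw : ∀ n, Measurable (taperC h (T n)) := fun n => hh.measurable.comp (by fun_prop)
  have hm : ∀ n, Measurable (taperFT (timeC (T n)) realPair (taperC h (T n))) := fun n =>
    measurable_taperFT isPairing_real (hw n)
  have hpos := hh.moment_pos (k := 4) (by norm_num)
  refine ⟨h1, hT, hm, fun n x => conj_taperFT isPairing_real x, fun n => hC _ (hT0 n),
    radiallyDominated_real, by positivity, ?_⟩
  have e1 : ∀ n : ℕ, ((T n : ℝ) : ℂ)⁻¹ * ∫ z, edge (taperFT (timeC (T n)) realPair
      (taperC h (T n))) z ∂((volume : Measure ℝ).prod (volume.prod volume)) =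
      ((8 * Real.pi ^ 3 * taperMoment h 4 : ℝ) : ℂ) := by
    intro n
    have hTc : (T n : ℂ) ≠ 0 := by exact_mod_cast (hT0 n).ne'
    rw [integral_edge_taperFT isPairing_real (integrable_edge_of_le (hT0 n)
      radiallyDominated_real (hm n) (hC _ (hT0 n)))]
    · have := integral_timeC (hT0 n) fun u => h u ^ 4
      rw [smul_eq_mul, intervalIntegral.integral_of_le zero_le_one, ← integral_Icc_eq_integral_Ioc,
        ← taperMoment] at this
      simp only [taperC, this]
      push_cast; field_simp
    · intro k hk x
      obtain ⟨M, -, hM⟩ := hh.exists_bound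
      obtain ⟨M', -, hM'⟩ := (hh.pow k hk).exists_bound
      obtain ⟨C', hC'⟩ := (hh.pow k hk).exists_norm_taperFT_timeC
      have := integral_taperFT_conv_timeC (T := T n) (M := max M M') (hw n) ((hw n).pow_const k)
        (fun t => (hM _).trans (le_max_left _ _)) (fun t => (hM' (t / T n)).trans (le_max_right _ _))
        (fun t ht => hh.taperC_eq_zero (hT0 n) ht)
        (fun t ht => by rw [hh.taperC_eq_zero (hT0 n) ht, zero_pow (by lia)]) (by
          filter_upwards [Measure.ae_ne volume 0, Measure.ae_ne volume (T n)] with t h0 h1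
          exact (hh.continuousAt_taperC (hT0 n).ne' h0 h1).pow k) x
        (((memLp_two_of_le_decay (hT0 n) (hm n) (hC _ (hT0 n))).comp_measurePreserving
          (Measure.measurePreserving_sub_left volume x)).integrable_mul
          (memLp_two_of_le_decay (hT0 n) (measurable_taperFT isPairing_real ((hw n).pow_const k))
            (hC' _ (hT0 n))))
      rw [this]
      simp_rw [pow_succ']
  simp_rw [e1]
  exact tendsto_const_nhds

end Continuous

/-! ### Continuous time: the quadratic functional -/

section Continuous

variable {f g h : ℝ → ℝ} {Ω : Type*} [MeasurableSpace Ω] {P : Measure Ω} [IsProbabilityMeasure P]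
  {X : ℝ → Ω → ℝ}

lemma isGaussianForm_quadC (hh : IsTaper h) (hXm : Measurable fun q : ℝ × Ω => X q.1 q.2)
    (hX : IsGaussianStationary (fun t : ℝ => t) freqC X P f) (hg : IntegrableOn g freqC)
    (T : ℝ) : IsGaussianForm P (timeC T) freqC f g (fun t : ℝ => t) (taperC h T)
      (quadC h g X T) := by
  obtain ⟨M, -, hM⟩ := hh.exists_bound
  have hr : ∀ t ∈ Ioo 0 T, Tendsto (fun n : ℕ => if t ∈ Icc 0 T then (⌊t * (n + 1)⌋₊ : ℝ) / (n + 1)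
      else 0) atTop (𝓝 t) := fun t ht => by
    simp only [if_pos (Ioo_subset_Icc_self ht)]
    exact (tendsto_nat_floor_mul_div_atTop ht.1.le).comp
      (tendsto_natCast_atTop_atTop.atTop_add (tendsto_const_nhds (x := (1 : ℝ))))
  refine hX.isGaussianForm (τ := timeC T) (w := taperC h T) (K := M)
    (r := fun n t => if t ∈ Icc 0 T then (⌊t * (n + 1)⌋₊ : ℝ) / (n + 1) else 0)
    (I := fun n => insert 0 ((Finset.range (⌊T * (n + 1)⌋₊ + 1)).image fun k : ℕ => (k : ℝ) / (n + 1)))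
    (A := Ioo 0 T) (fun _ _ => rfl) measurable_id hXm hg (hh.measurable.comp (by fun_prop))
    (fun t => hM _) (fun n => ?_) (fun n t => ?_) ?_ hr
    (fun t ht => (hh.continuousAt_taperC (ht.1.trans ht.2).ne' ht.1.ne' ht.2.ne).tendsto.comp
      (hr t ht)) ?_
  · exact Measurable.ite measurableSet_Icc (((measurable_from_nat (f := fun k : ℕ => (k : ℝ))).comp
      (Nat.measurable_floor.comp (by fun_prop))).div_const _) measurable_const
  · split_ifs with h1
    · refine Finset.mem_insert_of_mem (Finset.mem_image.2 ⟨_, ?_, rfl⟩)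
      rw [Finset.mem_range, Nat.lt_succ_iff]
      exact Nat.floor_mono (mul_le_mul_of_nonneg_right h1.2 (by positivity))
    · exact Finset.mem_insert_self _ _
  · rw [timeC, Measure.restrict_congr_set Ioo_ae_eq_Icc.symm]
    exact ae_restrict_mem measurableSet_Ioo
  · funext ω
    rw [timeC, Measure.prod_restrict, ← Measure.volume_eq_prod]
    rfl

lemma variance_normQuadC (hh : IsTaper h) (hXm : Measurable fun q : ℝ × Ω => X q.1 q.2)
    (hX : IsGaussianStationary (fun t : ℝ => t) freqC X P f) (hg : IntegrableOn g freqC)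
    {T : ℝ} (hT : 0 < T) : Var[normQuadC P h g X T; P] = 2 / T * traceC h f g T := by
  obtain ⟨h1, h2, -⟩ := isGaussianForm_quadC hh hXm hX hg T
  rw [normQuadC, variance_normalized hT h1.1, h2, mtrace2_formKernel fun _ _ => rfl]
  simp only [traceC, kernelTrace, kernelComp, toeplitzKernel, timeC, taperC]
  ring

theorem isAsympNormal_continuous (hh : IsTaper h) (hXm : Measurable fun q : ℝ × Ω => X q.1 q.2)
    (hX : IsGaussianStationary (fun t : ℝ => t) freqC X P f) (hg : IsGenerating freqC g)
    (hcond : (CondLp freqC f g ∨ CondConv freqC f g ∨ CondShift freqC f g ∨ CondSingular freqC f g) ∨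
      CondVariance freqC h f g fun T => Var[normQuadC P h g X T; P]) :
    IsAsympNormal P freqC h f g (normQuadC P h g X) := by
  obtain ⟨C, hH⟩ := hh.exists_taperedKernels_real
  obtain ⟨M, -, hM⟩ := hh.exists_bound
  have hF := isGaussianForm_quadC hh hXm hX hg.integrable
  have key : ∀ T : ℕ → ℝ, (∀ n, 1 ≤ T n) → Tendsto T atTop atTop →
      IntegrableOn (fun x => f x ^ 2 * g x ^ 2) freqC ∧
      TendstoInDistribution (fun n => normQuadC P h g X (T n)) atTop (id : ℝ → ℝ) (fun _ => P)
        (gaussianReal 0 (asympVar freqC h f g).toNNReal) := fun T h1 hT =>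
    freqChart_real.tendstoInDistribution isPairing_real (i := fun t : ℝ => t) (fun _ _ => rfl)
      (τ := fun n => timeC (T n)) (fun n => hh.measurable.comp (by fun_prop))
      (fun n t => hM _) (hH T h1 hT) hX.density_integrable hg.integrable hX.density_nonneg
      (fun _ => rfl) (fun _ => rfl) hX.fourierC_eq
      (fun t => fourierC_eq_ofReal (fun x => by simp) MeasurableSet.univ hg.even _)
      (fun n => hF (T n)) (hcond.imp_right fun h => ⟨h.1, h.2.1, h.2.2.comp hT⟩)
  have hm : ∀ T, AEMeasurable (normQuadC P h g X T) P := fun T =>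
    ((hF T).1.1.aemeasurable.sub_const _).const_mul _
  obtain ⟨h1, h2⟩ := key (fun n => (n : ℝ) + 1) (fun n => by simp)
    (tendsto_natCast_atTop_atTop.atTop_add tendsto_const_nhds)
  refine ⟨h1, hm, h2.aemeasurable_limit, tendsto_of_seq_tendsto fun u hu => ?_⟩
  have h3 := (key (fun n => max (u n) 1) (fun n => le_max_right _ _)
    (tendsto_atTop_mono (fun n => le_max_left _ _) hu)).2.tendsto
  refine h3.congr' ?_
  filter_upwards [hu.eventually_ge_atTop 1] with n hn
  simp only [max_eq_left hn]; rfl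

end Continuous

end

end TaperedCLT

theorem mainTheorem11 {Ω : Type*} [MeasurableSpace Ω] (P : Measure Ω) [IsProbabilityMeasure P]
    (h : ℝ → ℝ) (hh : TaperedCLT.IsTaper h) (f g : ℝ → ℝ) :
    -- discrete time
    (∀ X : ℤ → Ω → ℝ,
      TaperedCLT.IsGaussianStationary (fun n : ℤ => (n : ℝ)) TaperedCLT.freqD X P f →
      TaperedCLT.IsGenerating TaperedCLT.freqD g →
      Function.Periodic f (2 * Real.pi) → Function.Periodic g (2 * Real.pi) →
      (∀ T : ℕ, 0 < T →
        Var[TaperedCLT.normQuadD P h g X T; P] = 2 / (T : ℝ) * TaperedCLT.traceD h f g T) ∧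
      (TaperedCLT.CondLp TaperedCLT.freqD f g →
        TaperedCLT.IsAsympNormal P TaperedCLT.freqD h f g (TaperedCLT.normQuadD P h g X)) ∧
      (TaperedCLT.CondVariance TaperedCLT.freqD h f g
          (fun T => Var[TaperedCLT.normQuadD P h g X T; P]) →
        TaperedCLT.IsAsympNormal P TaperedCLT.freqD h f g (TaperedCLT.normQuadD P h g X)) ∧
      (TaperedCLT.CondConv TaperedCLT.freqD f g →
        TaperedCLT.IsAsympNormal P TaperedCLT.freqD h f g (TaperedCLT.normQuadD P h g X)) ∧
      (TaperedCLT.CondShift TaperedCLT.freqD f g →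
        TaperedCLT.IsAsympNormal P TaperedCLT.freqD h f g (TaperedCLT.normQuadD P h g X)) ∧
      (TaperedCLT.CondSingular TaperedCLT.freqD f g →
        TaperedCLT.IsAsympNormal P TaperedCLT.freqD h f g (TaperedCLT.normQuadD P h g X))) ∧
    -- continuous time
    (∀ X : ℝ → Ω → ℝ,
      Measurable (fun q : ℝ × Ω => X q.1 q.2) →
      TaperedCLT.IsGaussianStationary (fun t : ℝ => t) TaperedCLT.freqC X P f →
      TaperedCLT.IsGenerating TaperedCLT.freqC g →
      (∀ T : ℝ, 0 < T →
        Var[TaperedCLT.normQuadC P h g X T; P] = 2 / T * TaperedCLT.traceC h f g T) ∧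
      (TaperedCLT.CondLp TaperedCLT.freqC f g →
        TaperedCLT.IsAsympNormal P TaperedCLT.freqC h f g (TaperedCLT.normQuadC P h g X)) ∧
      (TaperedCLT.CondVariance TaperedCLT.freqC h f g
          (fun T => Var[TaperedCLT.normQuadC P h g X T; P]) →
        TaperedCLT.IsAsympNormal P TaperedCLT.freqC h f g (TaperedCLT.normQuadC P h g X)) ∧
      (TaperedCLT.CondConv TaperedCLT.freqC f g →
        TaperedCLT.IsAsympNormal P TaperedCLT.freqC h f g (TaperedCLT.normQuadC P h g X)) ∧
      (TaperedCLT.CondShift TaperedCLT.freqC f g →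
        TaperedCLT.IsAsympNormal P TaperedCLT.freqC h f g (TaperedCLT.normQuadC P h g X)) ∧
      (TaperedCLT.CondSingular TaperedCLT.freqC f g →
        TaperedCLT.IsAsympNormal P TaperedCLT.freqC h f g (TaperedCLT.normQuadC P h g X))) := by
  open TaperedCLT in
  exact ⟨fun X hX hg hfp hgp => ⟨fun T hT => variance_normQuadD hh hX hg.integrable hT,
      fun hc => isAsympNormal_discrete hh hX hg hfp hgp (.inl (.inl hc)),
      fun hc => isAsympNormal_discrete hh hX hg hfp hgp (.inr hc),
      fun hc => isAsympNormal_discrete hh hX hg hfp hgp (.inl (.inr (.inl hc))),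
      fun hc => isAsympNormal_discrete hh hX hg hfp hgp (.inl (.inr (.inr (.inl hc)))),
      fun hc => isAsympNormal_discrete hh hX hg hfp hgp (.inl (.inr (.inr (.inr hc))))⟩,
    fun X hXm hX hg => ⟨fun T hT => variance_normQuadC hh hXm hX hg.integrable hT,
      fun hc => isAsympNormal_continuous hh hXm hX hg (.inl (.inl hc)),
      fun hc => isAsympNormal_continuous hh hXm hX hg (.inr hc),
      fun hc => isAsympNormal_continuous hh hXm hX hg (.inl (.inr (.inl hc))),
      fun hc => isAsympNormal_continuous hh hXm hX hg (.inl (.inr (.inr (.inl hc)))),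
      fun hc => isAsympNormal_continuous hh hXm hX hg (.inl (.inr (.inr (.inr hc))))⟩⟩
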